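/- Let $k$ be an algebraically closed field of characteristic zero, $p\ge 2$ an integer, $q\in k$ a primitive $2p$-th root of unity and $[n]=\frac{q^n-q^{-n}}{q-q^{-1}}$. Let $\overline U$ be the restricted quantum group $\overline U_q(\mathfrak{sl}_2)$, generated by $E,F,K^{\pm1}$ with relations $KEK^{-1}=q^2E$, $KFK^{-1}=q^{-2}F$, $EF-FE=\frac{K-K^{-1}}{q-q^{-1}}$, $K^{2p}=1$, $E^p=F^p=0$, and with the coproduct $\Delta(E)=E\otimes K+1\otimes E$, $\Delta(F)=F\otimes1+K^{-1}\otimes F$, $\Delta(K)=K\otimes K$, through which $\overline U$ acts on tensor products over $k$ of finite dimensional left modules. A $B$-module is a tuple $Z=(V^+,V^-,\tau_1^+,\tau_2^+,\tau_1^-,\tau_2^-)$ of finite dimensional vector spaces and linear maps $\tau_i^\pm\colon V^\pm\to V^\mp$ with $\tau_i^\pm\tau_i^\mp=0$ and $\tau_1^\pm\tau_2^\mp=\tau_2^\pm\tau_1^\mp$. For $1\le s\le p-1$ let $\Phi_s(Z)$ be the $\overline U$-module $\bigoplus_{n=0}^{s-1}a_n\otimes V^+\oplus\bigoplus_{m=0}^{p-s-1}x_m\otimes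 V^-$ with $$K(a_n\otimes v)=q^{s-1-2n}a_n\otimes v,\qquad K(x_m\otimes w)=-q^{p-s-1-2m}x_m\otimes w,$$ $$F(a_n\otimes v)=a_{n+1}\otimes v\ (n\ne s-1),\quad F(a_{s-1}\otimes v)=x_0\otimes\tau_1^+v,\quad F(x_m\otimes w)=x_{m+1}\otimes w\ (m\neq p-s-1),\quad F(x_{p-s-1}\otimes w)=a_0\otimes\tau_1^-w,$$ $$E(a_n\otimes v)=a_{n-1}\otimes([n][s-n]v+\tau_1^-\tau_2^+v)\ (n\ne0),\quad E(a_0\otimes v)=x_{p-s-1}\otimes\tau_2^+v,$$ $$E(x_m\otimes w)=x_{m-1}\otimes(-[m][p-s-m]w+\tau_1^+\tau_2^-w)\ (m\ne0),\quad E(x_0\otimes w)=a_{s-1}\otimes\tau_2^-w.$$ Let $\mathcal C(s)$ be the full subcategory of the $\overline U$-modules isomorphic to some $\Phi_s(Z)$. Let $e_{i,j}$ be the matrix units, $N_n=\sum_{i=1}^{n-1}e_{i,i+1}$ of size $n$, and for $\lambda\in\mathbb P^1(k)$ put $(\varphi_1,\varphi_2)=(\beta\,\mathrm{id}+N_n,\mathrm{id})$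 if $\lambda=[\beta:1]$ and $(\varphi_1,\varphi_2)=(\mathrm{id},N_n)$ if $\lambda=[1:0]$. For $1\le s\le p-1$ set $$\mathcal E_s^+(n;\lambda)=\Phi_s(k^n,k^n,\varphi_1,\varphi_2,0,0),\qquad \mathcal E_{p-s}^-(n;\lambda)=\Phi_s(k^n,k^n,0,0,\varphi_1,\varphi_2),$$ $$\mathcal P_s^+=\Phi_s(k^2,k^2,e_{1,1},e_{2,1},e_{2,2},e_{2,1}),\qquad \mathcal P_{p-s}^-=\Phi_s(k^2,k^2,e_{2,2},e_{2,1},e_{1,1},e_{2,1}),$$ and let $\mathcal P_p^\pm=\mathcal X_p^\pm$ be the $p$-dimensional simple module with basis $a_0,\dots,a_{p-1}$, $Ka_n=\pm q^{p-1-2n}a_n$, $Ea_n=\pm[n][p-n]a_{n-1}$, $Fa_n=a_{n+1}$ (with $a_{-1}=a_p=0$). For $c\in k^\times$ and $\lambda=[\lambda_1:\lambda_2]$ write $c\lambda=[c\lambda_1:\lambda_2]$. For $1\le s\le s'\le p$ let $$I_{s,s'}=I_{s',s}=\{t=s'-s+2i-1\mid 1\le i\le s,\ t\le 2p-s-s'\},\qquad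 J_{s+s'}=\{t=2p-2i-s'+s+1\mid 1\le i\le s,\ t\le p\};$$ the latter set depends on $s+s'$ only. Proposition. Let $1\le s,s'\le p-1$, $m,n\ge1$ and $\lambda,\mu\in\mathbb P^1(k)$. Then there are modules $\mathcal V_t=\mathcal V_t(s,s';m,n;\lambda,\mu)$ in $\mathcal C(t)$, one for each $t\in I_{s,s'}$, such that $$\mathcal E_s^+(m;\lambda)\otimes\mathcal E_{s'}^+(n;\mu)\cong\bigoplus_{t\in I_{s,s'}}\mathcal V_t\oplus\bigoplus_{t\in J_{s+s'}}(\mathcal P_t^+)^{mn}\oplus\bigoplus_{t\in J_{2p-s-s'}}(\mathcal P_t^+)^{mn}\oplus\bigoplus_{t\in J_{p+s-s'}}(\mathcal P_t^-)^{mn}\oplus\bigoplus_{t\in J_{p-s+s'}}(\mathcal P_t^-)^{mn},$$ and such that for each $t\in I_{s,s'}$ there are exact sequences $$0\to\mathcal E_{p-t}^-\Bigl(m;-\tfrac{[s]}{[t]}\lambda\Bigr)^n\to\mathcal V_t\to\mathcal E_t^+\Bigl(m;\tfrac{[s]}{[t]}\lambda\Bigr)^n\to0,$$ $$0\to\mathcal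 E_{p-t}^-\Bigl(n;(-1)^s\tfrac{[s']}{[t]}\mu\Bigr)^m\to\mathcal V_t\to\mathcal E_t^+\Bigl(n;(-1)^{s-1}\tfrac{[s']}{[t]}\mu\Bigr)^m\to0.$$ -/

import Mathlib

open scoped TensorProduct LinearAlgebra.Projectivization

universe u

set_option linter.unusedSimpArgs false

namespace QSl2

/-! ### The restricted quantum group -/

section Algebra

variable {k : Type u} [Field k]

/-- The quantum integer `[n] = (q ^ n - q ^ (-n)) / (q - q⁻¹)`. -/
noncomputable def qint (q : k) (n : ℤ) : k := (q ^ n - q ^ (-n)) / (q - q⁻¹)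

/-- Names of the four generators of the restricted quantum group. -/
inductive Gen
  | E
  | F
  | K
  | Kinv

/-- The defining relations of the restricted quantum group, for four elements of a `k`-algebra. -/
structure UbarRel {A : Type*} [Ring A] [Algebra k A] (p : ℕ) (q : k) (E F K Kinv : A) :
    Prop where
  K_Kinv : K * Kinv = 1
  Kinv_K : Kinv * K = 1
  K_E : K * E * Kinv = q ^ 2 • E
  K_F : K * F * Kinv = (q ^ 2)⁻¹ • F
  E_F : E * F - F * E = (q - q⁻¹)⁻¹ • (K - Kinv)
  K_pow : K ^ (2 * p) = 1
  E_pow : E ^ p = 0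
  F_pow : F ^ p = 0

/-- The same relations as a relation on the free algebra. -/
inductive FreeRel (p : ℕ) (q : k) : FreeAlgebra k Gen → FreeAlgebra k Gen → Prop
  | K_Kinv : FreeRel p q (FreeAlgebra.ι k Gen.K * FreeAlgebra.ι k Gen.Kinv) 1
  | Kinv_K : FreeRel p q (FreeAlgebra.ι k Gen.Kinv * FreeAlgebra.ι k Gen.K) 1
  | K_E : FreeRel p q
      (FreeAlgebra.ι k Gen.K * FreeAlgebra.ι k Gen.E * FreeAlgebra.ι k Gen.Kinv)
      (q ^ 2 • FreeAlgebra.ι k Gen.E)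
  | K_F : FreeRel p q
      (FreeAlgebra.ι k Gen.K * FreeAlgebra.ι k Gen.F * FreeAlgebra.ι k Gen.Kinv)
      ((q ^ 2)⁻¹ • FreeAlgebra.ι k Gen.F)
  | E_F : FreeRel p q
      (FreeAlgebra.ι k Gen.E * FreeAlgebra.ι k Gen.F
        - FreeAlgebra.ι k Gen.F * FreeAlgebra.ι k Gen.E)
      ((q - q⁻¹)⁻¹ • (FreeAlgebra.ι k Gen.K - FreeAlgebra.ι k Gen.Kinv))
  | K_pow : FreeRel p q (FreeAlgebra.ι k Gen.K ^ (2 * p)) 1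
  | E_pow : FreeRel p q (FreeAlgebra.ι k Gen.E ^ p) 0
  | F_pow : FreeRel p q (FreeAlgebra.ι k Gen.F ^ p) 0

/-- The restricted quantum group `Ū_q(sl₂)`: the unital associative `k`-algebra generated by
`E, F, K, K⁻¹` subject to the relations `FreeRel`. -/
def Ubar (p : ℕ) (q : k) : Type u := RingQuot (FreeRel p q)

noncomputable instance (p : ℕ) (q : k) : Ring (Ubar p q) :=
  inferInstanceAs (Ring (RingQuot (FreeRel p q)))

noncomputable instance (p : ℕ) (q : k) : Algebra k (Ubar p q) :=
  inferInstanceAs (Algebra k (RingQuot (FreeRel p q)))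

/-- The generators, as elements of the restricted quantum group. -/
noncomputable def Ubar.gen (p : ℕ) (q : k) (g : Gen) : Ubar p q :=
  RingQuot.mkAlgHom k (FreeRel p q) (FreeAlgebra.ι k g)

theorem Ubar.rel (p : ℕ) (q : k) :
    UbarRel p q (Ubar.gen p q Gen.E) (Ubar.gen p q Gen.F) (Ubar.gen p q Gen.K)
      (Ubar.gen p q Gen.Kinv) := by
  have h := fun {x y} (w : FreeRel p q x y) => RingQuot.mkAlgHom_rel k w
  constructor
  · have w := h FreeRel.K_Kinv
    simp only [map_mul, map_one, map_smul, map_sub, map_pow, map_zero] at w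
    exact w
  · have w := h FreeRel.Kinv_K
    simp only [map_mul, map_one, map_smul, map_sub, map_pow, map_zero] at w
    exact w
  · have w := h FreeRel.K_E
    simp only [map_mul, map_one, map_smul, map_sub, map_pow, map_zero] at w
    exact w
  · have w := h FreeRel.K_F
    simp only [map_mul, map_one, map_smul, map_sub, map_pow, map_zero] at w
    exact w
  · have w := h FreeRel.E_F
    simp only [map_mul, map_one, map_smul, map_sub, map_pow, map_zero] at w
    exact w
  · have w := h FreeRel.K_pow
    simp only [map_mul, map_one, map_smul, map_sub, map_pow, map_zero] at w
    exact w
  · have w := h FreeRel.E_pow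
    simp only [map_mul, map_one, map_smul, map_sub, map_pow, map_zero] at w
    exact w
  · have w := h FreeRel.F_pow
    simp only [map_mul, map_one, map_smul, map_sub, map_pow, map_zero] at w
    exact w

/-- The universal property of the restricted quantum group. -/
noncomputable def Ubar.lift {A : Type*} [Ring A] [Algebra k A] {p : ℕ} {q : k}
    {E F K Kinv : A} (h : UbarRel p q E F K Kinv) : Ubar p q →ₐ[k] A :=
  RingQuot.liftAlgHom k
    ⟨FreeAlgebra.lift k (fun g => match g with
        | Gen.E => E
        | Gen.F => F
        | Gen.K => K
        | Gen.Kinv => Kinv), by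
      intro x y w
      cases w
      · simpa using h.K_Kinv
      · simpa using h.Kinv_K
      · simpa using h.K_E
      · simpa using h.K_F
      · simpa using h.E_F
      · simpa using h.K_pow
      · simpa using h.E_pow
      · simpa using h.F_pow⟩

theorem Ubar.lift_gen {A : Type*} [Ring A] [Algebra k A] {p : ℕ} {q : k}
    {E F K Kinv : A} (h : UbarRel p q E F K Kinv) :
    Ubar.lift h (Ubar.gen p q Gen.E) = E ∧ Ubar.lift h (Ubar.gen p q Gen.F) = F ∧
    Ubar.lift h (Ubar.gen p q Gen.K) = K ∧ Ubar.lift h (Ubar.gen p q Gen.Kinv) = Kinv := by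
  refine ⟨?_, ?_, ?_, ?_⟩ <;>
  · unfold Ubar.lift Ubar.gen
    erw [RingQuot.liftAlgHom_mkAlgHom_apply]
    simp

/-! ### The coproduct -/

/-- Gaussian binomial coefficients at `z`. -/
def gauss (z : k) : ℕ → ℕ → k
  | _, 0 => 1
  | 0, _ + 1 => 0
  | n + 1, j + 1 => gauss z n j + z ^ (j + 1) * gauss z n (j + 1)

theorem gauss_of_lt (z : k) : ∀ n j : ℕ, n < j → gauss z n j = 0
  | 0, _ + 1, _ => by simp [gauss]
  | n + 1, j + 1, h => by
      simp [gauss, gauss_of_lt z n j (by omega), gauss_of_lt z n (j + 1) (by omega)]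

theorem gauss_self (z : k) : ∀ n : ℕ, gauss z n n = 1
  | 0 => by simp [gauss]
  | n + 1 => by simp [gauss, gauss_self z n, gauss_of_lt z n (n + 1) (by omega)]

theorem gauss_step (z : k) : ∀ n j : ℕ, j ≤ n →
    (1 - z ^ (j + 1)) * gauss z n (j + 1) = (1 - z ^ (n - j)) * gauss z n j
  | 0, j, h => by
      obtain rfl : j = 0 := by omega
      simp [gauss]
  | n + 1, 0, _ => by
      have h := gauss_step z n 0 (by omega)
      simp only [gauss, Nat.sub_zero, zero_add, mul_one] at h ⊢
      linear_combination z ^ 1 * h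
  | n + 1, i + 1, hi => by
      rcases Nat.lt_or_ge n (i + 1) with h | h
      · obtain rfl : i = n := by omega
        simp [gauss_of_lt z (i + 1) (i + 1 + 1) (by omega)]
      · have h1 := gauss_step z n (i + 1) h
        have h2 := gauss_step z n i (by omega)
        obtain ⟨d, rfl⟩ : ∃ d, n = i + 1 + d := ⟨n - (i + 1), by omega⟩
        have e1 : i + 1 + d - (i + 1) = d := by omega
        have e2 : i + 1 + d - i = d + 1 := by omega
        have e3 : i + 1 + d + 1 - (i + 1) = d + 1 := by omega
        rw [e1] at h1
        rw [e2] at h2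
        rw [e3]
        simp only [gauss]
        linear_combination z ^ (i + 2) * h1 + h2

theorem gauss_vanish {z : k} {p : ℕ} (hz : IsPrimitiveRoot z p) {j : ℕ} (h0 : 0 < j)
    (hj : j < p) : gauss z p j = 0 := by
  induction j with
  | zero => omega
  | succ i ih =>
    have h := gauss_step z p i (by omega)
    have hne : (1 - z ^ (i + 1)) ≠ 0 := by
      rw [sub_ne_zero]
      exact (hz.pow_ne_one_of_pos_of_lt (by omega) hj).symm
    have hr : (1 - z ^ (p - i)) * gauss z p i = 0 := by
      rcases Nat.eq_zero_or_pos i with rfl | hi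
      · simp [hz.pow_eq_one]
      · simp [ih hi (by omega)]
    rw [hr] at h
    exact (mul_eq_zero.mp h).resolve_left hne

theorem add_pow_qcomm {A : Type*} [Ring A] [Algebra k A] {z : k} {x y : A}
    (h : x * y = z • (y * x)) (n : ℕ) :
    (x + y) ^ n = ∑ j ∈ Finset.range (n + 1), gauss z n j • (y ^ j * x ^ (n - j)) := by
  have hxy : ∀ j : ℕ, x * y ^ j = z ^ j • (y ^ j * x) := by
    intro j
    induction j with
    | zero => simp
    | succ j ih =>
      rw [pow_succ, ← mul_assoc, ih, smul_mul_assoc, mul_assoc, h, mul_smul_comm, smul_smul,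
        ← mul_assoc, pow_succ]
  induction n with
  | zero => simp [gauss]
  | succ n ih =>
    have key : ∀ j ∈ Finset.range (n + 1),
        (x + y) * (gauss z n j • (y ^ j * x ^ (n - j))) =
          (z ^ j * gauss z n j) • (y ^ j * x ^ (n + 1 - j))
            + gauss z n j • (y ^ (j + 1) * x ^ (n + 1 - (j + 1))) := by
      intro j hj
      have hj' : j ≤ n := by simpa [Nat.lt_succ_iff] using hj
      have e : n + 1 - j = (n - j) + 1 := by omega
      have e' : n + 1 - (j + 1) = n - j := by omega
      rw [add_mul, mul_smul_comm, mul_smul_comm, ← mul_assoc, hxy, smul_mul_assoc, smul_smul,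
        mul_assoc, ← pow_succ', e, e', ← mul_assoc, ← pow_succ', mul_comm (z ^ j)]
    rw [pow_succ', ih, Finset.mul_sum, Finset.sum_congr rfl key, Finset.sum_add_distrib]
    have hL : ∑ j ∈ Finset.range (n + 1), (z ^ j * gauss z n j) • (y ^ j * x ^ (n + 1 - j))
        = ∑ j ∈ Finset.range (n + 2), (z ^ j * gauss z n j) • (y ^ j * x ^ (n + 1 - j)) := by
      rw [Finset.sum_range_succ _ (n + 1)]
      simp [gauss_of_lt z n (n + 1) (by omega)]
    rw [hL, Finset.sum_range_succ' _ (n + 1), Finset.sum_range_succ' _ (n + 1), add_right_comm,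
      ← Finset.sum_add_distrib]
    congr 1
    · refine Finset.sum_congr rfl fun j _ => ?_
      rw [← add_smul]
      congr 1
      simp only [gauss]
      ring
    · cases n <;> simp [gauss]

theorem add_pow_eq_zero {A : Type*} [Ring A] [Algebra k A] {z : k} {p : ℕ} (hp : 0 < p)
    (hz : IsPrimitiveRoot z p) {x y : A} (h : x * y = z • (y * x)) (hx : x ^ p = 0)
    (hy : y ^ p = 0) : (x + y) ^ p = 0 := by
  rw [add_pow_qcomm h]
  refine Finset.sum_eq_zero fun j hj => ?_
  rcases Nat.eq_zero_or_pos j with rfl | h0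
  · simp [hx]
  · rcases Nat.lt_or_ge j p with hjp | hjp
    · simp [gauss_vanish hz h0 hjp]
    · obtain rfl : j = p := by
        have := Finset.mem_range.mp hj
        omega
      simp [hy]

theorem comul_rel {p : ℕ} {q : k} (hp : 2 ≤ p) (hq : IsPrimitiveRoot q (2 * p)) :
    UbarRel p q (A := Ubar p q ⊗[k] Ubar p q)
      (Ubar.gen p q Gen.E ⊗ₜ Ubar.gen p q Gen.K + 1 ⊗ₜ Ubar.gen p q Gen.E)
      (Ubar.gen p q Gen.F ⊗ₜ 1 + Ubar.gen p q Gen.Kinv ⊗ₜ Ubar.gen p q Gen.F)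
      (Ubar.gen p q Gen.K ⊗ₜ Ubar.gen p q Gen.K)
      (Ubar.gen p q Gen.Kinv ⊗ₜ Ubar.gen p q Gen.Kinv) := by
  have R := Ubar.rel p q
  generalize Ubar.gen p q Gen.E = E at *
  generalize Ubar.gen p q Gen.F = F at *
  generalize Ubar.gen p q Gen.K = K at *
  generalize Ubar.gen p q Gen.Kinv = L at *
  have hq0 : q ≠ 0 := hq.ne_zero (by omega)
  have hq2 : IsPrimitiveRoot (q ^ 2) p := hq.pow (by omega) rfl
  have KE : K * E = q ^ 2 • (E * K) := by
    rw [← smul_mul_assoc, ← R.K_E, mul_assoc, R.Kinv_K, mul_one]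
  have KF : K * F = (q ^ 2)⁻¹ • (F * K) := by
    rw [← smul_mul_assoc, ← R.K_F, mul_assoc, R.Kinv_K, mul_one]
  have EL : E * L = q ^ 2 • (L * E) := by
    rw [← mul_smul_comm, ← R.K_E, ← mul_assoc, ← mul_assoc, R.Kinv_K, one_mul]
  have FL : F * L = (q ^ 2)⁻¹ • (L * F) := by
    rw [← mul_smul_comm, ← R.K_F, ← mul_assoc, ← mul_assoc, R.Kinv_K, one_mul]
  constructor
  · simp [R.K_Kinv, Algebra.TensorProduct.one_def]
  · simp [R.Kinv_K, Algebra.TensorProduct.one_def]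
  · simp [mul_add, add_mul, R.K_E, R.K_Kinv, TensorProduct.smul_tmul', mul_assoc K K L]
  · simp [mul_add, add_mul, R.K_F, R.K_Kinv, TensorProduct.smul_tmul']
  · have e : (E ⊗ₜ[k] K + 1 ⊗ₜ[k] E) * (F ⊗ₜ[k] 1 + L ⊗ₜ[k] F)
        - (F ⊗ₜ[k] 1 + L ⊗ₜ[k] F) * (E ⊗ₜ[k] K + 1 ⊗ₜ[k] E)
        = (E * F - F * E) ⊗ₜ[k] K + L ⊗ₜ[k] (E * F - F * E) := by
      simp only [mul_add, add_mul, Algebra.TensorProduct.tmul_mul_tmul, mul_one, one_mul,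
        EL, KF, TensorProduct.sub_tmul, TensorProduct.tmul_sub, TensorProduct.tmul_smul,
        TensorProduct.smul_tmul', smul_smul]
      rw [inv_mul_cancel₀ (pow_ne_zero 2 hq0), one_smul]
      abel
    rw [e, R.E_F]
    simp only [TensorProduct.tmul_smul, TensorProduct.smul_tmul', TensorProduct.sub_tmul,
      TensorProduct.tmul_sub, smul_sub]
    abel
  · simp [Algebra.TensorProduct.tmul_pow, R.K_pow, Algebra.TensorProduct.one_def]
  · refine add_pow_eq_zero (z := q ^ 2) (by omega) hq2 ?_ ?_ ?_
    · simp [KE]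
    · simp [Algebra.TensorProduct.tmul_pow, R.E_pow]
    · simp [Algebra.TensorProduct.tmul_pow, R.E_pow]
  · refine add_pow_eq_zero (z := (q ^ 2)⁻¹) (by omega) hq2.inv ?_ ?_ ?_
    · simp [FL, TensorProduct.smul_tmul']
    · simp [Algebra.TensorProduct.tmul_pow, R.F_pow]
    · simp [Algebra.TensorProduct.tmul_pow, R.F_pow]

/-- The coproduct `Δ` of the restricted quantum group:
`E ↦ E ⊗ K + 1 ⊗ E`, `F ↦ F ⊗ 1 + K⁻¹ ⊗ F`, `K ↦ K ⊗ K`, `K⁻¹ ↦ K⁻¹ ⊗ K⁻¹`. -/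
noncomputable def comul {p : ℕ} {q : k} (hp : 2 ≤ p) (hq : IsPrimitiveRoot q (2 * p)) :
    Ubar p q →ₐ[k] Ubar p q ⊗[k] Ubar p q :=
  Ubar.lift (comul_rel hp hq)

end Algebra

/-! ### Modules -/

section Modules

variable {k : Type u} [Field k]

/-- A finite dimensional left module over the restricted quantum group. -/
structure UMod (p : ℕ) (q : k) where
  /-- the underlying vector space -/
  carrier : Type u
  [addCommGroup : AddCommGroup carrier]
  [moduleBase : Module k carrier]
  [finite : Module.Finite k carrier]
  [moduleUbar : Module (Ubar p q) carrier]
  [isScalarTower : IsScalarTower k (Ubar p q) carrier]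

attribute [instance] UMod.addCommGroup UMod.moduleBase UMod.finite UMod.moduleUbar
  UMod.isScalarTower

instance (p : ℕ) (q : k) : CoeSort (UMod p q) (Type u) := ⟨UMod.carrier⟩

/-- The module given by an algebra homomorphism to the endomorphisms of a vector space. -/
noncomputable def UMod.ofHom {p : ℕ} {q : k} (V : Type u) [AddCommGroup V] [Module k V]
    [Module.Finite k V] (ρ : Ubar p q →ₐ[k] Module.End k V) : UMod p q :=
  letI : Module (Ubar p q) V := Module.compHom V ρ.toRingHom
  { carrier := V
    isScalarTower := ⟨fun c a v => by
      change ρ (c • a) v = c • ρ a v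
      rw [map_smul, LinearMap.smul_apply]⟩ }

/-- The tensor product `M ⊗ N` over `k`, on which the restricted quantum group acts through
its coproduct. -/
noncomputable def UMod.tensor {p : ℕ} {q : k} (hp : 2 ≤ p) (hq : IsPrimitiveRoot q (2 * p))
    (M N : UMod p q) : UMod p q :=
  UMod.ofHom (M ⊗[k] N)
    (((Module.endTensorEndAlgHom (R := k) (S := k) (A := k) (M := M) (N := N)).comp
      (Algebra.TensorProduct.map (Algebra.lsmul k k (M : Type u))
        (Algebra.lsmul k k (N : Type u)))).comp (comul hp hq))

/-- There is a short exact sequence `0 → A → B → C → 0` of `R`-modules. -/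
def ExistsShortExact (R : Type*) [Ring R] (A B C : Type*) [AddCommGroup A] [Module R A]
    [AddCommGroup B] [Module R B] [AddCommGroup C] [Module R C] : Prop :=
  ∃ (f : A →ₗ[R] B) (g : B →ₗ[R] C),
    Function.Injective f ∧ Function.Exact f g ∧ Function.Surjective g

/-- A finite dimensional module over the eight-dimensional algebra `B` (the quiver with two
vertices `+`, `-`, arrows `τ₁^±, τ₂^±` from `±` to `∓`, and the relations below). -/
structure BMod (k : Type u) [Field k] where
  /-- the space at the vertex `+` -/
  Vp : Type u
  /-- the space at the vertex `-` -/
  Vm : Type u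
  [acgp : AddCommGroup Vp]
  [acgm : AddCommGroup Vm]
  [modp : Module k Vp]
  [modm : Module k Vm]
  [finp : Module.Finite k Vp]
  [finm : Module.Finite k Vm]
  t1p : Vp →ₗ[k] Vm
  t2p : Vp →ₗ[k] Vm
  t1m : Vm →ₗ[k] Vp
  t2m : Vm →ₗ[k] Vp
  t1m_t1p : t1m ∘ₗ t1p = 0
  t1p_t1m : t1p ∘ₗ t1m = 0
  t2m_t2p : t2m ∘ₗ t2p = 0
  t2p_t2m : t2p ∘ₗ t2m = 0
  t1p_t2m : t1p ∘ₗ t2m = t2p ∘ₗ t1m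
  t1m_t2p : t1m ∘ₗ t2p = t2m ∘ₗ t1p

attribute [instance] BMod.acgp BMod.acgm BMod.modp BMod.modm BMod.finp BMod.finm

/-- Interchange of the two vertices. -/
abbrev BMod.swap (Z : BMod k) : BMod k where
  Vp := Z.Vm
  Vm := Z.Vp
  t1p := Z.t1m
  t2p := Z.t2m
  t1m := Z.t1p
  t2m := Z.t2p
  t1m_t1p := Z.t1p_t1m
  t1p_t1m := Z.t1m_t1p
  t2m_t2p := Z.t2p_t2m
  t2p_t2m := Z.t2m_t2p
  t1p_t2m := Z.t1m_t2p
  t1m_t2p := Z.t1p_t2m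

/-! #### The functor from `B`-modules to modules over the restricted quantum group

On `(k^a ⊗ V⁺) ⊕ (k^b ⊗ V⁻)`, written as pairs of functions, with bases `a_0, …, a_{a-1}` and
`x_0, …, x_{b-1}` of `k^a` and `k^b`, where `a + b = p`, and with a sign `ε`:

* `K (a_n ⊗ v) = ε q^(a-1-2n) a_n ⊗ v`, `K (x_m ⊗ w) = -ε q^(b-1-2m) x_m ⊗ w`;
* `F (a_n ⊗ v) = a_{n+1} ⊗ v` for `n ≠ a-1`, `F (a_{a-1} ⊗ v) = x_0 ⊗ τ₁⁺ v`,
  `F (x_m ⊗ w) = x_{m+1} ⊗ w` for `m ≠ b-1`, `F (x_{b-1} ⊗ w) = a_0 ⊗ τ₁⁻ w`;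
* `E (a_n ⊗ v) = a_{n-1} ⊗ (ε [n] [a-n] v + τ₁⁻ τ₂⁺ v)` for `n ≠ 0`,
  `E (a_0 ⊗ v) = x_{b-1} ⊗ τ₂⁺ v`,
  `E (x_m ⊗ w) = x_{m-1} ⊗ (-ε [m] [b-m] w + τ₁⁺ τ₂⁻ w)` for `m ≠ 0`,
  `E (x_0 ⊗ w) = a_{a-1} ⊗ τ₂⁻ w`. -/

/-- The `V`-part of the action of `F`. -/
def halfF {V W : Type u} [AddCommGroup V] [Module k V] [AddCommGroup W] [Module k W] {a b : ℕ}
    (hb : 0 < b) (t1 : W →ₗ[k] V) : ((Fin a → V) × (Fin b → W)) →ₗ[k] (Fin a → V) where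
  toFun x n := if 0 < n.val then x.1 ⟨n.val - 1, by omega⟩ else t1 (x.2 ⟨b - 1, by omega⟩)
  map_add' x y := by
    ext n
    by_cases h : 0 < n.val <;> simp [h]
  map_smul' c x := by
    ext n
    by_cases h : 0 < n.val <;> simp [h]

/-- The `V`-part of the action of `E`. -/
def halfE {V W : Type u} [AddCommGroup V] [Module k V] [AddCommGroup W] [Module k W] {a b : ℕ}
    (hb : 0 < b) (c : ℕ → k) (N : V →ₗ[k] V) (t2 : W →ₗ[k] V) :
    ((Fin a → V) × (Fin b → W)) →ₗ[k] (Fin a → V) where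
  toFun x n := if h : n.val + 1 < a then
      c (n.val + 1) • x.1 ⟨n.val + 1, h⟩ + N (x.1 ⟨n.val + 1, h⟩)
    else t2 (x.2 ⟨0, hb⟩)
  map_add' x y := by
    ext n
    by_cases h : n.val + 1 < a
    · simp [h]
      abel
    · simp [h]
  map_smul' r x := by
    ext n
    by_cases h : n.val + 1 < a <;> simp [h, smul_smul, mul_comm]

/-- The diagonal operator with entries `w 0, w 1, …`. -/
def diagOp {V : Type u} [AddCommGroup V] [Module k V] {a : ℕ} (w : ℕ → k) :
    (Fin a → V) →ₗ[k] (Fin a → V) where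
  toFun f n := w n.val • f n
  map_add' f g := by
    ext n
    simp
  map_smul' r f := by
    ext n
    simp [smul_smul, mul_comm]

/-- The `K`-eigenvalue `ε q^(a-1-2n)`. -/
noncomputable def wt (q ε : k) (a n : ℕ) : k := ε * q ^ ((a : ℤ) - 1 - 2 * n)

/-- The coefficient `ε [n] [a-n]`. -/
noncomputable def coeffE (q ε : k) (a n : ℕ) : k := ε * (qint q n * qint q ((a : ℤ) - n))

/-- The action of `F`. -/
def opF (Z : BMod k) {a b : ℕ} (ha : 0 < a) (hb : 0 < b) :
    Module.End k ((Fin a → Z.Vp) × (Fin b → Z.Vm)) :=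
  LinearMap.prod (halfF hb Z.t1m)
    (halfF ha Z.t1p ∘ₗ (LinearEquiv.prodComm k (Fin a → Z.Vp) (Fin b → Z.Vm)).toLinearMap)

/-- The action of `E`. -/
noncomputable def opE (q ε : k) (Z : BMod k) {a b : ℕ} (ha : 0 < a) (hb : 0 < b) :
    Module.End k ((Fin a → Z.Vp) × (Fin b → Z.Vm)) :=
  LinearMap.prod (halfE hb (coeffE q ε a) (Z.t1m ∘ₗ Z.t2p) Z.t2m)
    (halfE ha (coeffE q (-ε) b) (Z.t1p ∘ₗ Z.t2m) Z.t2p ∘ₗ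
      (LinearEquiv.prodComm k (Fin a → Z.Vp) (Fin b → Z.Vm)).toLinearMap)

/-- The action of `K`. -/
noncomputable def opK (q ε : k) (Z : BMod k) (a b : ℕ) :
    Module.End k ((Fin a → Z.Vp) × (Fin b → Z.Vm)) :=
  LinearMap.prodMap (diagOp (wt q ε a)) (diagOp (wt q (-ε) b))

/-- The action of `K⁻¹`. -/
noncomputable def opKinv (q ε : k) (Z : BMod k) (a b : ℕ) :
    Module.End k ((Fin a → Z.Vp) × (Fin b → Z.Vm)) :=
  LinearMap.prodMap (diagOp fun n => (wt q ε a n)⁻¹) (diagOp fun n => (wt q (-ε) b n)⁻¹)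

theorem pow_p_eq {p : ℕ} {q : k} (hp : 2 ≤ p) (hq : IsPrimitiveRoot q (2 * p)) :
    q ^ p = -1 := by
  have h : (q ^ p) * (q ^ p) = 1 := by
    rw [← pow_add, ← two_mul]
    exact hq.pow_eq_one
  exact (mul_self_eq_one_iff.mp h).resolve_left
    (hq.pow_ne_one_of_pos_of_lt (by omega) (by omega))

theorem q_sub_ne {p : ℕ} {q : k} (hp : 2 ≤ p) (hq : IsPrimitiveRoot q (2 * p)) :
    q - q⁻¹ ≠ 0 := by
  have hq0 : q ≠ 0 := hq.ne_zero (by omega)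
  intro h
  refine hq.pow_ne_one_of_pos_of_lt (l := 2) (by omega) (by omega) ?_
  rw [sub_eq_zero] at h
  calc q ^ 2 = q * q := sq q
    _ = q * q⁻¹ := by rw [← h]
    _ = 1 := mul_inv_cancel₀ hq0

theorem wt_ne {q ε : k} (hq0 : q ≠ 0) (hε : ε * ε = 1) (a n : ℕ) : wt q ε a n ≠ 0 := by
  have : ε ≠ 0 := by
    rintro rfl
    simp at hε
  exact mul_ne_zero this (zpow_ne_zero _ hq0)

theorem wt_pow {p : ℕ} {q ε : k} (hq : IsPrimitiveRoot q (2 * p)) (hε : ε * ε = 1) (a n : ℕ) :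
    wt q ε a n ^ (2 * p) = 1 := by
  have h1 : ε ^ (2 * p) = 1 := by rw [pow_mul, sq, hε, one_pow]
  rw [wt, mul_pow, h1, one_mul, ← zpow_natCast, ← zpow_mul, mul_comm, zpow_mul, zpow_natCast,
    hq.pow_eq_one, one_zpow]

theorem wt_succ {q ε : k} (hq0 : q ≠ 0) (a n : ℕ) : wt q ε a n = q ^ 2 * wt q ε a (n + 1) := by
  have e : (a : ℤ) - 1 - 2 * n = 2 + ((a : ℤ) - 1 - 2 * (n + 1 : ℕ)) := by
    push_cast
    ring
  rw [wt, wt, e, zpow_add₀ hq0]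
  norm_cast
  ring

theorem wt_last {p : ℕ} {q ε : k} (hp : 2 ≤ p) (hq : IsPrimitiveRoot q (2 * p)) {a b n : ℕ}
    (hab : a + b = p) (hn : n + 1 = a) : wt q ε a n = q ^ 2 * wt q (-ε) b 0 := by
  have hq0 : q ≠ 0 := hq.ne_zero (by omega)
  have e : ((b : ℤ) - 1 - 2 * (0 : ℕ)) = p + (((a : ℤ) - 1 - 2 * n) - 2) := by
    push_cast [← hab, ← hn]
    ring
  have e2 : q ^ (2 : ℤ) = q ^ 2 := by norm_cast
  have e3 : q ^ 2 ≠ 0 := pow_ne_zero 2 hq0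
  rw [wt, wt, e, zpow_add₀ hq0, zpow_natCast, pow_p_eq hp hq, zpow_sub₀ hq0 _ 2, e2]
  generalize q ^ ((a : ℤ) - 1 - 2 * n) = y
  field_simp

theorem coeff_step {q ε : k} (hq0 : q ≠ 0) (hqs : q - q⁻¹ ≠ 0) (hε : ε * ε = 1) (a n : ℕ) :
    coeffE q ε a (n + 1) - coeffE q ε a n = (q - q⁻¹)⁻¹ * (wt q ε a n - (wt q ε a n)⁻¹) := by
  have hεi : ε⁻¹ = ε := inv_eq_of_mul_eq_one_left hε
  have hx : q ^ (n : ℤ) ≠ 0 := zpow_ne_zero _ hq0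
  have hy : q ^ (a : ℤ) ≠ 0 := zpow_ne_zero _ hq0
  have e1 : q ^ ((a : ℤ) - 1 - 2 * n) = q ^ (a : ℤ) * q⁻¹ * (q ^ (n : ℤ))⁻¹ * (q ^ (n : ℤ))⁻¹ := by
    rw [show (a : ℤ) - 1 - 2 * n = a + (-1) + (-n) + (-n) by ring, zpow_add₀ hq0, zpow_add₀ hq0,
      zpow_add₀ hq0, zpow_neg, zpow_neg, zpow_one]
  have e2 : q ^ ((n : ℤ) + 1) = q ^ (n : ℤ) * q := by rw [zpow_add₀ hq0, zpow_one]
  have e3 : q ^ ((a : ℤ) - (n + 1)) = q ^ (a : ℤ) * (q ^ (n : ℤ))⁻¹ * q⁻¹ := by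
    rw [show (a : ℤ) - (n + 1) = a + (-n) + (-1) by ring, zpow_add₀ hq0, zpow_add₀ hq0,
      zpow_neg, zpow_neg, zpow_one]
  have e4 : q ^ ((a : ℤ) - n) = q ^ (a : ℤ) * (q ^ (n : ℤ))⁻¹ := by
    rw [sub_eq_add_neg, zpow_add₀ hq0, zpow_neg]
  simp only [coeffE, wt, qint, Nat.cast_add, Nat.cast_one, zpow_neg, mul_inv, hεi, e1, e2, e3, e4]
  have hqs' : q ^ 2 - 1 ≠ 0 := by
    intro h
    apply hqs
    field_simp
    linear_combination h
  generalize q ^ (n : ℤ) = x at *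
  generalize q ^ (a : ℤ) = y at *
  field_simp
  ring

theorem coeff_zero (q ε : k) (a : ℕ) : coeffE q ε a 0 = 0 := by simp [coeffE, qint]

theorem coeff_last (q ε : k) (a : ℕ) : coeffE q ε a a = 0 := by simp [coeffE, qint]

section Relations

variable {p : ℕ} {q ε : k} (Z : BMod k) {a b : ℕ} (ha : 0 < a) (hb : 0 < b)

theorem opK_fst (x : (Fin a → Z.Vp) × (Fin b → Z.Vm)) (n : Fin a) :
    (opK q ε Z a b x).1 n = wt q ε a n.val • x.1 n := rfl

theorem opKinv_fst (x : (Fin a → Z.Vp) × (Fin b → Z.Vm)) (n : Fin a) :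
    (opKinv q ε Z a b x).1 n = (wt q ε a n.val)⁻¹ • x.1 n := rfl

theorem opKinv_snd (x : (Fin a → Z.Vp) × (Fin b → Z.Vm)) (n : Fin b) :
    (opKinv q ε Z a b x).2 n = (wt q (-ε) b n.val)⁻¹ • x.2 n := rfl

theorem opE_fst_lt (x : (Fin a → Z.Vp) × (Fin b → Z.Vm)) (n : Fin a) (h : n.val + 1 < a) :
    (opE q ε Z ha hb x).1 n = coeffE q ε a (n.val + 1) • x.1 ⟨n.val + 1, h⟩
      + Z.t1m (Z.t2p (x.1 ⟨n.val + 1, h⟩)) := dif_pos h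

theorem opE_fst_last (x : (Fin a → Z.Vp) × (Fin b → Z.Vm)) (n : Fin a) (h : ¬ n.val + 1 < a) :
    (opE q ε Z ha hb x).1 n = Z.t2m (x.2 ⟨0, hb⟩) := dif_neg h

theorem opF_fst_pos (x : (Fin a → Z.Vp) × (Fin b → Z.Vm)) (n : Fin a) (h : 0 < n.val) :
    (opF Z ha hb x).1 n = x.1 ⟨n.val - 1, by omega⟩ := if_pos h

theorem opF_fst_zero (x : (Fin a → Z.Vp) × (Fin b → Z.Vm)) (n : Fin a) (h : ¬ 0 < n.val) :
    (opF Z ha hb x).1 n = Z.t1m (x.2 ⟨b - 1, by omega⟩) := if_neg h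

theorem half_KE (hp : 2 ≤ p) (hq : IsPrimitiveRoot q (2 * p)) (hε : ε * ε = 1)
    (hab : a + b = p) (x : (Fin a → Z.Vp) × (Fin b → Z.Vm)) :
    (opK q ε Z a b (opE q ε Z ha hb (opKinv q ε Z a b x))).1
      = (q ^ 2 • opE q ε Z ha hb x).1 := by
  have hq0 : q ≠ 0 := hq.ne_zero (by omega)
  have hε' : (-ε) * (-ε) = 1 := by simpa using hε
  ext n
  rw [opK_fst, Prod.smul_fst, Pi.smul_apply]
  by_cases h : n.val + 1 < a
  · have hw := wt_ne hq0 hε a (n.val + 1)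
    rw [opE_fst_lt _ _ _ _ _ h, opE_fst_lt _ _ _ _ _ h, opKinv_fst, wt_succ hq0 a n.val]
    simp only [map_smul, smul_add, smul_smul]
    congr 2 <;> field_simp
  · have hw := wt_ne hq0 hε' b 0
    rw [opE_fst_last _ _ _ _ _ h, opE_fst_last _ _ _ _ _ h, opKinv_snd,
      wt_last hp hq hab (show n.val + 1 = a by omega)]
    simp only [map_smul, smul_smul]
    congr 1
    field_simp

theorem half_KF (hp : 2 ≤ p) (hq : IsPrimitiveRoot q (2 * p)) (hε : ε * ε = 1)
    (hab : a + b = p) (x : (Fin a → Z.Vp) × (Fin b → Z.Vm)) :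
    (opK q ε Z a b (opF Z ha hb (opKinv q ε Z a b x))).1
      = ((q ^ 2)⁻¹ • opF Z ha hb x).1 := by
  have hq0 : q ≠ 0 := hq.ne_zero (by omega)
  have hε' : (-ε) * (-ε) = 1 := by simpa using hε
  ext n
  have hw := wt_ne hq0 hε a n.val
  rw [opK_fst, Prod.smul_fst, Pi.smul_apply]
  by_cases h : 0 < n.val
  · have e := wt_succ (ε := ε) hq0 a (n.val - 1)
    rw [Nat.sub_add_cancel h] at e
    rw [opF_fst_pos _ _ _ _ _ h, opF_fst_pos _ _ _ _ _ h, opKinv_fst, e]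
    simp only [map_smul, smul_smul]
    congr 1
    field_simp
  · have hn : n.val = 0 := by omega
    have e := wt_last (ε := -ε) hp hq (show b + a = p by omega) (show b - 1 + 1 = b by omega)
    rw [neg_neg] at e
    rw [hn] at hw
    rw [opF_fst_zero _ _ _ _ _ h, opF_fst_zero _ _ _ _ _ h, opKinv_snd, e, hn]
    simp only [map_smul, smul_smul]
    congr 1
    field_simp

theorem half_EF (hp : 2 ≤ p) (hq : IsPrimitiveRoot q (2 * p)) (hε : ε * ε = 1)
    (x : (Fin a → Z.Vp) × (Fin b → Z.Vm)) :
    (opE q ε Z ha hb (opF Z ha hb x) - opF Z ha hb (opE q ε Z ha hb x)).1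
      = ((q - q⁻¹)⁻¹ • (opK q ε Z a b x - opKinv q ε Z a b x)).1 := by
  have hq0 : q ≠ 0 := hq.ne_zero (by omega)
  have hqs := q_sub_ne hp hq
  ext n
  have hc := coeff_step hq0 hqs hε a n.val
  have hrel : ∀ v, Z.t2m (Z.t1p v) = Z.t1m (Z.t2p v) := fun v =>
    (LinearMap.congr_fun Z.t1m_t2p v).symm
  have hR : ((q - q⁻¹)⁻¹ • (opK q ε Z a b x - opKinv q ε Z a b x)).1 n
      = (coeffE q ε a (n.val + 1) - coeffE q ε a n.val) • x.1 n := by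
    rw [hc]
    simp [opK, opKinv, diagOp, sub_smul, smul_sub, mul_smul]
  have hE : (opE q ε Z ha hb (opF Z ha hb x)).1 n
      = coeffE q ε a (n.val + 1) • x.1 n + Z.t1m (Z.t2p (x.1 n)) := by
    by_cases h : n.val + 1 < a
    · simp [opE, opF, halfE, halfF, h]
    · have hn : n.val + 1 = a := by omega
      have hn' : (⟨a - 1, by omega⟩ : Fin a) = n := Fin.ext (by simp; omega)
      have hz : coeffE q ε a (n.val + 1) = 0 := by rw [hn, coeff_last]
      simp [opE, opF, halfE, halfF, hn, hn', hrel, coeff_last]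
  have hF : (opF Z ha hb (opE q ε Z ha hb x)).1 n
      = coeffE q ε a n.val • x.1 n + Z.t1m (Z.t2p (x.1 n)) := by
    by_cases h : 0 < n.val
    · simp [opE, opF, halfE, halfF, h, Nat.sub_add_cancel (show 1 ≤ n.val from h)]
    · have hn : n = ⟨0, ha⟩ := Fin.ext (by simp; omega)
      subst hn
      simp [opE, opF, halfE, halfF, Nat.sub_add_cancel (show 1 ≤ b from hb), coeff_zero]
  rw [hR, Prod.fst_sub, Pi.sub_apply, hE, hF, sub_smul]
  abel

theorem opE_kill_aux (i : ℕ) (x : (Fin a → Z.Vp) × (Fin b → Z.Vm)) (h1 : x.1 = 0)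
    (h2 : ∀ n : Fin b, i ≤ n.val → x.2 n = 0) (h3 : ∀ n, Z.t2m (x.2 n) = 0) :
    (opE q ε Z ha hb ^ i) x = 0 := by
  induction i generalizing x with
  | zero =>
    have : x = 0 := Prod.ext h1 (funext fun n => h2 n (Nat.zero_le _))
    simp [this]
  | succ i ih =>
    rw [pow_succ, Module.End.mul_apply]
    refine ih _ ?_ ?_ ?_
    · ext n
      by_cases h : n.val + 1 < a <;> simp [opE, halfE, h, h1, h3]
    · intro n hn
      by_cases h : n.val + 1 < b
      · simp [opE, halfE, h, h2 ⟨n.val + 1, h⟩ (by simp; omega)]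
      · simp [opE, halfE, h, h1]
    · intro n
      by_cases h : n.val + 1 < b
      · simp [opE, halfE, h, h3]
      · simp [opE, halfE, h, h1]

theorem opE_kill (i : ℕ) (x : (Fin a → Z.Vp) × (Fin b → Z.Vm))
    (h1 : ∀ n : Fin a, i ≤ n.val → x.1 n = 0) (h3 : ∀ n, Z.t2m (x.2 n) = 0) :
    (opE q ε Z ha hb ^ (b + i)) x = 0 := by
  induction i generalizing x with
  | zero =>
    exact opE_kill_aux Z ha hb b x (funext fun n => h1 n (Nat.zero_le _))
      (fun n hn => absurd n.isLt (by omega)) h3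
  | succ i ih =>
    rw [← add_assoc, pow_succ, Module.End.mul_apply]
    refine ih _ ?_ ?_
    · intro n hn
      by_cases h : n.val + 1 < a
      · simp [opE, halfE, h, h1 ⟨n.val + 1, h⟩ (by simp; omega)]
      · simp [opE, halfE, h, h3]
    · intro n
      by_cases h : n.val + 1 < b
      · simp [opE, halfE, h, h3]
      · simpa [opE, halfE, h] using LinearMap.congr_fun Z.t2m_t2p (x.1 ⟨0, ha⟩)

theorem opF_kill_aux (i : ℕ) (x : (Fin a → Z.Vp) × (Fin b → Z.Vm)) (h1 : x.1 = 0)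
    (h2 : ∀ n : Fin b, n.val + i < b → x.2 n = 0) (h3 : ∀ n, Z.t1m (x.2 n) = 0) :
    (opF Z ha hb ^ i) x = 0 := by
  induction i generalizing x with
  | zero =>
    have : x = 0 := Prod.ext h1 (funext fun n => h2 n (by omega))
    simp [this]
  | succ i ih =>
    rw [pow_succ, Module.End.mul_apply]
    refine ih _ ?_ ?_ ?_
    · ext n
      by_cases h : 0 < n.val <;> simp [opF, halfF, h, h1, h3]
    · intro n hn
      by_cases h : 0 < n.val
      · simp [opF, halfF, h, h2 ⟨n.val - 1, by omega⟩ (by simp; omega)]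
      · simp [opF, halfF, h, h1]
    · intro n
      by_cases h : 0 < n.val
      · simp [opF, halfF, h, h3]
      · simp [opF, halfF, h, h1]

theorem opF_kill (i : ℕ) (x : (Fin a → Z.Vp) × (Fin b → Z.Vm))
    (h1 : ∀ n : Fin a, n.val + i < a → x.1 n = 0) (h3 : ∀ n, Z.t1m (x.2 n) = 0) :
    (opF Z ha hb ^ (b + i)) x = 0 := by
  induction i generalizing x with
  | zero =>
    exact opF_kill_aux Z ha hb b x (funext fun n => h1 n (by omega))
      (fun n hn => absurd hn (by omega)) h3
  | succ i ih =>
    rw [← add_assoc, pow_succ, Module.End.mul_apply]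
    refine ih _ ?_ ?_
    · intro n hn
      by_cases h : 0 < n.val
      · simp [opF, halfF, h, h1 ⟨n.val - 1, by omega⟩ (by simp; omega)]
      · simp [opF, halfF, h, h3]
    · intro n
      by_cases h : 0 < n.val
      · simp [opF, halfF, h, h3]
      · simpa [opF, halfF, h] using LinearMap.congr_fun Z.t1m_t1p (x.1 ⟨a - 1, by omega⟩)

theorem opE_swap (x : (Fin a → Z.Vp) × (Fin b → Z.Vm)) :
    opE q (-ε) Z.swap hb ha x.swap = (opE q ε Z ha hb x).swap := by
  simp only [opE, neg_neg]
  rfl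

theorem opF_swap (x : (Fin a → Z.Vp) × (Fin b → Z.Vm)) :
    opF Z.swap hb ha x.swap = (opF Z ha hb x).swap := rfl

theorem opK_swap (x : (Fin a → Z.Vp) × (Fin b → Z.Vm)) :
    opK q (-ε) Z.swap b a x.swap = (opK q ε Z a b x).swap := by
  simp only [opK, neg_neg]
  rfl

theorem opKinv_swap (x : (Fin a → Z.Vp) × (Fin b → Z.Vm)) :
    opKinv q (-ε) Z.swap b a x.swap = (opKinv q ε Z a b x).swap := by
  simp only [opKinv, neg_neg]
  rfl

theorem opE_pow_swap (i : ℕ) (x : (Fin a → Z.Vp) × (Fin b → Z.Vm)) :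
    (opE q (-ε) Z.swap hb ha ^ i) x.swap = ((opE q ε Z ha hb ^ i) x).swap := by
  induction i generalizing x with
  | zero => rfl
  | succ i ih => rw [pow_succ, pow_succ, Module.End.mul_apply, Module.End.mul_apply, opE_swap, ih]

theorem opF_pow_swap (i : ℕ) (x : (Fin a → Z.Vp) × (Fin b → Z.Vm)) :
    (opF Z.swap hb ha ^ i) x.swap = ((opF Z ha hb ^ i) x).swap := by
  induction i generalizing x with
  | zero => rfl
  | succ i ih => rw [pow_succ, pow_succ, Module.End.mul_apply, Module.End.mul_apply, opF_swap, ih]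

theorem ops_rel (hp : 2 ≤ p) (hq : IsPrimitiveRoot q (2 * p)) (hε : ε * ε = 1)
    (hab : a + b = p) :
    UbarRel p q (opE q ε Z ha hb) (opF Z ha hb) (opK q ε Z a b) (opKinv q ε Z a b) := by
  have hq0 : q ≠ 0 := hq.ne_zero (by omega)
  have hε' : (-ε) * (-ε) = 1 := by simpa using hε
  have hba : b + a = p := by omega
  constructor
  · refine LinearMap.ext fun x => Prod.ext (funext fun n => ?_) (funext fun n => ?_)
    · simp [opK, opKinv, diagOp, smul_smul, wt_ne hq0 hε]
    · simp [opK, opKinv, diagOp, smul_smul, wt_ne hq0 hε']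
  · refine LinearMap.ext fun x => Prod.ext (funext fun n => ?_) (funext fun n => ?_)
    · simp [opK, opKinv, diagOp, smul_smul, wt_ne hq0 hε]
    · simp [opK, opKinv, diagOp, smul_smul, wt_ne hq0 hε']
  · refine LinearMap.ext fun x => Prod.ext (half_KE Z ha hb hp hq hε hab x) ?_
    have h := half_KE Z.swap hb ha hp hq hε' hba x.swap
    rw [opKinv_swap, opE_swap, opK_swap, opE_swap] at h
    exact h
  · refine LinearMap.ext fun x => Prod.ext (half_KF Z ha hb hp hq hε hab x) ?_
    have h := half_KF Z.swap hb ha hp hq hε' hba x.swap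
    rw [opKinv_swap, opF_swap, opK_swap, opF_swap] at h
    exact h
  · refine LinearMap.ext fun x => Prod.ext (half_EF Z ha hb hp hq hε x) ?_
    have h := half_EF Z.swap hb ha hp hq hε' x.swap
    rw [opF_swap, opE_swap, opE_swap, opF_swap, opK_swap, opKinv_swap] at h
    exact h
  · have hd : ∀ i : ℕ, opK q ε Z a b ^ i
        = LinearMap.prodMap (diagOp fun n => wt q ε a n ^ i)
            (diagOp fun n => wt q (-ε) b n ^ i) := by
      intro i
      induction i with
      | zero =>
        refine LinearMap.ext fun x => Prod.ext (funext fun n => ?_) (funext fun n => ?_) <;>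
        simp [diagOp]
      | succ i ih =>
        rw [pow_succ, ih]
        refine LinearMap.ext fun x => Prod.ext (funext fun n => ?_) (funext fun n => ?_) <;>
        simp [opK, diagOp, smul_smul, pow_succ]
    rw [hd]
    refine LinearMap.ext fun x => Prod.ext (funext fun n => ?_) (funext fun n => ?_)
    · simp [diagOp, wt_pow hq hε]
    · simp [diagOp, wt_pow hq hε']
  · refine LinearMap.ext fun x => ?_
    have h1 := opE_kill (q := q) (ε := ε) Z ha hb a (x.1, 0)
      (fun n hn => absurd n.isLt (by omega)) (by simp)
    have h2 := opE_kill (q := q) (ε := -ε) Z.swap hb ha b (x.2, 0)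
      (fun n hn => absurd n.isLt (by omega)) (by simp)
    rw [hba] at h1
    rw [hab] at h2
    have h3 := opE_pow_swap (q := q) (ε := ε) Z ha hb p (0, x.2)
    have h4 : ((opE q ε Z ha hb ^ p) (0, x.2)).swap = 0 := h3.symm.trans h2
    have h5 : (opE q ε Z ha hb ^ p) (0, x.2) = 0 := Prod.swap_injective h4
    have hx : x = (x.1, 0) + (0, x.2) := by simp
    rw [hx, map_add, h1, h5]
    simp
  · refine LinearMap.ext fun x => ?_
    have h1 := opF_kill Z ha hb a (x.1, 0) (fun n hn => absurd hn (by omega)) (by simp)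
    have h2 := opF_kill Z.swap hb ha b (x.2, 0) (fun n hn => absurd hn (by omega)) (by simp)
    rw [hba] at h1
    rw [hab] at h2
    have h3 := opF_pow_swap Z ha hb p (0, x.2)
    have h4 : ((opF Z ha hb ^ p) (0, x.2)).swap = 0 := h3.symm.trans h2
    have h5 : (opF Z ha hb ^ p) (0, x.2) = 0 := Prod.swap_injective h4
    have hx : x = (x.1, 0) + (0, x.2) := by simp
    rw [hx, map_add, h1, h5]
    simp

end Relations

/-- The functor `Φ_s`, for `0 < s < p`, on objects. -/
noncomputable def PhiCore {p : ℕ} {q : k} (hp : 2 ≤ p) (hq : IsPrimitiveRoot q (2 * p)) (s : ℕ)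
    (hs : 0 < s ∧ s < p) (Z : BMod k) : UMod p q :=
  UMod.ofHom ((Fin s → Z.Vp) × (Fin (p - s) → Z.Vm))
    (Ubar.lift (ops_rel (ε := 1) Z hs.1 (Nat.sub_pos_of_lt hs.2) hp hq (one_mul 1)
      (Nat.add_sub_cancel' hs.2.le)))

/-- The functor `Φ_s` on objects; the value for `s` outside `1, …, p - 1` is the zero module,
which plays no role. -/
noncomputable def Phi {p : ℕ} {q : k} (hp : 2 ≤ p) (hq : IsPrimitiveRoot q (2 * p)) (s : ℕ)
    (Z : BMod k) : UMod p q :=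
  if hs : 0 < s ∧ s < p then PhiCore hp hq s hs Z else UMod.ofHom PUnit (Ubar.lift (E := 0)
    (F := 0) (K := 1) (Kinv := 1) (by constructor <;> exact Subsingleton.elim _ _))

/-- The full subcategory `C(t)`, for `t = 1, …, p - 1`: modules which come from `B`-modules
through `Φ_t`. -/
def InC {p : ℕ} {q : k} (hp : 2 ≤ p) (hq : IsPrimitiveRoot q (2 * p)) (t : ℕ)
    (M : UMod p q) : Prop :=
  0 < t ∧ t < p ∧ ∃ Z : BMod k, Nonempty (M ≃ₗ[Ubar p q] Phi hp hq t Z)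

/-! #### The simple modules of dimension `p` -/

/-- `F a_n = a_{n+1}` for `n ≠ p-1`, and `F a_{p-1} = 0`. -/
def stF (k : Type u) [Field k] (p : ℕ) : Module.End k (Fin p → k) where
  toFun f n := if 0 < n.val then f ⟨n.val - 1, by omega⟩ else 0
  map_add' x y := by
    ext n
    by_cases h : 0 < n.val <;> simp [h]
  map_smul' c x := by
    ext n
    by_cases h : 0 < n.val <;> simp [h]

/-- `E a_n = ε [n] [p-n] a_{n-1}` for `n ≠ 0`, and `E a_0 = 0`. -/
noncomputable def stE (q ε : k) (p : ℕ) : Module.End k (Fin p → k) where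
  toFun f n := if h : n.val + 1 < p then coeffE q ε p (n.val + 1) * f ⟨n.val + 1, h⟩ else 0
  map_add' x y := by
    ext n
    by_cases h : n.val + 1 < p <;> simp [h, mul_add]
  map_smul' r x := by
    ext n
    by_cases h : n.val + 1 < p <;> simp [h, mul_left_comm]

theorem stE_kill (q ε : k) (p i : ℕ) (f : Fin p → k) (h : ∀ n : Fin p, i ≤ n.val → f n = 0) :
    (stE q ε p ^ i) f = 0 := by
  induction i generalizing f with
  | zero =>
    have h0 : f = 0 := funext fun n => h n (Nat.zero_le _)
    simp [h0]
  | succ i ih =>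
    rw [pow_succ, Module.End.mul_apply]
    refine ih _ fun n hn => ?_
    by_cases h' : n.val + 1 < p
    · simp [stE, h', h ⟨n.val + 1, h'⟩ (by simp; omega)]
    · simp [stE, h']

theorem stF_kill (p i : ℕ) (f : Fin p → k) (h : ∀ n : Fin p, n.val + i < p → f n = 0) :
    (stF k p ^ i) f = 0 := by
  induction i generalizing f with
  | zero =>
    have h0 : f = 0 := funext fun n => h n (by omega)
    simp [h0]
  | succ i ih =>
    rw [pow_succ, Module.End.mul_apply]
    refine ih _ fun n hn => ?_
    by_cases h' : 0 < n.val
    · simp [stF, h', h ⟨n.val - 1, by omega⟩ (by simp; omega)]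
    · simp [stF, h']

theorem st_rel {p : ℕ} {q ε : k} (hp : 2 ≤ p) (hq : IsPrimitiveRoot q (2 * p))
    (hε : ε * ε = 1) :
    UbarRel p q (stE q ε p) (stF k p) (diagOp (wt q ε p)) (diagOp fun n => (wt q ε p n)⁻¹) := by
  have hq0 : q ≠ 0 := hq.ne_zero (by omega)
  have hqs := q_sub_ne hp hq
  constructor
  · refine LinearMap.ext fun f => funext fun n => ?_
    simp [diagOp, wt_ne hq0 hε]
  · refine LinearMap.ext fun f => funext fun n => ?_
    simp [diagOp, wt_ne hq0 hε]
  · refine LinearMap.ext fun f => funext fun n => ?_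
    have hw := wt_ne hq0 hε p (n.val + 1)
    by_cases h : n.val + 1 < p
    · simp only [diagOp, stE, Module.End.mul_apply, LinearMap.coe_mk, AddHom.coe_mk, h, dite_true,
        LinearMap.smul_apply, Pi.smul_apply, smul_eq_mul, wt_succ hq0 p n.val]
      field_simp
    · simp [diagOp, stE, h]
  · refine LinearMap.ext fun f => funext fun n => ?_
    have hw := wt_ne hq0 hε p n.val
    by_cases h : 0 < n.val
    · have e := wt_succ (ε := ε) hq0 p (n.val - 1)
      rw [Nat.sub_add_cancel h] at e
      simp only [diagOp, stF, Module.End.mul_apply, LinearMap.coe_mk, AddHom.coe_mk, h, if_true,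
        LinearMap.smul_apply, Pi.smul_apply, smul_eq_mul, e]
      field_simp
    · simp [diagOp, stF, h]
  · refine LinearMap.ext fun f => funext fun n => ?_
    have hc := coeff_step hq0 hqs hε p n.val
    have hE : (stE q ε p) (stF k p f) n = coeffE q ε p (n.val + 1) * f n := by
      by_cases h : n.val + 1 < p
      · simp [stE, stF, h]
      · have hn : n.val + 1 = p := by omega
        simp [stE, stF, hn, coeff_last]
    have hF : (stF k p) (stE q ε p f) n = coeffE q ε p n.val * f n := by
      by_cases h : 0 < n.val
      · simp [stE, stF, h, Nat.sub_add_cancel (show 1 ≤ n.val from h)]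
      · have hn : n.val = 0 := by omega
        simp [stE, stF, hn, coeff_zero]
    rw [LinearMap.sub_apply, Pi.sub_apply, Module.End.mul_apply, Module.End.mul_apply, hE, hF,
      ← sub_mul, hc]
    simp [diagOp]
    ring
  · have hd : ∀ i : ℕ, (diagOp (wt q ε p) : Module.End k (Fin p → k)) ^ i
        = diagOp fun n => wt q ε p n ^ i := by
      intro i
      induction i with
      | zero =>
        refine LinearMap.ext fun f => funext fun n => ?_
        simp [diagOp]
      | succ i ih =>
        rw [pow_succ, ih]
        refine LinearMap.ext fun f => funext fun n => ?_
        simp [diagOp, pow_succ, mul_assoc]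
    rw [hd]
    refine LinearMap.ext fun f => funext fun n => ?_
    simp [diagOp, wt_pow hq hε]
  · exact LinearMap.ext fun f => stE_kill q ε p p f fun n hn => absurd n.isLt (by omega)
  · exact LinearMap.ext fun f => stF_kill p p f fun n hn => absurd hn (by omega)

/-- The simple module `X_p⁺`, with basis `a_0, …, a_{p-1}` and `K a_n = q^(p-1-2n) a_n`. -/
noncomputable def XpPlus {p : ℕ} {q : k} (hp : 2 ≤ p) (hq : IsPrimitiveRoot q (2 * p)) :
    UMod p q :=
  UMod.ofHom (Fin p → k) (Ubar.lift (st_rel (ε := 1) hp hq (one_mul 1)))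

/-- The simple module `X_p⁻`, with basis `a_0, …, a_{p-1}` and `K a_n = -q^(p-1-2n) a_n`. -/
noncomputable def XpMinus {p : ℕ} {q : k} (hp : 2 ≤ p) (hq : IsPrimitiveRoot q (2 * p)) :
    UMod p q :=
  UMod.ofHom (Fin p → k) (Ubar.lift (st_rel (ε := -1) hp hq (by ring)))

/-! #### The modules `P_s^±` and `E_s^±(n; λ)` -/

/-- The linear map `e_{i,j}` of `k²`, with indices counted from `0`. -/
noncomputable def e2 (k : Type u) [Field k] (i j : Fin 2) : (Fin 2 → k) →ₗ[k] (Fin 2 → k) :=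
  Matrix.toLin' (Matrix.single i j 1)

theorem e2_comp (i j l m : Fin 2) :
    e2 k i j ∘ₗ e2 k l m = if j = l then e2 k i m else 0 := by
  rw [e2, e2, ← Matrix.toLin'_mul]
  split_ifs with h
  · subst h
    simp [e2]
  · simp [Matrix.single_mul_single_of_ne, h]

/-- The `B`-module `P⁺`. -/
noncomputable def BMod.PPlus (k : Type u) [Field k] : BMod k where
  Vp := Fin 2 → k
  Vm := Fin 2 → k
  t1p := e2 k 0 0
  t2p := e2 k 1 0
  t1m := e2 k 1 1
  t2m := e2 k 1 0
  t1m_t1p := by simp [e2_comp]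
  t1p_t1m := by simp [e2_comp]
  t2m_t2p := by simp [e2_comp]
  t2p_t2m := by simp [e2_comp]
  t1p_t2m := by simp [e2_comp]
  t1m_t2p := by simp [e2_comp]

/-- The `B`-module `P⁻`. -/
noncomputable def BMod.PMinus (k : Type u) [Field k] : BMod k where
  Vp := Fin 2 → k
  Vm := Fin 2 → k
  t1p := e2 k 1 1
  t2p := e2 k 1 0
  t1m := e2 k 0 0
  t2m := e2 k 1 0
  t1m_t1p := by simp [e2_comp]
  t1p_t1m := by simp [e2_comp]
  t2m_t2p := by simp [e2_comp]
  t2p_t2m := by simp [e2_comp]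
  t1p_t2m := by simp [e2_comp]
  t1m_t2p := by simp [e2_comp]

/-- The nilpotent matrix `∑ e_{i,i+1}` of size `n`. -/
def nilMatrix (k : Type u) [Field k] (n : ℕ) : Matrix (Fin n) (Fin n) k :=
  Matrix.of fun i j => if i.val + 1 = j.val then 1 else 0

/-- The affine coordinate on the projective line: `[β : 1] ↦ β` and `[1 : 0] ↦ ∞`. -/
noncomputable def P1.coord (l : ℙ k (Fin 2 → k)) : OnePoint k :=
  letI := Classical.decEq k
  (OnePoint.equivProjectivization k).symm l

/-- The product `c λ = [c λ₁ : λ₂]` of a nonzero scalar `c` and `λ = [λ₁ : λ₂]`. -/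
noncomputable def P1.scale (c : k) (l : ℙ k (Fin 2 → k)) : ℙ k (Fin 2 → k) :=
  letI := Classical.decEq k
  OnePoint.equivProjectivization k ((P1.coord l).map fun b => c * b)

theorem P1.scale_mk (c x y : k) (h : ![x, y] ≠ 0) (h' : ![c * x, y] ≠ 0) :
    P1.scale c (Projectivization.mk k ![x, y] h) = Projectivization.mk k ![c * x, y] h' := by
  classical
  unfold P1.scale
  rw [← Equiv.eq_symm_apply]
  unfold P1.coord
  by_cases hy : y = 0
  · simp [hy]
  · simp [hy]
    ring

/-- The matrix `φ₁(n; λ)`: `β + ∑ e_{i,i+1}` if `λ = [β : 1]`, the identity if `λ = [1 : 0]`. -/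
noncomputable def phi1 (n : ℕ) (l : ℙ k (Fin 2 → k)) : Matrix (Fin n) (Fin n) k :=
  (P1.coord l).elim 1 fun b => b • 1 + nilMatrix k n

/-- The matrix `φ₂(n; λ)`: the identity if `λ = [β : 1]`, `∑ e_{i,i+1}` if `λ = [1 : 0]`. -/
noncomputable def phi2 (n : ℕ) (l : ℙ k (Fin 2 → k)) : Matrix (Fin n) (Fin n) k :=
  (P1.coord l).elim (nilMatrix k n) fun _ => 1

/-- The `B`-module `E⁺(n; λ)`. -/
noncomputable def BMod.EPlus (n : ℕ) (l : ℙ k (Fin 2 → k)) : BMod k where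
  Vp := Fin n → k
  Vm := Fin n → k
  t1p := Matrix.toLin' (phi1 n l)
  t2p := Matrix.toLin' (phi2 n l)
  t1m := 0
  t2m := 0
  t1m_t1p := by simp
  t1p_t1m := by simp
  t2m_t2p := by simp
  t2p_t2m := by simp
  t1p_t2m := by simp
  t1m_t2p := by simp

/-- The `B`-module `E⁻(n; λ)`. -/
noncomputable def BMod.EMinus (n : ℕ) (l : ℙ k (Fin 2 → k)) : BMod k where
  Vp := Fin n → k
  Vm := Fin n → k
  t1p := 0
  t2p := 0
  t1m := Matrix.toLin' (phi1 n l)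
  t2m := Matrix.toLin' (phi2 n l)
  t1m_t1p := by simp
  t1p_t1m := by simp
  t2m_t2p := by simp
  t2p_t2m := by simp
  t1p_t2m := by simp
  t1m_t2p := by simp

variable {p : ℕ} {q : k} (hp : 2 ≤ p) (hq : IsPrimitiveRoot q (2 * p))

/-- `P_s⁺ = Φ_s(P⁺)` for `s = 1, …, p - 1`, and `P_p⁺ = X_p⁺`. -/
noncomputable def PPlus (s : ℕ) : UMod p q :=
  if s = p then XpPlus hp hq else Phi hp hq s (BMod.PPlus k)

/-- `P_s⁻ = Φ_{p-s}(P⁻)` for `s = 1, …, p - 1`, and `P_p⁻ = X_p⁻`. -/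
noncomputable def PMinus (s : ℕ) : UMod p q :=
  if s = p then XpMinus hp hq else Phi hp hq (p - s) (BMod.PMinus k)

/-- `E_s⁺(n; λ) = Φ_s(E⁺(n; λ))` for `s = 1, …, p - 1`. -/
noncomputable def EPlus (s n : ℕ) (l : ℙ k (Fin 2 → k)) : UMod p q :=
  Phi hp hq s (BMod.EPlus n l)

/-- `E_s⁻(n; λ) = Φ_{p-s}(E⁻(n; λ))` for `s = 1, …, p - 1`. -/
noncomputable def EMinus (s n : ℕ) (l : ℙ k (Fin 2 → k)) : UMod p q :=
  Phi hp hq (p - s) (BMod.EMinus n l)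

end Modules

/-! ### The index sets -/

/-- `I_{s,s'} = {t = s' - s + 2 i - 1 | i = 1, …, s, t ≤ 2 p - s - s'}` for `s ≤ s'`, and
`I_{s,s'} = I_{s',s}` in general. -/
def setI (p s s' : ℕ) : Finset ℕ :=
  ((Finset.Icc 1 (min s s')).image fun i => max s s' - min s s' + 2 * i - 1).filter
    fun t => t ≤ 2 * p - s - s'

/-- `J_{s,s'} = {t = 2 p - 2 i - s' + s + 1 | i = 1, …, s, t ≤ p}` for `s ≤ s'`, and
`J_{s,s'} = J_{s',s}` in general. -/
def setJpair (p s s' : ℕ) : Finset ℕ :=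
  ((Finset.Icc 1 (min s s')).image fun i => 2 * p + min s s' + 1 - 2 * i - max s s').filter
    fun t => t ≤ p

/-- `J_{s,s'}` for `s, s' = 1, …, p` depends on `N = s + s'` only; this is `J_N`. -/
def setJ (p N : ℕ) : Finset ℕ :=
  (Finset.Icc 1 p).filter fun t => 2 * p + 1 ≤ t + N ∧ Odd (t + N)

theorem setJpair_eq {p s s' : ℕ} (hs : 1 ≤ s) (hsp : s ≤ p) (hs' : 1 ≤ s') (hsp' : s' ≤ p) :
    setJpair p s s' = setJ p (s + s') := by
  ext t
  simp only [setJpair, setJ, Finset.mem_filter, Finset.mem_image, Finset.mem_Icc]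
  constructor
  · rintro ⟨⟨i, hi, rfl⟩, ht⟩
    refine ⟨⟨by omega, ht⟩, by omega, ?_⟩
    rw [Nat.odd_iff]
    omega
  · rintro ⟨⟨h1, h2⟩, h3, h4⟩
    rw [Nat.odd_iff] at h4
    exact ⟨⟨(2 * p + min s s' + 1 - t - max s s') / 2, by omega, by omega⟩, h2⟩

end QSl2

set_option linter.unusedSectionVars false

namespace QSl2

variable {k : Type u} [Field k] {p : ℕ} {q : k}

local notation "𝐄" => Ubar.gen p q Gen.E
local notation "𝐅" => Ubar.gen p q Gen.F
local notation "𝐊" => Ubar.gen p q Gen.K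
local notation "𝐋" => Ubar.gen p q Gen.Kinv

/-- The action of the quantum group on a module. -/
noncomputable def act {M : Type*} [AddCommGroup M] [Module (Ubar p q) M] (x : Ubar p q) (v : M) :
    M := x • v

local notation:73 x:74 "⋆" v:73 => act x v

/-! ### Modules over the restricted quantum group: weights and the Casimir element -/

section Basic

theorem Ubar.induction {P : Ubar p q → Prop} (halg : ∀ c : k, P (algebraMap k _ c))
    (hgen : ∀ g, P (Ubar.gen p q g)) (hadd : ∀ x y, P x → P y → P (x + y))
    (hmul : ∀ x y, P x → P y → P (x * y)) (x : Ubar p q) : P x := by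
  obtain ⟨y, rfl⟩ := RingQuot.mkAlgHom_surjective k (FreeRel p q) x
  induction y using FreeAlgebra.induction with
  | grade0 c =>
    rw [AlgHom.commutes]
    exact halg c
  | grade1 g => exact hgen g
  | mul a b ha hb => rw [map_mul]; exact hmul _ _ ha hb
  | add a b ha hb => rw [map_add]; exact hadd _ _ ha hb

variable {M : Type*} [AddCommGroup M] [Module k M] [Module (Ubar p q) M]
  [IsScalarTower k (Ubar p q) M]
variable {N : Type*} [AddCommGroup N] [Module k N] [Module (Ubar p q) N]
  [IsScalarTower k (Ubar p q) N]

theorem act_def (x : Ubar p q) (v : M) : x ⋆ v = x • v := rfl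

@[simp] theorem act_zero (x : Ubar p q) : x ⋆ (0 : M) = 0 := smul_zero x

@[simp] theorem zero_act (v : M) : (0 : Ubar p q) ⋆ v = 0 := zero_smul _ v

@[simp] theorem one_act (v : M) : (1 : Ubar p q) ⋆ v = v := one_smul _ v

theorem act_add (x : Ubar p q) (v w : M) : x ⋆ (v + w) = x ⋆ v + x ⋆ w := smul_add x v w

theorem act_sub (x : Ubar p q) (v w : M) : x ⋆ (v - w) = x ⋆ v - x ⋆ w := smul_sub x v w

theorem act_sum {ι : Type*} (x : Ubar p q) (s : Finset ι) (f : ι → M) :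
    x ⋆ (∑ i ∈ s, f i) = ∑ i ∈ s, x ⋆ f i := Finset.smul_sum

theorem add_act (x y : Ubar p q) (v : M) : (x + y) ⋆ v = x ⋆ v + y ⋆ v := add_smul x y v

theorem sub_act (x y : Ubar p q) (v : M) : (x - y) ⋆ v = x ⋆ v - y ⋆ v := sub_smul x y v

theorem sum_act {ι : Type*} (s : Finset ι) (f : ι → Ubar p q) (v : M) :
    (∑ i ∈ s, f i) ⋆ v = ∑ i ∈ s, f i ⋆ v := Finset.sum_smul

theorem mul_act (x y : Ubar p q) (v : M) : (x * y) ⋆ v = x ⋆ y ⋆ v := mul_smul x y v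

theorem usmul (x : Ubar p q) (c : k) (v : M) : x ⋆ (c • v) = c • (x ⋆ v) := smul_comm _ _ _

theorem smul_act (c : k) (x : Ubar p q) (v : M) : (c • x) ⋆ v = c • (x ⋆ v) := smul_assoc _ _ _

theorem algebraMap_act (c : k) (v : M) : algebraMap k (Ubar p q) c ⋆ v = c • v :=
  algebraMap_smul _ _ _

theorem map_act (f : M →ₗ[Ubar p q] N) (x : Ubar p q) (v : M) : f (x ⋆ v) = x ⋆ f v :=
  map_smul f x v

theorem F_succ_act (n : ℕ) (v : M) : 𝐅 ^ (n + 1) ⋆ v = 𝐅 ⋆ 𝐅 ^ n ⋆ v := by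
  rw [pow_succ', mul_act]

theorem F_succ_act' (n : ℕ) (v : M) : 𝐅 ^ (n + 1) ⋆ v = 𝐅 ^ n ⋆ 𝐅 ⋆ v := by
  rw [pow_succ, mul_act]

theorem E_succ_act' (n : ℕ) (v : M) : 𝐄 ^ (n + 1) ⋆ v = 𝐄 ^ n ⋆ 𝐄 ⋆ v := by
  rw [pow_succ, mul_act]

theorem F_add_act (m n : ℕ) (v : M) : 𝐅 ^ (m + n) ⋆ v = 𝐅 ^ m ⋆ 𝐅 ^ n ⋆ v := by
  rw [pow_add, mul_act]

theorem E_add_act (m n : ℕ) (v : M) : 𝐄 ^ (m + n) ⋆ v = 𝐄 ^ m ⋆ 𝐄 ^ n ⋆ v := by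
  rw [pow_add, mul_act]

theorem KL_smul (v : M) : 𝐊 ⋆ 𝐋 ⋆ v = v := by
  rw [← mul_act, (Ubar.rel p q).K_Kinv, one_act]

theorem LK_smul (v : M) : 𝐋 ⋆ 𝐊 ⋆ v = v := by
  rw [← mul_act, (Ubar.rel p q).Kinv_K, one_act]

theorem KE_smul (v : M) : 𝐊 ⋆ 𝐄 ⋆ v = q ^ 2 • 𝐄 ⋆ 𝐊 ⋆ v := by
  have h := congrArg (fun x : Ubar p q => x ⋆ 𝐊 ⋆ v) (Ubar.rel p q).K_E
  simpa only [mul_act, LK_smul, smul_act] using h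

theorem KF_smul (v : M) : 𝐊 ⋆ 𝐅 ⋆ v = (q ^ 2)⁻¹ • 𝐅 ⋆ 𝐊 ⋆ v := by
  have h := congrArg (fun x : Ubar p q => x ⋆ 𝐊 ⋆ v) (Ubar.rel p q).K_F
  simpa only [mul_act, LK_smul, smul_act] using h

theorem EF_comm (v : M) : 𝐄 ⋆ 𝐅 ⋆ v = 𝐅 ⋆ 𝐄 ⋆ v + (q - q⁻¹)⁻¹ • (𝐊 ⋆ v - 𝐋 ⋆ v) := by
  have h := congrArg (fun x : Ubar p q => x ⋆ v) (Ubar.rel p q).E_F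
  simp only [mul_act, sub_act, smul_act] at h
  rw [← h]
  abel

theorem E_pow_smul (v : M) : 𝐄 ^ p ⋆ v = 0 := by rw [(Ubar.rel p q).E_pow, zero_act]

theorem F_pow_smul (v : M) : 𝐅 ^ p ⋆ v = 0 := by rw [(Ubar.rel p q).F_pow, zero_act]

theorem L_smul_of_weight {ω : k} (hω : ω ≠ 0) {v : M} (h : 𝐊 ⋆ v = ω • v) :
    𝐋 ⋆ v = ω⁻¹ • v := by
  have h1 : 𝐋 ⋆ 𝐊 ⋆ v = 𝐋 ⋆ ω • v := by rw [h]
  rw [LK_smul, usmul] at h1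
  rw [eq_inv_smul_iff₀ hω]
  exact h1.symm

theorem weight_E {ω : k} {v : M} (h : 𝐊 ⋆ v = ω • v) : 𝐊 ⋆ 𝐄 ⋆ v = (q ^ 2 * ω) • 𝐄 ⋆ v := by
  rw [KE_smul, h, usmul, smul_smul]

theorem weight_F {ω : k} {v : M} (h : 𝐊 ⋆ v = ω • v) :
    𝐊 ⋆ 𝐅 ⋆ v = ((q ^ 2)⁻¹ * ω) • 𝐅 ⋆ v := by
  rw [KF_smul, h, usmul, smul_smul]

/-- A `k`-linear map which commutes with `E`, `F`, `K` is linear over the quantum group. -/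
def ulin (f : M →ₗ[k] N) (hE : ∀ v, f (𝐄 ⋆ v) = 𝐄 ⋆ f v) (hF : ∀ v, f (𝐅 ⋆ v) = 𝐅 ⋆ f v)
    (hK : ∀ v, f (𝐊 ⋆ v) = 𝐊 ⋆ f v) : M →ₗ[Ubar p q] N where
  toFun := f
  map_add' := map_add f
  map_smul' x := by
    have hL : ∀ v, f (𝐋 ⋆ v) = 𝐋 ⋆ f v := fun v => by
      have h := hK (𝐋 ⋆ v)
      rw [KL_smul] at h
      rw [h, LK_smul]
    refine Ubar.induction (P := fun x => ∀ v, f (x ⋆ v) = x ⋆ f v) ?_ ?_ ?_ ?_ x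
    · intro c v
      rw [algebraMap_act, map_smul, algebraMap_act]
    · rintro (_ | _ | _ | _) v
      exacts [hE v, hF v, hK v, hL v]
    · intro a b ha hb v
      rw [add_act, map_add, ha, hb, add_act]
    · intro a b ha hb v
      rw [mul_act, ha, hb, mul_act]

/-- The Casimir element. -/
noncomputable def cas (p : ℕ) (q : k) : Ubar p q :=
  Ubar.gen p q Gen.F * Ubar.gen p q Gen.E
    + ((q - q⁻¹) ^ 2)⁻¹ • (q • Ubar.gen p q Gen.K + q⁻¹ • Ubar.gen p q Gen.Kinv)

/-- The value `ε (q ^ t + q ^ (-t)) / (q - q⁻¹)²` of the Casimir element on a vector of weight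
`ε q ^ (t - 1)` which is killed by `E`. -/
noncomputable def gam (q ε : k) (t : ℤ) : k := ε * (q ^ t + q ^ (-t)) / (q - q⁻¹) ^ 2

theorem cas_smul (v : M) :
    cas p q ⋆ v = 𝐅 ⋆ 𝐄 ⋆ v + ((q - q⁻¹) ^ 2)⁻¹ • (q • 𝐊 ⋆ v + q⁻¹ • 𝐋 ⋆ v) := by
  rw [cas, add_act, mul_act, smul_act, add_act, smul_act, smul_act]

theorem LE_smul (hq0 : q ≠ 0) (v : M) : 𝐋 ⋆ 𝐄 ⋆ v = (q ^ 2)⁻¹ • 𝐄 ⋆ 𝐋 ⋆ v := by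
  have h := congrArg (fun x : M => 𝐋 ⋆ x) (KE_smul (p := p) (q := q) (𝐋 ⋆ v))
  simp only [KL_smul, LK_smul, usmul] at h
  rw [eq_inv_smul_iff₀ (pow_ne_zero 2 hq0), h]

theorem LF_smul (hq0 : q ≠ 0) (v : M) : 𝐋 ⋆ 𝐅 ⋆ v = q ^ 2 • 𝐅 ⋆ 𝐋 ⋆ v := by
  have h := congrArg (fun x : M => 𝐋 ⋆ x) (KF_smul (p := p) (q := q) (𝐋 ⋆ v))
  simp only [KL_smul, LK_smul, usmul] at h
  rw [eq_inv_smul_iff₀ (pow_ne_zero 2 hq0)] at h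
  exact h.symm

theorem cas_smul' (hδ : q - q⁻¹ ≠ 0) (v : M) :
    cas p q ⋆ v = 𝐄 ⋆ 𝐅 ⋆ v + ((q - q⁻¹) ^ 2)⁻¹ • (q⁻¹ • 𝐊 ⋆ v + q • 𝐋 ⋆ v) := by
  have h : (q - q⁻¹)⁻¹ = ((q - q⁻¹) ^ 2)⁻¹ * (q - q⁻¹) := by field_simp
  rw [cas_smul, EF_comm, h]
  module

theorem cas_comm_smul (hq0 : q ≠ 0) (hδ : q - q⁻¹ ≠ 0) (x : Ubar p q) (v : M) :
    cas p q ⋆ x ⋆ v = x ⋆ cas p q ⋆ v := by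
  refine Ubar.induction (P := fun x => ∀ v : M, cas p q ⋆ x ⋆ v = x ⋆ cas p q ⋆ v)
    ?_ ?_ ?_ ?_ x v
  · intro c v
    rw [algebraMap_act, algebraMap_act, usmul]
  · have hE : ∀ v : M, cas p q ⋆ 𝐄 ⋆ v = 𝐄 ⋆ cas p q ⋆ v := fun v => by
      rw [cas_smul' hδ, cas_smul]
      simp only [act_add, usmul, KE_smul, LE_smul hq0, smul_smul]
      congr 3 <;> field_simp
    have hF : ∀ v : M, cas p q ⋆ 𝐅 ⋆ v = 𝐅 ⋆ cas p q ⋆ v := fun v => by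
      rw [cas_smul, cas_smul' hδ]
      simp only [act_add, usmul, KF_smul, LF_smul hq0, smul_smul]
      congr 3 <;> field_simp
    have hK : ∀ v : M, cas p q ⋆ 𝐊 ⋆ v = 𝐊 ⋆ cas p q ⋆ v := fun v => by
      rw [cas_smul, cas_smul]
      simp only [act_add, usmul, KF_smul, KE_smul, smul_smul, LK_smul, KL_smul]
      rw [inv_mul_cancel₀ (pow_ne_zero 2 hq0), one_smul]
    rintro (_ | _ | _ | _) v
    · exact hE v
    · exact hF v
    · exact hK v
    · have h := hK (𝐋 ⋆ v)
      rw [KL_smul] at h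
      rw [h, LK_smul]
  · intro a b ha hb v
    rw [add_act, act_add, ha, hb, add_act]
  · intro a b ha hb v
    rw [mul_act, ha, hb, mul_act]

theorem FE_smul (hq0 : q ≠ 0) {ε : k} (hε : ε * ε = 1) {j : ℤ} {v : M}
    (h : 𝐊 ⋆ v = (ε * q ^ j) • v) :
    𝐅 ⋆ 𝐄 ⋆ v = cas p q ⋆ v - gam q ε (j + 1) • v := by
  have hε0 : ε ≠ 0 := by rintro rfl; simp at hε
  have hεi : ε⁻¹ = ε := inv_eq_of_mul_eq_one_left hε
  rw [cas_smul, h, L_smul_of_weight (mul_ne_zero hε0 (zpow_ne_zero _ hq0)) h, gam,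
    zpow_neg, zpow_add₀ hq0, zpow_one, mul_inv, mul_inv, hεi]
  module

theorem EF_smul (hq0 : q ≠ 0) (hδ : q - q⁻¹ ≠ 0) {ε : k} (hε : ε * ε = 1) {j : ℤ} {v : M}
    (h : 𝐊 ⋆ v = (ε * q ^ j) • v) :
    𝐄 ⋆ 𝐅 ⋆ v = cas p q ⋆ v - gam q ε (j - 1) • v := by
  have hε0 : ε ≠ 0 := by rintro rfl; simp at hε
  have hεi : ε⁻¹ = ε := inv_eq_of_mul_eq_one_left hε
  rw [cas_smul' hδ, h, L_smul_of_weight (mul_ne_zero hε0 (zpow_ne_zero _ hq0)) h, gam,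
    zpow_neg, zpow_sub₀ hq0, zpow_one, mul_inv, inv_div, hεi]
  module

theorem weight_E' (hq0 : q ≠ 0) {ε : k} {j : ℤ} {v : M} (h : 𝐊 ⋆ v = (ε * q ^ j) • v) :
    𝐊 ⋆ 𝐄 ⋆ v = (ε * q ^ (j + 2)) • 𝐄 ⋆ v := by
  rw [weight_E h, zpow_add₀ hq0]
  norm_cast
  module

theorem weight_F' (hq0 : q ≠ 0) {ε : k} {j : ℤ} {v : M} (h : 𝐊 ⋆ v = (ε * q ^ j) • v) :
    𝐊 ⋆ 𝐅 ⋆ v = (ε * q ^ (j - 2)) • 𝐅 ⋆ v := by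
  rw [weight_F h, zpow_sub₀ hq0]
  norm_cast
  module

theorem weight_F_pow (hq0 : q ≠ 0) {ε : k} {j : ℤ} {v : M} (h : 𝐊 ⋆ v = (ε * q ^ j) • v)
    (n : ℕ) : 𝐊 ⋆ 𝐅 ^ n ⋆ v = (ε * q ^ (j - 2 * n)) • 𝐅 ^ n ⋆ v := by
  induction n with
  | zero => simpa using h
  | succ n ih =>
    rw [pow_succ', mul_act, weight_F' hq0 ih]
    congr 3
    push_cast
    ring

theorem weight_E_pow (hq0 : q ≠ 0) {ε : k} {j : ℤ} {v : M} (h : 𝐊 ⋆ v = (ε * q ^ j) • v)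
    (n : ℕ) : 𝐊 ⋆ 𝐄 ^ n ⋆ v = (ε * q ^ (j + 2 * n)) • 𝐄 ^ n ⋆ v := by
  induction n with
  | zero => simpa using h
  | succ n ih =>
    rw [pow_succ', mul_act, weight_E' hq0 ih]
    congr 3
    push_cast
    ring

theorem weight_cas (hq0 : q ≠ 0) (hδ : q - q⁻¹ ≠ 0) {ω : k} {v : M} (h : 𝐊 ⋆ v = ω • v)
    (f : Polynomial k) : 𝐊 ⋆ Polynomial.aeval (cas p q) f ⋆ v
      = ω • Polynomial.aeval (cas p q) f ⋆ v := by
  induction f using Polynomial.induction_on with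
  | C a => simp only [Polynomial.aeval_C, algebraMap_act, usmul, h]; rw [smul_comm]
  | add f g hf hg => rw [map_add, add_act, act_add, hf, hg, smul_add]
  | monomial n a ih =>
    rw [pow_succ', mul_left_comm, map_mul, Polynomial.aeval_X, mul_act,
      ← cas_comm_smul hq0 hδ, ih, usmul]

theorem aeval_cas_comm (hq0 : q ≠ 0) (hδ : q - q⁻¹ ≠ 0) (f : Polynomial k) (x : Ubar p q)
    (v : M) :
    Polynomial.aeval (cas p q) f ⋆ x ⋆ v = x ⋆ Polynomial.aeval (cas p q) f ⋆ v := by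
  induction f using Polynomial.induction_on generalizing v with
  | C a => simp only [Polynomial.aeval_C, algebraMap_act, usmul]
  | add f g hf hg => rw [map_add, add_act, hf, hg, add_act, act_add]
  | monomial n a ih =>
    rw [pow_succ', mul_left_comm, map_mul, Polynomial.aeval_X, mul_act, ih,
      cas_comm_smul hq0 hδ, mul_act]

theorem F_pow_E_pow (hq0 : q ≠ 0) (hδ : q - q⁻¹ ≠ 0) {ε : k} (hε : ε * ε = 1) {j : ℤ} {v : M}
    (h : 𝐊 ⋆ v = (ε * q ^ j) • v) (n : ℕ) :
    𝐅 ^ n ⋆ 𝐄 ^ n ⋆ v = Polynomial.aeval (cas p q)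
      (∏ i ∈ Finset.range n, (Polynomial.X - Polynomial.C (gam q ε (j + 1 + 2 * i)))) ⋆ v := by
  induction n with
  | zero => simp
  | succ n ih =>
    have e : j + 2 * (n : ℤ) + 1 = j + 1 + 2 * n := by ring
    rw [Finset.prod_range_succ, mul_comm, map_mul, mul_act, ← ih, pow_succ 𝐅, pow_succ' 𝐄,
      mul_act, mul_act, FE_smul hq0 hε (weight_E_pow hq0 h n), e]
    simp only [map_sub, Polynomial.aeval_X, Polynomial.aeval_C, sub_act, algebraMap_act,
      act_sub, usmul, cas_comm_smul hq0 hδ]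

theorem E_pow_F_pow (hq0 : q ≠ 0) (hδ : q - q⁻¹ ≠ 0) {ε : k} (hε : ε * ε = 1) {j : ℤ} {v : M}
    (h : 𝐊 ⋆ v = (ε * q ^ j) • v) (n : ℕ) :
    𝐄 ^ n ⋆ 𝐅 ^ n ⋆ v = Polynomial.aeval (cas p q)
      (∏ i ∈ Finset.range n, (Polynomial.X - Polynomial.C (gam q ε (j - 1 - 2 * i)))) ⋆ v := by
  induction n with
  | zero => simp
  | succ n ih =>
    have e : j - 2 * (n : ℤ) - 1 = j - 1 - 2 * n := by ring
    rw [Finset.prod_range_succ, mul_comm, map_mul, mul_act, ← ih, pow_succ 𝐄, pow_succ' 𝐅,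
      mul_act, mul_act, EF_smul hq0 hδ hε (weight_F_pow hq0 h n), e]
    simp only [map_sub, Polynomial.aeval_X, Polynomial.aeval_C, sub_act, algebraMap_act,
      act_sub, usmul, cas_comm_smul hq0 hδ]

end Basic

/-! ### Quantum integers and values of the Casimir element -/

section Scalars

theorem q_ne_zero (hp : 2 ≤ p) (hq : IsPrimitiveRoot q (2 * p)) : q ≠ 0 :=
  hq.ne_zero (by omega)

theorem q_zpow_eq_iff (hp : 2 ≤ p) (hq : IsPrimitiveRoot q (2 * p)) (a b : ℤ) :
    q ^ a = q ^ b ↔ (2 * p : ℤ) ∣ a - b := by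
  have hq0 := q_ne_zero hp hq
  have h := hq.zpow_eq_one_iff_dvd (a - b)
  push_cast at h
  rw [← h, zpow_sub₀ hq0, div_eq_one_iff_eq (zpow_ne_zero _ hq0)]

theorem q_zpow_add_p (hp : 2 ≤ p) (hq : IsPrimitiveRoot q (2 * p)) (a : ℤ) :
    q ^ (a + p) = -q ^ a := by
  rw [zpow_add₀ (q_ne_zero hp hq), zpow_natCast, pow_p_eq hp hq]
  ring

theorem q_zpow_sub_p (hp : 2 ≤ p) (hq : IsPrimitiveRoot q (2 * p)) (a : ℤ) :
    q ^ (a - p) = -q ^ a := by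
  have h := q_zpow_add_p hp hq (a - p)
  rw [sub_add_cancel] at h
  rw [h, neg_neg]

theorem sign_cases {ε : k} (hε : ε * ε = 1) : ε = 1 ∨ ε = -1 := mul_self_eq_one_iff.mp hε

theorem sign_ne_zero {ε : k} (hε : ε * ε = 1) : ε ≠ 0 := by
  rintro rfl
  simp at hε

theorem sign_mul {ε ε' : k} (hε : ε * ε = 1) (hε' : ε' * ε' = 1) : ε * ε' * (ε * ε') = 1 := by
  linear_combination ε' * ε' * hε + hε'

theorem sign_neg {ε : k} (hε : ε * ε = 1) : -ε * -ε = 1 := by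
  linear_combination hε

theorem qint_neg (a : ℤ) : qint q (-a) = -qint q a := by
  rw [qint, qint, neg_neg]
  ring

theorem qint_zero : qint q 0 = 0 := by simp [qint]

theorem qint_one (hp : 2 ≤ p) (hq : IsPrimitiveRoot q (2 * p)) : qint q 1 = 1 := by
  rw [qint, zpow_neg, zpow_one, div_self (q_sub_ne hp hq)]

theorem qint_add_p (hp : 2 ≤ p) (hq : IsPrimitiveRoot q (2 * p)) (a : ℤ) :
    qint q (a + p) = -qint q a := by
  have e : -(a + (p : ℤ)) = -a - p := by ring
  rw [qint, qint, e, q_zpow_add_p hp hq, q_zpow_sub_p hp hq]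
  ring

theorem qint_sub_p (hp : 2 ≤ p) (hq : IsPrimitiveRoot q (2 * p)) (a : ℤ) :
    qint q (a - p) = -qint q a := by
  have h := qint_add_p hp hq (a - p)
  rw [sub_add_cancel] at h
  rw [h, neg_neg]

theorem qint_p_sub (hp : 2 ≤ p) (hq : IsPrimitiveRoot q (2 * p)) (a : ℤ) :
    qint q (p - a) = qint q a := by
  have h := qint_add_p hp hq (-a)
  rw [qint_neg, neg_neg] at h
  rw [← h]
  congr 1
  ring

theorem qint_ne_zero (hp : 2 ≤ p) (hq : IsPrimitiveRoot q (2 * p)) {a : ℤ} (h0 : 0 < a)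
    (h1 : a < p) : qint q a ≠ 0 := by
  rw [qint]
  refine div_ne_zero ?_ (q_sub_ne hp hq)
  rw [sub_ne_zero, Ne, q_zpow_eq_iff hp hq]
  rintro ⟨c, hc⟩
  have h3 : (a : ℤ) = p * c := by linarith
  have : 0 < c := by
    by_contra hcon
    nlinarith
  nlinarith

theorem gam_sub (hq0 : q ≠ 0) (hδ : q - q⁻¹ ≠ 0) (ε : k) (t n : ℤ) :
    gam q ε t - gam q ε (t - 2 * n) = ε * (qint q n * qint q (t - n)) := by
  have hx : q ^ n ≠ 0 := zpow_ne_zero _ hq0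
  have hy : q ^ t ≠ 0 := zpow_ne_zero _ hq0
  have e1 : q ^ (t - 2 * n) = q ^ t * (q ^ n)⁻¹ * (q ^ n)⁻¹ := by
    rw [show t - 2 * n = t + -n + -n by ring, zpow_add₀ hq0, zpow_add₀ hq0, zpow_neg]
  have e2 : q ^ (t - n) = q ^ t * (q ^ n)⁻¹ := by
    rw [sub_eq_add_neg, zpow_add₀ hq0, zpow_neg]
  simp only [gam, qint, zpow_neg, e1, e2]
  generalize q - q⁻¹ = d at *
  generalize q ^ n = x at *
  generalize q ^ t = y at *
  field_simp
  ring

theorem gam_swap (hp : 2 ≤ p) (hq : IsPrimitiveRoot q (2 * p)) (ε : k) (t : ℤ) :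
    gam q (-ε) (p - t) = gam q ε t := by
  have e1 : q ^ ((p : ℤ) - t) = -q ^ (-t) := by
    rw [show (p : ℤ) - t = -t + p by ring, q_zpow_add_p hp hq]
  have e2 : q ^ (-((p : ℤ) - t)) = -q ^ t := by
    rw [show -((p : ℤ) - t) = t - p by ring, q_zpow_sub_p hp hq]
  rw [gam, gam, e1, e2]
  ring

theorem gam_eq_iff (hp : 2 ≤ p) (hq : IsPrimitiveRoot q (2 * p)) {ε ε' : k} (hε : ε * ε = 1)
    (hε' : ε' * ε' = 1) (a b : ℤ) :
    gam q ε a = gam q ε' b ↔ ε * q ^ a = ε' * q ^ b ∨ ε * q ^ a = ε' * q ^ (-b) := by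
  have hq0 := q_ne_zero hp hq
  have hδ := pow_ne_zero 2 (q_sub_ne hp hq)
  have hx : q ^ a ≠ 0 := zpow_ne_zero _ hq0
  have hy : q ^ b ≠ 0 := zpow_ne_zero _ hq0
  rw [gam, gam, div_left_inj' hδ, zpow_neg, zpow_neg, ← sub_eq_zero,
    ← sub_eq_zero (b := ε' * q ^ b), ← sub_eq_zero (b := ε' * (q ^ b)⁻¹), ← mul_eq_zero]
  have : (ε * q ^ a - ε' * q ^ b) * (ε * q ^ a - ε' * (q ^ b)⁻¹)
      = (ε * q ^ a) * (ε * (q ^ a + (q ^ a)⁻¹) - ε' * (q ^ b + (q ^ b)⁻¹)) := by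
    generalize q ^ a = x at *
    generalize q ^ b = y at *
    field_simp
    linear_combination y * hε' - y * hε
  rw [this, mul_eq_zero, or_iff_right (mul_ne_zero (sign_ne_zero hε) hx)]

theorem gam_one_eq_iff (hp : 2 ≤ p) (hq : IsPrimitiveRoot q (2 * p)) {ε : k} (hε : ε * ε = 1)
    (a b : ℤ) :
    gam q ε a = gam q ε b ↔ (2 * p : ℤ) ∣ a - b ∨ (2 * p : ℤ) ∣ a + b := by
  rw [gam_eq_iff hp hq hε hε, mul_right_inj' (sign_ne_zero hε), mul_right_inj' (sign_ne_zero hε),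
    q_zpow_eq_iff hp hq, q_zpow_eq_iff hp hq, sub_neg_eq_add]

/-- The eigenvalues of the Casimir element. -/
noncomputable def casValues (p : ℕ) (q : k) : Finset k :=
  letI := Classical.decEq k
  (Finset.range (2 * p)).image fun j : ℕ => gam q 1 (j : ℤ)

theorem gam_mem_casValues (hp : 2 ≤ p) (hq : IsPrimitiveRoot q (2 * p)) {ε : k}
    (hε : ε * ε = 1) (t : ℤ) : gam q ε t ∈ casValues p q := by
  have h1 : ∀ t : ℤ, gam q 1 t ∈ casValues p q := fun t => by
    classical
    have h0 := Int.emod_nonneg t (show (2 * p : ℤ) ≠ 0 by omega)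
    have h2 := Int.emod_lt_of_pos t (show (0 : ℤ) < 2 * p by omega)
    refine Finset.mem_image.mpr ⟨(t % (2 * p)).toNat, Finset.mem_range.mpr (by omega), ?_⟩
    rw [gam_one_eq_iff hp hq (one_mul 1)]
    left
    rw [Int.toNat_of_nonneg h0, ← dvd_neg, neg_sub]
    exact Int.dvd_self_sub_emod
  rcases sign_cases hε with rfl | rfl
  · exact h1 t
  · rw [← neg_neg (1 : k), ← gam_swap hp hq, neg_neg, neg_neg]
    exact h1 _

end Scalars

/-! ### Weight spaces and blocks -/

section Blocks

variable {M : Type*} [AddCommGroup M] [Module k M] [Module (Ubar p q) M]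
  [IsScalarTower k (Ubar p q) M]
variable {N : Type*} [AddCommGroup N] [Module k N] [Module (Ubar p q) N]
  [IsScalarTower k (Ubar p q) N]

theorem exists_weight_decomposition [CharZero k] (hp : 2 ≤ p) (hq : IsPrimitiveRoot q (2 * p))
    (v : M) : ∃ w : ℕ → M, (∀ i : ℕ, 𝐊 ⋆ w i = q ^ i • w i) ∧
      v = ∑ i ∈ Finset.range (2 * p), w i := by
  have hq0 := q_ne_zero hp hq
  have h2p : ((2 * p : ℕ) : k) ≠ 0 := Nat.cast_ne_zero.mpr (by omega)
  refine ⟨fun i => ((2 * p : ℕ) : k)⁻¹ • ∑ j ∈ Finset.range (2 * p),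
    ((q ^ i)⁻¹) ^ j • 𝐊 ^ j ⋆ v, ?_, ?_⟩
  · intro i
    have hi : q ^ i ≠ 0 := pow_ne_zero _ hq0
    have h1 : ∑ j ∈ Finset.range (2 * p), ((q ^ i)⁻¹) ^ (j + 1) • 𝐊 ^ (j + 1) ⋆ v
        = ∑ j ∈ Finset.range (2 * p), ((q ^ i)⁻¹) ^ j • 𝐊 ^ j ⋆ v := by
      have h2 := (Finset.sum_range_succ' (fun j => ((q ^ i)⁻¹) ^ j • 𝐊 ^ j ⋆ v) (2 * p)).symm.trans
        (Finset.sum_range_succ (fun j => ((q ^ i)⁻¹) ^ j • 𝐊 ^ j ⋆ v) (2 * p))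
      have h3 : ((q ^ i)⁻¹) ^ (2 * p) = 1 := by
        rw [inv_pow, ← pow_mul, mul_comm, pow_mul, hq.pow_eq_one, one_pow, inv_one]
      rw [h3, (Ubar.rel p q).K_pow, pow_zero, pow_zero] at h2
      exact add_right_cancel h2
    rw [usmul, smul_comm]
    congr 1
    rw [act_sum, ← h1, Finset.smul_sum]
    refine Finset.sum_congr rfl fun j _ => ?_
    rw [usmul, ← mul_act, ← pow_succ', smul_smul, pow_succ' (q ^ i)⁻¹, mul_inv_cancel_left₀ hi]
  · rw [← Finset.smul_sum, Finset.sum_comm]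
    have h1 : ∀ j ∈ Finset.range (2 * p), ∑ i ∈ Finset.range (2 * p),
        ((q ^ i)⁻¹) ^ j • 𝐊 ^ j ⋆ v = if j = 0 then ((2 * p : ℕ) : k) • v else 0 := by
      intro j hj
      split_ifs with h0
      · subst h0
        simp [← Nat.cast_smul_eq_nsmul k]
      · rw [← Finset.sum_smul]
        have h2 : ∀ i ∈ Finset.range (2 * p), ((q ^ i)⁻¹) ^ j = ((q ^ j)⁻¹) ^ i := by
          intro i _
          rw [inv_pow, inv_pow, ← pow_mul, ← pow_mul, mul_comm]
        rw [Finset.sum_congr rfl h2]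
        have h3 : (q ^ j)⁻¹ - 1 ≠ 0 := by
          rw [sub_ne_zero, Ne, inv_eq_one]
          exact hq.pow_ne_one_of_pos_of_lt h0 (Finset.mem_range.mp hj)
        have h4 := geom_sum_mul ((q ^ j)⁻¹) (2 * p)
        rw [inv_pow, ← pow_mul, mul_comm j, pow_mul, hq.pow_eq_one, one_pow, inv_one,
          sub_self] at h4
        rw [(mul_eq_zero.mp h4).resolve_right h3, zero_smul]
    rw [Finset.sum_congr rfl h1, Finset.sum_ite_eq', if_pos (Finset.mem_range.mpr (by omega)),
      inv_smul_smul₀ h2p]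

theorem eq_zero_of_sum_weights {ι : Type*} (s : Finset ι) (ω : ι → k) (hω : Set.InjOn ω s)
    (z : ι → M) (hz : ∀ i ∈ s, 𝐊 ⋆ z i = ω i • z i) (h : ∑ i ∈ s, z i = 0) :
    ∀ i ∈ s, z i = 0 := by
  have h1 := Module.End.eigenspaces_iSupIndep (Algebra.lsmul k k M 𝐊)
  have h2 := h1.comp (f := fun i : s => ω i) (fun a b hab => Subtype.ext (hω a.2 b.2 hab))
  have h3 := (iSupIndep_iff_finsetSum_eq_zero_imp_eq_zero _).mp h2 Finset.univ
    (fun i => z i) (fun i _ => by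
      rw [Function.comp_apply, Module.End.mem_eigenspace_iff]
      exact hz i i.2) (by
      rw [Finset.sum_coe_sort s z]
      exact h)
  intro i hi
  exact h3 ⟨i, hi⟩ (Finset.mem_univ _)

/-- The vector `v` lies in the generalized eigenspace of the Casimir element for `γ`. -/
def InBl (γ : k) (v : M) : Prop :=
  Polynomial.aeval (cas p q) ((Polynomial.X - Polynomial.C γ) ^ p) ⋆ v = 0

theorem exists_inverse_of_eval_ne_zero {γ : k} {v : M} (h : InBl (p := p) (q := q) γ v)
    (f : Polynomial k) (hf : f.eval γ ≠ 0) : ∃ g : Polynomial k,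
      Polynomial.aeval (cas p q) g ⋆ Polynomial.aeval (cas p q) f ⋆ v = v := by
  have hc : IsCoprime f ((Polynomial.X - Polynomial.C γ) ^ p) := by
    refine IsCoprime.pow_right ?_
    refine ((Polynomial.irreducible_X_sub_C γ).coprime_iff_not_dvd.mpr ?_).symm
    rwa [Polynomial.dvd_iff_isRoot]
  obtain ⟨a, b, hab⟩ := hc
  refine ⟨a, ?_⟩
  have h1 := congrArg (fun f => Polynomial.aeval (cas p q) f ⋆ v) hab
  simp only [map_add, map_mul, add_act, mul_act, map_one, one_act] at h1
  rw [InBl] at h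
  rw [h, act_zero, add_zero] at h1
  exact h1

theorem InBl.eq_zero_of_aeval {γ : k} {v : M} (h : InBl (p := p) (q := q) γ v)
    (f : Polynomial k) (hf : f.eval γ ≠ 0) (h0 : Polynomial.aeval (cas p q) f ⋆ v = 0) :
    v = 0 := by
  obtain ⟨g, hg⟩ := exists_inverse_of_eval_ne_zero h f hf
  rw [← hg, h0, act_zero]

theorem InBl.eq_zero_of_ne {γ γ' : k} {v : M} (h : InBl (p := p) (q := q) γ v)
    (h' : InBl (p := p) (q := q) γ' v) (hne : γ ≠ γ') : v = 0 :=
  h.eq_zero_of_aeval _ (by simpa [sub_eq_zero] using fun h => absurd h hne) h'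

variable (M) in
/-- The generalized eigenspace of the Casimir element for `γ`. -/
noncomputable def blockSub (hp : 2 ≤ p) (hq : IsPrimitiveRoot q (2 * p)) (γ : k) :
    Submodule (Ubar p q) M where
  carrier := {v | InBl (p := p) (q := q) γ v}
  add_mem' {a b} ha hb := by
    simp only [Set.mem_ofPred_eq, InBl, act_add] at *
    rw [ha, hb, add_zero]
  zero_mem' := act_zero _
  smul_mem' x v hv := by
    simp only [Set.mem_ofPred_eq, InBl, ← act_def] at *
    rw [aeval_cas_comm (q_ne_zero hp hq) (q_sub_ne hp hq), hv, act_zero]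

theorem mem_blockSub (hp : 2 ≤ p) (hq : IsPrimitiveRoot q (2 * p)) {γ : k} {v : M} :
    v ∈ blockSub M hp hq γ ↔ InBl (p := p) (q := q) γ v := Iff.rfl

theorem InBl.act (hp : 2 ≤ p) (hq : IsPrimitiveRoot q (2 * p)) {γ : k} {v : M}
    (h : InBl (p := p) (q := q) γ v) (x : Ubar p q) : InBl (p := p) (q := q) γ (x ⋆ v) :=
  (blockSub M hp hq γ).smul_mem x h

theorem InBl.map {γ : k} {v : M} (h : InBl (p := p) (q := q) γ v) (f : M →ₗ[Ubar p q] N) :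
    InBl (p := p) (q := q) γ (f v) := by
  rw [InBl] at *
  rw [← map_act, h, map_zero]

theorem InBl.of_cas (hp : 2 ≤ p) {γ : k} {v : M} (h : cas p q ⋆ v = γ • v) :
    InBl (p := p) (q := q) γ v := by
  obtain ⟨n, rfl⟩ : ∃ n, p = n + 1 := ⟨p - 1, by omega⟩
  rw [InBl, pow_succ, map_mul, mul_act, map_sub, Polynomial.aeval_X, Polynomial.aeval_C, sub_act,
    algebraMap_act, h, sub_self, act_zero]

theorem prod_casValues_eq_zero [CharZero k] (hp : 2 ≤ p) (hq : IsPrimitiveRoot q (2 * p))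
    (v : M) : Polynomial.aeval (cas p q)
      (∏ γ ∈ casValues p q, (Polynomial.X - Polynomial.C γ) ^ p) ⋆ v = 0 := by
  have hq0 := q_ne_zero hp hq
  have hδ := q_sub_ne hp hq
  obtain ⟨w, hw, rfl⟩ := exists_weight_decomposition hp hq v
  rw [act_sum]
  refine Finset.sum_eq_zero fun i _ => ?_
  have h1 : 𝐊 ⋆ w i = ((1 : k) * q ^ (i : ℤ)) • w i := by simpa using hw i
  have h2 := F_pow_E_pow hq0 hδ (one_mul 1) h1 p
  rw [E_pow_smul, act_zero] at h2
  have h3 : (∏ j ∈ Finset.range p, (Polynomial.X - Polynomial.C (gam q 1 ((i : ℤ) + 1 + 2 * j))))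
      ∣ ∏ γ ∈ casValues p q, (Polynomial.X - Polynomial.C γ) ^ p := by
    rw [Finset.prod_pow]
    calc _ ∣ ∏ j ∈ Finset.range p, ∏ γ ∈ casValues p q, (Polynomial.X - Polynomial.C γ) :=
          Finset.prod_dvd_prod_of_dvd _ _ fun j _ =>
            Finset.dvd_prod_of_mem (fun γ => Polynomial.X - Polynomial.C γ)
              (gam_mem_casValues hp hq (one_mul 1) _)
      _ = _ := by rw [Finset.prod_const, Finset.card_range]
  obtain ⟨g, hg⟩ := h3
  rw [hg, mul_comm, map_mul, mul_act, ← h2, act_zero]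

theorem exists_blockPoly (hp : 2 ≤ p) (hq : IsPrimitiveRoot q (2 * p)) :
    ∃ e : k → Polynomial k, ∑ γ ∈ casValues p q, e γ = 1 ∧
      ∀ γ ∈ casValues p q, (∏ γ' ∈ casValues p q, (Polynomial.X - Polynomial.C γ') ^ p)
        ∣ e γ * (Polynomial.X - Polynomial.C γ) ^ p := by
  classical
  have hne : (casValues p q).Nonempty := ⟨_, gam_mem_casValues hp hq (one_mul 1) 0⟩
  obtain ⟨μ, hμ⟩ := (exists_sum_eq_one_iff_pairwise_coprime
    (s := fun γ : k => (Polynomial.X - Polynomial.C γ) ^ p) hne).mpr (by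
      intro a b hab
      refine IsCoprime.pow ?_
      exact Polynomial.pairwise_coprime_X_sub_C Subtype.val_injective hab)
  refine ⟨_, hμ, fun γ hγ => ?_⟩
  rw [mul_assoc, Finset.sdiff_singleton_eq_erase, Finset.prod_erase_mul _ _ hγ]
  exact Dvd.intro_left _ rfl

/-- The central idempotent of the quantum group which projects to a block. -/
noncomputable def blockIdem (hp : 2 ≤ p) (hq : IsPrimitiveRoot q (2 * p)) (γ : k) : Ubar p q :=
  Polynomial.aeval (cas p q) ((exists_blockPoly hp hq).choose γ)

theorem blockIdem_comm (hp : 2 ≤ p) (hq : IsPrimitiveRoot q (2 * p)) (γ : k) (x : Ubar p q)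
    (v : M) : blockIdem hp hq γ ⋆ x ⋆ v = x ⋆ blockIdem hp hq γ ⋆ v :=
  aeval_cas_comm (q_ne_zero hp hq) (q_sub_ne hp hq) _ _ _

theorem sum_blockIdem (hp : 2 ≤ p) (hq : IsPrimitiveRoot q (2 * p)) (v : M) :
    ∑ γ ∈ casValues p q, blockIdem hp hq γ ⋆ v = v := by
  have h := (exists_blockPoly hp hq).choose_spec.1
  simp only [blockIdem]
  rw [← sum_act, ← map_sum, h, map_one, one_act]

theorem inBl_blockIdem [CharZero k] (hp : 2 ≤ p) (hq : IsPrimitiveRoot q (2 * p)) {γ : k}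
    (hγ : γ ∈ casValues p q) (v : M) : InBl (p := p) (q := q) γ (blockIdem hp hq γ ⋆ v) := by
  obtain ⟨g, hg⟩ := (exists_blockPoly hp hq).choose_spec.2 γ hγ
  rw [InBl, blockIdem, ← mul_act, ← map_mul, mul_comm, hg, mul_comm, map_mul, mul_act,
    prod_casValues_eq_zero hp hq, act_zero]

theorem blockIdem_of_ne [CharZero k] (hp : 2 ≤ p) (hq : IsPrimitiveRoot q (2 * p)) {γ γ' : k}
    (hγ : γ ∈ casValues p q) (hne : γ ≠ γ') {v : M} (h : InBl (p := p) (q := q) γ' v) :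
    blockIdem hp hq γ ⋆ v = 0 :=
  (inBl_blockIdem hp hq hγ v).eq_zero_of_ne (h.act hp hq _) hne

theorem blockIdem_of_inBl [CharZero k] (hp : 2 ≤ p) (hq : IsPrimitiveRoot q (2 * p)) {γ : k}
    (hγ : γ ∈ casValues p q) {v : M} (h : InBl (p := p) (q := q) γ v) :
    blockIdem hp hq γ ⋆ v = v := by
  conv_rhs => rw [← sum_blockIdem hp hq v]
  rw [Finset.sum_eq_single γ]
  · intro γ' hγ' hne
    exact blockIdem_of_ne hp hq hγ' hne h
  · exact fun h => absurd hγ h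

theorem eq_zero_of_blockIdem (hp : 2 ≤ p) (hq : IsPrimitiveRoot q (2 * p)) {v : M}
    (h : ∀ γ ∈ casValues p q, blockIdem hp hq γ ⋆ v = 0) : v = 0 := by
  rw [← sum_blockIdem hp hq v]
  exact Finset.sum_eq_zero h

end Blocks

/-! ### Modules in a single block come from `B`-modules -/

section BlockModules

theorem lift_act {V : Type u} [AddCommGroup V] [Module k V] [Module.Finite k V]
    {E F K Kinv : Module.End k V} (h : UbarRel p q E F K Kinv)
    (v : UMod.ofHom V (Ubar.lift h)) :
    𝐄 ⋆ v = E v ∧ 𝐅 ⋆ v = F v ∧ 𝐊 ⋆ v = K v := by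
  obtain ⟨h1, h2, h3, -⟩ := Ubar.lift_gen h
  exact ⟨LinearMap.congr_fun h1 v, LinearMap.congr_fun h2 v, LinearMap.congr_fun h3 v⟩

/-- The functor `Φ_a` with a sign `ε`. -/
noncomputable def PhiSigned {ε : k} (hp : 2 ≤ p) (hq : IsPrimitiveRoot q (2 * p))
    (hε : ε * ε = 1) (a : ℕ) (ha : 0 < a ∧ a < p) (Z : BMod k) : UMod p q :=
  UMod.ofHom ((Fin a → Z.Vp) × (Fin (p - a) → Z.Vm))
    (Ubar.lift (ops_rel (ε := ε) Z ha.1 (Nat.sub_pos_of_lt ha.2) hp hq hε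
      (Nat.add_sub_cancel' ha.2.le)))

theorem Phi_eq (hp : 2 ≤ p) (hq : IsPrimitiveRoot q (2 * p)) (a : ℕ) (ha : 0 < a ∧ a < p)
    (Z : BMod k) : Phi hp hq a Z = PhiSigned hp hq (one_mul 1) a ha Z := by
  rw [Phi, dif_pos ha]
  rfl

section

variable {M : Type*} [AddCommGroup M] [Module k M] [Module (Ubar p q) M]
  [IsScalarTower k (Ubar p q) M]

variable (p q M) in
/-- The space of vectors of weight `ω`. -/
noncomputable def wtSub (ω : k) : Submodule k M where
  carrier := {v | 𝐊 ⋆ v = ω • v}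
  add_mem' {a b} ha hb := by
    simp only [Set.mem_ofPred_eq, act_add] at *
    rw [ha, hb, smul_add]
  zero_mem' := by
    simp only [Set.mem_ofPred_eq]
    rw [act_zero, smul_zero]
  smul_mem' c v hv := by
    simp only [Set.mem_ofPred_eq] at *
    rw [usmul, hv, smul_comm]

theorem mem_wtSub {ω : k} {v : M} : v ∈ wtSub p q M ω ↔ 𝐊 ⋆ v = ω • v := Iff.rfl

theorem eval_gam_prod_down (hp : 2 ≤ p) (hq : IsPrimitiveRoot q (2 * p)) {ε : k}
    (hε : ε * ε = 1) {a n : ℕ} (hap : a ≤ p) (hn : n < a) :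
    (∏ i ∈ Finset.range n, (Polynomial.X - Polynomial.C
      (gam q ε ((a : ℤ) - 1 - 1 - 2 * i)))).eval (gam q ε a) ≠ 0 := by
  rw [Polynomial.eval_prod, Finset.prod_ne_zero_iff]
  intro i hi
  have hi := Finset.mem_range.mp hi
  have e : (a : ℤ) - 1 - 1 - 2 * i = a - 2 * (i + 1) := by ring
  rw [Polynomial.eval_sub, Polynomial.eval_X, Polynomial.eval_C, e,
    gam_sub (q_ne_zero hp hq) (q_sub_ne hp hq)]
  exact mul_ne_zero (sign_ne_zero hε) (mul_ne_zero (qint_ne_zero hp hq (by omega) (by omega))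
    (qint_ne_zero hp hq (by omega) (by omega)))

theorem eval_gam_prod_up (hp : 2 ≤ p) (hq : IsPrimitiveRoot q (2 * p)) {ε : k}
    (hε : ε * ε = 1) {a n : ℕ} (hap : a ≤ p) (hn : n < a) :
    (∏ i ∈ Finset.range n, (Polynomial.X - Polynomial.C
      (gam q ε ((a : ℤ) - 1 - 2 * n + 1 + 2 * i)))).eval (gam q ε a) ≠ 0 := by
  rw [Polynomial.eval_prod, Finset.prod_ne_zero_iff]
  intro i hi
  have hi := Finset.mem_range.mp hi
  have e : (a : ℤ) - 1 - 2 * n + 1 + 2 * i = a - 2 * (n - i) := by ring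
  rw [Polynomial.eval_sub, Polynomial.eval_X, Polynomial.eval_C, e,
    gam_sub (q_ne_zero hp hq) (q_sub_ne hp hq)]
  exact mul_ne_zero (sign_ne_zero hε) (mul_ne_zero (qint_ne_zero hp hq (by omega) (by omega))
    (qint_ne_zero hp hq (by omega) (by omega)))

theorem eq_zero_of_F_pow (hp : 2 ≤ p) (hq : IsPrimitiveRoot q (2 * p)) {ε : k}
    (hε : ε * ε = 1) {a n : ℕ} (hap : a ≤ p) (hn : n < a) {v : M}
    (hv : InBl (p := p) (q := q) (gam q ε a) v) (hw : 𝐊 ⋆ v = (ε * q ^ ((a : ℤ) - 1)) • v)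
    (h : 𝐅 ^ n ⋆ v = 0) : v = 0 := by
  have h1 := E_pow_F_pow (q_ne_zero hp hq) (q_sub_ne hp hq) hε hw n
  rw [h, act_zero] at h1
  exact hv.eq_zero_of_aeval _ (eval_gam_prod_down hp hq hε hap hn) h1.symm

theorem exists_F_pow_eq [CharZero k] (hp : 2 ≤ p) (hq : IsPrimitiveRoot q (2 * p)) {ε : k}
    (hε : ε * ε = 1) {a n : ℕ} (hap : a ≤ p) (hn : n < a) {v : M}
    (hv : InBl (p := p) (q := q) (gam q ε a) v)
    (hw : 𝐊 ⋆ v = (ε * q ^ ((a : ℤ) - 1 - 2 * n)) • v) :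
    ∃ x : M, 𝐊 ⋆ x = (ε * q ^ ((a : ℤ) - 1)) • x ∧ 𝐅 ^ n ⋆ x = v := by
  have hq0 := q_ne_zero hp hq
  have hδ := q_sub_ne hp hq
  obtain ⟨g, hg⟩ := exists_inverse_of_eval_ne_zero hv _ (eval_gam_prod_up hp hq hε hap hn)
  rw [← F_pow_E_pow hq0 hδ hε hw n, aeval_cas_comm hq0 hδ] at hg
  refine ⟨_, ?_, hg⟩
  have h2 := weight_E_pow hq0 hw n
  rw [sub_add_cancel] at h2
  exact weight_cas hq0 hδ h2 g

theorem exists_weight_eq [CharZero k] (hp : 2 ≤ p) (hq : IsPrimitiveRoot q (2 * p)) {ε : k}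
    (hε : ε * ε = 1) {a i : ℕ} {v : M} (hv : InBl (p := p) (q := q) (gam q ε a) v)
    (hw : 𝐊 ⋆ v = q ^ i • v) (h0 : v ≠ 0) :
    ∃ n : ℕ, n < p ∧ q ^ i = ε * q ^ ((a : ℤ) - 1 - 2 * n) := by
  have hq0 := q_ne_zero hp hq
  have hδ := q_sub_ne hp hq
  have hred : ∀ n : ℕ, q ^ i = ε * q ^ ((a : ℤ) - 1 - 2 * n) →
      ∃ n : ℕ, n < p ∧ q ^ i = ε * q ^ ((a : ℤ) - 1 - 2 * n) := by
    intro n hn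
    refine ⟨n % p, Nat.mod_lt _ (by omega), hn.trans ?_⟩
    congr 1
    rw [q_zpow_eq_iff hp hq]
    refine ⟨-((n / p : ℕ) : ℤ), ?_⟩
    have h1 : (n : ℤ) = p * (n / p : ℕ) + (n % p : ℕ) := by exact_mod_cast (Nat.div_add_mod n p).symm
    linear_combination -2 * h1
  have h1 : 𝐊 ⋆ v = ((1 : k) * q ^ (i : ℤ)) • v := by simpa using hw
  have h2 := F_pow_E_pow hq0 hδ (one_mul 1) h1 p
  rw [E_pow_smul, act_zero] at h2
  by_contra hcon
  refine h0 (hv.eq_zero_of_aeval _ ?_ h2.symm)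
  rw [Polynomial.eval_prod, Finset.prod_ne_zero_iff]
  intro n _
  rw [Polynomial.eval_sub, Polynomial.eval_X, Polynomial.eval_C, sub_ne_zero]
  intro heq
  apply hcon
  have hi : (q : k) ^ i = q ^ (i + 1 + 2 * (n : ℤ)) * q ^ (-1 - 2 * (n : ℤ)) := by
    rw [← zpow_add₀ hq0, ← zpow_natCast]
    congr 1
    ring
  rcases (gam_eq_iff hp hq (one_mul 1) hε _ _).mp heq.symm with h | h
  · refine hred n ?_
    rw [one_mul] at h
    rw [hi, h, mul_assoc, ← zpow_add₀ hq0]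
    congr 2
    ring
  · refine hred (a + n) ?_
    rw [one_mul] at h
    rw [hi, h, mul_assoc, ← zpow_add₀ hq0]
    congr 2
    push_cast
    ring

section Maps

variable {ε ε' : k} {a b : ℕ}

theorem flip_weight (hp : 2 ≤ p) (hq : IsPrimitiveRoot q (2 * p)) (hε' : ε' = -ε)
    (hab : a + b = p) (j : ℤ) :
    ε' * q ^ ((b : ℤ) - j) = ε * q ^ (-(a : ℤ) - j) := by
  have e : (b : ℤ) - j = -(a : ℤ) - j + p := by
    rw [← hab]
    push_cast
    ring
  rw [e, q_zpow_add_p hp hq, hε']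
  ring

theorem flip_gam (hp : 2 ≤ p) (hq : IsPrimitiveRoot q (2 * p)) (hε' : ε' = -ε)
    (hab : a + b = p) : gam q ε' b = gam q ε a := by
  rw [hε', ← gam_swap hp hq ε a, ← hab]
  congr 1
  push_cast
  ring

theorem weight_F_pow_flip (hp : 2 ≤ p) (hq : IsPrimitiveRoot q (2 * p)) (hε' : ε' = -ε)
    (hab : a + b = p) {v : M} (hv : 𝐊 ⋆ v = (ε * q ^ ((a : ℤ) - 1)) • v) :
    𝐊 ⋆ 𝐅 ^ a ⋆ v = (ε' * q ^ ((b : ℤ) - 1)) • 𝐅 ^ a ⋆ v := by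
  rw [weight_F_pow (q_ne_zero hp hq) hv, flip_weight hp hq hε' hab]
  congr 3
  ring

theorem weight_E_flip (hp : 2 ≤ p) (hq : IsPrimitiveRoot q (2 * p)) (hε' : ε' = -ε)
    (hb : 0 < b) (hab : a + b = p) {v : M} (hv : 𝐊 ⋆ v = (ε * q ^ ((a : ℤ) - 1)) • v) :
    𝐊 ⋆ 𝐄 ⋆ v = (ε' * q ^ ((b : ℤ) - 1 - 2 * (b - 1 : ℕ))) • 𝐄 ⋆ v := by
  rw [weight_E' (q_ne_zero hp hq) hv]
  have e : (b : ℤ) - 1 - 2 * (b - 1 : ℕ) = b - (2 * b - 1) := by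
    rw [Nat.cast_sub hb]
    push_cast
    ring
  have e2 : (a : ℤ) - 1 + 2 = (-(a : ℤ) - (2 * b - 1)) + p + p := by
    rw [← hab]
    push_cast
    ring
  rw [e, flip_weight hp hq hε' hab, e2, q_zpow_add_p hp hq, q_zpow_add_p hp hq, neg_neg]

/-- The action of `F ^ a` between the weight spaces at the two vertices. -/
noncomputable def t1map (hp : 2 ≤ p) (hq : IsPrimitiveRoot q (2 * p)) (hε' : ε' = -ε)
    (hab : a + b = p) :
    wtSub p q M (ε * q ^ ((a : ℤ) - 1)) →ₗ[k] wtSub p q M (ε' * q ^ ((b : ℤ) - 1)) where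
  toFun v := ⟨𝐅 ^ a ⋆ v.1, weight_F_pow_flip hp hq hε' hab v.2⟩
  map_add' _ _ := Subtype.ext (act_add _ _ _)
  map_smul' _ _ := Subtype.ext (usmul _ _ _)

theorem exists_t2map [CharZero k] (hp : 2 ≤ p) (hq : IsPrimitiveRoot q (2 * p))
    (hε : ε * ε = 1) (hε' : ε' = -ε) (hb : 0 < b) (hab : a + b = p)
    (hM : ∀ v : M, InBl (p := p) (q := q) (gam q ε a) v) :
    ∃ t : wtSub p q M (ε * q ^ ((a : ℤ) - 1)) →ₗ[k] wtSub p q M (ε' * q ^ ((b : ℤ) - 1)),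
      ∀ v, 𝐅 ^ (b - 1) ⋆ (t v).1 = 𝐄 ⋆ v.1 := by
  have hε1 : ε' * ε' = 1 := by rw [hε']; exact sign_neg hε
  have hq0 := q_ne_zero hp hq
  let f : wtSub p q M (ε' * q ^ ((b : ℤ) - 1)) →ₗ[k]
      wtSub p q M (ε' * q ^ ((b : ℤ) - 1 - 2 * (b - 1 : ℕ))) :=
    { toFun := fun v => ⟨𝐅 ^ (b - 1) ⋆ v.1, weight_F_pow hq0 v.2 _⟩
      map_add' := fun v w => Subtype.ext (act_add _ _ _)
      map_smul' := fun c v => Subtype.ext (usmul _ _ _) }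
  let g : wtSub p q M (ε * q ^ ((a : ℤ) - 1)) →ₗ[k]
      wtSub p q M (ε' * q ^ ((b : ℤ) - 1 - 2 * (b - 1 : ℕ))) :=
    { toFun := fun v => ⟨𝐄 ⋆ v.1, weight_E_flip hp hq hε' hb hab v.2⟩
      map_add' := fun v w => Subtype.ext (act_add _ _ _)
      map_smul' := fun c v => Subtype.ext (usmul _ _ _) }
  have hbl : ∀ v : M, InBl (p := p) (q := q) (gam q ε' b) v := by
    rw [flip_gam hp hq hε' hab]
    exact hM
  have hf : Function.Bijective f := by
    constructor
    · rw [injective_iff_map_eq_zero]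
      intro v hv
      exact Subtype.ext (eq_zero_of_F_pow hp hq hε1 (by omega) (show b - 1 < b by omega) (hbl v)
        v.2 (congrArg Subtype.val hv))
    · intro v
      obtain ⟨x, hx, hxv⟩ := exists_F_pow_eq hp hq hε1 (by omega) (show b - 1 < b by omega)
        (hbl v) v.2
      exact ⟨⟨x, hx⟩, Subtype.ext hxv⟩
  refine ⟨(LinearEquiv.ofBijective f hf).symm.toLinearMap ∘ₗ g, fun v => ?_⟩
  exact congrArg Subtype.val ((LinearEquiv.ofBijective f hf).apply_symm_apply (g v))

/-- The map `v ↦ x` with `F ^ (b - 1) x = E v` between the weight spaces at the two vertices. -/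
noncomputable def t2map [CharZero k] (hp : 2 ≤ p) (hq : IsPrimitiveRoot q (2 * p))
    (hε : ε * ε = 1) (hε' : ε' = -ε) (hb : 0 < b) (hab : a + b = p)
    (hM : ∀ v : M, InBl (p := p) (q := q) (gam q ε a) v) :
    wtSub p q M (ε * q ^ ((a : ℤ) - 1)) →ₗ[k] wtSub p q M (ε' * q ^ ((b : ℤ) - 1)) :=
  (exists_t2map hp hq hε hε' hb hab hM).choose

theorem t2map_spec [CharZero k] (hp : 2 ≤ p) (hq : IsPrimitiveRoot q (2 * p))
    (hε : ε * ε = 1) (hε' : ε' = -ε) (hb : 0 < b) (hab : a + b = p)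
    (hM : ∀ v : M, InBl (p := p) (q := q) (gam q ε a) v)
    (v : wtSub p q M (ε * q ^ ((a : ℤ) - 1))) :
    𝐅 ^ (b - 1) ⋆ (t2map hp hq hε hε' hb hab hM v).1 = 𝐄 ⋆ v.1 :=
  (exists_t2map hp hq hε hε' hb hab hM).choose_spec v

theorem E_F_pow_succ (hp : 2 ≤ p) (hq : IsPrimitiveRoot q (2 * p)) (hε : ε * ε = 1) (n : ℕ)
    {v : M} (hv : 𝐊 ⋆ v = (ε * q ^ ((a : ℤ) - 1)) • v) :
    𝐄 ⋆ 𝐅 ^ (n + 1) ⋆ v = 𝐅 ^ n ⋆ (coeffE q ε a (n + 1) • v + 𝐅 ⋆ 𝐄 ⋆ v) := by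
  have hq0 := q_ne_zero hp hq
  have hδ := q_sub_ne hp hq
  have h2 := gam_sub hq0 hδ ε a (n + 1)
  have e1 : (a : ℤ) - 1 - 2 * n - 1 = a - 2 * (n + 1) := by ring
  have e2 : (a : ℤ) - 1 + 1 = a := by ring
  have e3 : ((n + 1 : ℕ) : ℤ) = n + 1 := by push_cast; ring
  rw [F_succ_act, EF_smul hq0 hδ hε (weight_F_pow hq0 hv n), FE_smul hq0 hε hv, e1, e2, coeffE,
    e3, ← h2, cas_comm_smul hq0 hδ, act_add, act_sub, usmul, usmul]
  module

theorem gam_neg (t : ℤ) : gam q ε (-t) = gam q ε t := by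
  rw [gam, gam, neg_neg, add_comm]

theorem t1map_t1map (hp : 2 ≤ p) (hq : IsPrimitiveRoot q (2 * p)) (hε' : ε' = -ε)
    (hε'' : ε = -ε') (hab : a + b = p) (hba : b + a = p) :
    (t1map (M := M) hp hq hε'' hba) ∘ₗ t1map hp hq hε' hab = 0 := by
  refine LinearMap.ext fun v => Subtype.ext ?_
  change 𝐅 ^ b ⋆ 𝐅 ^ a ⋆ v.1 = 0
  rw [← F_add_act, hba, F_pow_smul]

theorem t1map_t2map [CharZero k] (hp : 2 ≤ p) (hq : IsPrimitiveRoot q (2 * p))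
    (hε : ε * ε = 1) (hε' : ε' = -ε) (hε'' : ε = -ε') (hb : 0 < b) (hab : a + b = p)
    (hba : b + a = p) (hM : ∀ v : M, InBl (p := p) (q := q) (gam q ε a) v)
    (v : wtSub p q M (ε * q ^ ((a : ℤ) - 1))) :
    (t1map hp hq hε'' hba (t2map hp hq hε hε' hb hab hM v)).1 = 𝐅 ⋆ 𝐄 ⋆ v.1 := by
  rw [← t2map_spec hp hq hε hε' hb hab hM v, ← F_succ_act, Nat.sub_add_cancel hb]
  rfl

theorem t2map_t1map [CharZero k] (hp : 2 ≤ p) (hq : IsPrimitiveRoot q (2 * p))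
    (hε : ε * ε = 1) (hε1 : ε' * ε' = 1) (hε' : ε' = -ε) (hε'' : ε = -ε') (ha : 0 < a)
    (hab : a + b = p) (hba : b + a = p)
    (hM : ∀ v : M, InBl (p := p) (q := q) (gam q ε a) v)
    (hM' : ∀ v : M, InBl (p := p) (q := q) (gam q ε' b) v)
    (v : wtSub p q M (ε * q ^ ((a : ℤ) - 1))) :
    (t2map hp hq hε1 hε'' ha hba hM' (t1map hp hq hε' hab v)).1 = 𝐅 ⋆ 𝐄 ⋆ v.1 := by
  have hq0 := q_ne_zero hp hq
  have hδ := q_sub_ne hp hq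
  have h1 := t2map_spec hp hq hε1 hε'' ha hba hM' (t1map hp hq hε' hab v)
  have h2 : 𝐄 ⋆ (t1map hp hq hε' hab v).1 = 𝐅 ^ (a - 1) ⋆ 𝐅 ⋆ 𝐄 ⋆ v.1 := by
    have h3 := E_F_pow_succ hp hq hε (a - 1) v.2
    rw [Nat.sub_add_cancel ha, coeff_last, zero_smul, zero_add] at h3
    exact h3
  rw [h2, ← sub_eq_zero, ← act_sub] at h1
  have hw : 𝐊 ⋆ 𝐅 ⋆ 𝐄 ⋆ v.1 = (ε * q ^ ((a : ℤ) - 1)) • 𝐅 ⋆ 𝐄 ⋆ v.1 := by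
    have := weight_F' hq0 (weight_E' hq0 v.2)
    rwa [add_sub_cancel_right] at this
  exact sub_eq_zero.mp (eq_zero_of_F_pow hp hq hε (by omega) (show a - 1 < a by omega) (hM _)
    (Submodule.sub_mem (wtSub p q M _) (Subtype.property _) hw) h1)

theorem t2map_t2map [CharZero k] (hp : 2 ≤ p) (hq : IsPrimitiveRoot q (2 * p))
    (hε : ε * ε = 1) (hε1 : ε' * ε' = 1) (hε' : ε' = -ε) (hε'' : ε = -ε') (ha : 0 < a)
    (hb : 0 < b) (hab : a + b = p) (hba : b + a = p)
    (hM : ∀ v : M, InBl (p := p) (q := q) (gam q ε a) v)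
    (hM' : ∀ v : M, InBl (p := p) (q := q) (gam q ε' b) v) :
    (t2map hp hq hε1 hε'' ha hba hM') ∘ₗ (t2map hp hq hε hε' hb hab hM) = 0 := by
  have hq0 := q_ne_zero hp hq
  have hδ := q_sub_ne hp hq
  refine LinearMap.ext fun v => Subtype.ext ?_
  rw [LinearMap.comp_apply]
  have h1 := t2map_spec hp hq hε hε' hb hab hM v
  set x := t2map hp hq hε hε' hb hab hM v
  have h2 := t2map_spec hp hq hε1 hε'' ha hba hM' x
  set y := t2map hp hq hε1 hε'' ha hba hM' x
  have h3 : 𝐄 ^ (a + (b - 1)) ⋆ 𝐄 ⋆ v.1 = 0 := by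
    rw [← E_succ_act', show a + (b - 1) + 1 = p by omega, E_pow_smul]
  rw [← h1, E_add_act, E_pow_F_pow hq0 hδ hε1 x.2, ← aeval_cas_comm hq0 hδ] at h3
  have h4 := (hM' _).eq_zero_of_aeval _
    (eval_gam_prod_down hp hq hε1 (by omega) (show b - 1 < b by omega)) h3
  rw [show a = a - 1 + 1 by omega, E_succ_act', ← h2, E_pow_F_pow hq0 hδ hε y.2] at h4
  exact (hM _).eq_zero_of_aeval _
    (eval_gam_prod_down hp hq hε (by omega) (show a - 1 < a by omega)) h4

end Maps

end

end BlockModules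

section OfHom

variable {V : Type u} [AddCommGroup V] [Module k V] [Module.Finite k V]
  {N : Type*} [AddCommGroup N] [Module k N] [Module (Ubar p q) N] [IsScalarTower k (Ubar p q) N]
  {E F K Kinv : Module.End k V}

/-- A linear map from a module given by four operators which respects these operators. -/
noncomputable def ofHomMap (h : UbarRel p q E F K Kinv) (f : V →ₗ[k] N)
    (hE : ∀ v, f (E v) = 𝐄 ⋆ f v) (hF : ∀ v, f (F v) = 𝐅 ⋆ f v) (hK : ∀ v, f (K v) = 𝐊 ⋆ f v) :
    UMod.ofHom V (Ubar.lift h) →ₗ[Ubar p q] N :=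
  let g : (UMod.ofHom V (Ubar.lift h)) →ₗ[k] N := f
  ulin g (fun v => (congrArg g (lift_act h v).1).trans (hE v))
    (fun v => (congrArg g (lift_act h v).2.1).trans (hF v))
    (fun v => (congrArg g (lift_act h v).2.2).trans (hK v))

/-- A linear map between two modules given by operators which respects these operators. -/
noncomputable def ofHomHom {V' : Type u} [AddCommGroup V'] [Module k V'] [Module.Finite k V']
    {E' F' K' Kinv' : Module.End k V'} (h : UbarRel p q E F K Kinv)
    (h' : UbarRel p q E' F' K' Kinv') (f : V →ₗ[k] V') (hE : ∀ v, f (E v) = E' (f v))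
    (hF : ∀ v, f (F v) = F' (f v)) (hK : ∀ v, f (K v) = K' (f v)) :
    UMod.ofHom V (Ubar.lift h) →ₗ[Ubar p q] UMod.ofHom V' (Ubar.lift h') :=
  let g : V →ₗ[k] UMod.ofHom V' (Ubar.lift h') := f
  ofHomMap h g (fun v => (hE v).trans (lift_act h' (g v)).1.symm)
    (fun v => (hF v).trans (lift_act h' (g v)).2.1.symm)
    (fun v => (hK v).trans (lift_act h' (g v)).2.2.symm)

end OfHom

section OfBlock

variable (M : Type u) [AddCommGroup M] [Module k M] [Module (Ubar p q) M]
  [IsScalarTower k (Ubar p q) M] {ε : k} {a : ℕ}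

/-- The `B`-module of a module on which the Casimir element has the single eigenvalue
`gam q ε a`. -/
noncomputable def BMod.ofBlock [CharZero k] [Module.Finite k M] (hp : 2 ≤ p)
    (hq : IsPrimitiveRoot q (2 * p)) (hε : ε * ε = 1) (ha : 0 < a ∧ a < p)
    (hM : ∀ v : M, InBl (p := p) (q := q) (gam q ε a) v) : BMod k :=
  have hab : a + (p - a) = p := Nat.add_sub_cancel' ha.2.le
  have hba : p - a + a = p := Nat.sub_add_cancel ha.2.le
  have hb : 0 < p - a := Nat.sub_pos_of_lt ha.2
  have hM' : ∀ v : M, InBl (p := p) (q := q) (gam q (-ε) (p - a : ℕ)) v := by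
    rw [flip_gam hp hq rfl hab]
    exact hM
  { Vp := wtSub p q M (ε * q ^ ((a : ℤ) - 1))
    Vm := wtSub p q M (-ε * q ^ (((p - a : ℕ) : ℤ) - 1))
    t1p := t1map hp hq rfl hab
    t1m := t1map hp hq (neg_neg ε).symm hba
    t2p := t2map hp hq hε rfl hb hab hM
    t2m := t2map hp hq (sign_neg hε) (neg_neg ε).symm ha.1 hba hM'
    t1m_t1p := t1map_t1map hp hq _ _ _ _
    t1p_t1m := t1map_t1map hp hq _ _ _ _
    t2m_t2p := t2map_t2map hp hq _ _ _ _ _ _ _ _ _ _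
    t2p_t2m := t2map_t2map hp hq _ _ _ _ _ _ _ _ _ _
    t1p_t2m := LinearMap.ext fun v => Subtype.ext
      ((t1map_t2map hp hq (sign_neg hε) (neg_neg ε).symm rfl ha.1 hba hab hM' v).trans
        (t2map_t1map hp hq (sign_neg hε) hε (neg_neg ε).symm rfl hb hba hab hM' hM v).symm)
    t1m_t2p := LinearMap.ext fun v => Subtype.ext
      ((t1map_t2map hp hq hε rfl (neg_neg ε).symm hb hab hba hM v).trans
        (t2map_t1map hp hq hε (sign_neg hε) rfl (neg_neg ε).symm ha.1 hab hba hM hM' v).symm) }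

variable {M}

theorem sum_F_shift (ha : 0 < a) (f : Fin a → M) (z : M) :
    ∑ n : Fin a, 𝐅 ^ n.val ⋆ (if 0 < n.val then f ⟨n.val - 1, by omega⟩ else z)
      = 𝐅 ⋆ (∑ n : Fin a, 𝐅 ^ n.val ⋆ f n) - 𝐅 ^ a ⋆ f ⟨a - 1, by omega⟩ + z := by
  obtain ⟨b, rfl⟩ : ∃ b, a = b + 1 := ⟨a - 1, by omega⟩
  rw [Fin.sum_univ_succ, Fin.sum_univ_castSucc, act_add, act_sum]
  simp only [Fin.val_zero, lt_irrefl, if_false, pow_zero, one_act, Fin.val_succ, Nat.succ_pos,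
    if_true, Fin.val_castSucc, Fin.val_last, ← F_succ_act]
  have e : (⟨b + 1 - 1, by omega⟩ : Fin (b + 1)) = Fin.last b := rfl
  rw [e, add_sub_cancel_right, add_comm]
  rfl

theorem sum_E_shift (hp : 2 ≤ p) (hq : IsPrimitiveRoot q (2 * p)) (hε : ε * ε = 1) (ha : 0 < a)
    (f : Fin a → M) (hf : ∀ n, 𝐊 ⋆ f n = (ε * q ^ ((a : ℤ) - 1)) • f n) (z : M) :
    ∑ n : Fin a, 𝐅 ^ n.val ⋆ (if h : n.val + 1 < a then
        coeffE q ε a (n.val + 1) • f ⟨n.val + 1, h⟩ + 𝐅 ⋆ 𝐄 ⋆ f ⟨n.val + 1, h⟩ else z)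
      = 𝐄 ⋆ (∑ n : Fin a, 𝐅 ^ n.val ⋆ f n) - 𝐄 ⋆ f ⟨0, ha⟩ + 𝐅 ^ (a - 1) ⋆ z := by
  obtain ⟨b, rfl⟩ : ∃ b, a = b + 1 := ⟨a - 1, by omega⟩
  rw [Fin.sum_univ_castSucc, Fin.sum_univ_succ, act_add, act_sum]
  have e : (⟨0, ha⟩ : Fin (b + 1)) = 0 := rfl
  simp only [Fin.val_zero, pow_zero, one_act, Fin.val_succ, Fin.val_castSucc, Fin.val_last,
    lt_irrefl, dite_false, e, add_sub_cancel_left, Nat.add_sub_cancel]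
  congr 1
  refine Finset.sum_congr rfl fun n _ => ?_
  rw [dif_pos (by omega), E_F_pow_succ hp hq hε n.val (hf _)]
  rfl

theorem injOn_weights (hp : 2 ≤ p) (hq : IsPrimitiveRoot q (2 * p)) (hε : ε * ε = 1) (j : ℤ) :
    Set.InjOn (fun n : ℕ => ε * q ^ (j - 2 * n)) (Finset.range p) := by
  intro m hm n hn h
  have hm := Finset.mem_range.mp hm
  have hn := Finset.mem_range.mp hn
  have h1 := mul_left_cancel₀ (sign_ne_zero hε) h
  rw [q_zpow_eq_iff hp hq] at h1
  have h2 := Int.eq_zero_of_abs_lt_dvd h1 (by rw [abs_lt]; constructor <;> omega)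
  omega

variable (M) in
/-- The map `(f, g) ↦ ∑ F ^ n f_n + ∑ F ^ m g_m`. -/
noncomputable def blockMap [CharZero k] [Module.Finite k M] (hp : 2 ≤ p)
    (hq : IsPrimitiveRoot q (2 * p)) (hε : ε * ε = 1) (ha : 0 < a ∧ a < p)
    (hM : ∀ v : M, InBl (p := p) (q := q) (gam q ε a) v) :
    ((Fin a → (BMod.ofBlock M hp hq hε ha hM).Vp) ×
      (Fin (p - a) → (BMod.ofBlock M hp hq hε ha hM).Vm)) →ₗ[k] M where
  toFun x := (∑ n : Fin a, 𝐅 ^ n.val ⋆ (x.1 n).1) + ∑ n : Fin (p - a), 𝐅 ^ n.val ⋆ (x.2 n).1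
  map_add' x y := by
    have h1 : ∀ n, ((x + y).1 n).1 = (x.1 n).1 + (y.1 n).1 := fun n => rfl
    have h2 : ∀ n, ((x + y).2 n).1 = (x.2 n).1 + (y.2 n).1 := fun n => rfl
    simp only [h1, h2, act_add, Finset.sum_add_distrib]
    abel
  map_smul' c x := by
    have h1 : ∀ n, ((c • x).1 n).1 = c • (x.1 n).1 := fun n => rfl
    have h2 : ∀ n, ((c • x).2 n).1 = c • (x.2 n).1 := fun n => rfl
    simp only [h1, h2, usmul, ← Finset.smul_sum, ← smul_add, RingHom.id_apply]

section

variable [CharZero k] [Module.Finite k M] (hp : 2 ≤ p) (hq : IsPrimitiveRoot q (2 * p))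
  (hε : ε * ε = 1) (ha : 0 < a ∧ a < p) (hM : ∀ v : M, InBl (p := p) (q := q) (gam q ε a) v)

theorem blockMap_F (x : (Fin a → (BMod.ofBlock M hp hq hε ha hM).Vp) ×
      (Fin (p - a) → (BMod.ofBlock M hp hq hε ha hM).Vm)) :
    blockMap M hp hq hε ha hM (opF (BMod.ofBlock M hp hq hε ha hM) ha.1
      (Nat.sub_pos_of_lt ha.2) x) = 𝐅 ⋆ blockMap M hp hq hε ha hM x := by
  have hb : 0 < p - a := Nat.sub_pos_of_lt ha.2
  have h1 := sum_F_shift (p := p) (q := q) ha.1 (fun n => (x.1 n).1) (𝐅 ^ (p - a) ⋆ (x.2 ⟨p - a - 1, by omega⟩).1)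
  have h2 := sum_F_shift (p := p) (q := q) hb (fun n => (x.2 n).1) (𝐅 ^ a ⋆ (x.1 ⟨a - 1, by omega⟩).1)
  have e1 : ∀ n : Fin a, ((opF (BMod.ofBlock M hp hq hε ha hM) ha.1 hb x).1 n).1
      = if 0 < n.val then (x.1 ⟨n.val - 1, by omega⟩).1
        else 𝐅 ^ (p - a) ⋆ (x.2 ⟨p - a - 1, by omega⟩).1 := fun n => by
    by_cases h : 0 < n.val
    · rw [opF_fst_pos _ _ _ _ _ h, if_pos h]
    · rw [opF_fst_zero _ _ _ _ _ h, if_neg h]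
      rfl
  have e2 : ∀ n : Fin (p - a), ((opF (BMod.ofBlock M hp hq hε ha hM) ha.1 hb x).2 n).1
      = if 0 < n.val then (x.2 ⟨n.val - 1, by omega⟩).1
        else 𝐅 ^ a ⋆ (x.1 ⟨a - 1, by omega⟩).1 := fun n => by
    have hs := opF_swap (BMod.ofBlock M hp hq hε ha hM) ha.1 hb x
    have hs' : (opF (BMod.ofBlock M hp hq hε ha hM) ha.1 hb x).2 n
        = (opF (BMod.ofBlock M hp hq hε ha hM).swap hb ha.1 x.swap).1 n := by rw [hs]; rfl
    rw [hs']
    by_cases h : 0 < n.val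
    · rw [opF_fst_pos _ _ _ _ _ h, if_pos h]
      rfl
    · rw [opF_fst_zero _ _ _ _ _ h, if_neg h]
      rfl
  change (∑ n : Fin a, 𝐅 ^ n.val ⋆ _) + ∑ n : Fin (p - a), 𝐅 ^ n.val ⋆ _
    = 𝐅 ⋆ ((∑ n : Fin a, 𝐅 ^ n.val ⋆ (x.1 n).1) + ∑ n : Fin (p - a), 𝐅 ^ n.val ⋆ (x.2 n).1)
  rw [Finset.sum_congr rfl fun n _ => congrArg (act (𝐅 ^ n.val)) (e1 n),
    Finset.sum_congr rfl fun n _ => congrArg (act (𝐅 ^ n.val)) (e2 n), h1, h2, act_add]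
  abel

theorem blockMap_E (x : (Fin a → (BMod.ofBlock M hp hq hε ha hM).Vp) ×
      (Fin (p - a) → (BMod.ofBlock M hp hq hε ha hM).Vm)) :
    blockMap M hp hq hε ha hM (opE q ε (BMod.ofBlock M hp hq hε ha hM) ha.1
      (Nat.sub_pos_of_lt ha.2) x) = 𝐄 ⋆ blockMap M hp hq hε ha hM x := by
  have hb : 0 < p - a := Nat.sub_pos_of_lt ha.2
  have hab : a + (p - a) = p := Nat.add_sub_cancel' ha.2.le
  have hba : p - a + a = p := Nat.sub_add_cancel ha.2.le
  have hM' : ∀ v : M, InBl (p := p) (q := q) (gam q (-ε) (p - a : ℕ)) v := by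
    rw [flip_gam hp hq rfl hab]
    exact hM
  have h1 := sum_E_shift hp hq hε ha.1 (fun n => (x.1 n).1) (fun n => (x.1 n).2)
    ((BMod.ofBlock M hp hq hε ha hM).t2m (x.2 ⟨0, hb⟩)).1
  have h2 := sum_E_shift hp hq (sign_neg hε) hb (fun n => (x.2 n).1) (fun n => (x.2 n).2)
    ((BMod.ofBlock M hp hq hε ha hM).t2p (x.1 ⟨0, ha.1⟩)).1
  have s1 : 𝐅 ^ (a - 1) ⋆ ((BMod.ofBlock M hp hq hε ha hM).t2m (x.2 ⟨0, hb⟩)).1 = 𝐄 ⋆ (x.2 ⟨0, hb⟩).1 :=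
    t2map_spec hp hq (sign_neg hε) (neg_neg ε).symm ha.1 hba hM' (x.2 ⟨0, hb⟩)
  have s2 : 𝐅 ^ (p - a - 1) ⋆ ((BMod.ofBlock M hp hq hε ha hM).t2p (x.1 ⟨0, ha.1⟩)).1 = 𝐄 ⋆ (x.1 ⟨0, ha.1⟩).1 :=
    t2map_spec hp hq hε rfl hb hab hM (x.1 ⟨0, ha.1⟩)
  have r1 : ∀ v : (BMod.ofBlock M hp hq hε ha hM).Vp, ((BMod.ofBlock M hp hq hε ha hM).t1m ((BMod.ofBlock M hp hq hε ha hM).t2p v)).1 = 𝐅 ⋆ 𝐄 ⋆ v.1 := fun v =>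
    t1map_t2map hp hq hε rfl (neg_neg ε).symm hb hab hba hM v
  have r2 : ∀ v : (BMod.ofBlock M hp hq hε ha hM).Vm, ((BMod.ofBlock M hp hq hε ha hM).t1p ((BMod.ofBlock M hp hq hε ha hM).t2m v)).1 = 𝐅 ⋆ 𝐄 ⋆ v.1 := fun v =>
    t1map_t2map hp hq (sign_neg hε) (neg_neg ε).symm rfl ha.1 hba hab hM' v
  have e1 : ∀ n : Fin a, ((opE q ε (BMod.ofBlock M hp hq hε ha hM) ha.1 hb x).1 n).1
      = if h : n.val + 1 < a then coeffE q ε a (n.val + 1) • (x.1 ⟨n.val + 1, h⟩).1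
          + 𝐅 ⋆ 𝐄 ⋆ (x.1 ⟨n.val + 1, h⟩).1 else ((BMod.ofBlock M hp hq hε ha hM).t2m (x.2 ⟨0, hb⟩)).1 := fun n => by
    by_cases h : n.val + 1 < a
    · rw [opE_fst_lt _ _ _ _ _ h, dif_pos h, ← r1]
      rfl
    · rw [opE_fst_last _ _ _ _ _ h, dif_neg h]
  have e2 : ∀ n : Fin (p - a), ((opE q ε (BMod.ofBlock M hp hq hε ha hM) ha.1 hb x).2 n).1
      = if h : n.val + 1 < p - a then coeffE q (-ε) (p - a) (n.val + 1) • (x.2 ⟨n.val + 1, h⟩).1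
          + 𝐅 ⋆ 𝐄 ⋆ (x.2 ⟨n.val + 1, h⟩).1 else ((BMod.ofBlock M hp hq hε ha hM).t2p (x.1 ⟨0, ha.1⟩)).1 := fun n => by
    have hs := opE_swap (q := q) (ε := ε) (BMod.ofBlock M hp hq hε ha hM) ha.1 hb x
    have hs' : (opE q ε (BMod.ofBlock M hp hq hε ha hM) ha.1 hb x).2 n
        = (opE q (-ε) (BMod.ofBlock M hp hq hε ha hM).swap hb ha.1 x.swap).1 n := by rw [hs]; rfl
    rw [hs']
    by_cases h : n.val + 1 < p - a
    · rw [opE_fst_lt _ _ _ _ _ h, dif_pos h, ← r2]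
      rfl
    · rw [opE_fst_last _ _ _ _ _ h, dif_neg h]
      rfl
  change (∑ n : Fin a, 𝐅 ^ n.val ⋆ _) + ∑ n : Fin (p - a), 𝐅 ^ n.val ⋆ _
    = 𝐄 ⋆ ((∑ n : Fin a, 𝐅 ^ n.val ⋆ (x.1 n).1) + ∑ n : Fin (p - a), 𝐅 ^ n.val ⋆ (x.2 n).1)
  rw [Finset.sum_congr rfl fun n _ => congrArg (act (𝐅 ^ n.val)) (e1 n),
    Finset.sum_congr rfl fun n _ => congrArg (act (𝐅 ^ n.val)) (e2 n), h1, h2, act_add, s1, s2]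
  abel

theorem blockMap_K (x : (Fin a → (BMod.ofBlock M hp hq hε ha hM).Vp) ×
      (Fin (p - a) → (BMod.ofBlock M hp hq hε ha hM).Vm)) :
    blockMap M hp hq hε ha hM (opK q ε (BMod.ofBlock M hp hq hε ha hM) a (p - a) x)
      = 𝐊 ⋆ blockMap M hp hq hε ha hM x := by
  have hq0 := q_ne_zero hp hq
  change (∑ n : Fin a, 𝐅 ^ n.val ⋆ (wt q ε a n.val • (x.1 n).1))
      + ∑ n : Fin (p - a), 𝐅 ^ n.val ⋆ (wt q (-ε) (p - a) n.val • (x.2 n).1)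
    = 𝐊 ⋆ ((∑ n : Fin a, 𝐅 ^ n.val ⋆ (x.1 n).1) + ∑ n : Fin (p - a), 𝐅 ^ n.val ⋆ (x.2 n).1)
  rw [act_add, act_sum, act_sum]
  congr 1 <;> refine Finset.sum_congr rfl fun n _ => ?_
  · rw [weight_F_pow hq0 (x.1 n).2, usmul, wt]
  · rw [weight_F_pow hq0 (x.2 n).2, usmul, wt]

theorem blockMap_injective : Function.Injective (blockMap M hp hq hε ha hM) := by
  have hq0 := q_ne_zero hp hq
  have hab : a + (p - a) = p := Nat.add_sub_cancel' ha.2.le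
  have hM' : ∀ v : M, InBl (p := p) (q := q) (gam q (-ε) (p - a : ℕ)) v := by
    rw [flip_gam hp hq rfl hab]
    exact hM
  rw [injective_iff_map_eq_zero]
  intro x hx
  change (∑ n : Fin a, 𝐅 ^ n.val ⋆ (x.1 n).1) + ∑ n : Fin (p - a), 𝐅 ^ n.val ⋆ (x.2 n).1 = 0 at hx
  let idx : Fin a ⊕ Fin (p - a) → ℕ := Sum.elim (fun n => n.val) (fun n => a + n.val)
  have hidx : ∀ i, idx i < p := by
    rintro (n | n) <;> simp only [idx, Sum.elim_inl, Sum.elim_inr] <;> omega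
  have hinj : Function.Injective idx := by
    rintro (n | n) (m | m) h <;> simp only [idx, Sum.elim_inl, Sum.elim_inr] at h
    · rw [Fin.ext h]
    · omega
    · omega
    · rw [Fin.ext (show n.val = m.val by omega)]
  let z : Fin a ⊕ Fin (p - a) → M :=
    Sum.elim (fun n => 𝐅 ^ n.val ⋆ (x.1 n).1) (fun n => 𝐅 ^ n.val ⋆ (x.2 n).1)
  have key := eq_zero_of_sum_weights (p := p) (q := q) Finset.univ
    (fun i => ε * q ^ ((a : ℤ) - 1 - 2 * (idx i : ℕ)))
    (fun i _ j _ h => hinj (injOn_weights hp hq hε ((a : ℤ) - 1)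
      (Finset.mem_coe.mpr (Finset.mem_range.mpr (hidx i)))
      (Finset.mem_coe.mpr (Finset.mem_range.mpr (hidx j))) h)) z (by
    rintro (n | n) -
    · exact weight_F_pow hq0 (x.1 n).2 _
    · change 𝐊 ⋆ 𝐅 ^ n.val ⋆ (x.2 n).1 = (ε * q ^ ((a : ℤ) - 1 - 2 * ((a + n.val : ℕ) : ℤ)))
        • 𝐅 ^ n.val ⋆ (x.2 n).1
      have e1 : ((p - a : ℕ) : ℤ) - 1 - 2 * n.val = ((p - a : ℕ) : ℤ) - (1 + 2 * n.val) := by ring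
      have e2 : (a : ℤ) - 1 - 2 * ((a + n.val : ℕ) : ℤ) = -(a : ℤ) - (1 + 2 * n.val) := by
        push_cast
        ring
      rw [weight_F_pow hq0 (x.2 n).2, e1, flip_weight hp hq rfl hab, e2]) (by
    rw [Fintype.sum_sum_type]
    exact hx)
  refine Prod.ext (funext fun n => Subtype.ext ?_) (funext fun n => Subtype.ext ?_)
  · exact eq_zero_of_F_pow hp hq hε ha.2.le n.isLt (hM _) (x.1 n).2
      (key (Sum.inl n) (Finset.mem_univ _))
  · exact eq_zero_of_F_pow hp hq (sign_neg hε) (Nat.sub_le _ _) n.isLt (hM' _) (x.2 n).2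
      (key (Sum.inr n) (Finset.mem_univ _))

theorem blockMap_surjective : Function.Surjective (blockMap M hp hq hε ha hM) := by
  have hab : a + (p - a) = p := Nat.add_sub_cancel' ha.2.le
  have hM' : ∀ v : M, InBl (p := p) (q := q) (gam q (-ε) (p - a : ℕ)) v := by
    rw [flip_gam hp hq rfl hab]
    exact hM
  suffices h : LinearMap.range (blockMap M hp hq hε ha hM) = ⊤ from LinearMap.range_eq_top.mp h
  rw [eq_top_iff]
  rintro v -
  obtain ⟨w, hw, rfl⟩ := exists_weight_decomposition hp hq v
  refine Submodule.sum_mem _ fun i _ => ?_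
  by_cases h0 : w i = 0
  · rw [h0]
    exact Submodule.zero_mem _
  obtain ⟨n, hn, hwn⟩ := exists_weight_eq hp hq hε (hM (w i)) (hw i) h0
  have hwi := hw i
  rw [hwn] at hwi
  rcases Nat.lt_or_ge n a with hna | hna
  · obtain ⟨x, hx, hxv⟩ := exists_F_pow_eq hp hq hε ha.2.le hna (hM _) hwi
    let y : (BMod.ofBlock M hp hq hε ha hM).Vp := ⟨x, hx⟩
    let f : Fin a → (BMod.ofBlock M hp hq hε ha hM).Vp := Pi.single ⟨n, hna⟩ y
    refine ⟨(f, 0), ?_⟩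
    change (∑ m : Fin a, 𝐅 ^ m.val ⋆ (f m).1) + ∑ m : Fin (p - a), 𝐅 ^ m.val ⋆ (0 : M) = w i
    rw [Finset.sum_eq_single ⟨n, hna⟩]
    · simp only [act_zero, Finset.sum_const_zero, add_zero]
      have hf : f ⟨n, hna⟩ = y := Pi.single_eq_same _ _
      rw [hf]
      exact hxv
    · intro m _ hm
      have hf : f m = 0 := Pi.single_eq_of_ne hm _
      rw [hf]
      exact act_zero _
    · exact fun h => absurd (Finset.mem_univ _) h
  · have hnb : n - a < p - a := by omega
    have hwi' : 𝐊 ⋆ w i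
        = (-ε * q ^ (((p - a : ℕ) : ℤ) - 1 - 2 * ((n - a : ℕ) : ℤ))) • w i := by
      have e1 : ((p - a : ℕ) : ℤ) - 1 - 2 * ((n - a : ℕ) : ℤ)
          = ((p - a : ℕ) : ℤ) - (1 + 2 * ((n - a : ℕ) : ℤ)) := by ring
      rw [hwi, e1, flip_weight hp hq rfl hab]
      congr 3
      rw [Nat.cast_sub hna]
      ring
    obtain ⟨x, hx, hxv⟩ := exists_F_pow_eq hp hq (sign_neg hε) (Nat.sub_le _ _) hnb (hM' _) hwi'
    let y : (BMod.ofBlock M hp hq hε ha hM).Vm := ⟨x, hx⟩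
    let f : Fin (p - a) → (BMod.ofBlock M hp hq hε ha hM).Vm := Pi.single ⟨n - a, hnb⟩ y
    refine ⟨(0, f), ?_⟩
    change (∑ m : Fin a, 𝐅 ^ m.val ⋆ (0 : M)) + ∑ m : Fin (p - a), 𝐅 ^ m.val ⋆ (f m).1 = w i
    rw [Finset.sum_eq_single (⟨n - a, hnb⟩ : Fin (p - a))]
    · simp only [act_zero, Finset.sum_const_zero, zero_add]
      have hf : f ⟨n - a, hnb⟩ = y := Pi.single_eq_same _ _
      rw [hf]
      exact hxv
    · intro m _ hm
      have hf : f m = 0 := Pi.single_eq_of_ne hm _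
      rw [hf]
      exact act_zero _
    · exact fun h => absurd (Finset.mem_univ _) h

/-- A module in a single block is isomorphic to the image of its `B`-module. -/
noncomputable def blockEquiv :
    PhiSigned hp hq hε a ha (BMod.ofBlock M hp hq hε ha hM) ≃ₗ[Ubar p q] M :=
  LinearEquiv.ofBijective
    (ofHomMap _ (blockMap M hp hq hε ha hM) (blockMap_E hp hq hε ha hM)
      (blockMap_F hp hq hε ha hM) (blockMap_K hp hq hε ha hM))
    ⟨blockMap_injective hp hq hε ha hM, blockMap_surjective hp hq hε ha hM⟩

theorem finrank_block (hp : 2 ≤ p) (hq : IsPrimitiveRoot q (2 * p)) (hε : ε * ε = 1)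
    (ha : 0 < a ∧ a < p) (hM : ∀ v : M, InBl (p := p) (q := q) (gam q ε a) v) :
    Module.finrank k M
    = a * Module.finrank k (wtSub p q M (ε * q ^ ((a : ℤ) - 1)))
      + (p - a) * Module.finrank k (wtSub p q M (-ε * q ^ (((p - a : ℕ) : ℤ) - 1))) := by
  rw [← (LinearEquiv.ofBijective (blockMap M hp hq hε ha hM)
    ⟨blockMap_injective hp hq hε ha hM, blockMap_surjective hp hq hε ha hM⟩).finrank_eq,
    Module.finrank_prod, Module.finrank_pi_fintype, Module.finrank_pi_fintype]
  simp only [Finset.sum_const, Finset.card_univ, Fintype.card_fin, smul_eq_mul]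
  rfl

end

end OfBlock

/-! ### Simple modules and tensor products -/

section Simple

theorem simple_rel {ε : k} (hp : 2 ≤ p) (hq : IsPrimitiveRoot q (2 * p)) (hε : ε * ε = 1)
    {r : ℕ} (hr : r ≤ p) :
    UbarRel p q (stE q ε r) (stF k r) (diagOp (wt q ε r)) (diagOp fun n => (wt q ε r n)⁻¹) := by
  have hq0 : q ≠ 0 := hq.ne_zero (by omega)
  have hqs := q_sub_ne hp hq
  constructor
  · refine LinearMap.ext fun f => funext fun n => ?_
    simp [diagOp, wt_ne hq0 hε]
  · refine LinearMap.ext fun f => funext fun n => ?_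
    simp [diagOp, wt_ne hq0 hε]
  · refine LinearMap.ext fun f => funext fun n => ?_
    have hw := wt_ne hq0 hε r (n.val + 1)
    by_cases h : n.val + 1 < r
    · simp only [diagOp, stE, Module.End.mul_apply, LinearMap.coe_mk, AddHom.coe_mk, h, dite_true,
        LinearMap.smul_apply, Pi.smul_apply, smul_eq_mul, wt_succ hq0 r n.val]
      field_simp
    · simp [diagOp, stE, h]
  · refine LinearMap.ext fun f => funext fun n => ?_
    have hw := wt_ne hq0 hε r n.val
    by_cases h : 0 < n.val
    · have e := wt_succ (ε := ε) hq0 r (n.val - 1)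
      rw [Nat.sub_add_cancel h] at e
      simp only [diagOp, stF, Module.End.mul_apply, LinearMap.coe_mk, AddHom.coe_mk, h, if_true,
        LinearMap.smul_apply, Pi.smul_apply, smul_eq_mul, e]
      field_simp
    · simp [diagOp, stF, h]
  · refine LinearMap.ext fun f => funext fun n => ?_
    have hc := coeff_step hq0 hqs hε r n.val
    have hE : (stE q ε r) (stF k r f) n = coeffE q ε r (n.val + 1) * f n := by
      by_cases h : n.val + 1 < r
      · simp [stE, stF, h]
      · have hn : n.val + 1 = r := by omega
        simp [stE, stF, hn, coeff_last]
    have hF : (stF k r) (stE q ε r f) n = coeffE q ε r n.val * f n := by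
      by_cases h : 0 < n.val
      · simp [stE, stF, h, Nat.sub_add_cancel (show 1 ≤ n.val from h)]
      · have hn : n.val = 0 := by omega
        simp [stE, stF, hn, coeff_zero]
    rw [LinearMap.sub_apply, Pi.sub_apply, Module.End.mul_apply, Module.End.mul_apply, hE, hF,
      ← sub_mul, hc]
    simp [diagOp]
    ring
  · have hd : ∀ i : ℕ, (diagOp (wt q ε r) : Module.End k (Fin r → k)) ^ i
        = diagOp fun n => wt q ε r n ^ i := by
      intro i
      induction i with
      | zero =>
        refine LinearMap.ext fun f => funext fun n => ?_
        simp [diagOp]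
      | succ i ih =>
        rw [pow_succ, ih]
        refine LinearMap.ext fun f => funext fun n => ?_
        simp [diagOp, pow_succ, mul_assoc]
    rw [hd]
    refine LinearMap.ext fun f => funext fun n => ?_
    simp [diagOp, wt_pow hq hε]
  · exact LinearMap.ext fun f => stE_kill q ε r p f fun n hn => absurd n.isLt (by omega)
  · exact LinearMap.ext fun f => stF_kill r p f fun n hn => absurd hn (by omega)

/-- The simple module of dimension `r ≤ p` and sign `ε`. -/
noncomputable def XMod {ε : k} (hp : 2 ≤ p) (hq : IsPrimitiveRoot q (2 * p)) (hε : ε * ε = 1)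
    {r : ℕ} (hr : r ≤ p) : UMod p q :=
  UMod.ofHom (Fin r → k) (Ubar.lift (simple_rel hp hq hε hr))

section

variable {ε : k} (hp : 2 ≤ p) (hq : IsPrimitiveRoot q (2 * p)) (hε : ε * ε = 1)
  {r : ℕ} (hr : r ≤ p)

/-- The vector `a_i` of the simple module; it is zero for `r ≤ i`. -/
noncomputable def XMod.bas (i : ℕ) : XMod hp hq hε hr :=
  (show Fin r → k from fun n => if n.val = i then 1 else 0)

theorem XMod.F_bas (i : ℕ) : 𝐅 ⋆ XMod.bas hp hq hε hr i = XMod.bas hp hq hε hr (i + 1) := by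
  refine (lift_act _ _).2.1.trans ?_
  refine funext fun n => ?_
  change (if 0 < n.val then (if n.val - 1 = i then (1 : k) else 0) else 0)
    = if n.val = i + 1 then 1 else 0
  split_ifs <;> first | rfl | omega

theorem XMod.E_bas (i : ℕ) :
    𝐄 ⋆ XMod.bas hp hq hε hr i = coeffE q ε r i • XMod.bas hp hq hε hr (i - 1) := by
  refine (lift_act _ _).1.trans ?_
  refine funext fun n => ?_
  change (if h : n.val + 1 < r then coeffE q ε r (n.val + 1) * (if n.val + 1 = i then (1 : k) else 0)
    else 0) = coeffE q ε r i * if n.val = i - 1 then 1 else 0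
  rcases Nat.eq_zero_or_pos i with rfl | hi
  · simp [coeff_zero]
  · by_cases h : n.val + 1 = i
    · subst h
      by_cases h' : n.val + 1 < r
      · simp [h']
      · have : n.val + 1 = r := by omega
        simp [this, coeff_last]
    · have h' : n.val ≠ i - 1 := by omega
      simp [h, h']

theorem XMod.K_bas (i : ℕ) :
    𝐊 ⋆ XMod.bas hp hq hε hr i = wt q ε r i • XMod.bas hp hq hε hr i := by
  refine (lift_act _ _).2.2.trans ?_
  refine funext fun n => ?_
  change wt q ε r n.val * (if n.val = i then (1 : k) else 0)
    = wt q ε r i * if n.val = i then 1 else 0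
  by_cases h : n.val = i <;> simp [h]

theorem XMod.L_bas (i : ℕ) :
    𝐋 ⋆ XMod.bas hp hq hε hr i = (wt q ε r i)⁻¹ • XMod.bas hp hq hε hr i :=
  L_smul_of_weight (wt_ne (q_ne_zero hp hq) hε r i) (XMod.K_bas hp hq hε hr i)

theorem XMod.bas_of_le {i : ℕ} (h : r ≤ i) : XMod.bas hp hq hε hr i = 0 :=
  funext fun n => if_neg (by omega)

theorem XMod.eq_sum (v : XMod hp hq hε hr) :
    v = ∑ n : Fin r, (show Fin r → k from v) n • XMod.bas hp hq hε hr n.val := by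
  have h : ∀ f : Fin r → k, f = ∑ n : Fin r, f n • (fun m : Fin r => if m.val = n.val then (1 : k) else 0) := by
    intro f
    ext m
    simp [Finset.sum_apply, Fin.val_inj]
  exact h v

/-- Two linear maps on the simple module agree if they agree on the basis. -/
theorem XMod.hom_ext {P : Type*} [AddCommGroup P] [Module k P]
    {f g : XMod hp hq hε hr →ₗ[k] P}
    (h : ∀ i < r, f (XMod.bas hp hq hε hr i) = g (XMod.bas hp hq hε hr i)) (v) : f v = g v := by
  rw [XMod.eq_sum hp hq hε hr v, map_sum, map_sum]
  refine Finset.sum_congr rfl fun n _ => ?_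
  rw [map_smul, map_smul, h n.val n.isLt]

/-- The linear map on the simple module with given values on the basis. -/
noncomputable def XMod.constr {P : Type*} [AddCommGroup P] [Module k P] (f : ℕ → P) :
    XMod hp hq hε hr →ₗ[k] P :=
  (show (Fin r → k) →ₗ[k] P from Fintype.linearCombination k (fun n : Fin r => f n.val))

theorem XMod.constr_bas {P : Type*} [AddCommGroup P] [Module k P] (f : ℕ → P) {i : ℕ}
    (hi : i < r) : XMod.constr hp hq hε hr f (XMod.bas hp hq hε hr i) = f i := by
  change Fintype.linearCombination k (fun n : Fin r => f n.val)
    (fun n : Fin r => if n.val = i then (1 : k) else 0) = f i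
  rw [Fintype.linearCombination_apply, Finset.sum_eq_single ⟨i, hi⟩]
  · simp
  · intro n _ hn
    rw [if_neg (fun h => hn (Fin.ext h)), zero_smul]
  · exact fun h => absurd (Finset.mem_univ _) h

end

/-! #### Tensor products -/

section

variable (hp : 2 ≤ p) (hq : IsPrimitiveRoot q (2 * p)) {M N M' N' : UMod p q}

/-- The pure tensor `m ⊗ n`. -/
noncomputable def tm : M →ₗ[k] N →ₗ[k] M.tensor hp hq N := TensorProduct.mk k M N

theorem tm_induction {P : M.tensor hp hq N → Prop} (h : ∀ m n, P (tm hp hq m n))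
    (hadd : ∀ v w, P v → P w → P (v + w)) (v) : P v := by
  refine TensorProduct.induction_on (motive := P) v ?_ h hadd
  have h0 := h 0 0
  rw [map_zero] at h0
  exact h0

theorem act_tm (x : Ubar p q) (m : M) (n : N) :
    x ⋆ tm hp hq m n = (Module.endTensorEndAlgHom (R := k) (S := k) (A := k) (M := M) (N := N))
      (Algebra.TensorProduct.map (Algebra.lsmul k k (M : Type u))
        (Algebra.lsmul k k (N : Type u)) (comul hp hq x)) (m ⊗ₜ n) := rfl

theorem E_tm (m : M) (n : N) :
    𝐄 ⋆ tm hp hq m n = tm hp hq (𝐄 ⋆ m) (𝐊 ⋆ n) + tm hp hq m (𝐄 ⋆ n) := by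
  rw [act_tm, comul, (Ubar.lift_gen (comul_rel hp hq)).1, map_add, map_add,
    Algebra.TensorProduct.map_tmul, Algebra.TensorProduct.map_tmul, map_one]
  rfl

theorem F_tm (m : M) (n : N) :
    𝐅 ⋆ tm hp hq m n = tm hp hq (𝐅 ⋆ m) n + tm hp hq (𝐋 ⋆ m) (𝐅 ⋆ n) := by
  rw [act_tm, comul, (Ubar.lift_gen (comul_rel hp hq)).2.1, map_add, map_add,
    Algebra.TensorProduct.map_tmul, Algebra.TensorProduct.map_tmul, map_one]
  rfl

theorem K_tm (m : M) (n : N) :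
    𝐊 ⋆ tm hp hq m n = tm hp hq (𝐊 ⋆ m) (𝐊 ⋆ n) := by
  rw [act_tm, comul, (Ubar.lift_gen (comul_rel hp hq)).2.2.1, Algebra.TensorProduct.map_tmul]
  rfl

theorem L_tm (m : M) (n : N) :
    𝐋 ⋆ tm hp hq m n = tm hp hq (𝐋 ⋆ m) (𝐋 ⋆ n) := by
  rw [act_tm, comul, (Ubar.lift_gen (comul_rel hp hq)).2.2.2, Algebra.TensorProduct.map_tmul]
  rfl

/-- The tensor product of two linear maps. -/
noncomputable def tmap (f : M →ₗ[k] M') (g : N →ₗ[k] N') :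
    M.tensor hp hq N →ₗ[k] M'.tensor hp hq N' := TensorProduct.map f g

theorem tmap_tm (f : M →ₗ[k] M') (g : N →ₗ[k] N') (m : M) (n : N) :
    tmap hp hq f g (tm hp hq m n) = tm hp hq (f m) (g n) := rfl

/-- Linear maps on a tensor product agree if they agree on pure tensors. -/
theorem tm_ext {P : Type*} [AddCommGroup P] [Module k P] {f g : M.tensor hp hq N →ₗ[k] P}
    (h : ∀ m n, f (tm hp hq m n) = g (tm hp hq m n)) (v) : f v = g v :=
  tm_induction hp hq (P := fun v => f v = g v) h
    (fun v w hv hw => by rw [map_add, map_add, hv, hw]) v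

/-- The tensor product of two linear maps over the quantum group. -/
noncomputable def tmapU (f : M →ₗ[Ubar p q] M') (g : N →ₗ[Ubar p q] N') :
    M.tensor hp hq N →ₗ[Ubar p q] M'.tensor hp hq N' :=
  ulin (tmap hp hq (f.restrictScalars k) (g.restrictScalars k))
    (fun v => tm_induction hp hq
      (P := fun v => tmap hp hq (f.restrictScalars k) (g.restrictScalars k) (𝐄 ⋆ v)
        = 𝐄 ⋆ tmap hp hq (f.restrictScalars k) (g.restrictScalars k) v)
      (fun m n => by
        simp only [E_tm, map_add, tmap_tm, LinearMap.restrictScalars_apply, map_act])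
      (fun v w hv hw => by rw [act_add, map_add, hv, hw, map_add, act_add]) v)
    (fun v => tm_induction hp hq
      (P := fun v => tmap hp hq (f.restrictScalars k) (g.restrictScalars k) (𝐅 ⋆ v)
        = 𝐅 ⋆ tmap hp hq (f.restrictScalars k) (g.restrictScalars k) v)
      (fun m n => by
        simp only [F_tm, map_add, tmap_tm, LinearMap.restrictScalars_apply, map_act])
      (fun v w hv hw => by rw [act_add, map_add, hv, hw, map_add, act_add]) v)
    (fun v => tm_induction hp hq
      (P := fun v => tmap hp hq (f.restrictScalars k) (g.restrictScalars k) (𝐊 ⋆ v)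
        = 𝐊 ⋆ tmap hp hq (f.restrictScalars k) (g.restrictScalars k) v)
      (fun m n => by
        simp only [K_tm, tmap_tm, LinearMap.restrictScalars_apply, map_act])
      (fun v w hv hw => by rw [act_add, map_add, hv, hw, map_add, act_add]) v)

theorem tmapU_tm (f : M →ₗ[Ubar p q] M') (g : N →ₗ[Ubar p q] N') (m : M) (n : N) :
    tmapU hp hq f g (tm hp hq m n) = tm hp hq (f m) (g n) := rfl

theorem tmap_K {f : M →ₗ[k] M'} {g : N →ₗ[k] N'} (hf : ∀ m, f (𝐊 ⋆ m) = 𝐊 ⋆ f m)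
    (hg : ∀ n, g (𝐊 ⋆ n) = 𝐊 ⋆ g n) (v : M.tensor hp hq N) :
    tmap hp hq f g (𝐊 ⋆ v) = 𝐊 ⋆ tmap hp hq f g v :=
  tm_induction hp hq (P := fun v => tmap hp hq f g (𝐊 ⋆ v) = 𝐊 ⋆ tmap hp hq f g v)
    (fun m n => by simp only [K_tm, tmap_tm, hf, hg])
    (fun v w hv hw => by rw [act_add, map_add, hv, hw, map_add, act_add]) v

theorem finrank_tensor : Module.finrank k (M.tensor hp hq N)
    = Module.finrank k M * Module.finrank k N := Module.finrank_tensorProduct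

end

end Simple

/-! ### Block components and split extensions -/

section SplitExtensions

section

variable (hp : 2 ≤ p) (hq : IsPrimitiveRoot q (2 * p)) (γ : k)

/-- The component of a module in the block of `γ`. -/
noncomputable def UMod.block (M : UMod p q) : UMod p q where
  carrier := blockSub M hp hq γ
  finite := Module.Finite.of_injective
    ((blockSub (M : Type u) hp hq γ).subtype.restrictScalars k) Subtype.val_injective

variable {M N : UMod p q}

theorem UMod.block.coe_act (x : Ubar p q) (v : M.block hp hq γ) : (x ⋆ v).1 = x ⋆ v.1 := rfl

/-- The inclusion of a block component. -/
noncomputable def UMod.block.incl : M.block hp hq γ →ₗ[Ubar p q] M := (blockSub M hp hq γ).subtype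

theorem UMod.block.inBl (v : M.block hp hq γ) : InBl (p := p) (q := q) γ v := by
  have h : InBl (p := p) (q := q) γ v.1 := v.2
  refine Subtype.ext ?_
  rw [UMod.block.coe_act, h]
  rfl

/-- The map on block components. -/
noncomputable def UMod.block.map (f : M →ₗ[Ubar p q] N) :
    M.block hp hq γ →ₗ[Ubar p q] N.block hp hq γ :=
  LinearMap.restrict f fun _ hv => InBl.map hv f

theorem UMod.block.coe_map (f : M →ₗ[Ubar p q] N) (v : M.block hp hq γ) :
    (UMod.block.map hp hq γ f v).1 = f v.1 := rfl

/-- The linear map on block components given by a linear map followed by the projection. -/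
noncomputable def UMod.block.mapLin [CharZero k] {γ : k} (hγ : γ ∈ casValues p q)
    (f : M →ₗ[k] N) : M.block hp hq γ →ₗ[k] N.block hp hq γ where
  toFun v := ⟨blockIdem hp hq γ ⋆ f v.1, inBl_blockIdem hp hq hγ _⟩
  map_add' v w := Subtype.ext (by
    change blockIdem hp hq γ ⋆ f (v.1 + w.1) = _ + _
    rw [map_add, act_add])
  map_smul' c v := Subtype.ext (by
    change blockIdem hp hq γ ⋆ f (c • v.1) = c • _
    rw [map_smul, usmul])

theorem UMod.block.coe_mapLin [CharZero k] {γ : k} (hγ : γ ∈ casValues p q) (f : M →ₗ[k] N)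
    (v : M.block hp hq γ) :
    (UMod.block.mapLin hp hq hγ f v).1 = blockIdem hp hq γ ⋆ f v.1 := rfl

end

/-- A description of `M` as an extension of `X ^ m` by `Y ^ m`, with a linear splitting which is
compatible with `K`. -/
structure SplitExt (M X Y : UMod p q) (m : ℕ) where
  π : Fin m → M →ₗ[Ubar p q] X
  ι : Fin m → Y →ₗ[Ubar p q] M
  σ : Fin m → X →ₗ[k] M
  ρ : Fin m → M →ₗ[k] Y
  σ_K : ∀ i x, σ i (𝐊 ⋆ x) = 𝐊 ⋆ σ i x
  ρ_K : ∀ i x, ρ i (𝐊 ⋆ x) = 𝐊 ⋆ ρ i x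
  π_σ : ∀ i j x, π i (σ j x) = if i = j then x else 0
  ρ_ι : ∀ i j y, ρ i (ι j y) = if i = j then y else 0
  π_ι : ∀ i j y, π i (ι j y) = 0
  decomp : ∀ v, v = ∑ i, σ i (π i v) + ∑ i, ι i (ρ i v)

namespace SplitExt

variable {M X Y : UMod p q} {m : ℕ} (S : SplitExt M X Y m)

section

variable (hp : 2 ≤ p) (hq : IsPrimitiveRoot q (2 * p))

theorem exists_shortExact (S : SplitExt M X Y m) :
    ExistsShortExact (Ubar p q) (Fin m → Y) M (Fin m → X) := by
  have hsum : ∀ y : Fin m → Y, (∑ i, S.ι i ∘ₗ LinearMap.proj (R := Ubar p q) i) y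
      = ∑ i, S.ι i (y i) := fun y => by simp
  refine ⟨∑ i, S.ι i ∘ₗ LinearMap.proj i, LinearMap.pi S.π, ?_, ?_, ?_⟩
  · rw [injective_iff_map_eq_zero]
    intro y hy
    rw [hsum] at hy
    ext j
    have h := congrArg (S.ρ j) hy
    rw [map_sum, map_zero, Finset.sum_eq_single j, S.ρ_ι, if_pos rfl] at h
    · exact h
    · intro i _ hi
      rw [S.ρ_ι, if_neg hi.symm]
    · exact fun h => absurd (Finset.mem_univ _) h
  · intro v
    constructor
    · intro hv
      refine ⟨fun i => S.ρ i v, ?_⟩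
      rw [hsum]
      conv_rhs => rw [S.decomp v]
      have h0 : ∀ i, S.π i v = 0 := fun i => congrFun hv i
      simp only [h0, map_zero, Finset.sum_const_zero, zero_add]
    · rintro ⟨y, rfl⟩
      rw [hsum]
      ext j
      simp [S.π_ι]
  · intro x
    refine ⟨∑ i, S.σ i (x i), ?_⟩
    ext j
    rw [LinearMap.pi_apply, map_sum, Finset.sum_eq_single j, S.π_σ, if_pos rfl]
    · intro i _ hi
      rw [S.π_σ, if_neg hi.symm]
    · exact fun h => absurd (Finset.mem_univ _) h

/-- The block component of a split extension. -/
noncomputable def block [CharZero k] {γ : k} (hγ : γ ∈ casValues p q) :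
    SplitExt (M.block hp hq γ) (X.block hp hq γ) (Y.block hp hq γ) m where
  π i := UMod.block.map hp hq γ (S.π i)
  ι i := UMod.block.map hp hq γ (S.ι i)
  σ i := UMod.block.mapLin hp hq hγ (S.σ i)
  ρ i := UMod.block.mapLin hp hq hγ (S.ρ i)
  σ_K i x := Subtype.ext (by
    rw [UMod.block.coe_mapLin, UMod.block.coe_act, S.σ_K, UMod.block.coe_act,
      UMod.block.coe_mapLin, blockIdem_comm])
  ρ_K i x := Subtype.ext (by
    rw [UMod.block.coe_mapLin, UMod.block.coe_act, S.ρ_K, UMod.block.coe_act,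
      UMod.block.coe_mapLin, blockIdem_comm])
  π_σ i j x := Subtype.ext (by
    rw [UMod.block.coe_map, UMod.block.coe_mapLin, map_act, S.π_σ]
    split_ifs
    · exact blockIdem_of_inBl hp hq hγ x.2
    · exact act_zero _)
  ρ_ι i j y := Subtype.ext (by
    rw [UMod.block.coe_mapLin, UMod.block.coe_map, S.ρ_ι]
    split_ifs
    · exact blockIdem_of_inBl hp hq hγ y.2
    · exact act_zero _)
  π_ι i j y := Subtype.ext (by
    rw [UMod.block.coe_map, UMod.block.coe_map, S.π_ι]
    rfl)
  decomp v := by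
    have h := congrArg (fun w => blockIdem hp hq γ ⋆ w) (S.decomp v.1)
    simp only [act_add, act_sum] at h
    rw [blockIdem_of_inBl hp hq hγ v.2] at h
    refine Subtype.ext (h.trans ?_)
    have e : ∀ f : Fin m → M.block hp hq γ, (∑ i, f i).1 = ∑ i, (f i).1 :=
      fun f => map_sum (UMod.block.incl hp hq γ) f _
    change _ = (∑ i, UMod.block.mapLin hp hq hγ (S.σ i) (UMod.block.map hp hq γ (S.π i) v)).1
      + (∑ i, UMod.block.map hp hq γ (S.ι i) (UMod.block.mapLin hp hq hγ (S.ρ i) v)).1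
    rw [e, e]
    congr 1
    refine Finset.sum_congr rfl fun i _ => ?_
    rw [UMod.block.coe_map, UMod.block.coe_mapLin, map_act]

/-- The tensor product of a split extension with a module on the right. -/
noncomputable def tensorRight (N : UMod p q) :
    SplitExt (M.tensor hp hq N) (X.tensor hp hq N) (Y.tensor hp hq N) m where
  π i := tmapU hp hq (S.π i) LinearMap.id
  ι i := tmapU hp hq (S.ι i) LinearMap.id
  σ i := tmap hp hq (S.σ i) LinearMap.id
  ρ i := tmap hp hq (S.ρ i) LinearMap.id
  σ_K i x := tmap_K hp hq (S.σ_K i) (fun _ => rfl) x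
  ρ_K i x := tmap_K hp hq (S.ρ_K i) (fun _ => rfl) x
  π_σ i j x := tm_induction hp hq (P := fun x => tmapU hp hq (S.π i) LinearMap.id
      (tmap hp hq (S.σ j) LinearMap.id x) = if i = j then x else 0)
    (fun a b => by
      rw [tmap_tm, tmapU_tm, S.π_σ]
      split_ifs
      · rfl
      · rw [map_zero]
        rfl)
    (fun a b ha hb => by
      rw [map_add, map_add, ha, hb]
      split_ifs <;> simp) x
  ρ_ι i j x := tm_induction hp hq (P := fun x => tmap hp hq (S.ρ i) LinearMap.id
      (tmapU hp hq (S.ι j) LinearMap.id x) = if i = j then x else 0)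
    (fun a b => by
      rw [tmapU_tm, tmap_tm, S.ρ_ι]
      split_ifs
      · rfl
      · rw [map_zero]
        rfl)
    (fun a b ha hb => by
      rw [map_add, map_add, ha, hb]
      split_ifs <;> simp) x
  π_ι i j x := tm_induction hp hq (P := fun x => tmapU hp hq (S.π i) LinearMap.id
      (tmapU hp hq (S.ι j) LinearMap.id x) = 0)
    (fun a b => by
      rw [tmapU_tm, tmapU_tm, S.π_ι, map_zero]
      rfl)
    (fun a b ha hb => by
      rw [map_add, map_add, ha, hb, add_zero]) x
  decomp v := tm_induction hp hq (P := fun v => v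
      = ∑ i, tmap hp hq (S.σ i) LinearMap.id (tmapU hp hq (S.π i) LinearMap.id v)
        + ∑ i, tmapU hp hq (S.ι i) LinearMap.id (tmap hp hq (S.ρ i) LinearMap.id v))
    (fun a b => by
      simp only [tmapU_tm, tmap_tm, LinearMap.id_apply]
      conv_lhs => rw [S.decomp a]
      rw [map_add, LinearMap.add_apply, map_sum, map_sum, LinearMap.sum_apply,
        LinearMap.sum_apply])
    (fun a b ha hb => by
      simp only [map_add, Finset.sum_add_distrib]
      conv_lhs => rw [ha, hb]
      abel) v

/-- The tensor product of a split extension with a module on the left. -/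
noncomputable def tensorLeft (N : UMod p q) :
    SplitExt (N.tensor hp hq M) (N.tensor hp hq X) (N.tensor hp hq Y) m where
  π i := tmapU hp hq LinearMap.id (S.π i)
  ι i := tmapU hp hq LinearMap.id (S.ι i)
  σ i := tmap hp hq LinearMap.id (S.σ i)
  ρ i := tmap hp hq LinearMap.id (S.ρ i)
  σ_K i x := tmap_K hp hq (fun _ => rfl) (S.σ_K i) x
  ρ_K i x := tmap_K hp hq (fun _ => rfl) (S.ρ_K i) x
  π_σ i j x := tm_induction hp hq (P := fun x => tmapU hp hq LinearMap.id (S.π i)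
      (tmap hp hq LinearMap.id (S.σ j) x) = if i = j then x else 0)
    (fun a b => by
      rw [tmap_tm, tmapU_tm, S.π_σ]
      split_ifs
      · rfl
      · rw [map_zero])
    (fun a b ha hb => by
      rw [map_add, map_add, ha, hb]
      split_ifs <;> simp) x
  ρ_ι i j x := tm_induction hp hq (P := fun x => tmap hp hq LinearMap.id (S.ρ i)
      (tmapU hp hq LinearMap.id (S.ι j) x) = if i = j then x else 0)
    (fun a b => by
      rw [tmapU_tm, tmap_tm, S.ρ_ι]
      split_ifs
      · rfl
      · rw [map_zero])
    (fun a b ha hb => by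
      rw [map_add, map_add, ha, hb]
      split_ifs <;> simp) x
  π_ι i j x := tm_induction hp hq (P := fun x => tmapU hp hq LinearMap.id (S.π i)
      (tmapU hp hq LinearMap.id (S.ι j) x) = 0)
    (fun a b => by
      rw [tmapU_tm, tmapU_tm, S.π_ι, map_zero])
    (fun a b ha hb => by
      rw [map_add, map_add, ha, hb, add_zero]) x
  decomp v := tm_induction hp hq (P := fun v => v
      = ∑ i, tmap hp hq LinearMap.id (S.σ i) (tmapU hp hq LinearMap.id (S.π i) v)
        + ∑ i, tmapU hp hq LinearMap.id (S.ι i) (tmap hp hq LinearMap.id (S.ρ i) v))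
    (fun a b => by
      simp only [tmapU_tm, tmap_tm, LinearMap.id_apply]
      conv_lhs => rw [S.decomp b]
      rw [map_add, map_sum, map_sum])
    (fun a b ha hb => by
      simp only [map_add, Finset.sum_add_distrib]
      conv_lhs => rw [ha, hb]
      abel) v

end

theorem finrank_wtSub (S : SplitExt M X Y m) (ω : k) : Module.finrank k (wtSub p q M ω)
    = m * (Module.finrank k (wtSub p q X ω) + Module.finrank k (wtSub p q Y ω)) := by
  let f : wtSub p q M ω →ₗ[k] (Fin m → wtSub p q X ω) × (Fin m → wtSub p q Y ω) :=
    { toFun := fun v => (fun i => ⟨S.π i v.1, by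
          rw [mem_wtSub, ← map_act, v.2, ← LinearMap.restrictScalars_apply k, map_smul]
          rfl⟩,
        fun i => ⟨S.ρ i v.1, by rw [mem_wtSub, ← S.ρ_K, v.2, map_smul]⟩)
      map_add' := fun v w => by
        refine Prod.ext (funext fun i => Subtype.ext ?_) (funext fun i => Subtype.ext ?_)
        · exact map_add (S.π i) _ _
        · exact map_add (S.ρ i) _ _
      map_smul' := fun c v => by
        refine Prod.ext (funext fun i => Subtype.ext ?_) (funext fun i => Subtype.ext ?_)
        · exact map_smul ((S.π i).restrictScalars k) _ _
        · exact map_smul (S.ρ i) _ _ }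
  have hf : Function.Bijective f := by
    constructor
    · rw [injective_iff_map_eq_zero]
      intro v hv
      have h1 : ∀ i, S.π i v.1 = 0 := fun i =>
        congrArg Subtype.val (congrFun (congrArg Prod.fst hv) i)
      have h2 : ∀ i, S.ρ i v.1 = 0 := fun i =>
        congrArg Subtype.val (congrFun (congrArg Prod.snd hv) i)
      refine Subtype.ext ?_
      rw [S.decomp v.1]
      simp [h1, h2]
    · rintro ⟨x, y⟩
      set v₀ := ∑ i, S.σ i (x i).1 with hv₀
      have hx : ∀ i, S.π i v₀ = (x i).1 := by
        intro j
        rw [hv₀, map_sum, Finset.sum_eq_single j, S.π_σ, if_pos rfl]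
        · intro i _ hi
          rw [S.π_σ, if_neg hi.symm]
        · exact fun h => absurd (Finset.mem_univ _) h
      have hw₀ : 𝐊 ⋆ v₀ = ω • v₀ := by
        rw [hv₀, act_sum, Finset.smul_sum]
        refine Finset.sum_congr rfl fun i _ => ?_
        rw [← S.σ_K, (x i).2, map_smul]
      have hsub : ∀ z : Fin m → Y, ∀ j, S.ρ j (∑ i, S.ι i (z i)) = z j := by
        intro z j
        rw [map_sum, Finset.sum_eq_single j, S.ρ_ι, if_pos rfl]
        · intro i _ hi
          rw [S.ρ_ι, if_neg hi.symm]
        · exact fun h => absurd (Finset.mem_univ _) h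
      have hyw : ∀ i, 𝐊 ⋆ ((y i).1 - S.ρ i v₀) = ω • ((y i).1 - S.ρ i v₀) := by
        intro i
        rw [act_sub, (y i).2, ← S.ρ_K, hw₀, map_smul, smul_sub]
      refine ⟨⟨v₀ + ∑ i, S.ι i ((y i).1 - S.ρ i v₀), ?_⟩, ?_⟩
      · refine Submodule.add_mem _ hw₀ (Submodule.sum_mem _ fun i _ => ?_)
        rw [mem_wtSub, ← map_act, hyw, ← LinearMap.restrictScalars_apply k, map_smul]
        rfl
      · refine Prod.ext (funext fun i => Subtype.ext ?_) (funext fun i => Subtype.ext ?_)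
        · change S.π i (v₀ + _) = _
          rw [map_add, hx, map_sum]
          simp [S.π_ι]
        · change S.ρ i (v₀ + _) = _
          rw [map_add, hsub (fun i => (y i).1 - S.ρ i v₀)]
          abel
  rw [(LinearEquiv.ofBijective f hf).finrank_eq, Module.finrank_prod, Module.finrank_pi_fintype,
    Module.finrank_pi_fintype]
  simp only [Finset.sum_const, Finset.card_univ, Fintype.card_fin, smul_eq_mul]
  ring

end SplitExt

end SplitExtensions

/-! ### Highest weight vectors in tensor products of simple modules -/

section HighestWeight

variable {ε ε' : k} (hp : 2 ≤ p) (hq : IsPrimitiveRoot q (2 * p)) (hε : ε * ε = 1)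
  (hε' : ε' * ε' = 1) {r r' : ℕ} (hr : r ≤ p) (hr' : r' ≤ p)

/-- The vector `∑ ξ_i a_i ⊗ a_{l-i}`. -/
noncomputable def diagVec (l : ℕ) (ξ : ℕ → k) :
    (XMod hp hq hε hr).tensor hp hq (XMod hp hq hε' hr') :=
  ∑ i ∈ Finset.range (l + 1),
    ξ i • tm hp hq (XMod.bas hp hq hε hr i) (XMod.bas hp hq hε' hr' (l - i))

theorem coeffE_ne_zero (hp : 2 ≤ p) (hq : IsPrimitiveRoot q (2 * p)) (hε : ε * ε = 1)
    (hr : r ≤ p) {i : ℕ} (h0 : 0 < i) (hi : i < r) : coeffE q ε r i ≠ 0 :=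
  mul_ne_zero (sign_ne_zero hε) (mul_ne_zero (qint_ne_zero hp hq (by omega) (by omega))
    (qint_ne_zero hp hq (by omega) (by omega)))

theorem E_diagVec_zero (ξ : ℕ → k) : 𝐄 ⋆ diagVec hp hq hε hε' hr hr' 0 ξ = 0 := by
  simp only [diagVec, zero_add, Nat.sub_zero, Finset.sum_range_one, usmul, E_tm, XMod.E_bas, coeff_zero, zero_smul,
    map_zero, LinearMap.zero_apply, add_zero, smul_zero]

theorem E_diagVec_succ (l : ℕ) (ξ : ℕ → k) : 𝐄 ⋆ diagVec hp hq hε hε' hr hr' (l + 1) ξ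
    = diagVec hp hq hε hε' hr hr' l fun i => ξ (i + 1) * (coeffE q ε r (i + 1) * wt q ε' r' (l - i))
        + ξ i * coeffE q ε' r' (l + 1 - i) := by
  have h : ∀ i : ℕ, 𝐄 ⋆ (ξ i • tm hp hq (XMod.bas hp hq hε hr i) (XMod.bas hp hq hε' hr' (l + 1 - i)))
      = (ξ i * (coeffE q ε r i * wt q ε' r' (l + 1 - i))) •
          tm hp hq (XMod.bas hp hq hε hr (i - 1)) (XMod.bas hp hq hε' hr' (l + 1 - i))
        + (ξ i * coeffE q ε' r' (l + 1 - i)) •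
          tm hp hq (XMod.bas hp hq hε hr i) (XMod.bas hp hq hε' hr' (l + 1 - i - 1)) := by
    intro i
    simp only [usmul, E_tm, XMod.E_bas, XMod.K_bas, map_smul, LinearMap.smul_apply, smul_add,
      smul_smul]
    congr 2
    ring
  rw [diagVec, act_sum, Finset.sum_congr rfl fun i _ => h i, Finset.sum_add_distrib,
    Finset.sum_range_succ' _ (l + 1), Finset.sum_range_succ _ (l + 1), diagVec]
  simp only [coeff_zero, zero_mul, mul_zero, zero_smul, add_zero, Nat.sub_self]
  rw [← Finset.sum_add_distrib]
  refine Finset.sum_congr rfl fun i _ => ?_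
  rw [add_smul, Nat.add_sub_add_right, Nat.add_sub_cancel, show l + 1 - i - 1 = l - i by omega]

theorem exists_E_diagVec_eq {l : ℕ} (hl : l + 1 < r) (y : ℕ → k) (c : k) :
    ∃ ξ : ℕ → k, ξ 0 = c ∧ 𝐄 ⋆ diagVec hp hq hε hε' hr hr' (l + 1) ξ
      = diagVec hp hq hε hε' hr hr' l y := by
  let ξ : ℕ → k := fun i => Nat.rec c (fun i x => (y i - x * coeffE q ε' r' (l + 1 - i))
    * (coeffE q ε r (i + 1) * wt q ε' r' (l - i))⁻¹) i
  refine ⟨ξ, rfl, ?_⟩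
  rw [E_diagVec_succ]
  refine Finset.sum_congr rfl fun i hi => ?_
  have hi := Finset.mem_range.mp hi
  have hne : coeffE q ε r (i + 1) * wt q ε' r' (l - i) ≠ 0 :=
    mul_ne_zero (coeffE_ne_zero hp hq hε hr (by omega) (by omega))
      (wt_ne (q_ne_zero hp hq) hε' _ _)
  have hξ : ξ (i + 1) = (y i - ξ i * coeffE q ε' r' (l + 1 - i))
    * (coeffE q ε r (i + 1) * wt q ε' r' (l - i))⁻¹ := rfl
  simp only [hξ]
  rw [inv_mul_cancel_right₀ hne, sub_add_cancel]

theorem F_diagVec (l : ℕ) (ξ : ℕ → k) : ∃ ξ' : ℕ → k, ξ' 0 = (wt q ε r 0)⁻¹ * ξ 0 ∧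
    𝐅 ⋆ diagVec hp hq hε hε' hr hr' l ξ = diagVec hp hq hε hε' hr hr' (l + 1) ξ' := by
  refine ⟨fun i => (if i = 0 then 0 else ξ (i - 1)) + if i ≤ l then (wt q ε r i)⁻¹ * ξ i else 0,
    by simp, ?_⟩
  have h : ∀ i ∈ Finset.range (l + 1),
      𝐅 ⋆ (ξ i • tm hp hq (XMod.bas hp hq hε hr i) (XMod.bas hp hq hε' hr' (l - i)))
      = ξ i • tm hp hq (XMod.bas hp hq hε hr (i + 1)) (XMod.bas hp hq hε' hr' (l - i))
        + ((wt q ε r i)⁻¹ * ξ i) •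
          tm hp hq (XMod.bas hp hq hε hr i) (XMod.bas hp hq hε' hr' (l + 1 - i)) := by
    intro i hi
    have hi := Finset.mem_range.mp hi
    rw [usmul, F_tm, XMod.F_bas, XMod.F_bas, XMod.L_bas, map_smul, LinearMap.smul_apply, smul_add,
      smul_smul, mul_comm, show l - i + 1 = l + 1 - i by omega]
  rw [diagVec, act_sum, Finset.sum_congr rfl h, Finset.sum_add_distrib, diagVec]
  simp only [add_smul, Finset.sum_add_distrib]
  congr 1
  · rw [Finset.sum_range_succ' _ (l + 1)]
    simp
  · rw [Finset.sum_range_succ _ (l + 1)]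
    simp only [show ¬ l + 1 ≤ l by omega, if_false, zero_smul, add_zero]
    refine Finset.sum_congr rfl fun i hi => ?_
    have hi := Finset.mem_range.mp hi
    rw [if_pos (by omega)]

theorem K_diagVec (l : ℕ) (ξ : ℕ → k) : 𝐊 ⋆ diagVec hp hq hε hε' hr hr' l ξ
    = (ε * ε' * q ^ ((r : ℤ) + r' - 2 - 2 * l)) • diagVec hp hq hε hε' hr hr' l ξ := by
  rw [diagVec, act_sum, Finset.smul_sum]
  refine Finset.sum_congr rfl fun i hi => ?_
  have hi := Finset.mem_range.mp hi
  rw [usmul, K_tm, XMod.K_bas, XMod.K_bas, map_smul, map_smul, LinearMap.smul_apply, smul_smul,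
    smul_smul, smul_smul]
  congr 1
  have e : (r : ℤ) + r' - 2 - 2 * l = (r - 1 - 2 * i) + (r' - 1 - 2 * (l - i : ℕ)) := by
    rw [Nat.cast_sub (by omega)]
    ring
  rw [wt, wt, e, zpow_add₀ (q_ne_zero hp hq)]
  ring

theorem eq_zero_of_diagVec {l : ℕ} (h0 : 0 < r) (hl : l < r') {ξ : ℕ → k}
    (h : diagVec hp hq hε hε' hr hr' l ξ = 0) : ξ 0 = 0 := by
  let a := XMod.constr hp hq hε hr fun i => if i = 0 then (1 : k) else 0
  let b := XMod.constr hp hq hε' hr' fun i => if i = l then (1 : k) else 0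
  let c : (XMod hp hq hε hr).tensor hp hq (XMod hp hq hε' hr') →ₗ[k] k :=
    TensorProduct.lift ((LinearMap.mul k k).compl₁₂ a b)
  have hc : ∀ m n, c (tm hp hq m n) = a m * b n := fun m n => rfl
  have h1 := congrArg c h
  rw [map_zero, diagVec, map_sum, Finset.sum_eq_single 0] at h1
  · rw [map_smul, hc, XMod.constr_bas hp hq hε hr _ h0, Nat.sub_zero,
      XMod.constr_bas hp hq hε' hr' _ hl] at h1
    simpa using h1
  · intro i _ hi
    rw [map_smul, hc]
    have ha : a (XMod.bas hp hq hε hr i) = 0 := by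
      rcases Nat.lt_or_ge i r with hir | hir
      · exact (XMod.constr_bas hp hq hε hr _ hir).trans (if_neg hi)
      · rw [XMod.bas_of_le hp hq hε hr hir, map_zero]
    rw [ha, zero_mul, smul_zero]
  · simp

theorem exists_diagVec_highest {l : ℕ} (hl : l < r) :
    ∃ ξ : ℕ → k, ξ 0 = 1 ∧ 𝐄 ⋆ diagVec hp hq hε hε' hr hr' l ξ = 0 := by
  rcases l with _ | l
  · exact ⟨fun _ => 1, rfl, E_diagVec_zero hp hq hε hε' hr hr' _⟩
  · obtain ⟨ξ, h0, hξ⟩ := exists_E_diagVec_eq hp hq hε hε' hr hr' hl 0 1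
    refine ⟨ξ, h0, hξ.trans ?_⟩
    simp [diagVec]

theorem inBl_of_highest {M : Type*} [AddCommGroup M] [Module k M] [Module (Ubar p q) M]
    [IsScalarTower k (Ubar p q) M] (hp : 2 ≤ p) (hq : IsPrimitiveRoot q (2 * p))
    (hε : ε * ε = 1) {j : ℤ} {v : M} (hE : 𝐄 ⋆ v = 0) (hK : 𝐊 ⋆ v = (ε * q ^ j) • v) :
    InBl (p := p) (q := q) (gam q ε (j + 1)) v := by
  have h := FE_smul (q_ne_zero hp hq) hε hK
  rw [hE, act_zero] at h
  exact InBl.of_cas hp (sub_eq_zero.mp h.symm)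

theorem exists_highest {l t : ℕ} (hl : l < r) (hl' : l < r') (ht : r + r' = 2 * l + t + 1) :
    ∃ v : (XMod hp hq hε hr).tensor hp hq (XMod hp hq hε' hr'), v ≠ 0 ∧ 𝐄 ⋆ v = 0 ∧
      𝐊 ⋆ v = (ε * ε' * q ^ ((t : ℤ) - 1)) • v ∧
      InBl (p := p) (q := q) (gam q (ε * ε') t) v := by
  obtain ⟨ξ, h0, hξ⟩ := exists_diagVec_highest hp hq hε hε' hr hr' hl
  have hK := K_diagVec hp hq hε hε' hr hr' l ξ
  have e : (r : ℤ) + r' - 2 - 2 * l = t - 1 := by omega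
  rw [e] at hK
  refine ⟨_, fun h => ?_, hξ, hK, ?_⟩
  · rw [eq_zero_of_diagVec hp hq hε hε' hr hr' (by omega) hl' h] at h0
    exact zero_ne_one h0
  · have := inBl_of_highest hp hq (sign_mul hε hε') hξ hK
    rwa [sub_add_cancel] at this

theorem exists_projective_generator [CharZero k] {t l l₀ : ℕ} (htp : t < p)
    (hl : l < r) (hl' : l < r') (ht : r + r' = 2 * l + t + 1) (hl₀ : l₀ + p = l + t) :
    ∃ u : (XMod hp hq hε hr).tensor hp hq (XMod hp hq hε' hr'), 𝐅 ⋆ 𝐄 ⋆ u ≠ 0 ∧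
      𝐊 ⋆ u = (ε * ε' * q ^ ((t : ℤ) - 1)) • u ∧
      InBl (p := p) (q := q) (gam q (ε * ε') t) u := by
  have hq0 := q_ne_zero hp hq
  have hδ := q_sub_ne hp hq
  obtain ⟨ξ, h0, hξ⟩ := exists_diagVec_highest hp hq hε hε' hr hr' (show l₀ < r by omega)
  have hK := K_diagVec hp hq hε hε' hr hr' l₀ ξ
  have hbl := inBl_of_highest hp hq (sign_mul hε hε') hξ hK
  have e : (r : ℤ) + r' - 2 - 2 * l₀ + 1 = 2 * p - t := by omega
  rw [e, (gam_one_eq_iff hp hq (sign_mul hε hε') _ t).mpr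
    (Or.inr ⟨1, by ring⟩)] at hbl
  have hF : ∀ n : ℕ, ∃ ξ' : ℕ → k, ξ' 0 ≠ 0 ∧ 𝐅 ^ n ⋆ diagVec hp hq hε hε' hr hr' l₀ ξ
      = diagVec hp hq hε hε' hr hr' (l₀ + n) ξ' := by
    intro n
    induction n with
    | zero => exact ⟨ξ, by rw [h0]; exact one_ne_zero, by simp⟩
    | succ n ih =>
      obtain ⟨ξ', h1, h2⟩ := ih
      obtain ⟨ξ'', h3, h4⟩ := F_diagVec hp hq hε hε' hr hr' (l₀ + n) ξ'
      refine ⟨ξ'', ?_, ?_⟩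
      · rw [h3]
        exact mul_ne_zero (inv_ne_zero (wt_ne hq0 hε _ _)) h1
      · rw [F_succ_act, h2, h4]
        rfl
  obtain ⟨n, hn⟩ : ∃ n, p = t + n + 1 := ⟨p - t - 1, by omega⟩
  obtain ⟨ξ', hξ0, hξ'⟩ := hF n
  obtain ⟨η, -, hη⟩ := exists_E_diagVec_eq hp hq hε hε' hr hr' (show l₀ + n + 1 < r by omega) ξ' 0
  have hγ := gam_mem_casValues hp hq (sign_mul hε hε') t
  have hel : l₀ + n + 1 = l := by omega
  have hy : blockIdem hp hq (gam q (ε * ε') t) ⋆ diagVec hp hq hε hε' hr hr' (l₀ + n) ξ'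
      = diagVec hp hq hε hε' hr hr' (l₀ + n) ξ' := by
    rw [← hξ']
    exact blockIdem_of_inBl hp hq hγ (hbl.act hp hq _)
  have hKη := K_diagVec hp hq hε hε' hr hr' (l₀ + n + 1) η
  refine ⟨blockIdem hp hq (gam q (ε * ε') t) ⋆ diagVec hp hq hε hε' hr hr' (l₀ + n + 1) η,
    ?_, ?_, inBl_blockIdem hp hq hγ _⟩
  · rw [← blockIdem_comm, hη, hy, ← hξ', ← F_succ_act]
    obtain ⟨ξ'', h1, h2⟩ := hF (n + 1)
    rw [h2]
    exact fun h => h1 (eq_zero_of_diagVec hp hq hε hε' hr hr' (by omega) (by omega) h)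
  · rw [← blockIdem_comm, hKη, usmul]
    congr 3
    push_cast
    omega

end HighestWeight

/-! ### Functoriality of `Φ` and the projective modules -/

section Functor

/-- A homomorphism of `B`-modules. -/
structure BMod.Hom (Z Z' : BMod k) where
  fp : Z.Vp →ₗ[k] Z'.Vp
  fm : Z.Vm →ₗ[k] Z'.Vm
  t1p : ∀ v, fm (Z.t1p v) = Z'.t1p (fp v)
  t2p : ∀ v, fm (Z.t2p v) = Z'.t2p (fp v)
  t1m : ∀ v, fp (Z.t1m v) = Z'.t1m (fm v)
  t2m : ∀ v, fp (Z.t2m v) = Z'.t2m (fm v)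

variable {ε : k} (hp : 2 ≤ p) (hq : IsPrimitiveRoot q (2 * p)) (hε : ε * ε = 1)

section

variable {a : ℕ} (ha : 0 < a ∧ a < p) {Z Y : BMod k} (h : BMod.Hom Z Y)

/-- The action of `Φ` on homomorphisms, as a linear map. -/
def phiLin (a b : ℕ) : ((Fin a → Z.Vp) × (Fin b → Z.Vm)) →ₗ[k]
    ((Fin a → Y.Vp) × (Fin b → Y.Vm)) :=
  LinearMap.prodMap (LinearMap.compLeft h.fp (Fin a)) (LinearMap.compLeft h.fm (Fin b))

theorem phiLin_E {b : ℕ} (ha : 0 < a) (hb : 0 < b) (x : (Fin a → Z.Vp) × (Fin b → Z.Vm)) :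
    phiLin h a b (opE q ε Z ha hb x) = opE q ε Y ha hb (phiLin h a b x) := by
  refine Prod.ext (funext fun n => ?_) (funext fun n => ?_)
  · by_cases hn : n.val + 1 < a
    · simp [phiLin, opE, halfE, hn, h.t1m, h.t2p]
    · simp [phiLin, opE, halfE, hn, h.t2m]
  · by_cases hn : n.val + 1 < b
    · simp [phiLin, opE, halfE, hn, h.t1p, h.t2m]
    · simp [phiLin, opE, halfE, hn, h.t2p]

theorem phiLin_F {b : ℕ} (ha : 0 < a) (hb : 0 < b) (x : (Fin a → Z.Vp) × (Fin b → Z.Vm)) :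
    phiLin h a b (opF Z ha hb x) = opF Y ha hb (phiLin h a b x) := by
  refine Prod.ext (funext fun n => ?_) (funext fun n => ?_)
  · by_cases hn : 0 < n.val <;> simp [phiLin, opF, halfF, hn, h.t1m]
  · by_cases hn : 0 < n.val <;> simp [phiLin, opF, halfF, hn, h.t1p]

theorem phiLin_K {b : ℕ} (x : (Fin a → Z.Vp) × (Fin b → Z.Vm)) :
    phiLin h a b (opK q ε Z a b x) = opK q ε Y a b (phiLin h a b x) := by
  refine Prod.ext (funext fun n => ?_) (funext fun n => ?_) <;>
  simp [phiLin, opK, diagOp]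

/-- The action of `Φ` on homomorphisms. -/
noncomputable def phiMap : PhiSigned hp hq hε a ha Z →ₗ[Ubar p q] PhiSigned hp hq hε a ha Y :=
  ofHomHom _ _ (phiLin h a (p - a)) (phiLin_E h ha.1 (Nat.sub_pos_of_lt ha.2))
    (phiLin_F h ha.1 (Nat.sub_pos_of_lt ha.2)) (phiLin_K h)

theorem phiMap_snd (x : PhiSigned hp hq hε a ha Z) (n : Fin (p - a)) :
    (show (Fin a → Y.Vp) × (Fin (p - a) → Y.Vm) from phiMap hp hq hε ha h x).2 n
      = h.fm ((show (Fin a → Z.Vp) × (Fin (p - a) → Z.Vm) from x).2 n) := rfl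

/-- A direct sum decomposition of a `B`-module gives one of its image under `Φ`. -/
theorem exists_equiv_of_homs {d : ℕ} (h : Fin d → BMod.Hom Z Y)
    (hbp : Function.Bijective fun x : Fin d → Z.Vp => ∑ i, (h i).fp (x i))
    (hbm : Function.Bijective fun x : Fin d → Z.Vm => ∑ i, (h i).fm (x i)) :
    Nonempty (PhiSigned hp hq hε a ha Y ≃ₗ[Ubar p q]
      (Fin d → PhiSigned hp hq hε a ha Z)) := by
  let f : (Fin d → PhiSigned hp hq hε a ha Z) →ₗ[Ubar p q] PhiSigned hp hq hε a ha Y :=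
    ∑ i, phiMap hp hq hε ha (h i) ∘ₗ LinearMap.proj i
  let pr1 : ∀ {W : BMod k}, Fin a → PhiSigned hp hq hε a ha W →+ W.Vp := fun {W} n =>
    { toFun := fun x => (show (Fin a → W.Vp) × (Fin (p - a) → W.Vm) from x).1 n
      map_zero' := rfl
      map_add' := fun _ _ => rfl }
  let pr2 : ∀ {W : BMod k}, Fin (p - a) → PhiSigned hp hq hε a ha W →+ W.Vm := fun {W} n =>
    { toFun := fun x => (show (Fin a → W.Vp) × (Fin (p - a) → W.Vm) from x).2 n
      map_zero' := rfl
      map_add' := fun _ _ => rfl }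
  have hf : ∀ x, f x = ∑ i, phiMap hp hq hε ha (h i) (x i) := fun x => by simp [f]
  have h1 : ∀ x n, pr1 n (f x) = ∑ i, (h i).fp (pr1 n (x i)) := fun x n => by
    rw [hf, map_sum]
    rfl
  have h2 : ∀ x n, pr2 n (f x) = ∑ i, (h i).fm (pr2 n (x i)) := fun x n => by
    rw [hf, map_sum]
    rfl
  refine ⟨(LinearEquiv.ofBijective f ⟨?_, ?_⟩).symm⟩
  · intro x y hxy
    refine funext fun i => Prod.ext (funext fun n => ?_) (funext fun n => ?_)
    · have h3 := congrArg (pr1 n) hxy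
      rw [h1, h1] at h3
      exact congrFun (hbp.1 (a₁ := fun i => pr1 n (x i)) (a₂ := fun i => pr1 n (y i)) h3) i
    · have h3 := congrArg (pr2 n) hxy
      rw [h2, h2] at h3
      exact congrFun (hbm.1 (a₁ := fun i => pr2 n (x i)) (a₂ := fun i => pr2 n (y i)) h3) i
  · intro y
    choose u hu using fun n => hbp.2 (pr1 n y)
    choose w hw using fun n => hbm.2 (pr2 n y)
    refine ⟨fun i => (show PhiSigned hp hq hε a ha Z from (fun n => u n i, fun n => w n i)), ?_⟩
    refine Prod.ext (funext fun n => ?_) (funext fun n => ?_)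
    · exact (h1 _ n).trans (hu n)
    · exact (h2 _ n).trans (hw n)

theorem exists_equiv_of_hom (h : BMod.Hom Z Y) (hbp : Function.Bijective h.fp)
    (hbm : Function.Bijective h.fm) :
    Nonempty (PhiSigned hp hq hε a ha Z ≃ₗ[Ubar p q] PhiSigned hp hq hε a ha Y) := by
  refine ⟨LinearEquiv.ofBijective (phiMap hp hq hε ha h) ⟨?_, ?_⟩⟩
  · intro x y hxy
    refine Prod.ext (funext fun n => hbp.1 ?_) (funext fun n => hbm.1 ?_)
    · exact congrFun (congrArg Prod.fst hxy) n
    · exact congrFun (congrArg Prod.snd hxy) n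
  · intro y
    choose u hu using fun n => hbp.2 ((show (Fin a → Y.Vp) × (Fin (p - a) → Y.Vm) from y).1 n)
    choose w hw using fun n => hbm.2 ((show (Fin a → Y.Vp) × (Fin (p - a) → Y.Vm) from y).2 n)
    exact ⟨(show PhiSigned hp hq hε a ha Z from (u, w)), Prod.ext (funext hu) (funext hw)⟩

end

theorem exists_equiv_swap {ε' : k} (hε' : ε' * ε' = 1) (hεε : ε' = -ε) {a b : ℕ}
    (ha : 0 < a ∧ a < p) (hb : 0 < b ∧ b < p) (hab : a + b = p) (Z : BMod k) :
    Nonempty (PhiSigned hp hq hε a ha Z ≃ₗ[Ubar p q] PhiSigned hp hq hε' b hb Z.swap) := by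
  subst hεε
  obtain rfl : b = p - a := by omega
  let e₁ : (Fin a → Z.Vp) ≃ₗ[k] (Fin (p - (p - a)) → Z.Vp) :=
    LinearEquiv.funCongrLeft k Z.Vp (finCongr (by omega))
  let e : ((Fin a → Z.Vp) × (Fin (p - a) → Z.Vm)) ≃ₗ[k]
      ((Fin (p - a) → Z.Vm) × (Fin (p - (p - a)) → Z.Vp)) :=
    (LinearEquiv.prodCongr e₁ (LinearEquiv.refl k _)).trans (LinearEquiv.prodComm k _ _)
  have e1 : ∀ x, (e x).1 = x.2 := fun _ => rfl
  have e2 : ∀ x n, (e x).2 n = x.1 ⟨n.val, by omega⟩ := fun _ _ => rfl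
  have hpa : p - (p - a) = a := by omega
  refine ⟨LinearEquiv.ofBijective (ofHomHom _ _ e.toLinearMap
    (fun x => Prod.ext (funext fun n => ?_) (funext fun n => ?_))
    (fun x => Prod.ext (funext fun n => ?_) (funext fun n => ?_))
    (fun x => Prod.ext (funext fun n => ?_) (funext fun n => ?_))) e.bijective⟩
  · rw [LinearEquiv.coe_coe, e1]
    by_cases hn : n.val + 1 < p - a
    · simp [opE, halfE, hn, e1]
    · simp [opE, halfE, hn, e2]
  · rw [LinearEquiv.coe_coe, e2]
    by_cases hn : n.val + 1 < a
    · simp [opE, halfE, hn, e2, hpa]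
    · simp [opE, halfE, hn, e1, hpa]
  · rw [LinearEquiv.coe_coe, e1]
    by_cases hn : 0 < n.val
    · simp [opF, halfF, hn, e1]
    · simp [opF, halfF, hn, e2, hpa]
  · rw [LinearEquiv.coe_coe, e2]
    by_cases hn : 0 < n.val
    · simp [opF, halfF, hn, e2]
    · simp [opF, halfF, hn, e1]
  · rw [LinearEquiv.coe_coe, e1]
    simp [opK, diagOp, e1]
  · rw [LinearEquiv.coe_coe, e2]
    simp [opK, diagOp, e2, hpa]

end Functor

section Criteria

section

variable (Z : BMod k) {U : Type*} [AddCommGroup U] [Module k U] (j : U →ₗ[k] Z.Vp)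

theorem BMod.t2m_t1p_apply (v : Z.Vp) : Z.t2m (Z.t1p v) = Z.t1m (Z.t2p v) :=
  (LinearMap.congr_fun Z.t1m_t2p v).symm

theorem BMod.t1p_nil (v : Z.Vp) : Z.t1p (Z.t1m (Z.t2p v)) = 0 :=
  LinearMap.congr_fun Z.t1p_t1m (Z.t2p v)

theorem BMod.t2p_nil (v : Z.Vp) : Z.t2p (Z.t1m (Z.t2p v)) = 0 := by
  rw [← Z.t2m_t1p_apply]
  exact LinearMap.congr_fun Z.t2p_t2m (Z.t1p v)

theorem BMod.injective_vp (hj : ∀ u, Z.t1m (Z.t2p (j u)) = 0 → u = 0) :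
    Function.Injective (j.coprod ((Z.t1m ∘ₗ Z.t2p) ∘ₗ j)) := by
  rw [injective_iff_map_eq_zero]
  rintro ⟨u, u'⟩ h
  change j u + Z.t1m (Z.t2p (j u')) = 0 at h
  have h1 := congrArg (fun v => Z.t1m (Z.t2p v)) h
  simp only [map_add, Z.t2p_nil, map_zero, add_zero] at h1
  have hu := hj u h1
  rw [hu, map_zero, zero_add] at h
  rw [hu, hj u' h]
  rfl

theorem BMod.injective_vm (hj : ∀ u, Z.t1m (Z.t2p (j u)) = 0 → u = 0) :
    Function.Injective ((Z.t1p ∘ₗ j).coprod (Z.t2p ∘ₗ j)) := by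
  rw [injective_iff_map_eq_zero]
  rintro ⟨u, u'⟩ h
  change Z.t1p (j u) + Z.t2p (j u') = 0 at h
  have h1 := congrArg Z.t1m h
  have h2 := congrArg Z.t2m h
  have e1 : Z.t1m (Z.t1p (j u)) = 0 := LinearMap.congr_fun Z.t1m_t1p (j u)
  have e2 : Z.t2m (Z.t2p (j u')) = 0 := LinearMap.congr_fun Z.t2m_t2p (j u')
  rw [map_add, e1, zero_add, map_zero] at h1
  rw [map_add, e2, add_zero, map_zero, Z.t2m_t1p_apply] at h2
  rw [hj u h2, hj u' h1]
  rfl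

theorem e2_apply (i l : Fin 2) (c : Fin 2 → k) : e2 k i l c = Pi.single i (c l) := by
  rw [e2, Matrix.toLin'_apply]
  ext x
  rw [Matrix.single_mulVec, one_mul]
  rfl

/-- The homomorphism from `P⁺` given by a vector at the vertex `+`. -/
noncomputable def BMod.homPPlus (v : Z.Vp) : BMod.Hom (BMod.PPlus k) Z where
  fp := (LinearMap.proj 0).smulRight v + (LinearMap.proj 1).smulRight (Z.t1m (Z.t2p v))
  fm := (LinearMap.proj 0).smulRight (Z.t1p v) + (LinearMap.proj 1).smulRight (Z.t2p v)
  t1p := fun (c : Fin 2 → k) => by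
    change (e2 k 0 0 c) 0 • Z.t1p v + (e2 k 0 0 c) 1 • Z.t2p v = Z.t1p (c 0 • v + c 1 • Z.t1m (Z.t2p v))
    simp [e2_apply, Z.t1p_nil]
  t2p := fun (c : Fin 2 → k) => by
    change (e2 k 1 0 c) 0 • Z.t1p v + (e2 k 1 0 c) 1 • Z.t2p v = Z.t2p (c 0 • v + c 1 • Z.t1m (Z.t2p v))
    simp [e2_apply, Z.t2p_nil]
  t1m := fun (c : Fin 2 → k) => by
    change (e2 k 1 1 c) 0 • v + (e2 k 1 1 c) 1 • Z.t1m (Z.t2p v) = Z.t1m (c 0 • Z.t1p v + c 1 • Z.t2p v)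
    have e1 : Z.t1m (Z.t1p v) = 0 := LinearMap.congr_fun Z.t1m_t1p v
    simp [e2_apply, e1]
  t2m := fun (c : Fin 2 → k) => by
    change (e2 k 1 0 c) 0 • v + (e2 k 1 0 c) 1 • Z.t1m (Z.t2p v) = Z.t2m (c 0 • Z.t1p v + c 1 • Z.t2p v)
    have e1 : Z.t2m (Z.t2p v) = 0 := LinearMap.congr_fun Z.t2m_t2p v
    simp [e2_apply, e1, Z.t2m_t1p_apply]

theorem BMod.bijective_homPPlus {d : ℕ} (j : (Fin d → k) →ₗ[k] Z.Vp)
    (hj : ∀ u, Z.t1m (Z.t2p (j u)) = 0 → u = 0) (h4 : Module.finrank k Z.Vp = 2 * d)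
    (h5 : Module.finrank k Z.Vm = 2 * d) :
    (Function.Bijective fun x : Fin d → (BMod.PPlus k).Vp =>
      ∑ i, (Z.homPPlus (j (Pi.single i 1))).fp (x i)) ∧
    (Function.Bijective fun x : Fin d → (BMod.PPlus k).Vm =>
      ∑ i, (Z.homPPlus (j (Pi.single i 1))).fm (x i)) := by
  let e : Fin d → Fin d → k := fun i => Pi.single i 1
  let col : Fin 2 → (Fin d → Fin 2 → k) →ₗ[k] (Fin d → k) := fun l =>
    LinearMap.compLeft (LinearMap.proj l) (Fin d)
  have hcol : ∀ x : Fin d → Fin 2 → k, col 0 x = 0 → col 1 x = 0 → x = 0 := by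
    intro x hx0 hx1
    ext i l
    fin_cases l
    · exact congrFun hx0 i
    · exact congrFun hx1 i
  have hsum : ∀ y : Fin d → k, ∑ i, y i • j (e i) = j y := by
    intro y
    conv_rhs => rw [← Finset.univ_sum_single y, map_sum]
    refine Finset.sum_congr rfl fun i _ => ?_
    rw [← map_smul, ← Pi.single_smul, smul_eq_mul, mul_one]
  have hfin : Module.finrank k (Fin d → Fin 2 → k) = 2 * d := by
    rw [Module.finrank_pi_fintype]
    simp [mul_comm]
  have bij : ∀ {W : Type u} [AddCommGroup W] [Module k W] [Module.Finite k W]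
      (g : (Fin d → Fin 2 → k) →ₗ[k] W) (g' : ((Fin d → k) × (Fin d → k)) →ₗ[k] W),
      (∀ x, g x = g' (col 0 x, col 1 x)) → Function.Injective g' →
      Module.finrank k W = 2 * d → Function.Bijective g := by
    intro W _ _ _ g g' hg hg' hW
    have hinj : Function.Injective g := by
      rw [injective_iff_map_eq_zero]
      intro x hx
      rw [hg] at hx
      have h0 := (injective_iff_map_eq_zero _).mp hg' _ hx
      exact hcol x (congrArg Prod.fst h0) (congrArg Prod.snd h0)
    exact ⟨hinj, (LinearMap.injective_iff_surjective_of_finrank_eq_finrank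
      (hfin.trans hW.symm)).mp hinj⟩
  have hbp := bij (∑ i, (Z.homPPlus (j (e i))).fp ∘ₗ LinearMap.proj i) _ (fun x => by
    change _ = j (col 0 x) + Z.t1m (Z.t2p (j (col 1 x)))
    rw [← hsum (col 0 x), ← hsum (col 1 x)]
    simp only [LinearMap.sum_apply, map_sum, map_smul]
    rw [← Finset.sum_add_distrib]
    rfl) (BMod.injective_vp Z j hj) h4
  have hbm := bij (∑ i, (Z.homPPlus (j (e i))).fm ∘ₗ LinearMap.proj i) _ (fun x => by
    change _ = Z.t1p (j (col 0 x)) + Z.t2p (j (col 1 x))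
    rw [← hsum (col 0 x), ← hsum (col 1 x)]
    simp only [LinearMap.sum_apply, map_sum, map_smul]
    rw [← Finset.sum_add_distrib]
    rfl) (BMod.injective_vm Z j hj) h5
  have ep : ⇑(∑ i, (Z.homPPlus (j (e i))).fp ∘ₗ LinearMap.proj i : (Fin d → Fin 2 → k) →ₗ[k] Z.Vp)
      = fun x : Fin d → Fin 2 → k => ∑ i, (Z.homPPlus (j (e i))).fp (x i) := funext fun x => by
    rw [LinearMap.sum_apply]
    rfl
  have em : ⇑(∑ i, (Z.homPPlus (j (e i))).fm ∘ₗ LinearMap.proj i : (Fin d → Fin 2 → k) →ₗ[k] Z.Vm)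
      = fun x : Fin d → Fin 2 → k => ∑ i, (Z.homPPlus (j (e i))).fm (x i) := funext fun x => by
    rw [LinearMap.sum_apply]
    rfl
  rw [ep] at hbp
  rw [em] at hbm
  exact ⟨hbp, hbm⟩

end

section

variable {Q : Type u} [AddCommGroup Q] [Module k Q] [Module (Ubar p q) Q]
  [IsScalarTower k (Ubar p q) Q] [Module.Finite k Q] [CharZero k] {ε : k} {a : ℕ}
  (hp : 2 ≤ p) (hq : IsPrimitiveRoot q (2 * p)) (hε : ε * ε = 1)

section

variable (ha : 0 < a ∧ a < p) (hQ : ∀ v : Q, InBl (p := p) (q := q) (gam q ε a) v)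

theorem ofBlock_t1m_t2p (v : (BMod.ofBlock Q hp hq hε ha hQ).Vp) :
    ((BMod.ofBlock Q hp hq hε ha hQ).t1m ((BMod.ofBlock Q hp hq hε ha hQ).t2p v)).1
      = 𝐅 ⋆ 𝐄 ⋆ v.1 :=
  t1map_t2map hp hq hε rfl (neg_neg ε).symm (Nat.sub_pos_of_lt ha.2)
    (Nat.add_sub_cancel' ha.2.le) (Nat.sub_add_cancel ha.2.le) hQ v

theorem ofBlock_t1p (v : (BMod.ofBlock Q hp hq hε ha hQ).Vp) :
    ((BMod.ofBlock Q hp hq hε ha hQ).t1p v).1 = 𝐅 ^ a ⋆ v.1 := rfl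

theorem ofBlock_t2p (v : (BMod.ofBlock Q hp hq hε ha hQ).Vp) :
    𝐅 ^ (p - a - 1) ⋆ ((BMod.ofBlock Q hp hq hε ha hQ).t2p v).1 = 𝐄 ⋆ v.1 :=
  t2map_spec hp hq hε rfl (Nat.sub_pos_of_lt ha.2) (Nat.add_sub_cancel' ha.2.le) hQ v

theorem exists_linearMap_of_rank {ι : Type*} [Fintype ι] {u : ι → Q}
    (hu : ∀ i, 𝐊 ⋆ u i = (ε * q ^ ((a : ℤ) - 1)) • u i)
    (hi : LinearIndependent k fun i => 𝐅 ⋆ 𝐄 ⋆ u i) :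
    ∃ j : (ι → k) →ₗ[k] (BMod.ofBlock Q hp hq hε ha hQ).Vp,
      ∀ c, (BMod.ofBlock Q hp hq hε ha hQ).t1m ((BMod.ofBlock Q hp hq hε ha hQ).t2p (j c)) = 0
        → c = 0 := by
  let w : ι → wtSub p q Q (ε * q ^ ((a : ℤ) - 1)) := fun i => ⟨u i, hu i⟩
  refine ⟨Fintype.linearCombination k w, fun c hc => ?_⟩
  have h1 := ofBlock_t1m_t2p hp hq hε ha hQ (Fintype.linearCombination k w c)
  have h0 := congrArg Subtype.val hc
  have h2 : (Fintype.linearCombination k w c).1 = ∑ i, c i • u i := by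
    rw [Fintype.linearCombination_apply]
    exact map_sum (wtSub p q Q (ε * q ^ ((a : ℤ) - 1))).subtype _ _
  have h3 : (0 : Q) = 𝐅 ⋆ 𝐄 ⋆ (Fintype.linearCombination k w c).1 := h0.symm.trans h1
  rw [h2, act_sum, act_sum] at h3
  simp only [usmul] at h3
  exact funext (Fintype.linearIndependent_iff.mp hi c h3.symm)

theorem finrank_ge_of_rank {ι : Type*} [Fintype ι] {u : ι → Q} (ha : 0 < a ∧ a < p)
    (hQ : ∀ v : Q, InBl (p := p) (q := q) (gam q ε a) v)
    (hu : ∀ i, 𝐊 ⋆ u i = (ε * q ^ ((a : ℤ) - 1)) • u i)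
    (hi : LinearIndependent k fun i => 𝐅 ⋆ 𝐄 ⋆ u i) :
    2 * Fintype.card ι ≤ Module.finrank k (BMod.ofBlock Q hp hq hε ha hQ).Vp ∧
    2 * Fintype.card ι ≤ Module.finrank k (BMod.ofBlock Q hp hq hε ha hQ).Vm := by
  obtain ⟨j, hj⟩ := exists_linearMap_of_rank hp hq hε ha hQ hu hi
  have h1 := LinearMap.finrank_le_finrank_of_injective (BMod.injective_vp _ j hj)
  have h2 := LinearMap.finrank_le_finrank_of_injective (BMod.injective_vm _ j hj)
  rw [Module.finrank_prod, Module.finrank_fintype_fun_eq_card] at h1 h2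
  omega

theorem eq_of_weighted_sum_le {a b x y d : ℕ} (ha : 0 < a) (hb : 0 < b) (hx : 2 * d ≤ x)
    (hy : 2 * d ≤ y) (h : a * x + b * y ≤ 2 * (a + b) * d) : x = 2 * d ∧ y = 2 * d := by
  have h1 : a * (2 * d) ≤ a * x := Nat.mul_le_mul_left _ hx
  have h2 : b * (2 * d) ≤ b * y := Nat.mul_le_mul_left _ hy
  have h3 : 2 * (a + b) * d = a * (2 * d) + b * (2 * d) := by ring
  exact ⟨Nat.eq_of_mul_eq_mul_left ha (by omega), Nat.eq_of_mul_eq_mul_left hb (by omega)⟩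

theorem exists_equiv_PPlus {d : ℕ} {u : Fin d → Q} (ha : 0 < a ∧ a < p)
    (hQ : ∀ v : Q, InBl (p := p) (q := q) (gam q ε a) v)
    (hu : ∀ i, 𝐊 ⋆ u i = (ε * q ^ ((a : ℤ) - 1)) • u i)
    (hi : LinearIndependent k fun i => 𝐅 ⋆ 𝐄 ⋆ u i)
    (hd : Module.finrank k Q ≤ 2 * p * d) :
    Nonempty (Q ≃ₗ[Ubar p q] (Fin d → PhiSigned hp hq hε a ha (BMod.PPlus k))) := by
  obtain ⟨h1, h2⟩ := finrank_ge_of_rank hp hq hε ha hQ hu hi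
  rw [Fintype.card_fin] at h1 h2
  obtain ⟨j, hj⟩ := exists_linearMap_of_rank hp hq hε ha hQ hu hi
  have h3 := finrank_block hp hq hε ha hQ
  change _ = a * Module.finrank k (BMod.ofBlock Q hp hq hε ha hQ).Vp
    + (p - a) * Module.finrank k (BMod.ofBlock Q hp hq hε ha hQ).Vm at h3
  rw [h3, show 2 * p * d = 2 * (a + (p - a)) * d by rw [Nat.add_sub_cancel' ha.2.le]] at hd
  obtain ⟨h4, h5⟩ := eq_of_weighted_sum_le ha.1 (by omega) h1 h2 hd
  obtain ⟨hbp, hbm⟩ := BMod.bijective_homPPlus _ j hj h4 h5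
  obtain ⟨f⟩ := exists_equiv_of_homs hp hq hε ha
    (fun i => BMod.homPPlus _ (j (Pi.single i 1))) hbp hbm
  exact ⟨(blockEquiv hp hq hε ha hQ).symm.trans f⟩

end

end

end Criteria

section TopBlock

theorem XMod.constr_apply {ε : k} (hp : 2 ≤ p) (hq : IsPrimitiveRoot q (2 * p))
    (hε : ε * ε = 1) {r : ℕ} (hr : r ≤ p) {P : Type*} [AddCommGroup P] [Module k P] (f : ℕ → P)
    (v : XMod hp hq hε hr) : XMod.constr hp hq hε hr f v
      = ∑ n : Fin r, (show Fin r → k from v) n • f n.val :=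
  Fintype.linearCombination_apply k (fun n : Fin r => f n.val) (show Fin r → k from v)

variable {Q : Type*} [AddCommGroup Q] [Module k Q] [Module (Ubar p q) Q]
  [IsScalarTower k (Ubar p q) Q] {ε : k}
  (hp : 2 ≤ p) (hq : IsPrimitiveRoot q (2 * p)) (hε : ε * ε = 1)

/-- The homomorphism from a simple module given by a highest weight vector `w` with
`F ^ r w = 0`. -/
noncomputable def XMod.hom {r : ℕ} (hr : r ≤ p) {w : Q} (hE : 𝐄 ⋆ w = 0)
    (hK : 𝐊 ⋆ w = (ε * q ^ ((r : ℤ) - 1)) • w) (hF : 𝐅 ^ r ⋆ w = 0) :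
    XMod hp hq hε hr →ₗ[Ubar p q] Q :=
  have hb : ∀ i, XMod.constr hp hq hε hr (fun n => 𝐅 ^ n ⋆ w) (XMod.bas hp hq hε hr i)
      = 𝐅 ^ i ⋆ w := fun i => by
    rcases Nat.lt_or_ge i r with h | h
    · exact XMod.constr_bas hp hq hε hr _ h
    · obtain ⟨d, rfl⟩ := Nat.exists_eq_add_of_le h
      rw [XMod.bas_of_le hp hq hε hr h, map_zero, add_comm, F_add_act, hF, act_zero]
  ulin (XMod.constr hp hq hε hr fun n => 𝐅 ^ n ⋆ w)
    (XMod.hom_ext hp hq hε hr (f := XMod.constr hp hq hε hr (fun n => 𝐅 ^ n ⋆ w) ∘ₗ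
        Algebra.lsmul k k (XMod hp hq hε hr : Type u) 𝐄)
      (g := Algebra.lsmul k k Q 𝐄 ∘ₗ XMod.constr hp hq hε hr (fun n => 𝐅 ^ n ⋆ w)) fun i _ => by
        change XMod.constr hp hq hε hr (fun n => 𝐅 ^ n ⋆ w) (𝐄 ⋆ XMod.bas hp hq hε hr i)
          = 𝐄 ⋆ XMod.constr hp hq hε hr (fun n => 𝐅 ^ n ⋆ w) (XMod.bas hp hq hε hr i)
        rw [XMod.E_bas, map_smul, hb, hb]
        rcases i with _ | i
        · rw [coeff_zero, zero_smul, pow_zero, one_act, hE]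
        · rw [E_F_pow_succ hp hq hε i hK, hE, act_zero, add_zero, usmul, Nat.add_sub_cancel])
    (XMod.hom_ext hp hq hε hr (f := XMod.constr hp hq hε hr (fun n => 𝐅 ^ n ⋆ w) ∘ₗ
        Algebra.lsmul k k (XMod hp hq hε hr : Type u) 𝐅)
      (g := Algebra.lsmul k k Q 𝐅 ∘ₗ XMod.constr hp hq hε hr (fun n => 𝐅 ^ n ⋆ w)) fun i _ => by
        change XMod.constr hp hq hε hr (fun n => 𝐅 ^ n ⋆ w) (𝐅 ⋆ XMod.bas hp hq hε hr i)
          = 𝐅 ⋆ XMod.constr hp hq hε hr (fun n => 𝐅 ^ n ⋆ w) (XMod.bas hp hq hε hr i)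
        rw [XMod.F_bas, hb, hb, F_succ_act])
    (XMod.hom_ext hp hq hε hr (f := XMod.constr hp hq hε hr (fun n => 𝐅 ^ n ⋆ w) ∘ₗ
        Algebra.lsmul k k (XMod hp hq hε hr : Type u) 𝐊)
      (g := Algebra.lsmul k k Q 𝐊 ∘ₗ XMod.constr hp hq hε hr (fun n => 𝐅 ^ n ⋆ w)) fun i _ => by
        change XMod.constr hp hq hε hr (fun n => 𝐅 ^ n ⋆ w) (𝐊 ⋆ XMod.bas hp hq hε hr i)
          = 𝐊 ⋆ XMod.constr hp hq hε hr (fun n => 𝐅 ^ n ⋆ w) (XMod.bas hp hq hε hr i)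
        rw [XMod.K_bas, map_smul, hb, weight_F_pow (q_ne_zero hp hq) hK, wt])

theorem XMod.hom_apply {r : ℕ} (hr : r ≤ p) {w : Q} (hE : 𝐄 ⋆ w = 0)
    (hK : 𝐊 ⋆ w = (ε * q ^ ((r : ℤ) - 1)) • w) (hF : 𝐅 ^ r ⋆ w = 0) (v : XMod hp hq hε hr) :
    XMod.hom hp hq hε hr hE hK hF v
      = ∑ n : Fin r, (show Fin r → k from v) n • 𝐅 ^ n.val ⋆ w :=
  XMod.constr_apply hp hq hε hr (fun n => 𝐅 ^ n ⋆ w) v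

theorem E_eq_zero_of_top [CharZero k] (hp : 2 ≤ p) (hq : IsPrimitiveRoot q (2 * p))
    (hε : ε * ε = 1) {v : Q} (hQ : ∀ v : Q, InBl (p := p) (q := q) (gam q ε p) v)
    (hK : 𝐊 ⋆ v = (ε * q ^ ((p : ℤ) - 1)) • v) : 𝐄 ⋆ v = 0 := by
  have hq0 := q_ne_zero hp hq
  have hδ := q_sub_ne hp hq
  have hw := weight_E' hq0 hK
  have e : (p : ℤ) - 1 + 2 = p - 1 - 2 * (p - 1 : ℕ) + p + p := by
    rw [Nat.cast_sub (by omega)]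
    push_cast
    ring
  rw [e, q_zpow_add_p hp hq, q_zpow_add_p hp hq, neg_neg] at hw
  obtain ⟨x, hx, hxv⟩ := exists_F_pow_eq hp hq hε le_rfl (show p - 1 < p by omega) (hQ _) hw
  have h1 : 𝐄 ^ (p - 1) ⋆ 𝐅 ^ (p - 1) ⋆ x = 0 := by
    rw [hxv, ← E_succ_act', Nat.sub_add_cancel (by omega), E_pow_smul]
  rw [E_pow_F_pow hq0 hδ hε hx] at h1
  rw [← hxv, (hQ x).eq_zero_of_aeval _
    (eval_gam_prod_down hp hq hε le_rfl (show p - 1 < p by omega)) h1, act_zero]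

theorem exists_equiv_top [CharZero k] [Module.Finite k Q]
    (hQ : ∀ v : Q, InBl (p := p) (q := q) (gam q ε p) v) {d : ℕ}
    (hd : Module.finrank k (wtSub p q Q (ε * q ^ ((p : ℤ) - 1))) = d) :
    Nonempty (Q ≃ₗ[Ubar p q] (Fin d → XMod hp hq hε (le_refl p))) := by
  have hq0 := q_ne_zero hp hq
  let b : Module.Basis (Fin d) k (wtSub p q Q (ε * q ^ ((p : ℤ) - 1))) :=
    Module.finBasisOfFinrankEq k _ hd
  let h : Fin d → XMod hp hq hε (le_refl p) →ₗ[Ubar p q] Q := fun i =>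
    XMod.hom hp hq hε le_rfl (E_eq_zero_of_top hp hq hε hQ (b i).2) (b i).2 (F_pow_smul _)
  let f : (Fin d → XMod hp hq hε (le_refl p)) →ₗ[Ubar p q] Q :=
    LinearMap.lsum (Ubar p q) _ ℕ h
  have hcoe : ∀ c : Fin d → k, (∑ i, c i • b i : wtSub p q Q (ε * q ^ ((p : ℤ) - 1))).1
      = ∑ i, c i • (b i).1 := fun c =>
    map_sum (wtSub p q Q (ε * q ^ ((p : ℤ) - 1))).subtype (fun i => c i • b i) _
  have hf : ∀ x, f x = ∑ n : Fin p, 𝐅 ^ n.val ⋆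
      (∑ i, (show Fin p → k from x i) n • b i : wtSub p q Q (ε * q ^ ((p : ℤ) - 1))).1 := by
    intro x
    have h1 : f x = ∑ i, h i (x i) := by simp [f]
    have h2 : ∀ i, h i (x i)
        = ∑ n : Fin p, (show Fin p → k from x i) n • 𝐅 ^ n.val ⋆ (b i).1 := fun i =>
      XMod.hom_apply hp hq hε le_rfl _ _ _ (x i)
    rw [h1, Finset.sum_congr rfl fun i _ => h2 i, Finset.sum_comm]
    refine Finset.sum_congr rfl fun n _ => ?_
    rw [hcoe, act_sum]
    exact Finset.sum_congr rfl fun i _ => (usmul _ _ _).symm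
  refine ⟨(LinearEquiv.ofBijective f ⟨?_, ?_⟩).symm⟩
  · rw [injective_iff_map_eq_zero]
    intro x hx
    rw [hf] at hx
    have key := eq_zero_of_sum_weights (p := p) (q := q) Finset.univ
      (fun n : Fin p => ε * q ^ ((p : ℤ) - 1 - 2 * (n.val : ℕ)))
      (fun i _ j _ hij => Fin.ext (injOn_weights hp hq hε ((p : ℤ) - 1)
        (Finset.mem_coe.mpr (Finset.mem_range.mpr i.isLt))
        (Finset.mem_coe.mpr (Finset.mem_range.mpr j.isLt)) hij)) _
      (fun n _ => weight_F_pow hq0 (∑ i, (show Fin p → k from x i) n • b i : wtSub p q Q (ε * q ^ ((p : ℤ) - 1))).2 n.val) hx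
    refine funext fun i => funext fun n => ?_
    have h1 := eq_zero_of_F_pow hp hq hε le_rfl n.isLt (hQ _)
      (∑ i, (show Fin p → k from x i) n • b i : wtSub p q Q (ε * q ^ ((p : ℤ) - 1))).2 (key n (Finset.mem_univ _))
    exact Fintype.linearIndependent_iff.mp b.linearIndependent
      (fun i => (show Fin p → k from x i) n) (Subtype.ext h1) i
  · suffices hr : LinearMap.range f = ⊤ from LinearMap.range_eq_top.mp hr
    rw [eq_top_iff]
    rintro v -
    obtain ⟨w, hw, rfl⟩ := exists_weight_decomposition hp hq v
    refine Submodule.sum_mem _ fun i _ => ?_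
    by_cases h0 : w i = 0
    · rw [h0]
      exact Submodule.zero_mem _
    obtain ⟨n, hn, hwn⟩ := exists_weight_eq hp hq hε (hQ (w i)) (hw i) h0
    have hwi := hw i
    rw [hwn] at hwi
    obtain ⟨x, hx, hxv⟩ := exists_F_pow_eq hp hq hε le_rfl hn (hQ _) hwi
    refine ⟨fun i => b.repr ⟨x, hx⟩ i • XMod.bas hp hq hε le_rfl n, ?_⟩
    rw [hf, Finset.sum_eq_single ⟨n, hn⟩]
    · have e : ∀ i, (show Fin p → k from b.repr ⟨x, hx⟩ i • XMod.bas hp hq hε le_rfl n) ⟨n, hn⟩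
          = b.repr ⟨x, hx⟩ i := fun i => by
        change b.repr ⟨x, hx⟩ i * (if n = n then 1 else 0) = _
        simp
      simp only [e]
      rw [b.sum_repr]
      exact hxv
    · intro m _ hm
      have e : ∀ i, (show Fin p → k from b.repr ⟨x, hx⟩ i • XMod.bas hp hq hε le_rfl n) m
          = 0 := fun i => by
        change b.repr ⟨x, hx⟩ i * (if m.val = n then 1 else 0) = _
        rw [if_neg (fun h => hm (Fin.ext h)), mul_zero]
      simp only [e, zero_smul, Finset.sum_const_zero]
      exact act_zero _
    · exact fun h => absurd (Finset.mem_univ _) h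

theorem finrank_XMod {r : ℕ} (hr : r ≤ p) : Module.finrank k (XMod hp hq hε hr) = r :=
  (Module.finrank_fintype_fun_eq_card k).trans (Fintype.card_fin r)

theorem finrank_top [CharZero k] [Module.Finite k Q] (hp : 2 ≤ p)
    (hq : IsPrimitiveRoot q (2 * p)) (hε : ε * ε = 1)
    (hQ : ∀ v : Q, InBl (p := p) (q := q) (gam q ε p) v) :
    Module.finrank k Q = p * Module.finrank k (wtSub p q Q (ε * q ^ ((p : ℤ) - 1))) := by
  obtain ⟨e⟩ := exists_equiv_top hp hq hε hQ rfl
  rw [(e.restrictScalars k).finrank_eq, Module.finrank_pi_fintype]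
  simp [finrank_XMod, mul_comm]

end TopBlock

section Ladder

variable {S : Type*} [AddCommGroup S] [Module k S] [Module (Ubar p q) S]
  [IsScalarTower k (Ubar p q) S]
variable {R' : Type*} [AddCommGroup R'] [Module k R'] [Module (Ubar p q) R']
  [IsScalarTower k (Ubar p q) R']
variable {R : Type*} [AddCommGroup R] [Module k R] [Module (Ubar p q) R]
  [IsScalarTower k (Ubar p q) R]

/-- The block `γ(ε, t)` of a module looks like a Kronecker module: on its highest weight vectors
`F E` vanishes, the operators `E` and `F ^ (p - 1)` are jointly injective and related by
`g₁ F ^ (p - 1) = ρ g₂ E`, and `F` vanishes one step above. -/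
structure Kron (ε : k) (t : ℤ) (ρ : k) (g₁ g₂ : R →ₗ[Ubar p q] R) : Prop where
  FE : ∀ v : R, InBl (p := p) (q := q) (gam q ε t) v → 𝐊 ⋆ v = (ε * q ^ (t - 1)) • v →
    𝐅 ⋆ 𝐄 ⋆ v = 0
  ratio : ∀ v : R, InBl (p := p) (q := q) (gam q ε t) v → 𝐊 ⋆ v = (ε * q ^ (t - 1)) • v →
    g₁ (𝐅 ^ (p - 1) ⋆ v) = ρ • g₂ (𝐄 ⋆ v)
  inj : ∀ v : R, InBl (p := p) (q := q) (gam q ε t) v → 𝐊 ⋆ v = (ε * q ^ (t - 1)) • v →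
    𝐄 ⋆ v = 0 → 𝐅 ^ (p - 1) ⋆ v = 0 → v = 0
  F : ∀ v : R, InBl (p := p) (q := q) (gam q ε t) v → 𝐊 ⋆ v = (ε * q ^ (t + 1)) • v →
    𝐅 ⋆ v = 0

/-- The coefficients of a ladder of linear maps, at weight `ε q ^ (t - 1)`. -/
structure LadderCoeff (p : ℕ) (q ε : k) (t : ℤ) where
  x : k
  y : k
  z : k
  w : k
  κ : k
  κ' : k
  η : k
  ν : k
  θ : k
  τ : k
  θ_eq : θ = q ∨ θ = q⁻¹
  x_mul_z : x * z = θ⁻¹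
  w_mul_y : w * y = θ
  κ_mul_κ' : κ * κ' = ε * θ ^ t
  ν_eq : -ν = τ * y * κ' * x
  z_pow : z ^ (p - 1) = τ * x * θ
  η_eq : η * x * ε * qint q t - ν * κ = τ * y * x * ε * qint q (t + 1)
  τ_mul_τ : τ * τ = 1

/-- A ladder: two linear maps `A`, `B` which shift the weight by `q ^ (-1)` and `q`, and
intertwine `E` and `F` in a triangular way. -/
structure Ladder {ε : k} {t : ℤ} (c : LadderCoeff p q ε t) (A B : S →ₗ[k] R) : Prop where
  A_K : ∀ v, A (𝐊 ⋆ v) = q • 𝐊 ⋆ A v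
  B_K : ∀ v, B (𝐊 ⋆ v) = q⁻¹ • 𝐊 ⋆ B v
  A_E : ∀ v, 𝐊 ⋆ v = (ε * q ^ (t - 1)) • v → A (𝐄 ⋆ v) = c.x • 𝐄 ⋆ A v + c.κ • B v
  B_E : ∀ v, B (𝐄 ⋆ v) = c.y • 𝐄 ⋆ B v
  A_F : ∀ v, A (𝐅 ⋆ v) = c.z • 𝐅 ⋆ A v
  B_F : ∀ v, 𝐊 ⋆ v = (ε * q ^ (t + 1)) • v → B (𝐅 ⋆ v) = c.κ' • A v + c.w • 𝐅 ⋆ B v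
  B_F_pow : ∀ v, 𝐊 ⋆ v = (ε * q ^ (t - 1)) • v →
    B (𝐅 ^ (p - 1) ⋆ v) = c.η • 𝐅 ^ (p - 1) ⋆ B v + c.ν • 𝐅 ^ (p - 2) ⋆ A v

namespace Ladder

variable {ε : k} {t : ℤ} {c : LadderCoeff p q ε t} {A B : S →ₗ[k] R}

theorem comp (L : Ladder c A B) (f : R →ₗ[Ubar p q] R') {A' B' : S →ₗ[k] R'}
    (hA : ∀ v, A' v = f (A v)) (hB : ∀ v, B' v = f (B v)) : Ladder c A' B' where
  A_K v := by rw [hA, hA, L.A_K, f.map_smul_of_tower, map_act]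
  B_K v := by rw [hB, hB, L.B_K, f.map_smul_of_tower, map_act]
  A_E v h := by rw [hA, hA, hB, L.A_E v h, map_add, f.map_smul_of_tower, f.map_smul_of_tower,
      map_act]
  B_E v := by rw [hB, hB, L.B_E, f.map_smul_of_tower, map_act]
  A_F v := by rw [hA, hA, L.A_F, f.map_smul_of_tower, map_act]
  B_F v h := by rw [hA, hB, hB, L.B_F v h, map_add, f.map_smul_of_tower, f.map_smul_of_tower,
      map_act]
  B_F_pow v h := by rw [hA, hB, hB, L.B_F_pow v h, map_add, f.map_smul_of_tower, f.map_smul_of_tower,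
      map_act, map_act]

theorem weight_A (hp : 2 ≤ p) (hq : IsPrimitiveRoot q (2 * p)) (L : Ladder c A B) {j : ℤ} {v : S}
    (h : 𝐊 ⋆ v = (ε * q ^ j) • v) : 𝐊 ⋆ A v = (ε * q ^ (j - 1)) • A v := by
  have hq0 := q_ne_zero hp hq
  have h1 := L.A_K v
  rw [h, map_smul] at h1
  rw [← inv_smul_smul₀ hq0 (𝐊 ⋆ A v), ← h1, smul_smul, zpow_sub_one₀ hq0]
  congr 1
  ring

theorem weight_B (hp : 2 ≤ p) (hq : IsPrimitiveRoot q (2 * p)) (L : Ladder c A B) {j : ℤ} {v : S}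
    (h : 𝐊 ⋆ v = (ε * q ^ j) • v) : 𝐊 ⋆ B v = (ε * q ^ (j + 1)) • B v := by
  have hq0 := q_ne_zero hp hq
  have h1 := L.B_K v
  rw [h, map_smul] at h1
  rw [← smul_inv_smul₀ hq0 (𝐊 ⋆ B v), ← h1, smul_smul, zpow_add_one₀ hq0]
  congr 1
  ring

theorem A_F_pow (L : Ladder c A B) (n : ℕ) (v : S) :
    A (𝐅 ^ n ⋆ v) = c.z ^ n • 𝐅 ^ n ⋆ A v := by
  induction n with
  | zero => simp only [pow_zero, one_act, one_smul]
  | succ n ih => rw [F_succ_act, L.A_F, ih, usmul, smul_smul, ← pow_succ', ← F_succ_act]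

end Ladder

namespace LadderCoeff

variable {ε : k} {t : ℤ} (hp : 2 ≤ p) (hq : IsPrimitiveRoot q (2 * p)) (hε : ε * ε = 1)
  (c : LadderCoeff p q ε t)

theorem θ_ne (hp : 2 ≤ p) (hq : IsPrimitiveRoot q (2 * p)) (c : LadderCoeff p q ε t) :
    c.θ ≠ 0 := by
  have hq0 := q_ne_zero hp hq
  rcases c.θ_eq with h | h <;> rw [h]
  · exact hq0
  · exact inv_ne_zero hq0

theorem x_ne (hp : 2 ≤ p) (hq : IsPrimitiveRoot q (2 * p)) (c : LadderCoeff p q ε t) :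
    c.x ≠ 0 := fun h => inv_ne_zero (c.θ_ne hp hq) (by rw [← c.x_mul_z, h, zero_mul])

theorem z_ne (hp : 2 ≤ p) (hq : IsPrimitiveRoot q (2 * p)) (c : LadderCoeff p q ε t) :
    c.z ≠ 0 := fun h => inv_ne_zero (c.θ_ne hp hq) (by rw [← c.x_mul_z, h, mul_zero])

theorem w_ne (hp : 2 ≤ p) (hq : IsPrimitiveRoot q (2 * p)) (c : LadderCoeff p q ε t) :
    c.w ≠ 0 := fun h => c.θ_ne hp hq (by rw [← c.w_mul_y, h, zero_mul])

theorem y_ne (hp : 2 ≤ p) (hq : IsPrimitiveRoot q (2 * p)) (c : LadderCoeff p q ε t) :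
    c.y ≠ 0 := fun h => c.θ_ne hp hq (by rw [← c.w_mul_y, h, mul_zero])

theorem κ'_ne (hp : 2 ≤ p) (hq : IsPrimitiveRoot q (2 * p)) (hε : ε * ε = 1)
    (c : LadderCoeff p q ε t) : c.κ' ≠ 0 := fun h =>
  mul_ne_zero (sign_ne_zero hε) (zpow_ne_zero t (c.θ_ne hp hq)) (by rw [← c.κ_mul_κ', h, mul_zero])

theorem up (hp : 2 ≤ p) (hq : IsPrimitiveRoot q (2 * p)) (c : LadderCoeff p q ε t) :
    c.x * c.z * (ε * qint q t) + c.κ * c.κ' = ε * qint q (t + 1) := by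
  have hq0 := q_ne_zero hp hq
  have hδ := q_sub_ne hp hq
  have hx : q ^ t ≠ 0 := zpow_ne_zero _ hq0
  rw [c.x_mul_z, c.κ_mul_κ', qint, qint, neg_add, zpow_add₀ hq0, zpow_add₀ hq0, zpow_neg, zpow_neg]
  have hδ' : q ^ 2 - 1 ≠ 0 := fun h => hδ (by field_simp; linear_combination h)
  rcases c.θ_eq with h | h <;> rw [h]
  · simp only [zpow_one]
    field_simp
    ring
  · simp only [zpow_one, inv_zpow]
    field_simp
    ring

theorem down (hp : 2 ≤ p) (hq : IsPrimitiveRoot q (2 * p)) (c : LadderCoeff p q ε t) :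
    c.w * c.y * (ε * qint q t) - c.κ * c.κ' = ε * qint q (t - 1) := by
  have hq0 := q_ne_zero hp hq
  have hδ := q_sub_ne hp hq
  have hx : q ^ t ≠ 0 := zpow_ne_zero _ hq0
  rw [c.w_mul_y, c.κ_mul_κ', qint, qint, neg_sub, zpow_sub₀ hq0, zpow_sub₀ hq0, zpow_neg]
  have hδ' : q ^ 2 - 1 ≠ 0 := fun h => hδ (by field_simp; linear_combination h)
  rcases c.θ_eq with h | h <;> rw [h]
  · simp only [zpow_one]
    field_simp
    ring
  · simp only [zpow_one, inv_zpow]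
    field_simp
    ring

end LadderCoeff

end Ladder

section LadderBlocks

variable {S : Type*} [AddCommGroup S] [Module k S] [Module (Ubar p q) S]
  [IsScalarTower k (Ubar p q) S]
variable {R : Type*} [AddCommGroup R] [Module k R] [Module (Ubar p q) R]
  [IsScalarTower k (Ubar p q) R]

/-- Induction on the nilpotency of `F E` on a weight space of a block. -/
theorem InBl.nilpotent_induction (hp : 2 ≤ p) (hq : IsPrimitiveRoot q (2 * p)) {ε : k}
    (hε : ε * ε = 1) {t : ℤ} {P : S → Prop} (h0 : P 0)
    (hs : ∀ v : S, 𝐊 ⋆ v = (ε * q ^ (t - 1)) • v → P (𝐅 ⋆ 𝐄 ⋆ v) → P v) {v : S}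
    (hv : InBl (p := p) (q := q) (gam q ε t) v) (hK : 𝐊 ⋆ v = (ε * q ^ (t - 1)) • v) : P v := by
  have hq0 := q_ne_zero hp hq
  have hδ := q_sub_ne hp hq
  suffices H : ∀ (n : ℕ) (v : S), 𝐊 ⋆ v = (ε * q ^ (t - 1)) • v →
      Polynomial.aeval (cas p q) ((Polynomial.X - Polynomial.C (gam q ε t)) ^ n) ⋆ v = 0 → P v from
    H p v hK hv
  intro n
  induction n with
  | zero =>
    intro v _ h
    rw [pow_zero, map_one, one_act] at h
    rwa [h]
  | succ n ih =>
    intro v hK h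
    refine hs v hK (ih _ ?_ ?_)
    · have h1 := weight_F' hq0 (weight_E' hq0 hK)
      rwa [add_sub_cancel_right] at h1
    · have h1 : 𝐅 ⋆ 𝐄 ⋆ v
          = Polynomial.aeval (cas p q) (Polynomial.X - Polynomial.C (gam q ε t)) ⋆ v := by
        rw [FE_smul hq0 hε hK, sub_add_cancel, map_sub, Polynomial.aeval_X, Polynomial.aeval_C,
          sub_act, algebraMap_act]
      rw [h1, ← mul_act, ← map_mul, ← pow_succ]
      exact h

theorem InBl.eq_zero_of_cas (hp : 2 ≤ p) {γ γ' : k} {v : R}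
    (h : InBl (p := p) (q := q) γ v) (h' : cas p q ⋆ v = γ' • v) (hne : γ ≠ γ') : v = 0 :=
  h.eq_zero_of_ne (InBl.of_cas hp h') hne

namespace Ladder

variable {ε : k} {t : ℤ} {c : LadderCoeff p q ε t} {A B : S →ₗ[k] R}

theorem A_FE (L : Ladder c A B) {v : S} (hK : 𝐊 ⋆ v = (ε * q ^ (t - 1)) • v) :
    A (𝐅 ⋆ 𝐄 ⋆ v) = c.z • (c.x • 𝐅 ⋆ 𝐄 ⋆ A v + c.κ • 𝐅 ⋆ B v) := by
  rw [L.A_F, L.A_E v hK, act_add, usmul, usmul]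

theorem B_FE (hp : 2 ≤ p) (hq : IsPrimitiveRoot q (2 * p)) (L : Ladder c A B) {v : S}
    (hK : 𝐊 ⋆ v = (ε * q ^ (t - 1)) • v) :
    B (𝐅 ⋆ 𝐄 ⋆ v) = c.κ' • (c.x • 𝐄 ⋆ A v + c.κ • B v) + (c.w * c.y) • 𝐅 ⋆ 𝐄 ⋆ B v := by
  have h1 := weight_E' (q_ne_zero hp hq) hK
  rw [show t - 1 + 2 = t + 1 by ring] at h1
  rw [L.B_F _ h1, L.A_E v hK, L.B_E, usmul, smul_smul]

theorem eq_zero_of_ne (hp : 2 ≤ p) (hq : IsPrimitiveRoot q (2 * p)) (hε : ε * ε = 1)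
    (L : Ladder c A B) {γ : k} (hA : ∀ v, InBl (p := p) (q := q) γ (A v))
    (hB : ∀ v, InBl (p := p) (q := q) γ (B v)) (hlo : γ ≠ gam q ε (t - 1))
    (hhi : γ ≠ gam q ε (t + 1)) {v : S} (hv : InBl (p := p) (q := q) (gam q ε t) v)
    (hK : 𝐊 ⋆ v = (ε * q ^ (t - 1)) • v) : A v = 0 ∧ B v = 0 := by
  have hq0 := q_ne_zero hp hq
  have hδ := q_sub_ne hp hq
  refine InBl.nilpotent_induction hp hq hε (P := fun v => A v = 0 ∧ B v = 0)
    ⟨map_zero A, map_zero B⟩ (fun v hK ih => ?_) hv hK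
  obtain ⟨hA0, hB0⟩ := ih
  rw [L.A_FE hK] at hA0
  rw [L.B_FE hp hq hK] at hB0
  have hA1 := (smul_eq_zero.mp hA0).resolve_left (c.z_ne hp hq)
  have wA := L.weight_A hp hq hK
  have wB := L.weight_B hp hq hK
  have fA := FE_smul hq0 hε wA
  have fB := EF_smul hq0 hδ hε wB
  have hB1 := congrArg (fun y => 𝐅 ⋆ y) hB0
  simp only [act_add, usmul, act_zero] at hB1
  rw [hA1, smul_zero, zero_add] at hB1
  have hB2 : 𝐅 ⋆ 𝐅 ⋆ 𝐄 ⋆ B v = 0 := (smul_eq_zero.mp hB1).resolve_left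
    (mul_ne_zero (c.w_ne hp hq) (c.y_ne hp hq))
  have wBE := FE_smul hq0 hε wB
  rw [wBE, act_sub, usmul, ← cas_comm_smul hq0 hδ] at hB2
  have hFB : 𝐅 ⋆ B v = 0 := by
    refine ((hB v).act hp hq 𝐅).eq_zero_of_cas hp (sub_eq_zero.mp hB2) ?_
    rwa [show t - 1 + 1 + 1 = t + 1 by ring]
  rw [hFB, act_zero] at fB
  have hBv : B v = 0 := by
    refine (hB v).eq_zero_of_cas hp (sub_eq_zero.mp fB.symm) ?_
    rwa [show t - 1 + 1 - 1 = t - 1 by ring]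
  rw [hFB, smul_zero, add_zero, fA] at hA1
  have hA2 := (smul_eq_zero.mp hA1).resolve_left (c.x_ne hp hq)
  refine ⟨(hA v).eq_zero_of_cas hp (sub_eq_zero.mp hA2) ?_, hBv⟩
  rwa [show t - 1 - 1 + 1 = t - 1 by ring]

theorem gam_diff (hp : 2 ≤ p) (hq : IsPrimitiveRoot q (2 * p)) (ε : k) (t : ℤ) :
    gam q ε (t + 1) - gam q ε (t - 1) = ε * qint q t := by
  have h := gam_sub (q_ne_zero hp hq) (q_sub_ne hp hq) ε (t + 1) 1
  rw [qint_one hp hq, one_mul] at h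
  rwa [show t + 1 - 2 * 1 = t - 1 by ring, add_sub_cancel_right] at h

/-- In the block above, `A v = F w` for a vector `w` with `x ε [t] w + κ B v = 0`. -/
theorem exists_plus (hp : 2 ≤ p) (hq : IsPrimitiveRoot q (2 * p)) (hε : ε * ε = 1)
    (ht : qint q t ≠ 0) (L : Ladder c A B) {ρ : k} {g₁ g₂ : R →ₗ[Ubar p q] R}
    (hA : ∀ v, InBl (p := p) (q := q) (gam q ε (t + 1)) (A v))
    (hB : ∀ v, InBl (p := p) (q := q) (gam q ε (t + 1)) (B v))
    (h : Kron ε (t + 1) ρ g₁ g₂)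
    (hz : qint q (t + 1) = 0 → ∀ v : R, InBl (p := p) (q := q) (gam q ε (t + 1)) v → v = 0)
    {v : S} (hv : InBl (p := p) (q := q) (gam q ε t) v)
    (hK : 𝐊 ⋆ v = (ε * q ^ (t - 1)) • v) :
    A (𝐄 ⋆ v) = 0 ∧ ∃ w, A v = 𝐅 ⋆ w ∧ (c.x * (ε * qint q t)) • w + c.κ • B v = 0 := by
  have hq0 := q_ne_zero hp hq
  have hδ := q_sub_ne hp hq
  have hne : gam q ε (t + 1) ≠ gam q ε (t - 1) := fun h0 => by
    have := gam_diff hp hq ε t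
    rw [h0, sub_self] at this
    exact mul_ne_zero (sign_ne_zero hε) ht this.symm
  have top : ∀ w : R, InBl (p := p) (q := q) (gam q ε (t + 1)) w →
      𝐊 ⋆ w = (ε * q ^ t) • w → 𝐄 ⋆ 𝐅 ⋆ w = (ε * qint q t) • w ∧ 𝐅 ⋆ 𝐄 ⋆ w = 0 := by
    intro w hw hwK
    have h1 := h.FE w hw (by rwa [add_sub_cancel_right])
    have h2 := FE_smul hq0 hε hwK
    rw [h1] at h2
    refine ⟨?_, h1⟩
    rw [EF_smul hq0 hδ hε hwK, sub_eq_zero.mp h2.symm, ← sub_smul, gam_diff hp hq]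
  have exw : ∀ v : S, 𝐊 ⋆ v = (ε * q ^ (t - 1)) • v → ∃ w, A v = 𝐅 ⋆ w ∧
      InBl (p := p) (q := q) (gam q ε (t + 1)) w ∧ 𝐊 ⋆ w = (ε * q ^ t) • w := by
    intro v hK
    have wA := L.weight_A hp hq hK
    obtain ⟨g, hg⟩ := exists_inverse_of_eval_ne_zero (hA v)
      (Polynomial.X - Polynomial.C (gam q ε (t - 1))) (by simpa [sub_ne_zero] using hne)
    rw [map_sub, Polynomial.aeval_X, Polynomial.aeval_C, sub_act, algebraMap_act] at hg
    have h1 := FE_smul hq0 hε wA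
    rw [show t - 1 - 1 + 1 = t - 1 by ring] at h1
    rw [← h1, aeval_cas_comm hq0 hδ] at hg
    refine ⟨_, hg.symm, ((hA v).act hp hq _).act hp hq _, weight_cas hq0 hδ ?_ _⟩
    have h2 := weight_E' hq0 wA
    rwa [show t - 1 - 1 + 2 = t by ring] at h2
  have key : ∀ v : S, 𝐊 ⋆ v = (ε * q ^ (t - 1)) • v → ∀ w, A v = 𝐅 ⋆ w →
      InBl (p := p) (q := q) (gam q ε (t + 1)) w → 𝐊 ⋆ w = (ε * q ^ t) • w →
      A (𝐄 ⋆ v) = (c.x * (ε * qint q t)) • w + c.κ • B v := by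
    intro v hK w hAw hw hwK
    rw [L.A_E v hK, hAw, (top w hw hwK).1, smul_smul]
  have wBv : ∀ v : S, 𝐊 ⋆ v = (ε * q ^ (t - 1)) • v → 𝐊 ⋆ B v = (ε * q ^ t) • B v := by
    intro v hK
    have := L.weight_B hp hq hK
    rwa [sub_add_cancel] at this
  have main : A (𝐄 ⋆ v) = 0 := by
    refine InBl.nilpotent_induction hp hq hε (P := fun v => A (𝐄 ⋆ v) = 0)
      (by rw [act_zero, map_zero]) (fun v hK ih => ?_) hv hK
    have hEK := weight_E' hq0 hK
    rw [show t - 1 + 2 = t + 1 by ring] at hEK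
    have hu := weight_F' hq0 hEK
    rw [show t + 1 - 2 = t - 1 by ring] at hu
    have wX := L.weight_A hp hq hEK
    rw [add_sub_cancel_right] at wX
    have hAu : A (𝐅 ⋆ 𝐄 ⋆ v) = 𝐅 ⋆ (c.z • A (𝐄 ⋆ v)) := by rw [L.A_F, usmul]
    have hBu : B (𝐅 ⋆ 𝐄 ⋆ v) = c.κ' • A (𝐄 ⋆ v) := by
      rw [L.B_F _ hEK, L.B_E, usmul, (top _ (hB v) (wBv v hK)).2, smul_zero, smul_zero, add_zero]
    have h1 := key _ hu _ hAu
      (by rw [← mem_blockSub hp hq] ; exact (blockSub R hp hq _).smul_of_tower_mem _ (hA _))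
      (by rw [usmul, wX, smul_comm])
    rw [ih, hBu, smul_smul, smul_smul, ← add_smul] at h1
    have h2 : c.x * (ε * qint q t) * c.z + c.κ * c.κ' = ε * qint q (t + 1) := by
      rw [← c.up hp hq]
      ring
    rw [h2] at h1
    rcases smul_eq_zero.mp h1.symm with h3 | h3
    · exact hz ((mul_eq_zero.mp h3).resolve_left (sign_ne_zero hε)) _ (hA _)
    · exact h3
  refine ⟨main, ?_⟩
  obtain ⟨w, h1, h2, h3⟩ := exw v hK
  exact ⟨w, h1, (key v hK w h1 h2 h3).symm.trans main⟩

/-- In the block below, `F E v` is killed and `κ' x E (A v) = ε [t - 1] B v`. -/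
theorem minus (hp : 2 ≤ p) (hq : IsPrimitiveRoot q (2 * p)) (hε : ε * ε = 1)
    (L : Ladder c A B) {ρ : k} {g₁ g₂ : R →ₗ[Ubar p q] R}
    (hA : ∀ v, InBl (p := p) (q := q) (gam q ε (t - 1)) (A v))
    (hB : ∀ v, InBl (p := p) (q := q) (gam q ε (t - 1)) (B v))
    (h : Kron ε (t - 1) ρ g₁ g₂)
    (hz : qint q (t - 1) = 0 → ∀ v : R, InBl (p := p) (q := q) (gam q ε (t - 1)) v → v = 0)
    {v : S} (hv : InBl (p := p) (q := q) (gam q ε t) v)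
    (hK : 𝐊 ⋆ v = (ε * q ^ (t - 1)) • v) :
    A (𝐅 ⋆ 𝐄 ⋆ v) = 0 ∧ B (𝐅 ⋆ 𝐄 ⋆ v) = 0 ∧ 𝐅 ⋆ B v = 0 ∧
      (c.κ' * c.x) • 𝐄 ⋆ A v = (ε * qint q (t - 1)) • B v ∧
      c.κ' • A (𝐄 ⋆ v) = (c.θ * (ε * qint q t)) • B v := by
  have hq0 := q_ne_zero hp hq
  have hδ := q_sub_ne hp hq
  have wBv : ∀ v : S, 𝐊 ⋆ v = (ε * q ^ (t - 1)) • v → 𝐊 ⋆ B v = (ε * q ^ t) • B v := by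
    intro v hK
    have := L.weight_B hp hq hK
    rwa [sub_add_cancel] at this
  have hFB : ∀ v : S, 𝐊 ⋆ v = (ε * q ^ (t - 1)) • v → 𝐅 ⋆ B v = 0 := fun v hK =>
    h.F _ (hB v) (by rw [sub_add_cancel]; exact wBv v hK)
  have hAu : ∀ v : S, 𝐊 ⋆ v = (ε * q ^ (t - 1)) • v → A (𝐅 ⋆ 𝐄 ⋆ v) = 0 := fun v hK => by
    rw [L.A_FE hK, hFB v hK, h.FE _ (hA v) (L.weight_A hp hq hK), smul_zero, smul_zero, add_zero,
      smul_zero]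
  have hFEB : ∀ v : S, 𝐊 ⋆ v = (ε * q ^ (t - 1)) • v →
      𝐅 ⋆ 𝐄 ⋆ B v = -((ε * qint q t) • B v) := fun v hK => by
    have h1 := EF_smul hq0 hδ hε (wBv v hK)
    rw [hFB v hK, act_zero] at h1
    rw [FE_smul hq0 hε (wBv v hK), sub_eq_zero.mp h1.symm, ← sub_smul, ← gam_diff hp hq,
      ← neg_smul, neg_sub]
  have hBu : ∀ v : S, 𝐊 ⋆ v = (ε * q ^ (t - 1)) • v → B (𝐅 ⋆ 𝐄 ⋆ v)
      = (c.κ' * c.x) • 𝐄 ⋆ A v - (ε * qint q (t - 1)) • B v := fun v hK => by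
    rw [L.B_FE hp hq hK, hFEB v hK, ← c.down hp hq]
    module
  have main : B (𝐅 ⋆ 𝐄 ⋆ v) = 0 := by
    refine InBl.nilpotent_induction hp hq hε (P := fun v => B (𝐅 ⋆ 𝐄 ⋆ v) = 0)
      (by rw [act_zero, act_zero, map_zero]) (fun v hK ih => ?_) hv hK
    have hu : 𝐊 ⋆ 𝐅 ⋆ 𝐄 ⋆ v = (ε * q ^ (t - 1)) • 𝐅 ⋆ 𝐄 ⋆ v := by
      have h1 := weight_F' hq0 (weight_E' hq0 hK)
      rwa [add_sub_cancel_right] at h1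
    rw [hBu _ hu, hAu v hK, act_zero, smul_zero, zero_sub, neg_eq_zero] at ih
    rcases smul_eq_zero.mp ih with h3 | h3
    · exact hz ((mul_eq_zero.mp h3).resolve_left (sign_ne_zero hε)) _ (hB _)
    · exact h3
  have h1 := (hBu v hK).symm.trans main
  refine ⟨hAu v hK, main, hFB v hK, sub_eq_zero.mp h1, ?_⟩
  rw [L.A_E v hK, smul_add, smul_smul, sub_eq_zero.mp h1, smul_smul, ← add_smul, ← c.w_mul_y,
    ← c.down hp hq]
  congr 1
  ring

end Ladder

end LadderBlocks

section LadderStep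

variable {S : Type*} [AddCommGroup S] [Module k S] [Module (Ubar p q) S]
  [IsScalarTower k (Ubar p q) S]
variable {R : Type*} [AddCommGroup R] [Module k R] [Module (Ubar p q) R]
  [IsScalarTower k (Ubar p q) R]

/-- The projection to a block. -/
noncomputable def blockProj (hp : 2 ≤ p) (hq : IsPrimitiveRoot q (2 * p)) (γ : k) :
    R →ₗ[Ubar p q] R where
  toFun v := blockIdem hp hq γ ⋆ v
  map_add' := act_add _
  map_smul' x v := blockIdem_comm hp hq γ x v

namespace Ladder

variable {ε : k} {t : ℤ} {c : LadderCoeff p q ε t} {A B : S →ₗ[k] R}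

theorem eq_zero_of_ne_up (hp : 2 ≤ p) (hq : IsPrimitiveRoot q (2 * p)) (hε : ε * ε = 1)
    (L : Ladder c A B) {γ : k} (hA : ∀ v, InBl (p := p) (q := q) γ (A v))
    (hB : ∀ v, InBl (p := p) (q := q) γ (B v)) (hlo : γ ≠ gam q ε (t - 1))
    (hhi : γ ≠ gam q ε (t + 1)) {v : S} (hv : InBl (p := p) (q := q) (gam q ε t) v)
    (hK : 𝐊 ⋆ v = (ε * q ^ (t + 1)) • v) : A v = 0 ∧ B v = 0 := by
  have hq0 := q_ne_zero hp hq
  have hδ := q_sub_ne hp hq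
  have hFK := weight_F' hq0 hK
  rw [show t + 1 - 2 = t - 1 by ring] at hFK
  obtain ⟨h1, h2⟩ := L.eq_zero_of_ne hp hq hε hA hB hlo hhi (hv.act hp hq 𝐅) hFK
  have wA := EF_smul hq0 hδ hε (L.weight_A hp hq hK)
  have wB := EF_smul hq0 hδ hε (L.weight_B hp hq hK)
  rw [L.A_F] at h1
  rw [(smul_eq_zero.mp h1).resolve_left (c.z_ne hp hq), act_zero] at wA
  have hA0 : A v = 0 := by
    refine (hA v).eq_zero_of_cas hp (sub_eq_zero.mp wA.symm) ?_
    rwa [add_sub_cancel_right]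
  rw [L.B_F v hK, hA0, smul_zero, zero_add] at h2
  rw [(smul_eq_zero.mp h2).resolve_left (c.w_ne hp hq), act_zero] at wB
  refine ⟨hA0, (hB v).eq_zero_of_cas hp (sub_eq_zero.mp wB.symm) ?_⟩
  rwa [add_sub_cancel_right]

/-- The component of a ladder in a block. -/
theorem proj (hp : 2 ≤ p) (hq : IsPrimitiveRoot q (2 * p)) (L : Ladder c A B) (γ : k) :
    Ladder c (Algebra.lsmul k k R (blockIdem hp hq γ) ∘ₗ A)
      (Algebra.lsmul k k R (blockIdem hp hq γ) ∘ₗ B) :=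
  L.comp (blockProj hp hq γ) (fun _ => rfl) fun _ => rfl

theorem eq_zero_of_proj [CharZero k] (hp : 2 ≤ p) (hq : IsPrimitiveRoot q (2 * p))
    (hε : ε * ε = 1) (L : Ladder c A B) (hinj : ∀ v, A v = 0 → B v = 0 → v = 0) {v : S}
    (hv : InBl (p := p) (q := q) (gam q ε t) v)
    (hK : 𝐊 ⋆ v = (ε * q ^ (t - 1)) • v ∨ 𝐊 ⋆ v = (ε * q ^ (t + 1)) • v)
    (hlo : blockIdem hp hq (gam q ε (t - 1)) ⋆ A v = 0 ∧
      blockIdem hp hq (gam q ε (t - 1)) ⋆ B v = 0)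
    (hhi : blockIdem hp hq (gam q ε (t + 1)) ⋆ A v = 0 ∧
      blockIdem hp hq (gam q ε (t + 1)) ⋆ B v = 0) : v = 0 := by
  have key : ∀ γ ∈ casValues p q, blockIdem hp hq γ ⋆ A v = 0 ∧ blockIdem hp hq γ ⋆ B v = 0 := by
    intro γ hγ
    by_cases h1 : γ = gam q ε (t - 1)
    · rw [h1]
      exact hlo
    by_cases h2 : γ = gam q ε (t + 1)
    · rw [h2]
      exact hhi
    rcases hK with hK | hK
    · exact (L.proj hp hq γ).eq_zero_of_ne hp hq hε (fun v => inBl_blockIdem hp hq hγ _)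
        (fun v => inBl_blockIdem hp hq hγ _) h1 h2 hv hK
    · exact (L.proj hp hq γ).eq_zero_of_ne_up hp hq hε (fun v => inBl_blockIdem hp hq hγ _)
        (fun v => inBl_blockIdem hp hq hγ _) h1 h2 hv hK
  exact hinj v (eq_zero_of_blockIdem hp hq fun γ hγ => (key γ hγ).1)
    (eq_zero_of_blockIdem hp hq fun γ hγ => (key γ hγ).2)

/-- A block is zero if the two neighbouring blocks at the other end of a ladder are. -/
theorem block_eq_zero [CharZero k] (hp : 2 ≤ p) (hq : IsPrimitiveRoot q (2 * p))
    (hε : ε * ε = 1) (L : Ladder c A B) (hinj : ∀ v, A v = 0 → B v = 0 → v = 0)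
    (hlo : ∀ v : R, InBl (p := p) (q := q) (gam q ε (t - 1)) v → v = 0)
    (hhi : ∀ v : R, InBl (p := p) (q := q) (gam q ε (t + 1)) v → v = 0)
    {v : S} (hv : InBl (p := p) (q := q) (gam q ε t) v)
    (hK : 𝐊 ⋆ v = (ε * q ^ (t - 1)) • v) : v = 0 := by
  have m : ∀ s : ℤ, gam q ε s ∈ casValues p q := gam_mem_casValues hp hq hε
  exact L.eq_zero_of_proj hp hq hε hinj hv (Or.inl hK)
    ⟨hlo _ (inBl_blockIdem hp hq (m _) _), hlo _ (inBl_blockIdem hp hq (m _) _)⟩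
    ⟨hhi _ (inBl_blockIdem hp hq (m _) _), hhi _ (inBl_blockIdem hp hq (m _) _)⟩

end Ladder

theorem E_F_pow_of_FE (hp : 2 ≤ p) (hq : IsPrimitiveRoot q (2 * p)) {ε : k} (hε : ε * ε = 1)
    {t : ℤ} {v : R} (hK : 𝐊 ⋆ v = (ε * q ^ (t - 1 - 1)) • v) (h : 𝐅 ⋆ 𝐄 ⋆ v = 0) :
    𝐄 ⋆ 𝐅 ^ (p - 1) ⋆ v = -((ε * qint q t) • 𝐅 ^ (p - 2) ⋆ v) := by
  have hq0 := q_ne_zero hp hq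
  have hδ := q_sub_ne hp hq
  have h1 := weight_F_pow hq0 hK (p - 2)
  have h2 := FE_smul hq0 hε hK
  rw [h] at h2
  have h3 := EF_smul hq0 hδ hε h1
  rw [← F_succ_act, show p - 2 + 1 = p - 1 by omega, cas_comm_smul hq0 hδ,
    sub_eq_zero.mp h2.symm, usmul, ← sub_smul] at h3
  rw [h3, ← neg_smul]
  congr 1
  have e : t - 1 - 1 - 2 * ((p - 2 : ℕ) : ℤ) - 1 = (t - 1 - 1 + 1) - 2 * ((p - 1 : ℕ) : ℤ) := by
    rw [Nat.cast_sub hp, Nat.cast_sub (show 1 ≤ p by omega)]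
    push_cast
    ring
  rw [e, gam_sub hq0 hδ, Nat.cast_sub (show 1 ≤ p by omega), Nat.cast_one, qint_p_sub hp hq,
    qint_one hp hq, show t - 1 - 1 + 1 - ((p : ℤ) - 1) = t - p by ring, qint_sub_p hp hq]
  ring

theorem Kron.step [CharZero k] (hp : 2 ≤ p) (hq : IsPrimitiveRoot q (2 * p)) {ε : k}
    (hε : ε * ε = 1) {t : ℤ} (ht : qint q t ≠ 0) {c : LadderCoeff p q ε t} {A B : S →ₗ[k] R}
    (L : Ladder c A B) (hinj : ∀ v, A v = 0 → B v = 0 → v = 0) {g₁ g₂ : R →ₗ[Ubar p q] R}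
    {f₁ f₂ : S →ₗ[Ubar p q] S} (hA₁ : ∀ v, A (f₁ v) = g₁ (A v)) (hA₂ : ∀ v, A (f₂ v) = g₂ (A v))
    (hB₁ : ∀ v, B (f₁ v) = g₁ (B v)) (hB₂ : ∀ v, B (f₂ v) = g₂ (B v)) {ρ ρlo ρhi : k}
    (hlo : Kron ε (t - 1) ρlo g₁ g₂) (hhi : Kron ε (t + 1) ρhi g₁ g₂)
    (zlo : qint q (t - 1) = 0 → ∀ v : R, InBl (p := p) (q := q) (gam q ε (t - 1)) v → v = 0)
    (zhi : qint q (t + 1) = 0 → ∀ v : R, InBl (p := p) (q := q) (gam q ε (t + 1)) v → v = 0)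
    (hρlo : qint q (t - 1) ≠ 0 → ρlo * qint q (t - 1) = c.τ * ρ * qint q t)
    (hρhi : qint q (t + 1) ≠ 0 → ρhi * qint q (t + 1) = c.τ * ρ * qint q t) : Kron ε t ρ f₁ f₂ := by
  have hq0 := q_ne_zero hp hq
  have hδ := q_sub_ne hp hq
  have hε0 := sign_ne_zero hε
  have hx := c.x_ne hp hq
  have hy := c.y_ne hp hq
  have hz := c.z_ne hp hq
  have hκ' := c.κ'_ne hp hq hε
  have hτ : c.τ ≠ 0 := sign_ne_zero c.τ_mul_τ
  have m : ∀ s : ℤ, gam q ε s ∈ casValues p q := gam_mem_casValues hp hq hε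
  obtain ⟨Al, hAl⟩ : ∃ f, f = Algebra.lsmul k k R (blockIdem hp hq (gam q ε (t - 1))) ∘ₗ A :=
    ⟨_, rfl⟩
  obtain ⟨Bl, hBl⟩ : ∃ f, f = Algebra.lsmul k k R (blockIdem hp hq (gam q ε (t - 1))) ∘ₗ B :=
    ⟨_, rfl⟩
  obtain ⟨Ah, hAh⟩ : ∃ f, f = Algebra.lsmul k k R (blockIdem hp hq (gam q ε (t + 1))) ∘ₗ A :=
    ⟨_, rfl⟩
  obtain ⟨Bh, hBh⟩ : ∃ f, f = Algebra.lsmul k k R (blockIdem hp hq (gam q ε (t + 1))) ∘ₗ B :=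
    ⟨_, rfl⟩
  have Ll : Ladder c Al Bl := by
    rw [hAl, hBl]
    exact L.proj hp hq _
  have Lh : Ladder c Ah Bh := by
    rw [hAh, hBh]
    exact L.proj hp hq _
  have iAl : ∀ v, InBl (p := p) (q := q) (gam q ε (t - 1)) (Al v) := fun v => by
    rw [hAl]
    exact inBl_blockIdem hp hq (m _) _
  have iBl : ∀ v, InBl (p := p) (q := q) (gam q ε (t - 1)) (Bl v) := fun v => by
    rw [hBl]
    exact inBl_blockIdem hp hq (m _) _
  have iAh : ∀ v, InBl (p := p) (q := q) (gam q ε (t + 1)) (Ah v) := fun v => by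
    rw [hAh]
    exact inBl_blockIdem hp hq (m _) _
  have iBh : ∀ v, InBl (p := p) (q := q) (gam q ε (t + 1)) (Bh v) := fun v => by
    rw [hBh]
    exact inBl_blockIdem hp hq (m _) _
  have J : ∀ v : S, InBl (p := p) (q := q) (gam q ε t) v →
      (𝐊 ⋆ v = (ε * q ^ (t - 1)) • v ∨ 𝐊 ⋆ v = (ε * q ^ (t + 1)) • v) →
      Al v = 0 → Bl v = 0 → Ah v = 0 → Bh v = 0 → v = 0 := by
    intro v hv hK h1 h2 h3 h4
    rw [hAl] at h1
    rw [hBl] at h2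
    rw [hAh] at h3
    rw [hBh] at h4
    exact L.eq_zero_of_proj hp hq hε hinj hv hK ⟨h1, h2⟩ ⟨h3, h4⟩
  have gcomm : ∀ (γ : k) (g : R →ₗ[Ubar p q] R) (v : R),
      blockIdem hp hq γ ⋆ g v = g (blockIdem hp hq γ ⋆ v) := fun γ g v => (map_act g _ v).symm
  have Al₁ : ∀ v, Al (f₁ v) = g₁ (Al v) := fun v => by
    rw [hAl]
    exact (congrArg _ (hA₁ v)).trans (gcomm _ _ _)
  have Al₂ : ∀ v, Al (f₂ v) = g₂ (Al v) := fun v => by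
    rw [hAl]
    exact (congrArg _ (hA₂ v)).trans (gcomm _ _ _)
  have Bl₁ : ∀ v, Bl (f₁ v) = g₁ (Bl v) := fun v => by
    rw [hBl]
    exact (congrArg _ (hB₁ v)).trans (gcomm _ _ _)
  have Bl₂ : ∀ v, Bl (f₂ v) = g₂ (Bl v) := fun v => by
    rw [hBl]
    exact (congrArg _ (hB₂ v)).trans (gcomm _ _ _)
  have Ah₁ : ∀ v, Ah (f₁ v) = g₁ (Ah v) := fun v => by
    rw [hAh]
    exact (congrArg _ (hA₁ v)).trans (gcomm _ _ _)
  have Ah₂ : ∀ v, Ah (f₂ v) = g₂ (Ah v) := fun v => by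
    rw [hAh]
    exact (congrArg _ (hA₂ v)).trans (gcomm _ _ _)
  have Bh₁ : ∀ v, Bh (f₁ v) = g₁ (Bh v) := fun v => by
    rw [hBh]
    exact (congrArg _ (hB₁ v)).trans (gcomm _ _ _)
  have Bh₂ : ∀ v, Bh (f₂ v) = g₂ (Bh v) := fun v => by
    rw [hBh]
    exact (congrArg _ (hB₂ v)).trans (gcomm _ _ _)
  clear hAl hBl hAh hBh
  have wlo : ∀ v : S, 𝐊 ⋆ v = (ε * q ^ (t - 1)) • v → 𝐊 ⋆ Al v = (ε * q ^ (t - 1 - 1)) • Al v :=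
    fun v hK => Ll.weight_A hp hq hK
  have whi : ∀ v : S, 𝐊 ⋆ v = (ε * q ^ (t - 1)) • v → 𝐊 ⋆ Bh v = (ε * q ^ (t + 1 - 1)) • Bh v :=
    fun v hK => by
      have := Lh.weight_B hp hq hK
      rwa [show t - 1 + 1 = t + 1 - 1 by ring] at this
  have plus : ∀ v : S, InBl (p := p) (q := q) (gam q ε t) v → 𝐊 ⋆ v = (ε * q ^ (t - 1)) • v → _ :=
    fun v hv hK => Lh.exists_plus hp hq hε ht iAh iBh hhi zhi hv hK
  have mns : ∀ v : S, InBl (p := p) (q := q) (gam q ε t) v → 𝐊 ⋆ v = (ε * q ^ (t - 1)) • v → _ :=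
    fun v hv hK => Ll.minus hp hq hε iAl iBl hlo zlo hv hK
  have hF1 : ∀ v : R, 𝐅 ^ (p - 2) ⋆ 𝐅 ⋆ v = 𝐅 ^ (p - 1) ⋆ v := fun v => by
    rw [← F_succ_act', show p - 2 + 1 = p - 1 by omega]
  have hxt : c.x * (ε * qint q t) ≠ 0 := mul_ne_zero hx (mul_ne_zero hε0 ht)
  have BhF : ∀ v : S, InBl (p := p) (q := q) (gam q ε t) v → 𝐊 ⋆ v = (ε * q ^ (t - 1)) • v →
      (qint q t) • Bh (𝐅 ^ (p - 1) ⋆ v) = (c.τ * c.y * qint q (t + 1)) • 𝐅 ^ (p - 1) ⋆ Bh v := by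
    intro v hv hK
    obtain ⟨-, w, hw, hw2⟩ := plus v hv hK
    have h1 := congrArg (fun y => 𝐅 ^ (p - 1) ⋆ y) hw2
    simp only [act_add, usmul, act_zero] at h1
    have h2 := c.η_eq
    rw [Lh.B_F_pow v hK, hw, hF1]
    have hxe : c.x * ε ≠ 0 := mul_ne_zero hx hε0
    refine smul_right_injective R hxe ?_
    simp only
    have e1 : (c.x * ε) • (qint q t • (c.η • 𝐅 ^ (p - 1) ⋆ Bh v + c.ν • 𝐅 ^ (p - 1) ⋆ w))
        = (c.η * c.x * ε * qint q t - c.ν * c.κ) • 𝐅 ^ (p - 1) ⋆ Bh v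
          + c.ν • ((c.x * (ε * qint q t)) • 𝐅 ^ (p - 1) ⋆ w + c.κ • 𝐅 ^ (p - 1) ⋆ Bh v) := by
      module
    rw [e1, h1, smul_zero, add_zero, h2]
    module
  refine ⟨fun v hv hK => ?_, fun v hv hK => ?_, fun v hv hK hE hF => ?_, fun v hv hK => ?_⟩
  · have hu : 𝐊 ⋆ 𝐅 ⋆ 𝐄 ⋆ v = (ε * q ^ (t - 1)) • 𝐅 ⋆ 𝐄 ⋆ v := by
      have h1 := weight_F' hq0 (weight_E' hq0 hK)
      rwa [add_sub_cancel_right] at h1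
    obtain ⟨h1, h2, -⟩ := mns v hv hK
    obtain ⟨h3, -⟩ := plus v hv hK
    have hEK := weight_E' hq0 hK
    rw [show t - 1 + 2 = t + 1 by ring] at hEK
    refine J _ ((hv.act hp hq _).act hp hq _) (Or.inl hu) h1 h2 ?_ ?_
    · rw [Lh.A_F, h3, act_zero, smul_zero]
    · rw [Lh.B_F _ hEK, h3, Lh.B_E, usmul, hhi.FE _ (iBh v) (whi v hK), smul_zero, smul_zero,
        smul_zero, add_zero]
  · have hEK := weight_E' hq0 hK
    rw [show t - 1 + 2 = t + 1 by ring] at hEK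
    have hFK := weight_F_pow hq0 hK (p - 1)
    have e : t - 1 - 2 * ((p - 1 : ℕ) : ℤ) = t + 1 - p - p := by
      rw [Nat.cast_sub (by omega)]
      push_cast
      ring
    rw [e, q_zpow_sub_p hp hq, q_zpow_sub_p hp hq, neg_neg] at hFK
    rw [← sub_eq_zero]
    have iv : InBl (p := p) (q := q) (gam q ε t) (f₁ (𝐅 ^ (p - 1) ⋆ v) - ρ • f₂ (𝐄 ⋆ v)) := by
      rw [← mem_blockSub hp hq]
      exact Submodule.sub_mem _ ((hv.act hp hq _).map f₁)
        (Submodule.smul_of_tower_mem _ _ ((hv.act hp hq _).map f₂))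
    have wv : 𝐊 ⋆ (f₁ (𝐅 ^ (p - 1) ⋆ v) - ρ • f₂ (𝐄 ⋆ v))
        = (ε * q ^ (t + 1)) • (f₁ (𝐅 ^ (p - 1) ⋆ v) - ρ • f₂ (𝐄 ⋆ v)) := by
      rw [act_sub, usmul, ← map_act, ← map_act, hFK, hEK, f₁.map_smul_of_tower,
        f₂.map_smul_of_tower, smul_sub, smul_comm ρ]
    obtain ⟨-, -, h3, h4, h5⟩ := mns v hv hK
    obtain ⟨h6, w, hw, hw2⟩ := plus v hv hK
    have rlo := hlo.ratio _ (iAl v) (wlo v hK)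
    have rhi := hhi.ratio _ (iBh v) (whi v hK)
    have key : ∀ X Y : R, (c.κ' * c.x) • X = (ε * qint q (t - 1)) • Y →
        (qint q (t - 1) = 0 → X = 0 ∧ Y = 0) →
        (c.κ' * c.x * ρlo) • X = (ε * c.τ * ρ * qint q t) • Y := by
      intro X Y hXY hZ
      by_cases h0 : qint q (t - 1) = 0
      · rw [(hZ h0).1, (hZ h0).2, smul_zero, smul_zero]
      · calc (c.κ' * c.x * ρlo) • X = ρlo • ((c.κ' * c.x) • X) := by module
          _ = (ε * (ρlo * qint q (t - 1))) • Y := by rw [hXY]; module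
          _ = _ := by rw [hρlo h0]; module
    have g₂s : ∀ (a : k) (v : R), g₂ (a • v) = a • g₂ v := fun a v => g₂.map_smul_of_tower a v
    have g₁s : ∀ (a : k) (v : R), g₁ (a • v) = a • g₁ v := fun a v => g₁.map_smul_of_tower a v
    have hEA := key (g₂ (𝐄 ⋆ Al v)) (g₂ (Bl v))
      (by rw [← g₂s, h4, g₂s])
      (fun h0 => by rw [zlo h0 _ (iAl v), zlo h0 _ (iBl v), act_zero, map_zero]; exact ⟨rfl, rfl⟩)
    refine J _ iv (Or.inr wv) ?_ ?_ ?_ ?_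
    · rw [map_sub, map_smul, Al₁, Al₂, Ll.A_F_pow, g₁s, rlo, c.z_pow]
      have h7 := congrArg g₂ h5
      rw [g₂s, g₂s] at h7
      refine smul_right_injective R hκ' ?_
      simp only [smul_zero]
      calc c.κ' • ((c.τ * c.x * c.θ) • (ρlo • g₂ (𝐄 ⋆ Al v)) - ρ • g₂ (Al (𝐄 ⋆ v)))
          = (c.τ * c.θ) • ((c.κ' * c.x * ρlo) • g₂ (𝐄 ⋆ Al v))
            - ρ • (c.κ' • g₂ (Al (𝐄 ⋆ v))) := by module
        _ = (c.τ * c.τ - 1) • ((ε * ρ * c.θ * qint q t) • g₂ (Bl v)) := by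
          rw [hEA, h7]
          module
        _ = 0 := by rw [c.τ_mul_τ, sub_self, zero_smul]
    · rw [map_sub, map_smul, Bl₁, Bl₂, Ll.B_F_pow v hK, Ll.B_E]
      have h8 : 𝐅 ^ (p - 1) ⋆ Bl v = 0 := by
        rw [← hF1, h3, act_zero]
      rw [h8, smul_zero, zero_add, g₁s, g₂s]
      have h9 := congrArg (fun y => 𝐄 ⋆ y) rlo
      simp only [usmul] at h9
      rw [← map_act, E_F_pow_of_FE hp hq hε (wlo v hK) (hlo.FE _ (iAl v) (wlo v hK)), map_neg,
        g₁s, ← map_act] at h9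
      have h4' := congrArg (fun y => 𝐄 ⋆ y) h4
      simp only [usmul] at h4'
      have hEE := key (g₂ (𝐄 ⋆ 𝐄 ⋆ Al v)) (g₂ (𝐄 ⋆ Bl v))
        (by rw [← g₂s, h4', g₂s])
        (fun h0 => by
          rw [zlo h0 _ (iAl v), zlo h0 _ (iBl v), act_zero, act_zero, map_zero]
          exact ⟨rfl, rfl⟩)
      refine smul_right_injective R (mul_ne_zero hε0 ht) ?_
      simp only [smul_zero]
      calc (ε * qint q t) • (c.ν • g₁ (𝐅 ^ (p - 2) ⋆ Al v) - ρ • c.y • g₂ (𝐄 ⋆ Bl v))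
          = (-c.ν) • (-((ε * qint q t) • g₁ (𝐅 ^ (p - 2) ⋆ Al v)))
            - (ε * qint q t * ρ * c.y) • g₂ (𝐄 ⋆ Bl v) := by module
        _ = (c.τ * c.y) • ((c.κ' * c.x * ρlo) • g₂ (𝐄 ⋆ 𝐄 ⋆ Al v))
            - (ε * qint q t * ρ * c.y) • g₂ (𝐄 ⋆ Bl v) := by
          rw [h9, c.ν_eq]
          module
        _ = (c.τ * c.τ - 1) • ((ε * ρ * c.y * qint q t) • g₂ (𝐄 ⋆ Bl v)) := by
          rw [hEE]
          module
        _ = 0 := by rw [c.τ_mul_τ, sub_self, zero_smul]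
    · rw [map_sub, map_smul, Ah₁, Ah₂, h6, map_zero, smul_zero, sub_zero, Lh.A_F_pow, hw, g₁s,
        ← F_succ_act', Nat.sub_add_cancel (by omega : 1 ≤ p), F_pow_smul, map_zero, smul_zero]
    · by_cases h0 : qint q (t + 1) = 0
      · exact zhi h0 _ (iBh _)
      rw [map_sub, map_smul, Bh₁, Bh₂, Lh.B_E, g₂s]
      have h7 := congrArg g₁ (BhF v hv hK)
      rw [g₁s, g₁s, rhi] at h7
      refine smul_right_injective R ht ?_
      simp only [smul_zero]
      calc qint q t • (g₁ (Bh (𝐅 ^ (p - 1) ⋆ v)) - ρ • c.y • g₂ (𝐄 ⋆ Bh v))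
          = qint q t • g₁ (Bh (𝐅 ^ (p - 1) ⋆ v)) - (qint q t * ρ * c.y) • g₂ (𝐄 ⋆ Bh v) := by
            module
        _ = (c.τ * c.y * (ρhi * qint q (t + 1)) - qint q t * ρ * c.y) • g₂ (𝐄 ⋆ Bh v) := by
            rw [h7]
            module
        _ = (c.τ * c.τ - 1) • ((ρ * c.y * qint q t) • g₂ (𝐄 ⋆ Bh v)) := by
            rw [hρhi h0]
            module
        _ = 0 := by rw [c.τ_mul_τ, sub_self, zero_smul]
  · obtain ⟨-, -, h3, h4, h5⟩ := mns v hv hK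
    obtain ⟨h6, w, hw, hw2⟩ := plus v hv hK
    rw [hE, map_zero, smul_zero] at h5
    have hBl0 : Bl v = 0 := (smul_eq_zero.mp h5.symm).resolve_left
      (mul_ne_zero (c.θ_ne hp hq) (mul_ne_zero hε0 ht))
    rw [hBl0, smul_zero] at h4
    have hEA : 𝐄 ⋆ Al v = 0 := (smul_eq_zero.mp h4).resolve_left (mul_ne_zero hκ' hx)
    have hFA : 𝐅 ^ (p - 1) ⋆ Al v = 0 := by
      have h7 := Ll.A_F_pow (p - 1) v
      rw [hF, map_zero] at h7
      exact (smul_eq_zero.mp h7.symm).resolve_left (pow_ne_zero _ hz)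
    have hAl0 := hlo.inj _ (iAl v) (wlo v hK) hEA hFA
    have hEB : 𝐄 ⋆ Bh v = 0 := by
      have h7 := Lh.B_E v
      rw [hE, map_zero] at h7
      exact (smul_eq_zero.mp h7.symm).resolve_left hy
    have hBh0 : Bh v = 0 := by
      by_cases h0 : qint q (t + 1) = 0
      · exact zhi h0 _ (iBh v)
      have h7 := BhF v hv hK
      rw [hF, map_zero, smul_zero] at h7
      exact hhi.inj _ (iBh v) (whi v hK) hEB
        ((smul_eq_zero.mp h7.symm).resolve_left (mul_ne_zero (mul_ne_zero hτ hy) h0))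
    rw [hBh0, smul_zero, add_zero] at hw2
    have hAh0 : Ah v = 0 := by
      rw [hw, (smul_eq_zero.mp hw2).resolve_left hxt, act_zero]
    exact J v hv (Or.inl hK) hAl0 hBl0 hAh0 hBh0
  · have hFK := weight_F' hq0 hK
    rw [show t + 1 - 2 = t - 1 by ring] at hFK
    have hFv := hv.act hp hq 𝐅
    obtain ⟨-, -, h3, h4, h5⟩ := mns _ hFv hFK
    have wA : 𝐊 ⋆ Al v = (ε * q ^ (t - 1 + 1)) • Al v := by
      have := Ll.weight_A hp hq hK
      rwa [show t + 1 - 1 = t - 1 + 1 by ring] at this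
    have hAl0 : Al (𝐅 ⋆ v) = 0 := by rw [Ll.A_F, hlo.F _ (iAl v) wA, smul_zero]
    have hBl0 : Bl (𝐅 ⋆ v) = 0 := by
      rw [hAl0, act_zero, smul_zero] at h4
      rcases smul_eq_zero.mp h4.symm with h0 | h0
      · exact zlo ((mul_eq_zero.mp h0).resolve_left hε0) _ (iBl _)
      · exact h0
    have hBhv : 𝐅 ⋆ Bh v = 0 := hhi.F _ (iBh v) (Lh.weight_B hp hq hK)
    have wAh := Lh.weight_A hp hq hK
    have hEF : 𝐄 ⋆ 𝐅 ⋆ Ah v = (ε * qint q t) • Ah v := by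
      have h7 := FE_smul hq0 hε wAh
      rw [hhi.FE _ (iAh v) wAh] at h7
      rw [EF_smul hq0 hδ hε wAh, sub_eq_zero.mp h7.symm, ← sub_smul, ← Ladder.gam_diff hp hq]
      congr 3 <;> ring
    have hBhF : Bh (𝐅 ⋆ v) = c.κ' • Ah v := by
      rw [Lh.B_F v hK, hBhv, smul_zero, add_zero]
    have hAh0 : Ah v = 0 := by
      obtain ⟨h6, -⟩ := plus _ hFv hFK
      rw [Lh.A_E _ hFK, Lh.A_F, usmul, hEF, hBhF] at h6
      have h7 : (ε * qint q (t + 1)) • Ah v = 0 := by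
        rw [← c.up hp hq, ← h6]
        module
      rcases smul_eq_zero.mp h7 with h0 | h0
      · exact zhi ((mul_eq_zero.mp h0).resolve_left hε0) _ (iAh _)
      · exact h0
    refine J _ hFv (Or.inl hFK) hAl0 hBl0 ?_ ?_
    · rw [Lh.A_F, hAh0, act_zero, smul_zero]
    · rw [hBhF, hAh0, smul_zero]

end LadderStep

section Shift

theorem qint_succ (hp : 2 ≤ p) (hq : IsPrimitiveRoot q (2 * p)) (t : ℤ) :
    qint q (t + 1) = q * qint q t + q ^ (-t) := by
  have hq0 := q_ne_zero hp hq
  have hδ := q_sub_ne hp hq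
  have hx : q ^ t ≠ 0 := zpow_ne_zero _ hq0
  have hδ' : q ^ 2 - 1 ≠ 0 := fun h => hδ (by field_simp; linear_combination h)
  rw [qint, qint, neg_add, zpow_add₀ hq0, zpow_add₀ hq0, zpow_neg, zpow_neg, zpow_one]
  field_simp
  ring

theorem qint_succ' (hp : 2 ≤ p) (hq : IsPrimitiveRoot q (2 * p)) (t : ℤ) :
    qint q (t + 1) = q⁻¹ * qint q t + q ^ t := by
  have hq0 := q_ne_zero hp hq
  have hδ := q_sub_ne hp hq
  have hx : q ^ t ≠ 0 := zpow_ne_zero _ hq0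
  have hδ' : q ^ 2 - 1 ≠ 0 := fun h => hδ (by field_simp; linear_combination h)
  rw [qint, qint, neg_add, zpow_add₀ hq0, zpow_add₀ hq0, zpow_neg, zpow_neg, zpow_one]
  field_simp
  ring

theorem q_pow_pred (hp : 2 ≤ p) (hq : IsPrimitiveRoot q (2 * p)) : q ^ (p - 1) = -q⁻¹ := by
  have hq0 := q_ne_zero hp hq
  have h := pow_p_eq hp hq
  rw [← Nat.sub_add_cancel (show 1 ≤ p by omega), pow_succ] at h
  field_simp
  exact h

/-- The coefficients of the ladder in a left tensor factor. -/
noncomputable def LadderCoeff.left (hp : 2 ≤ p) (hq : IsPrimitiveRoot q (2 * p)) (ε : k) (t : ℤ) :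
    LadderCoeff p q ε t where
  x := 1
  y := 1
  z := q⁻¹
  w := q
  κ := ε * q ^ t
  κ' := 1
  η := -q⁻¹
  ν := 1
  θ := q
  τ := -1
  θ_eq := Or.inl rfl
  x_mul_z := one_mul _
  w_mul_y := mul_one _
  κ_mul_κ' := mul_one _
  ν_eq := by ring
  z_pow := by rw [inv_pow, q_pow_pred hp hq, inv_neg, inv_inv]; ring
  η_eq := by rw [qint_succ' hp hq]; ring
  τ_mul_τ := by ring

/-- The coefficients of the ladder in a right tensor factor. -/
noncomputable def LadderCoeff.right (hp : 2 ≤ p) (hq : IsPrimitiveRoot q (2 * p)) (ε : k)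
    (t : ℤ) : LadderCoeff p q ε t where
  x := q
  y := q⁻¹
  z := 1
  w := 1
  κ := 1
  κ' := ε * q ^ (-t)
  η := 1
  ν := -(ε * q ^ (-t))
  θ := q⁻¹
  τ := 1
  θ_eq := Or.inr rfl
  x_mul_z := by rw [mul_one, inv_inv]
  w_mul_y := one_mul _
  κ_mul_κ' := by rw [one_mul, inv_zpow, zpow_neg]
  ν_eq := by
    have hq0 := q_ne_zero hp hq
    field_simp
  z_pow := by
    have hq0 := q_ne_zero hp hq
    rw [one_pow, one_mul, mul_inv_cancel₀ hq0]
  η_eq := by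
    have hq0 := q_ne_zero hp hq
    rw [qint_succ hp hq]
    field_simp
    ring
  τ_mul_τ := by ring

section

variable {X X' : Type*} [AddCommGroup X'] [Module k X'] [Module (Ubar p q) X']
  [IsScalarTower k (Ubar p q) X'] [AddCommGroup X] [Module k X] [Module (Ubar p q) X]
  [IsScalarTower k (Ubar p q) X]

/-- The relations of the ladder maps in a left tensor factor. -/
structure LeftShift (α β : X →ₗ[k] X') : Prop where
  A_K : ∀ x, α (𝐊 ⋆ x) = q • 𝐊 ⋆ α x
  B_K : ∀ x, β (𝐊 ⋆ x) = q⁻¹ • 𝐊 ⋆ β x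
  A_E : ∀ x, α (𝐄 ⋆ x) = 𝐄 ⋆ α x + 𝐊 ⋆ β x
  B_E : ∀ x, β (𝐄 ⋆ x) = 𝐄 ⋆ β x
  A_F : ∀ x, α (𝐅 ⋆ x) = q⁻¹ • 𝐅 ⋆ α x
  B_F : ∀ x, β (𝐅 ⋆ x) = α x + q • 𝐅 ⋆ β x

/-- The relations of the ladder maps in a right tensor factor. -/
structure RightShift (α β : X →ₗ[k] X') : Prop where
  A_K : ∀ x, α (𝐊 ⋆ x) = q • 𝐊 ⋆ α x
  B_K : ∀ x, β (𝐊 ⋆ x) = q⁻¹ • 𝐊 ⋆ β x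
  A_E : ∀ x, α (𝐄 ⋆ x) = q • 𝐄 ⋆ α x + β x
  B_E : ∀ x, β (𝐄 ⋆ x) = q⁻¹ • 𝐄 ⋆ β x
  A_F : ∀ x, α (𝐅 ⋆ x) = 𝐅 ⋆ α x
  B_F : ∀ x, β (𝐅 ⋆ x) = 𝐋 ⋆ α x + 𝐅 ⋆ β x

theorem shift_L {α : X →ₗ[k] X'} {a : k} (ha : a ≠ 0) (h : ∀ x, α (𝐊 ⋆ x) = a • 𝐊 ⋆ α x) (x : X) :
    α (𝐋 ⋆ x) = a⁻¹ • 𝐋 ⋆ α x := by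
  have h1 := h (𝐋 ⋆ x)
  rw [KL_smul] at h1
  rw [h1, usmul, LK_smul, inv_smul_smul₀ ha]

variable {α β : X →ₗ[k] X'} (hp : 2 ≤ p) (hq : IsPrimitiveRoot q (2 * p)) {ε : k}

theorem shift_weight {α : X →ₗ[k] X'} {a : k} (ha : a ≠ 0)
    (h : ∀ x, α (𝐊 ⋆ x) = a • 𝐊 ⋆ α x) {ω : k} {x : X} (hx : 𝐊 ⋆ x = ω • x) :
    𝐊 ⋆ α x = (a⁻¹ * ω) • α x := by
  have h1 := h x
  rw [hx, map_smul] at h1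
  rw [mul_smul, h1, inv_smul_smul₀ ha]

theorem LeftShift.ladder (hp : 2 ≤ p) (hq : IsPrimitiveRoot q (2 * p))
    (h : LeftShift (p := p) (q := q) α β) (ε : k) (t : ℤ) :
    Ladder (LadderCoeff.left hp hq ε t) α β := by
  have hq0 := q_ne_zero hp hq
  have hAn : ∀ (n : ℕ) (v : X), α (𝐅 ^ n ⋆ v) = q ^ (-(n : ℤ)) • 𝐅 ^ n ⋆ α v := by
    intro n v
    induction n with
    | zero => simp only [pow_zero, one_act, Nat.cast_zero, neg_zero, zpow_zero, one_smul]
    | succ n ih =>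
      rw [F_succ_act, h.A_F, ih, usmul, smul_smul, ← F_succ_act, Nat.cast_succ, neg_add,
        zpow_add₀ hq0, zpow_neg_one, mul_comm]
  have hBn : ∀ (n : ℕ) (v : X), β (𝐅 ^ (n + 1) ⋆ v)
      = q ^ (n + 1) • 𝐅 ^ (n + 1) ⋆ β v + qint q ((n : ℤ) + 1) • 𝐅 ^ n ⋆ α v := by
    intro n v
    induction n with
    | zero =>
      rw [zero_add, pow_one, pow_zero, one_act, h.B_F, pow_one, Nat.cast_zero, zero_add,
        qint_one hp hq, one_smul, add_comm]
    | succ n ih =>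
      rw [F_succ_act, h.B_F, ih, hAn, act_add, usmul, usmul, ← F_succ_act, ← F_succ_act,
        Nat.cast_succ, qint_succ hp hq ((n : ℤ) + 1)]
      module
  refine ⟨h.A_K, h.B_K, fun v hv => ?_, fun v => ?_, h.A_F, fun v _ => ?_, fun v _ => ?_⟩
  · have h1 := shift_weight (inv_ne_zero hq0) h.B_K hv
    change _ = (1 : k) • 𝐄 ⋆ α v + (ε * q ^ t) • β v
    rw [h.A_E, h1, one_smul, inv_inv, zpow_sub_one₀ hq0]
    congr 2
    field_simp
  · change _ = (1 : k) • 𝐄 ⋆ β v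
    rw [h.B_E, one_smul]
  · change _ = (1 : k) • α v + q • 𝐅 ⋆ β v
    rw [h.B_F, one_smul]
  · change _ = (-q⁻¹) • 𝐅 ^ (p - 1) ⋆ β v + (1 : k) • 𝐅 ^ (p - 2) ⋆ α v
    have h1 := hBn (p - 2) v
    have e : ((p - 2 : ℕ) : ℤ) + 1 = p - 1 := by
      rw [Nat.cast_sub hp]
      push_cast
      ring
    rw [show p - 2 + 1 = p - 1 by omega, q_pow_pred hp hq, e, qint_p_sub hp hq,
      qint_one hp hq] at h1
    exact h1

theorem RightShift.ladder (hp : 2 ≤ p) (hq : IsPrimitiveRoot q (2 * p))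
    (h : RightShift (p := p) (q := q) α β) (hε : ε * ε = 1) (t : ℤ) :
    Ladder (LadderCoeff.right hp hq ε t) α β := by
  have hq0 := q_ne_zero hp hq
  have hε0 := sign_ne_zero hε
  have hεi : ε⁻¹ = ε := inv_eq_of_mul_eq_one_left hε
  have hAn : ∀ (n : ℕ) (v : X), α (𝐅 ^ n ⋆ v) = 𝐅 ^ n ⋆ α v := by
    intro n v
    induction n with
    | zero => simp only [pow_zero, one_act]
    | succ n ih => rw [F_succ_act, h.A_F, ih, ← F_succ_act]
  have hBn : ∀ (n : ℕ) (v : X), 𝐊 ⋆ v = (ε * q ^ (t - 1)) • v → β (𝐅 ^ (n + 1) ⋆ v)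
      = 𝐅 ^ (n + 1) ⋆ β v + (ε * q ^ (-t) * q ^ (n + 2) * qint q ((n : ℤ) + 1)) •
        𝐅 ^ n ⋆ α v := by
    intro n v hv
    have hw : ∀ n : ℕ, 𝐋 ⋆ 𝐅 ^ n ⋆ α v = (ε * q ^ (-t) * q ^ (2 * n + 2)) • 𝐅 ^ n ⋆ α v := by
      intro n
      have h0 := shift_weight hq0 h.A_K hv
      have h1 : 𝐊 ⋆ α v = (ε * q ^ (t - 2)) • α v := by
        rw [h0, zpow_sub₀ hq0, zpow_sub₀ hq0]
        congr 1
        rw [zpow_one, zpow_ofNat]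
        field_simp
      rw [L_smul_of_weight (mul_ne_zero hε0 (zpow_ne_zero _ hq0)) (weight_F_pow hq0 h1 n),
        mul_inv, hεi, mul_assoc, ← zpow_neg, ← zpow_natCast q (2 * n + 2), ← zpow_add₀ hq0]
      congr 3
      push_cast
      ring
    induction n with
    | zero =>
      have h1 := hw 0
      rw [pow_zero, one_act] at h1
      rw [zero_add, pow_one, pow_zero, one_act, h.B_F, Nat.cast_zero, zero_add,
        zero_add, qint_one hp hq, h1, mul_one, add_comm]
    | succ n ih =>
      rw [F_succ_act, h.B_F, ih, hAn, act_add, usmul, ← F_succ_act, ← F_succ_act, hw,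
        Nat.cast_succ, qint_succ' hp hq ((n : ℤ) + 1)]
      have e : q ^ ((n : ℤ) + 1) = q ^ (n + 1) := by
        rw [← Nat.cast_succ, zpow_natCast]
      rw [e]
      have e2 : ε * q ^ (-t) * q ^ (n + 1 + 2) * (q⁻¹ * qint q ((n : ℤ) + 1) + q ^ (n + 1))
          = ε * q ^ (-t) * q ^ (2 * (n + 1) + 2)
            + ε * q ^ (-t) * q ^ (n + 2) * qint q ((n : ℤ) + 1) := by
        field_simp
        ring
      rw [e2]
      module
  refine ⟨h.A_K, h.B_K, fun v _ => ?_, h.B_E, fun v => ?_, fun v hv => ?_, fun v hv => ?_⟩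
  · change _ = q • 𝐄 ⋆ α v + (1 : k) • β v
    rw [h.A_E, one_smul]
  · change _ = (1 : k) • 𝐅 ⋆ α v
    rw [h.A_F, one_smul]
  · change _ = (ε * q ^ (-t)) • α v + (1 : k) • 𝐅 ⋆ β v
    have h0 := shift_weight hq0 h.A_K hv
    have h1 : 𝐊 ⋆ α v = (ε * q ^ t) • α v := by
      rw [h0, zpow_add_one₀ hq0]
      congr 1
      field_simp
    rw [h.B_F, one_smul, L_smul_of_weight (mul_ne_zero hε0 (zpow_ne_zero _ hq0)) h1, mul_inv, hεi,
      zpow_neg]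
  · change _ = (1 : k) • 𝐅 ^ (p - 1) ⋆ β v + (-(ε * q ^ (-t))) • 𝐅 ^ (p - 2) ⋆ α v
    have h1 := hBn (p - 2) v hv
    have e : ((p - 2 : ℕ) : ℤ) + 1 = p - 1 := by
      rw [Nat.cast_sub hp]
      push_cast
      ring
    rw [show p - 2 + 1 = p - 1 by omega, e, qint_p_sub hp hq, qint_one hp hq,
      show p - 2 + 2 = p by omega, pow_p_eq hp hq] at h1
    rw [h1, one_smul]
    congr 2
    ring

end

section

variable {X X' N : UMod p q} {α β : X →ₗ[k] X'} (hp : 2 ≤ p) (hq : IsPrimitiveRoot q (2 * p))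

theorem LeftShift.tensor (N : UMod p q) (h : LeftShift (p := p) (q := q) α β) :
    LeftShift (p := p) (q := q) (tmap hp hq α (LinearMap.id (M := N)))
      (tmap hp hq β (LinearMap.id (M := N))) := by
  have hq0 := q_ne_zero hp hq
  have hL := shift_L hq0 h.A_K
  have hL' := shift_L (inv_ne_zero hq0) h.B_K
  rw [inv_inv] at hL'
  refine ⟨fun v => ?_, fun v => ?_, fun v => ?_, fun v => ?_, fun v => ?_, fun v => ?_⟩
  · induction v using tm_induction hp hq with
    | h m n =>
      simp only [K_tm, tmap_tm, LinearMap.id_apply, h.A_K, map_smul, LinearMap.smul_apply]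
    | hadd v w hv hw =>
      rw [act_add, map_add, map_add, act_add, hv, hw, smul_add]
  · induction v using tm_induction hp hq with
    | h m n =>
      simp only [K_tm, tmap_tm, LinearMap.id_apply, h.B_K, map_smul, LinearMap.smul_apply]
    | hadd v w hv hw =>
      rw [act_add, map_add, map_add, act_add, hv, hw, smul_add]
  · induction v using tm_induction hp hq with
    | h m n =>
      simp only [E_tm, K_tm, tmap_tm, LinearMap.id_apply, h.A_E, map_add, LinearMap.add_apply]
      abel
    | hadd v w hv hw =>
      rw [act_add, map_add, map_add, map_add, act_add, act_add, hv, hw]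
      abel
  · induction v using tm_induction hp hq with
    | h m n =>
      simp only [E_tm, tmap_tm, LinearMap.id_apply, h.B_E, map_add]
    | hadd v w hv hw =>
      rw [act_add, map_add, map_add, act_add, hv, hw]
  · induction v using tm_induction hp hq with
    | h m n =>
      simp only [F_tm, tmap_tm, LinearMap.id_apply, h.A_F, hL, map_add, map_smul,
        LinearMap.smul_apply, smul_add]
    | hadd v w hv hw =>
      rw [act_add, map_add, map_add, act_add, hv, hw, smul_add]
  · induction v using tm_induction hp hq with
    | h m n =>
      simp only [F_tm, tmap_tm, LinearMap.id_apply, h.B_F, hL', map_add, map_smul,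
        LinearMap.smul_apply, LinearMap.add_apply, smul_add]
      abel
    | hadd v w hv hw =>
      rw [act_add, map_add, map_add, map_add, act_add, hv, hw, smul_add]
      abel

theorem RightShift.tensor (N : UMod p q) (h : RightShift (p := p) (q := q) α β) :
    RightShift (p := p) (q := q) (tmap hp hq (LinearMap.id (M := N)) α)
      (tmap hp hq (LinearMap.id (M := N)) β) := by
  refine ⟨fun v => ?_, fun v => ?_, fun v => ?_, fun v => ?_, fun v => ?_, fun v => ?_⟩
  · induction v using tm_induction hp hq with
    | h m n =>
      simp only [K_tm, tmap_tm, LinearMap.id_apply, h.A_K, map_smul]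
    | hadd v w hv hw =>
      rw [act_add, map_add, map_add, act_add, hv, hw, smul_add]
  · induction v using tm_induction hp hq with
    | h m n =>
      simp only [K_tm, tmap_tm, LinearMap.id_apply, h.B_K, map_smul]
    | hadd v w hv hw =>
      rw [act_add, map_add, map_add, act_add, hv, hw, smul_add]
  · induction v using tm_induction hp hq with
    | h m n =>
      simp only [E_tm, tmap_tm, LinearMap.id_apply, h.A_E, h.A_K, map_add, map_smul, smul_add]
      abel
    | hadd v w hv hw =>
      rw [act_add, map_add, map_add, map_add, act_add, hv, hw, smul_add]
      abel
  · induction v using tm_induction hp hq with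
    | h m n =>
      simp only [E_tm, tmap_tm, LinearMap.id_apply, h.B_E, h.B_K, map_add, map_smul, smul_add]
    | hadd v w hv hw =>
      rw [act_add, map_add, map_add, act_add, hv, hw, smul_add]
  · induction v using tm_induction hp hq with
    | h m n =>
      simp only [F_tm, tmap_tm, LinearMap.id_apply, h.A_F, map_add]
    | hadd v w hv hw =>
      rw [act_add, map_add, map_add, act_add, hv, hw]
  · induction v using tm_induction hp hq with
    | h m n =>
      simp only [F_tm, L_tm, tmap_tm, LinearMap.id_apply, h.B_F, map_add]
      abel
    | hadd v w hv hw =>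
      rw [act_add, map_add, map_add, map_add, act_add, act_add, hv, hw]
      abel

end

end Shift

section SimpleShift

variable {ε : k} (hp : 2 ≤ p) (hq : IsPrimitiveRoot q (2 * p)) (hε : ε * ε = 1)
  {r : ℕ} (hr : r + 1 ≤ p)

/-- The map `a_n ↦ f n a_n` from the simple module of dimension `r + 1` to that of dimension
`r`. -/
noncomputable def XMod.shiftA (f : ℕ → k) :
    XMod hp hq hε hr →ₗ[k] XMod hp hq hε (Nat.le_of_succ_le hr) :=
  XMod.constr hp hq hε hr fun n => f n • XMod.bas hp hq hε (Nat.le_of_succ_le hr) n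

/-- The map `a_n ↦ f n a_{n-1}` from the simple module of dimension `r + 1` to that of dimension
`r`. -/
noncomputable def XMod.shiftB (f : ℕ → k) :
    XMod hp hq hε hr →ₗ[k] XMod hp hq hε (Nat.le_of_succ_le hr) :=
  XMod.constr hp hq hε hr fun n => f n • XMod.bas hp hq hε (Nat.le_of_succ_le hr) (n - 1)

theorem XMod.shiftA_bas (f : ℕ → k) (i : ℕ) :
    XMod.shiftA hp hq hε hr f (XMod.bas hp hq hε hr i)
      = f i • XMod.bas hp hq hε (Nat.le_of_succ_le hr) i := by
  rcases Nat.lt_or_ge i (r + 1) with h | h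
  · exact XMod.constr_bas hp hq hε hr _ h
  · rw [XMod.bas_of_le hp hq hε hr h, XMod.bas_of_le hp hq hε _ (show r ≤ i by omega), smul_zero,
      map_zero]

theorem XMod.shiftB_bas (f : ℕ → k) (i : ℕ) :
    XMod.shiftB hp hq hε hr f (XMod.bas hp hq hε hr i)
      = f i • XMod.bas hp hq hε (Nat.le_of_succ_le hr) (i - 1) := by
  rcases Nat.lt_or_ge i (r + 1) with h | h
  · exact XMod.constr_bas hp hq hε hr _ h
  · rw [XMod.bas_of_le hp hq hε hr h, XMod.bas_of_le hp hq hε _ (show r ≤ i - 1 by omega),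
      smul_zero, map_zero]

theorem XMod.exists_retract (h0 : 0 < r) {f g : ℕ → k} (hf : ∀ n, f n ≠ 0) (hg₀ : g 0 = 0)
    (hg : g r ≠ 0) :
    ∃ α' β' : XMod hp hq hε (Nat.le_of_succ_le hr) →ₗ[k] XMod hp hq hε hr, ∀ x,
      α' (XMod.shiftA hp hq hε hr f x) + β' (XMod.shiftB hp hq hε hr g x) = x := by
  let α' : XMod hp hq hε (Nat.le_of_succ_le hr) →ₗ[k] XMod hp hq hε hr :=
    XMod.constr hp hq hε (Nat.le_of_succ_le hr) fun n => (f n)⁻¹ • XMod.bas hp hq hε hr n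
  let β' : XMod hp hq hε (Nat.le_of_succ_le hr) →ₗ[k] XMod hp hq hε hr :=
    XMod.constr hp hq hε (Nat.le_of_succ_le hr) fun n =>
      if n + 1 = r then (g r)⁻¹ • XMod.bas hp hq hε hr r else 0
  refine ⟨α', β', XMod.hom_ext hp hq hε hr
    (f := α' ∘ₗ XMod.shiftA hp hq hε hr f + β' ∘ₗ XMod.shiftB hp hq hε hr g)
    (g := LinearMap.id) fun i hi => ?_⟩
  change α' (XMod.shiftA hp hq hε hr f _) + β' (XMod.shiftB hp hq hε hr g _) = _
  rw [XMod.shiftA_bas, XMod.shiftB_bas, map_smul, map_smul]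
  have hβ : β' (XMod.bas hp hq hε (Nat.le_of_succ_le hr) (i - 1))
      = if i - 1 + 1 = r then (g r)⁻¹ • XMod.bas hp hq hε hr r else 0 :=
    XMod.constr_bas hp hq hε _ _ (by omega)
  rw [hβ]
  rcases Nat.lt_or_ge i r with h | h
  · have hα : α' (XMod.bas hp hq hε (Nat.le_of_succ_le hr) i)
        = (f i)⁻¹ • XMod.bas hp hq hε hr i := XMod.constr_bas hp hq hε _ _ h
    rw [hα, smul_inv_smul₀ (hf i)]
    split_ifs with h1
    · obtain rfl : i = 0 := by omega
      rw [hg₀, zero_smul, add_zero]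
      rfl
    · rw [smul_zero, add_zero]
      rfl
  · obtain rfl : i = r := by omega
    rw [XMod.bas_of_le hp hq hε _ le_rfl, map_zero, smul_zero, zero_add, if_pos (by omega),
      smul_inv_smul₀ hg]
    rfl

theorem XMod.exists_leftShift (h0 : 0 < r) :
    ∃ α β : XMod hp hq hε hr →ₗ[k] XMod hp hq hε (Nat.le_of_succ_le hr),
      LeftShift (p := p) (q := q) α β ∧
      ∃ α' β' : XMod hp hq hε (Nat.le_of_succ_le hr) →ₗ[k] XMod hp hq hε hr, ∀ x,
        α' (α x) + β' (β x) = x := by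
  have hq0 := q_ne_zero hp hq
  have ext := fun (f g : XMod hp hq hε hr →ₗ[k] XMod hp hq hε (Nat.le_of_succ_le hr)) =>
    XMod.hom_ext hp hq hε hr (f := f) (g := g)
  let U : Ubar p q → Module.End k (XMod hp hq hε hr) := Algebra.lsmul k k _
  let U' : Ubar p q → Module.End k (XMod hp hq hε (Nat.le_of_succ_le hr)) := Algebra.lsmul k k _
  obtain ⟨α, hα⟩ : ∃ α, α = XMod.shiftA hp hq hε hr fun n => q ^ (-(n : ℤ)) := ⟨_, rfl⟩
  obtain ⟨β, hβ⟩ : ∃ β, β = XMod.shiftB hp hq hε hr fun n => qint q n := ⟨_, rfl⟩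
  have hαb : ∀ i : ℕ, α (XMod.bas hp hq hε hr i)
      = q ^ (-(i : ℤ)) • XMod.bas hp hq hε (Nat.le_of_succ_le hr) i := fun i => by
    rw [hα]
    exact XMod.shiftA_bas hp hq hε hr _ i
  have hβb : ∀ i : ℕ, β (XMod.bas hp hq hε hr i)
      = qint q i • XMod.bas hp hq hε (Nat.le_of_succ_le hr) (i - 1) := fun i => by
    rw [hβ]
    exact XMod.shiftB_bas hp hq hε hr _ i
  refine ⟨α, β, ⟨ext (α ∘ₗ U 𝐊) (q • U' 𝐊 ∘ₗ α) fun i _ => ?_,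
    ext (β ∘ₗ U 𝐊) (q⁻¹ • U' 𝐊 ∘ₗ β) fun i _ => ?_,
    ext (α ∘ₗ U 𝐄) (U' 𝐄 ∘ₗ α + U' 𝐊 ∘ₗ β) fun i _ => ?_,
    ext (β ∘ₗ U 𝐄) (U' 𝐄 ∘ₗ β) fun i _ => ?_,
    ext (α ∘ₗ U 𝐅) (q⁻¹ • U' 𝐅 ∘ₗ α) fun i _ => ?_,
    ext (β ∘ₗ U 𝐅) (α + q • U' 𝐅 ∘ₗ β) fun i hi => ?_⟩, ?_⟩
  · change α (𝐊 ⋆ XMod.bas hp hq hε hr i) = q • 𝐊 ⋆ α (XMod.bas hp hq hε hr i)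
    rw [XMod.K_bas, map_smul, hαb, usmul, XMod.K_bas, smul_smul, smul_smul, smul_smul, wt, wt]
    congr 1
    rw [Nat.cast_succ, show (r : ℤ) + 1 - 1 - 2 * i = r - 1 - 2 * i + 1 by ring, zpow_add_one₀ hq0]
    ring
  · change β (𝐊 ⋆ XMod.bas hp hq hε hr i) = q⁻¹ • 𝐊 ⋆ β (XMod.bas hp hq hε hr i)
    rw [XMod.K_bas, map_smul, hβb, usmul, XMod.K_bas, smul_smul, smul_smul, smul_smul, wt, wt]
    rcases i with _ | i
    · simp only [Nat.cast_zero, qint_zero, mul_zero, zero_mul, zero_smul]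
    · congr 1
      rw [Nat.add_sub_cancel, Nat.cast_succ, Nat.cast_succ,
        show (r : ℤ) - 1 - 2 * i = r + 1 - 1 - 2 * (i + 1) + 1 by ring, zpow_add_one₀ hq0]
      field_simp
  · change α (𝐄 ⋆ XMod.bas hp hq hε hr i)
      = 𝐄 ⋆ α (XMod.bas hp hq hε hr i) + 𝐊 ⋆ β (XMod.bas hp hq hε hr i)
    rw [XMod.E_bas, map_smul, hαb, hαb, hβb, usmul, usmul, XMod.E_bas, XMod.K_bas, smul_smul,
      smul_smul, smul_smul, ← add_smul, coeffE, coeffE, wt]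
    rcases i with _ | i
    · rw [Nat.cast_zero, qint_zero, zero_mul, zero_mul, mul_zero, mul_zero, zero_mul, zero_mul,
        zero_add]
    · congr 1
      rw [Nat.add_sub_cancel, Nat.cast_succ, Nat.cast_succ,
        show (r : ℤ) + 1 - (i + 1) = r - (i + 1) + 1 by ring,
        qint_succ' hp hq ((r : ℤ) - (i + 1)),
        show (r : ℤ) - 1 - 2 * i = -(i + 1) + (r - (i + 1) + 1) by ring, zpow_add₀ hq0,
        zpow_add_one₀ hq0, neg_add, zpow_add₀ hq0, zpow_neg_one]
      field_simp
  · change β (𝐄 ⋆ XMod.bas hp hq hε hr i) = 𝐄 ⋆ β (XMod.bas hp hq hε hr i)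
    rw [XMod.E_bas, map_smul, hβb, hβb, usmul, XMod.E_bas, smul_smul, smul_smul, coeffE, coeffE]
    congr 1
    rcases i with _ | i
    · simp only [Nat.cast_zero, qint_zero, mul_zero, zero_mul]
    · rw [Nat.add_sub_cancel, Nat.cast_succ, Nat.cast_succ,
        show (r : ℤ) + 1 - (i + 1) = r - i by ring]
      ring
  · change α (𝐅 ⋆ XMod.bas hp hq hε hr i) = q⁻¹ • 𝐅 ⋆ α (XMod.bas hp hq hε hr i)
    rw [XMod.F_bas, hαb, hαb, usmul, XMod.F_bas, smul_smul, Nat.cast_succ, neg_add,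
      zpow_add₀ hq0, zpow_neg_one, mul_comm]
  · change β (𝐅 ⋆ XMod.bas hp hq hε hr i)
      = α (XMod.bas hp hq hε hr i) + q • 𝐅 ⋆ β (XMod.bas hp hq hε hr i)
    rw [XMod.F_bas, hαb, hβb, hβb, usmul, XMod.F_bas, smul_smul, Nat.add_sub_cancel, Nat.cast_succ,
      qint_succ hp hq]
    rcases i with _ | i
    · rw [Nat.cast_zero, qint_zero, mul_zero, zero_smul, zero_add, add_zero]
    · rw [Nat.add_sub_cancel, add_smul, add_comm]
  · rw [hα, hβ]
    exact XMod.exists_retract hp hq hε hr h0 (fun n => zpow_ne_zero _ hq0) qint_zero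
      (qint_ne_zero hp hq (by omega) (by omega))

theorem XMod.exists_rightShift (h0 : 0 < r) :
    ∃ α β : XMod hp hq hε hr →ₗ[k] XMod hp hq hε (Nat.le_of_succ_le hr),
      RightShift (p := p) (q := q) α β ∧
      ∃ α' β' : XMod hp hq hε (Nat.le_of_succ_le hr) →ₗ[k] XMod hp hq hε hr, ∀ x,
        α' (α x) + β' (β x) = x := by
  have hq0 := q_ne_zero hp hq
  have hε0 := sign_ne_zero hε
  have hεi : ε⁻¹ = ε := inv_eq_of_mul_eq_one_left hε
  have ext := fun (f g : XMod hp hq hε hr →ₗ[k] XMod hp hq hε (Nat.le_of_succ_le hr)) =>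
    XMod.hom_ext hp hq hε hr (f := f) (g := g)
  let U : Ubar p q → Module.End k (XMod hp hq hε hr) := Algebra.lsmul k k _
  let U' : Ubar p q → Module.End k (XMod hp hq hε (Nat.le_of_succ_le hr)) := Algebra.lsmul k k _
  obtain ⟨α, hα⟩ : ∃ α, α = XMod.shiftA hp hq hε hr fun _ => 1 := ⟨_, rfl⟩
  obtain ⟨β, hβ⟩ : ∃ β, β = XMod.shiftB hp hq hε hr
    fun n => ε * q ^ ((n : ℤ) - r) * qint q n := ⟨_, rfl⟩
  have hαb : ∀ i, α (XMod.bas hp hq hε hr i)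
      = XMod.bas hp hq hε (Nat.le_of_succ_le hr) i := fun i => by
    rw [hα]
    exact (XMod.shiftA_bas hp hq hε hr _ i).trans (one_smul _ _)
  have hβb : ∀ i : ℕ, β (XMod.bas hp hq hε hr i) = (ε * q ^ ((i : ℤ) - r) * qint q i) •
      XMod.bas hp hq hε (Nat.le_of_succ_le hr) (i - 1) := fun i => by
    rw [hβ]
    exact XMod.shiftB_bas hp hq hε hr _ i
  refine ⟨α, β, ⟨ext (α ∘ₗ U 𝐊) (q • U' 𝐊 ∘ₗ α) fun i _ => ?_,
    ext (β ∘ₗ U 𝐊) (q⁻¹ • U' 𝐊 ∘ₗ β) fun i _ => ?_,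
    ext (α ∘ₗ U 𝐄) (q • U' 𝐄 ∘ₗ α + β) fun i _ => ?_,
    ext (β ∘ₗ U 𝐄) (q⁻¹ • U' 𝐄 ∘ₗ β) fun i _ => ?_,
    ext (α ∘ₗ U 𝐅) (U' 𝐅 ∘ₗ α) fun i _ => ?_,
    ext (β ∘ₗ U 𝐅) (U' 𝐋 ∘ₗ α + U' 𝐅 ∘ₗ β) fun i hi => ?_⟩, ?_⟩
  · change α (𝐊 ⋆ XMod.bas hp hq hε hr i) = q • 𝐊 ⋆ α (XMod.bas hp hq hε hr i)
    rw [XMod.K_bas, map_smul, hαb, XMod.K_bas, smul_smul, wt, wt]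
    congr 1
    rw [Nat.cast_succ, show (r : ℤ) + 1 - 1 - 2 * i = r - 1 - 2 * i + 1 by ring, zpow_add_one₀ hq0]
    ring
  · change β (𝐊 ⋆ XMod.bas hp hq hε hr i) = q⁻¹ • 𝐊 ⋆ β (XMod.bas hp hq hε hr i)
    rw [XMod.K_bas, map_smul, hβb, usmul, XMod.K_bas, smul_smul, smul_smul, smul_smul, wt, wt]
    rcases i with _ | i
    · simp only [Nat.cast_zero, qint_zero, mul_zero, zero_mul, zero_smul]
    · congr 1
      rw [Nat.add_sub_cancel, Nat.cast_succ, Nat.cast_succ,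
        show (r : ℤ) - 1 - 2 * i = r + 1 - 1 - 2 * (i + 1) + 1 by ring, zpow_add_one₀ hq0]
      field_simp
  · change α (𝐄 ⋆ XMod.bas hp hq hε hr i)
      = q • 𝐄 ⋆ α (XMod.bas hp hq hε hr i) + β (XMod.bas hp hq hε hr i)
    rw [XMod.E_bas, map_smul, hαb, hαb, hβb, XMod.E_bas, smul_smul, ← add_smul, coeffE, coeffE]
    congr 1
    rw [Nat.cast_succ, show (r : ℤ) + 1 - i = r - i + 1 by ring, qint_succ hp hq, neg_sub]
    ring
  · change β (𝐄 ⋆ XMod.bas hp hq hε hr i) = q⁻¹ • 𝐄 ⋆ β (XMod.bas hp hq hε hr i)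
    rw [XMod.E_bas, map_smul, hβb, hβb, usmul, XMod.E_bas, smul_smul, smul_smul, smul_smul, coeffE,
      coeffE]
    congr 1
    rcases i with _ | i
    · simp only [Nat.cast_zero, qint_zero, mul_zero, zero_mul]
    · rw [Nat.add_sub_cancel, Nat.cast_succ, Nat.cast_succ,
        show (r : ℤ) + 1 - (i + 1) = r - i by ring,
        show (i : ℤ) + 1 - r = i - r + 1 by ring, zpow_add_one₀ hq0]
      field_simp
  · change α (𝐅 ⋆ XMod.bas hp hq hε hr i) = 𝐅 ⋆ α (XMod.bas hp hq hε hr i)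
    rw [XMod.F_bas, hαb, hαb, XMod.F_bas]
  · change β (𝐅 ⋆ XMod.bas hp hq hε hr i)
      = 𝐋 ⋆ α (XMod.bas hp hq hε hr i) + 𝐅 ⋆ β (XMod.bas hp hq hε hr i)
    rw [XMod.F_bas, hαb, hβb, hβb, usmul, XMod.F_bas, XMod.L_bas, Nat.add_sub_cancel,
      Nat.cast_succ, qint_succ' hp hq, wt, mul_inv, hεi, ← zpow_neg,
      show -((r : ℤ) - 1 - 2 * i) = i - r + 1 + i by ring, zpow_add₀ hq0,
      show (i : ℤ) + 1 - r = i - r + 1 by ring, zpow_add_one₀ hq0]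
    rcases i with _ | i
    · rw [Nat.cast_zero, qint_zero, mul_zero, mul_zero, zero_smul, zero_add, add_zero]
      congr 1
      ring
    · rw [Nat.add_sub_cancel, ← add_smul]
      congr 1
      field_simp
      ring
  · rw [hα, hβ]
    refine XMod.exists_retract hp hq hε hr h0 (fun n => one_ne_zero) ?_ ?_
    · rw [Nat.cast_zero, qint_zero, mul_zero]
    · exact mul_ne_zero (mul_ne_zero hε0 (zpow_ne_zero _ hq0))
        (qint_ne_zero hp hq (by omega) (by omega))

theorem tmap_jointly_injective_left {X X' N : UMod p q} {α β : X →ₗ[k] X'} {α' β' : X' →ₗ[k] X}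
    (h : ∀ x, α' (α x) + β' (β x) = x) (v : X.tensor hp hq N)
    (hA : tmap hp hq α (LinearMap.id (M := N)) v = 0)
    (hB : tmap hp hq β (LinearMap.id (M := N)) v = 0) : v = 0 := by
  have key := tm_ext hp hq (M := X) (N := N)
    (f := tmap hp hq α' LinearMap.id ∘ₗ tmap hp hq α LinearMap.id
      + tmap hp hq β' LinearMap.id ∘ₗ tmap hp hq β LinearMap.id) (g := LinearMap.id)
    (fun m n => by
      simp only [LinearMap.add_apply, LinearMap.comp_apply, tmap_tm, LinearMap.id_apply]
      rw [← LinearMap.add_apply, ← map_add, h]) v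
  rw [LinearMap.add_apply, LinearMap.comp_apply, LinearMap.comp_apply, hA, hB, map_zero, map_zero,
    add_zero] at key
  exact key.symm

theorem tmap_jointly_injective_right {X X' N : UMod p q} {α β : X →ₗ[k] X'}
    {α' β' : X' →ₗ[k] X} (h : ∀ x, α' (α x) + β' (β x) = x) (v : N.tensor hp hq X)
    (hA : tmap hp hq (LinearMap.id (M := N)) α v = 0)
    (hB : tmap hp hq (LinearMap.id (M := N)) β v = 0) : v = 0 := by
  have key := tm_ext hp hq (M := N) (N := X)
    (f := tmap hp hq LinearMap.id α' ∘ₗ tmap hp hq LinearMap.id α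
      + tmap hp hq LinearMap.id β' ∘ₗ tmap hp hq LinearMap.id β) (g := LinearMap.id)
    (fun m n => by
      simp only [LinearMap.add_apply, LinearMap.comp_apply, tmap_tm, LinearMap.id_apply]
      rw [← map_add, h]) v
  rw [LinearMap.add_apply, LinearMap.comp_apply, LinearMap.comp_apply, hA, hB, map_zero, map_zero,
    add_zero] at key
  exact key.symm

end SimpleShift

section KronRange

theorem finrank_wtSub_block_eq_zero (hp : 2 ≤ p) (hq : IsPrimitiveRoot q (2 * p)) {S : UMod p q}
    {γ ω : k} (h : ∀ v : S, InBl (p := p) (q := q) γ v → 𝐊 ⋆ v = ω • v → v = 0) :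
    Module.finrank k (wtSub p q (S.block hp hq γ) ω) = 0 := by
  have : Subsingleton (wtSub p q (S.block hp hq γ) ω) := subsingleton_of_forall_eq 0 fun v =>
    Subtype.ext (Subtype.ext (h _ v.1.2 (by
      have h1 := congrArg Subtype.val v.2
      exact h1)))
  exact Module.finrank_zero_of_subsingleton

theorem eq_zero_of_finrank_block (hp : 2 ≤ p) (hq : IsPrimitiveRoot q (2 * p)) {S : UMod p q}
    {γ : k} (h : Module.finrank k (S.block hp hq γ) = 0) (v : S)
    (hv : InBl (p := p) (q := q) γ v) : v = 0 := by
  have := Module.finrank_zero_iff.mp h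
  have h1 : (⟨v, hv⟩ : S.block hp hq γ) = 0 := this.elim _ _
  exact congrArg Subtype.val h1

/-- A block is zero if its two possible highest weight spaces are. -/
theorem block_eq_zero_of_weights [CharZero k] (hp : 2 ≤ p) (hq : IsPrimitiveRoot q (2 * p))
    {S : UMod p q} {ε : k} (hε : ε * ε = 1) {a : ℕ} (ha : a ≤ p)
    (h : ∀ v : S, InBl (p := p) (q := q) (gam q ε a) v →
      𝐊 ⋆ v = (ε * q ^ ((a : ℤ) - 1)) • v → v = 0)
    (h' : ∀ v : S, InBl (p := p) (q := q) (gam q (-ε) ((p : ℤ) - a)) v →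
      𝐊 ⋆ v = (-ε * q ^ ((p : ℤ) - a - 1)) • v → v = 0) (v : S)
    (hv : InBl (p := p) (q := q) (gam q ε a) v) : v = 0 := by
  refine eq_zero_of_finrank_block hp hq ?_ v hv
  have hbl := UMod.block.inBl hp hq (gam q ε a) (M := S)
  rw [gam_swap hp hq] at h'
  rcases Nat.eq_zero_or_pos a with rfl | ha0
  · have e : gam q (-ε) (p : ℤ) = gam q ε (0 : ℕ) := by
      have := gam_swap hp hq ε 0
      rwa [sub_zero] at this
    have hbl' : ∀ v : S.block hp hq (gam q ε (0 : ℕ)),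
        InBl (p := p) (q := q) (gam q (-ε) (p : ℤ)) v := by
      rw [e]
      exact hbl
    rw [Nat.cast_zero, sub_zero] at h'
    rw [finrank_top hp hq (sign_neg hε) hbl',
      finrank_wtSub_block_eq_zero hp hq (γ := gam q ε (0 : ℕ)) (by rwa [Nat.cast_zero]), mul_zero]
  rcases Nat.eq_or_lt_of_le ha with rfl | hap
  · rw [finrank_top hp hq hε hbl, finrank_wtSub_block_eq_zero hp hq h, mul_zero]
  · rw [finrank_block hp hq hε ⟨ha0, hap⟩ hbl, finrank_wtSub_block_eq_zero hp hq h,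
      finrank_wtSub_block_eq_zero hp hq (by rwa [Nat.cast_sub ha]), mul_zero, mul_zero,
      add_zero]

theorem Kron.of_zero {R : Type*} [AddCommGroup R] [Module k R] [Module (Ubar p q) R]
    [IsScalarTower k (Ubar p q) R] {ε : k} {t : ℤ}
    (h : ∀ v : R, InBl (p := p) (q := q) (gam q ε t) v → v = 0) (ρ : k)
    (g₁ g₂ : R →ₗ[Ubar p q] R) : Kron ε t ρ g₁ g₂ :=
  ⟨fun v hv _ => by rw [h v hv, act_zero, act_zero],
    fun v hv _ => by rw [h v hv, act_zero, act_zero, map_zero, map_zero, smul_zero],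
    fun v hv _ _ _ => h v hv, fun v hv _ => by rw [h v hv, act_zero]⟩

/-- The blocks of the product of a simple module of dimension `r` with a module on which the
Casimir element acts by `γ(s')`. -/
def KronRange (R : UMod p q) (ε ρ τ : k) (s' r : ℕ) (g₁ g₂ : R →ₗ[Ubar p q] R) : Prop :=
  ∀ t : ℕ, t ≤ p → (t + r + s') % 2 = 1 → r + 1 ≤ t + s' → t + r + s' + 1 ≤ 2 * p →
    (s' + 1 ≤ t + r ∧ t + 1 ≤ r + s' →
      Kron ε t (ρ * τ ^ (r - 1) * qint q s' / qint q t) g₁ g₂) ∧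
    (¬(s' + 1 ≤ t + r ∧ t + 1 ≤ r + s') →
      ∀ v : R, InBl (p := p) (q := q) (gam q ε t) v → v = 0)

theorem KronRange.step [CharZero k] (hp : 2 ≤ p) (hq : IsPrimitiveRoot q (2 * p))
    {S R : UMod p q} {A B : S →ₗ[k] R} {τ : k} (hτ : τ * τ = 1)
    (hL : ∀ (ε : k) (t : ℤ), ε * ε = 1 → ∃ c : LadderCoeff p q ε t, c.τ = τ ∧ Ladder c A B)
    (hinj : ∀ v, A v = 0 → B v = 0 → v = 0) {g₁ g₂ : R →ₗ[Ubar p q] R}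
    {f₁ f₂ : S →ₗ[Ubar p q] S} (hA₁ : ∀ v, A (f₁ v) = g₁ (A v)) (hA₂ : ∀ v, A (f₂ v) = g₂ (A v))
    (hB₁ : ∀ v, B (f₁ v) = g₁ (B v)) (hB₂ : ∀ v, B (f₂ v) = g₂ (B v)) {ε ρ : k}
    (hε : ε * ε = 1) {s' r : ℕ} (hr : 1 ≤ r) (h : KronRange R ε ρ τ s' r g₁ g₂) :
    KronRange S ε ρ τ s' (r + 1) f₁ f₂ := by
  intro t htp hodd h1 h2
  have val : ∀ u : ℕ, u ≤ p → (u + r + s') % 2 = 1 → r + 1 ≤ u + s' → u + r + s' + 1 ≤ 2 * p →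
      Kron ε u (ρ * τ ^ (r - 1) * qint q s' / qint q u) g₁ g₂ := by
    intro u hu1 hu2 hu3 hu4
    by_cases hc : s' + 1 ≤ u + r ∧ u + 1 ≤ r + s'
    · exact (h u hu1 hu2 hu3 hu4).1 hc
    · exact Kron.of_zero ((h u hu1 hu2 hu3 hu4).2 hc) _ _ _
  constructor
  · rintro ⟨h3, h4⟩
    obtain ⟨c, hc, L⟩ := hL ε t hε
    have ht0 : 0 < t := by omega
    have htp' : t + 1 ≤ p := by omega
    have hqt : qint q t ≠ 0 := qint_ne_zero hp hq (by omega) (by omega)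
    have hlo := val (t - 1) (by omega) (by omega) (by omega) (by omega)
    have hhi := val (t + 1) (by omega) (by omega) (by omega) (by omega)
    have zlo := (h (t - 1) (by omega) (by omega) (by omega) (by omega)).2
    have zhi := (h (t + 1) (by omega) (by omega) (by omega) (by omega)).2
    have e1 : ((t - 1 : ℕ) : ℤ) = (t : ℤ) - 1 := by omega
    have e2 : ((t + 1 : ℕ) : ℤ) = (t : ℤ) + 1 := by omega
    rw [e1] at hlo zlo
    rw [e2] at hhi zhi
    have hpow : τ * τ ^ r = τ ^ (r - 1) := by
      obtain ⟨r, rfl⟩ : ∃ r', r = r' + 1 := ⟨r - 1, by omega⟩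
      rw [Nat.add_sub_cancel, pow_succ', ← mul_assoc, hτ, one_mul]
    have hval : ∀ x : k, x ≠ 0 → ρ * τ ^ (r - 1) * qint q s' / x * x
        = c.τ * (ρ * τ ^ (r + 1 - 1) * qint q s' / qint q t) * qint q t := by
      intro x hx
      rw [div_mul_cancel₀ _ hx, hc, Nat.add_sub_cancel, mul_assoc τ, div_mul_cancel₀ _ hqt, ← hpow]
      ring
    refine Kron.step hp hq hε hqt L hinj hA₁ hA₂ hB₁ hB₂ hlo hhi (fun h0 => zlo ?_)
      (fun h0 => zhi ?_) (hval _) (hval _)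
    · rintro ⟨h5, h6⟩
      exact qint_ne_zero hp hq (show (0 : ℤ) < (t : ℤ) - 1 by omega) (by omega) h0
    · rintro ⟨h5, h6⟩
      exact qint_ne_zero hp hq (show (0 : ℤ) < (t : ℤ) + 1 by omega) (by omega) h0
  · intro hn
    have zlo : ∀ v : R, InBl (p := p) (q := q) (gam q ε ((t : ℤ) - 1)) v → v = 0 := by
      rcases Nat.eq_zero_or_pos t with rfl | ht0
      · have z := (h 1 (by omega) (by omega) (by omega) (by omega)).2 (by omega)
        rw [Nat.cast_zero, zero_sub, gam_neg]
        rwa [Nat.cast_one] at z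
      · have z := (h (t - 1) (by omega) (by omega) (by omega) (by omega)).2 (by omega)
        have e1 : ((t - 1 : ℕ) : ℤ) = (t : ℤ) - 1 := by omega
        rwa [e1] at z
    have zhi : ∀ v : R, InBl (p := p) (q := q) (gam q ε ((t : ℤ) + 1)) v → v = 0 := by
      rcases Nat.eq_or_lt_of_le htp with rfl | ht0
      · have e : gam q ε ((t : ℤ) + 1) = gam q ε ((t : ℤ) - 1) := by
          rw [gam_one_eq_iff hp hq hε]
          exact Or.inr ⟨1, by ring⟩
        rw [e]
        exact zlo
      · have z := (h (t + 1) (by omega) (by omega) (by omega) (by omega)).2 (by omega)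
        have e1 : ((t + 1 : ℕ) : ℤ) = (t : ℤ) + 1 := by omega
        rwa [e1] at z
    refine block_eq_zero_of_weights hp hq hε htp (fun v hv hK => ?_) (fun v hv hK => ?_)
    · obtain ⟨c, -, L⟩ := hL ε t hε
      exact L.block_eq_zero hp hq hε hinj zlo zhi hv hK
    · obtain ⟨c, -, L⟩ := hL (-ε) ((p : ℤ) - t) (sign_neg hε)
      refine L.block_eq_zero hp hq (sign_neg hε) hinj ?_ ?_ hv hK
      · rw [show (p : ℤ) - t - 1 = p - (t + 1) by ring, gam_swap hp hq]
        exact zhi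
      · rw [show (p : ℤ) - t + 1 = p - (t - 1) by ring, gam_swap hp hq]
        exact zlo

/-- The product with a one dimensional module, as a twist. -/
theorem KronRange.base (hp : 2 ≤ p) (hq : IsPrimitiveRoot q (2 * p)) {N R : UMod p q} {ε e f : k}
    (hε : ε * ε = 1) (he : e * e = 1) (hf : f * f = 1) (hef : e * f = ε) (τ : k) {s' : ℕ}
    (hs : 0 < s' ∧ s' < p) (hN : ∀ v : N, cas p q ⋆ v = gam q 1 s' • v) {g₁ g₂ : N →ₗ[Ubar p q] N}
    (hK : Kron 1 s' 1 g₁ g₂) (j : N →ₗ[k] R) (hj : Function.Bijective j)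
    (jE : ∀ v, 𝐄 ⋆ j v = e • j (𝐄 ⋆ v)) (jF : ∀ v, 𝐅 ⋆ j v = f • j (𝐅 ⋆ v))
    (jK : ∀ v, 𝐊 ⋆ j v = ε • j (𝐊 ⋆ v)) {f₁ f₂ : R →ₗ[Ubar p q] R}
    (h₁ : ∀ v, f₁ (j v) = j (g₁ v)) (h₂ : ∀ v, f₂ (j v) = j (g₂ v)) :
    KronRange R ε (f ^ (p - 1) * e) τ s' 1 f₁ f₂ := by
  have hε0 := sign_ne_zero hε
  have he0 := sign_ne_zero he
  have hf0 := sign_ne_zero hf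
  have hεi : ε⁻¹ = ε := inv_eq_of_mul_eq_one_left hε
  have jL : ∀ v, 𝐋 ⋆ j v = ε • j (𝐋 ⋆ v) := fun v => by
    have h1 := jK (𝐋 ⋆ v)
    rw [KL_smul] at h1
    have h2 := congrArg (fun y => ε • 𝐋 ⋆ y) h1
    simp only [usmul, LK_smul, smul_smul, hε, one_smul] at h2
    exact h2.symm
  have jC : ∀ v, cas p q ⋆ j v = gam q ε s' • j v := fun v => by
    have h1 := congrArg (fun y => ε • j y) (hN v)
    simp only [cas_smul, map_add, map_smul] at h1
    rw [cas_smul, jE, usmul, jF, jK, jL, smul_smul, hef]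
    have e2 : gam q ε s' = ε * gam q 1 s' := by
      rw [gam, gam]
      ring
    rw [e2, mul_smul, ← h1]
    module
  have jFn : ∀ (n : ℕ) (v : N), 𝐅 ^ n ⋆ j v = f ^ n • j (𝐅 ^ n ⋆ v) := fun n v => by
    induction n with
    | zero => simp only [pow_zero, one_act, one_smul]
    | succ n ih => rw [F_succ_act, ih, usmul, jF, smul_smul, ← pow_succ, ← F_succ_act]
  have inN : ∀ v : N, InBl (p := p) (q := q) (gam q 1 s') v := fun v => InBl.of_cas hp (hN v)
  have wt' : ∀ (j' : ℤ) (v : N), 𝐊 ⋆ j v = (ε * q ^ j') • j v → 𝐊 ⋆ v = (1 * q ^ j') • v := by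
    intro j' v hv
    rw [jK, mul_smul] at hv
    have h3 := hj.1 (smul_right_injective R hε0 (hv.trans (by rw [map_smul])) : _ = j (q ^ j' • v))
    rw [one_mul]
    exact h3
  intro t htp hodd h1 h2
  refine ⟨fun hc => ?_, fun hc v hv => ?_⟩
  · obtain rfl : t = s' := by omega
    have hqt : qint q t ≠ 0 := qint_ne_zero hp hq (by omega) (by omega)
    rw [Nat.sub_self, pow_zero, mul_one, mul_div_assoc, div_self hqt, mul_one]
    refine ⟨fun w hw hwK => ?_, fun w hw hwK => ?_, fun w hw hwK hE hF => ?_, fun w hw hwK => ?_⟩ <;>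
      obtain ⟨v, rfl⟩ := hj.2 w
    · rw [jE, usmul, jF, hK.FE v (inN v) (wt' _ _ hwK), map_zero, smul_zero, smul_zero]
    · rw [jFn, f₁.map_smul_of_tower, h₁, hK.ratio v (inN v) (wt' _ _ hwK), one_smul, jE,
        f₂.map_smul_of_tower, h₂, smul_smul, mul_assoc, he, mul_one]
    · rw [jE] at hE
      rw [jFn] at hF
      have hE' := (smul_eq_zero.mp hE).resolve_left he0
      have hF' := (smul_eq_zero.mp hF).resolve_left (pow_ne_zero _ hf0)
      rw [hK.inj v (inN v) (wt' _ _ hwK) (hj.1 (hE'.trans (map_zero j).symm))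
        (hj.1 (hF'.trans (map_zero j).symm)), map_zero]
    · rw [jF, hK.F v (inN v) (wt' _ _ hwK), map_zero, smul_zero]
  · obtain ⟨w, rfl⟩ := hj.2 v
    refine hv.eq_zero_of_cas hp (jC w) ?_
    rw [Ne, gam_one_eq_iff hp hq hε]
    rintro (⟨c, h⟩ | ⟨c, h⟩)
    · have : c = 0 := by
        have h5 : (2 * p : ℤ) * c < 2 * p := by omega
        have h6 : -(2 * p : ℤ) < 2 * p * c := by omega
        have : c < 1 := by nlinarith
        have : -1 < c := by nlinarith
        omega
      rw [this] at h
      omega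
    · have h5 : (2 * p : ℤ) * c < 2 * p := by omega
      have h6 : 0 < (2 * p : ℤ) * c := by omega
      have : c < 1 := by nlinarith
      have : 0 < c := by nlinarith
      omega

end KronRange

section KroneckerModule

section

variable {ε : k} (Z : BMod k) {a b : ℕ} (ha : 0 < a) (hb : 0 < b)

theorem opE_snd_lt (x : (Fin a → Z.Vp) × (Fin b → Z.Vm)) (n : Fin b) (h : n.val + 1 < b) :
    (opE q ε Z ha hb x).2 n = coeffE q (-ε) b (n.val + 1) • x.2 ⟨n.val + 1, h⟩
      + Z.t1p (Z.t2m (x.2 ⟨n.val + 1, h⟩)) := dif_pos h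

theorem opE_snd_last (x : (Fin a → Z.Vp) × (Fin b → Z.Vm)) (n : Fin b) (h : ¬ n.val + 1 < b) :
    (opE q ε Z ha hb x).2 n = Z.t2p (x.1 ⟨0, ha⟩) := dif_neg h

theorem opF_snd_pos (x : (Fin a → Z.Vp) × (Fin b → Z.Vm)) (n : Fin b) (h : 0 < n.val) :
    (opF Z ha hb x).2 n = x.2 ⟨n.val - 1, by omega⟩ := if_pos h

theorem opF_snd_zero (x : (Fin a → Z.Vp) × (Fin b → Z.Vm)) (n : Fin b) (h : ¬ 0 < n.val) :
    (opF Z ha hb x).2 n = Z.t1p (x.1 ⟨a - 1, by omega⟩) := if_neg h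

theorem opF_opE_fst (x : (Fin a → Z.Vp) × (Fin b → Z.Vm)) (n : Fin a) :
    (opF Z ha hb (opE q ε Z ha hb x)).1 n
      = coeffE q ε a n.val • x.1 n + Z.t1m (Z.t2p (x.1 n)) := by
  obtain ⟨n, hn⟩ := n
  rcases Nat.eq_zero_or_pos n with rfl | h
  · rw [opF_fst_zero _ _ _ _ _ (lt_irrefl 0), opE_snd_last _ _ _ _ _ (by dsimp only; omega),
      coeff_zero, zero_smul, zero_add]
  · obtain ⟨n, rfl⟩ : ∃ i, n = i + 1 := ⟨n - 1, by omega⟩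
    rw [opF_fst_pos _ _ _ _ _ (Nat.succ_pos n), opE_fst_lt _ _ _ _ _ (by dsimp only; omega)]
    rfl

theorem opF_opE_snd (x : (Fin a → Z.Vp) × (Fin b → Z.Vm)) (n : Fin b) :
    (opF Z ha hb (opE q ε Z ha hb x)).2 n
      = coeffE q (-ε) b n.val • x.2 n + Z.t1p (Z.t2m (x.2 n)) := by
  obtain ⟨n, hn⟩ := n
  rcases Nat.eq_zero_or_pos n with rfl | h
  · rw [opF_snd_zero _ _ _ _ _ (lt_irrefl 0), opE_fst_last _ _ _ _ _ (by dsimp only; omega),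
      coeff_zero, zero_smul, zero_add]
  · obtain ⟨n, rfl⟩ : ∃ i, n = i + 1 := ⟨n - 1, by omega⟩
    rw [opF_snd_pos _ _ _ _ _ (Nat.succ_pos n), opE_snd_lt _ _ _ _ _ (by dsimp only; omega)]
    rfl

theorem coeffE_add_wt (hp : 2 ≤ p) (hq : IsPrimitiveRoot q (2 * p)) (hε : ε * ε = 1) (a n : ℕ) :
    coeffE q ε a n + ((q - q⁻¹) ^ 2)⁻¹ * (q * wt q ε a n + q⁻¹ * (wt q ε a n)⁻¹)
      = gam q ε a := by
  have hq0 := q_ne_zero hp hq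
  have hεi : ε⁻¹ = ε := inv_eq_of_mul_eq_one_left hε
  have h1 := gam_sub hq0 (q_sub_ne hp hq) ε a n
  rw [coeffE, ← h1, wt, mul_inv, hεi, ← zpow_neg]
  have e1 : q ^ ((a : ℤ) - 2 * n) = q * q ^ ((a : ℤ) - 1 - 2 * n) := by
    rw [← zpow_one_add₀ hq0]
    congr 1
    ring
  have e2 : q ^ (-((a : ℤ) - 2 * n)) = q⁻¹ * q ^ (-((a : ℤ) - 1 - 2 * n)) := by
    rw [← zpow_neg_one, ← zpow_add₀ hq0]
    congr 1
    ring
  have e3 : gam q ε ((a : ℤ) - 2 * n) = ((q - q⁻¹) ^ 2)⁻¹ * (q * (ε * q ^ ((a : ℤ) - 1 - 2 * n))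
      + q⁻¹ * (ε * q ^ (-((a : ℤ) - 1 - 2 * n)))) := by
    rw [gam, e1, e2]
    ring
  rw [e3]
  ring

end

section

variable {ε : k} (hp : 2 ≤ p) (hq : IsPrimitiveRoot q (2 * p)) (hε : ε * ε = 1) {a : ℕ}
  (ha : 0 < a ∧ a < p) {Z : BMod k}

/-- The coordinates of an element of `Φ`. -/
abbrev PhiSigned.fst (v : PhiSigned hp hq hε a ha Z) : Fin a → Z.Vp :=
  (show (Fin a → Z.Vp) × (Fin (p - a) → Z.Vm) from v).1

/-- The coordinates of an element of `Φ`. -/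
abbrev PhiSigned.snd (v : PhiSigned hp hq hε a ha Z) : Fin (p - a) → Z.Vm :=
  (show (Fin a → Z.Vp) × (Fin (p - a) → Z.Vm) from v).2

theorem PhiSigned.E_eq (v : PhiSigned hp hq hε a ha Z) : 𝐄 ⋆ v =
    (opE q ε Z ha.1 (Nat.sub_pos_of_lt ha.2) v : PhiSigned hp hq hε a ha Z) := (lift_act _ v).1

theorem PhiSigned.F_eq (v : PhiSigned hp hq hε a ha Z) : 𝐅 ⋆ v =
    (opF Z ha.1 (Nat.sub_pos_of_lt ha.2) v : PhiSigned hp hq hε a ha Z) := (lift_act _ v).2.1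

theorem PhiSigned.cas_smul (h : ∀ v, Z.t1m (Z.t2p v) = 0) (h' : ∀ v, Z.t1p (Z.t2m v) = 0)
    (v : PhiSigned hp hq hε a ha Z) : cas p q ⋆ v = gam q ε a • v := by
  have hL : 𝐋 ⋆ v = (opKinv q ε Z a (p - a) v : PhiSigned hp hq hε a ha Z) :=
    LinearMap.congr_fun (Ubar.lift_gen (ops_rel (ε := ε) Z ha.1 (Nat.sub_pos_of_lt ha.2) hp hq hε
      (Nat.add_sub_cancel' ha.2.le))).2.2.2 v
  have hK : 𝐊 ⋆ v = (opK q ε Z a (p - a) v : PhiSigned hp hq hε a ha Z) := (lift_act _ v).2.2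
  have g1 := flip_gam (ε := ε) hp hq rfl (Nat.add_sub_cancel' ha.2.le)
  have key : ∀ x : (Fin a → Z.Vp) × (Fin (p - a) → Z.Vm),
      opF Z ha.1 (Nat.sub_pos_of_lt ha.2) (opE q ε Z ha.1 (Nat.sub_pos_of_lt ha.2) x)
        + ((q - q⁻¹) ^ 2)⁻¹ • (q • opK q ε Z a (p - a) x + q⁻¹ • opKinv q ε Z a (p - a) x)
        = gam q ε a • x := by
    intro x
    refine Prod.ext (funext fun n => ?_) (funext fun n => ?_)
    · change (opF Z ha.1 _ (opE q ε Z ha.1 _ x)).1 n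
        + ((q - q⁻¹) ^ 2)⁻¹ • (q • wt q ε a n.val • x.1 n + q⁻¹ • (wt q ε a n.val)⁻¹ • x.1 n)
        = gam q ε a • x.1 n
      rw [opF_opE_fst, h, add_zero, ← coeffE_add_wt hp hq hε a n.val]
      module
    · change (opF Z ha.1 _ (opE q ε Z ha.1 _ x)).2 n
        + ((q - q⁻¹) ^ 2)⁻¹ • (q • wt q (-ε) (p - a) n.val • x.2 n
          + q⁻¹ • (wt q (-ε) (p - a) n.val)⁻¹ • x.2 n) = gam q ε a • x.2 n
      rw [opF_opE_snd, h', add_zero, ← g1, ← coeffE_add_wt hp hq (sign_neg hε) (p - a) n.val]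
      module
  rw [QSl2.cas_smul, hL, hK, PhiSigned.F_eq, PhiSigned.E_eq]
  exact key v

theorem PhiSigned.coord_of_weight {v : PhiSigned hp hq hε a ha Z} {N : ℕ} (hN : N < p)
    (hK : 𝐊 ⋆ v = (ε * q ^ ((a : ℤ) - 1 - 2 * N)) • v) :
    (∀ n : Fin a, n.val ≠ N → PhiSigned.fst hp hq hε ha v n = 0) ∧
      ∀ n : Fin (p - a), a + n.val ≠ N → PhiSigned.snd hp hq hε ha v n = 0 := by
  have hab : a + (p - a) = p := Nat.add_sub_cancel' ha.2.le
  have h0 : (opK q ε Z a (p - a) v : PhiSigned hp hq hε a ha Z)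
      = (ε * q ^ ((a : ℤ) - 1 - 2 * N)) • v := (lift_act _ v).2.2.symm.trans hK
  have key : ∀ i : ℕ, i < p → i ≠ N → ε * q ^ ((a : ℤ) - 1 - 2 * i)
      - ε * q ^ ((a : ℤ) - 1 - 2 * N) ≠ 0 := fun i hi hne h => hne
    (injOn_weights hp hq hε ((a : ℤ) - 1) (Finset.mem_coe.mpr (Finset.mem_range.mpr hi))
      (Finset.mem_coe.mpr (Finset.mem_range.mpr hN)) (sub_eq_zero.mp h))
  refine ⟨fun n hn => ?_, fun n hn => ?_⟩
  · have h1 := congrFun (congrArg (fun w : (Fin a → Z.Vp) × (Fin (p - a) → Z.Vm) => w.1) h0) n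
    change (ε * q ^ ((a : ℤ) - 1 - 2 * n.val)) • v.1 n
      = (ε * q ^ ((a : ℤ) - 1 - 2 * N)) • v.1 n at h1
    rw [← sub_eq_zero, ← sub_smul] at h1
    exact (smul_eq_zero.mp h1).resolve_left (key n.val (by omega) hn)
  · have h1 := congrFun (congrArg (fun w : (Fin a → Z.Vp) × (Fin (p - a) → Z.Vm) => w.2) h0) n
    change (-ε * q ^ (((p - a : ℕ) : ℤ) - 1 - 2 * n.val)) • v.2 n
      = (ε * q ^ ((a : ℤ) - 1 - 2 * N)) • v.2 n at h1
    have e1 : ((p - a : ℕ) : ℤ) - 1 - 2 * n.val = ((p - a : ℕ) : ℤ) - (1 + 2 * n.val) := by ring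
    have e2 : -(a : ℤ) - (1 + 2 * n.val) = (a : ℤ) - 1 - 2 * ((a + n.val : ℕ) : ℤ) := by
      push_cast
      ring
    rw [e1, flip_weight hp hq rfl hab, e2, ← sub_eq_zero, ← sub_smul] at h1
    exact (smul_eq_zero.mp h1).resolve_left (key (a + n.val) (by omega) hn)

theorem PhiSigned.fst_F_pow (j : ℕ) (v : PhiSigned hp hq hε a ha Z) (i : ℕ) (h : j + i < a) :
    PhiSigned.fst hp hq hε ha (𝐅 ^ j ⋆ v) ⟨j + i, h⟩
      = PhiSigned.fst hp hq hε ha v ⟨i, by omega⟩ := by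
  induction j with
  | zero =>
    rw [pow_zero, one_act]
    exact congrArg _ (Fin.ext (zero_add i))
  | succ j ih =>
    rw [F_succ_act, PhiSigned.F_eq, ← ih (by omega)]
    refine (opF_fst_pos _ _ _ _ _ (by dsimp only; omega)).trans ?_
    exact congrArg (PhiSigned.fst hp hq hε ha (𝐅 ^ j ⋆ v)) (Fin.ext (by dsimp only; omega))

theorem PhiSigned.snd_F_pow (j : ℕ) (v : PhiSigned hp hq hε a ha Z) (i : ℕ) (h : j + i < p - a) :
    PhiSigned.snd hp hq hε ha (𝐅 ^ j ⋆ v) ⟨j + i, h⟩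
      = PhiSigned.snd hp hq hε ha v ⟨i, by omega⟩ := by
  induction j with
  | zero =>
    rw [pow_zero, one_act]
    exact congrArg _ (Fin.ext (zero_add i))
  | succ j ih =>
    rw [F_succ_act, PhiSigned.F_eq, ← ih (by omega)]
    refine (opF_snd_pos _ _ _ _ _ (by dsimp only; omega)).trans ?_
    exact congrArg (PhiSigned.snd hp hq hε ha (𝐅 ^ j ⋆ v)) (Fin.ext (by dsimp only; omega))

theorem PhiSigned.snd_F_pow_last (v : PhiSigned hp hq hε a ha Z) :
    PhiSigned.snd hp hq hε ha (𝐅 ^ (p - 1) ⋆ v) ⟨p - a - 1, by omega⟩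
      = Z.t1p (PhiSigned.fst hp hq hε ha v ⟨0, ha.1⟩) := by
  have e : p - 1 = (p - a - 1) + (a - 1 + 1) := by omega
  have h1 := PhiSigned.snd_F_pow hp hq hε ha (p - a - 1) (𝐅 ^ (a - 1 + 1) ⋆ v) 0 (by omega)
  rw [← F_add_act, ← e] at h1
  refine (Eq.trans ?_ h1).trans ?_
  · congr 1
  · rw [F_succ_act, PhiSigned.F_eq]
    refine (opF_snd_zero _ _ _ _ _ (lt_irrefl 0)).trans ?_
    exact congrArg Z.t1p (PhiSigned.fst_F_pow hp hq hε ha (a - 1) v 0 (by omega))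

theorem PhiSigned.snd_E_last (v : PhiSigned hp hq hε a ha Z) :
    PhiSigned.snd hp hq hε ha (𝐄 ⋆ v) ⟨p - a - 1, by omega⟩
      = Z.t2p (PhiSigned.fst hp hq hε ha v ⟨0, ha.1⟩) := by
  rw [PhiSigned.E_eq]
  exact opE_snd_last _ _ _ _ _ (by dsimp only; omega)

/-- The module given by a Kronecker module satisfies the predicate `Kron`. -/
theorem PhiSigned.kron (h1 : Z.t1m = 0) (h2 : Z.t2m = 0)
    (hi : ∀ v, Z.t1p v = 0 → Z.t2p v = 0 → v = 0) (f₁ f₂ : BMod.Hom Z Z)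
    (hf : ∀ v, f₁.fm (Z.t1p v) = f₂.fm (Z.t2p v)) :
    Kron (R := PhiSigned hp hq hε a ha Z) ε a 1 (phiMap hp hq hε ha f₁) (phiMap hp hq hε ha f₂) := by
  have hq0 := q_ne_zero hp hq
  have hC := PhiSigned.cas_smul hp hq hε ha (Z := Z)
    (fun v => by rw [h1, LinearMap.zero_apply]) (fun v => by rw [h2, LinearMap.zero_apply, map_zero])
  have e0 : (a : ℤ) - 1 = a - 1 - 2 * (0 : ℕ) := by simp
  have eup : ε * q ^ ((a : ℤ) + 1) = ε * q ^ ((a : ℤ) - 1 - 2 * ((p - 1 : ℕ) : ℤ)) := by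
    have e : (a : ℤ) - 1 - 2 * ((p - 1 : ℕ) : ℤ) = a + 1 - p - p := by
      rw [Nat.cast_sub (by omega)]
      push_cast
      ring
    rw [e, q_zpow_sub_p hp hq, q_zpow_sub_p hp hq, neg_neg]
  have ext : ∀ v w : PhiSigned hp hq hε a ha Z, 𝐊 ⋆ v = (ε * q ^ ((a : ℤ) + 1)) • v →
      𝐊 ⋆ w = (ε * q ^ ((a : ℤ) + 1)) • w → PhiSigned.snd hp hq hε ha v ⟨p - a - 1, by omega⟩
        = PhiSigned.snd hp hq hε ha w ⟨p - a - 1, by omega⟩ → v = w := by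
    intro v w hv hw h
    rw [eup] at hv hw
    obtain ⟨hv1, hv2⟩ := PhiSigned.coord_of_weight hp hq hε ha (by omega) hv
    obtain ⟨hw1, hw2⟩ := PhiSigned.coord_of_weight hp hq hε ha (by omega) hw
    refine Prod.ext (funext fun n => ?_) (funext fun n => ?_)
    · exact (hv1 n (by omega)).trans (hw1 n (by omega)).symm
    · by_cases hn : n = ⟨p - a - 1, by omega⟩
      · rw [hn]
        exact h
      · have hne : a + n.val ≠ p - 1 := fun h' => hn (Fin.ext (by dsimp only; omega))
        exact (hv2 n hne).trans (hw2 n hne).symm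
  have wE : ∀ v : PhiSigned hp hq hε a ha Z, 𝐊 ⋆ v = (ε * q ^ ((a : ℤ) - 1)) • v →
      𝐊 ⋆ 𝐄 ⋆ v = (ε * q ^ ((a : ℤ) + 1)) • 𝐄 ⋆ v := fun v hv => by
    have := weight_E' hq0 hv
    rwa [show (a : ℤ) - 1 + 2 = a + 1 by ring] at this
  have wF : ∀ v : PhiSigned hp hq hε a ha Z, 𝐊 ⋆ v = (ε * q ^ ((a : ℤ) - 1)) • v →
      𝐊 ⋆ 𝐅 ^ (p - 1) ⋆ v = (ε * q ^ ((a : ℤ) + 1)) • 𝐅 ^ (p - 1) ⋆ v := fun v hv => by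
    rw [eup]
    exact weight_F_pow hq0 hv (p - 1)
  refine ⟨fun v _ hK => ?_, fun v _ hK => ?_, fun v _ hK hE hF => ?_, fun v _ hK => ?_⟩
  · rw [FE_smul hq0 hε hK, hC, sub_add_cancel, sub_self]
  · rw [one_smul]
    refine ext _ _ ?_ ?_ ?_
    · rw [← map_act, wF v hK, LinearMap.map_smul_of_tower]
    · rw [← map_act, wE v hK, LinearMap.map_smul_of_tower]
    · refine (phiMap_snd hp hq hε ha f₁ _ _).trans (Eq.trans ?_ (phiMap_snd hp hq hε ha f₂ _ _).symm)
      refine (congrArg f₁.fm (PhiSigned.snd_F_pow_last hp hq hε ha v)).trans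
        (Eq.trans ?_ (congrArg f₂.fm (PhiSigned.snd_E_last hp hq hε ha v)).symm)
      exact hf _
  · have hx : PhiSigned.fst hp hq hε ha v ⟨0, ha.1⟩ = 0 := by
      refine hi _ ?_ ?_
      · rw [← PhiSigned.snd_F_pow_last, hF]
        rfl
      · rw [← PhiSigned.snd_E_last, hE]
        rfl
    rw [e0] at hK
    obtain ⟨hv1, hv2⟩ := PhiSigned.coord_of_weight hp hq hε ha (by omega) hK
    refine Prod.ext (funext fun n => ?_) (funext fun n => hv2 n (by omega))
    by_cases hn : n.val = 0
    · have : n = ⟨0, ha.1⟩ := Fin.ext hn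
      rw [this]
      exact hx
    · exact hv1 n hn
  · rw [eup] at hK
    obtain ⟨hv1, hv2⟩ := PhiSigned.coord_of_weight hp hq hε ha (by omega) hK
    rw [PhiSigned.F_eq]
    refine Prod.ext (funext fun n => ?_) (funext fun n => ?_)
    · by_cases hn : 0 < n.val
      · exact (opF_fst_pos _ _ _ _ _ hn).trans (hv1 _ (by dsimp only; omega))
      · refine (opF_fst_zero _ _ _ _ _ hn).trans ?_
        rw [h1]
        rfl
    · by_cases hn : 0 < n.val
      · exact (opF_snd_pos _ _ _ _ _ hn).trans (hv2 _ (by dsimp only; omega))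
      · refine (opF_snd_zero _ _ _ _ _ hn).trans ?_
        refine (congrArg Z.t1p (hv1 ⟨a - 1, by omega⟩ (by dsimp only; omega))).trans (map_zero _)

end

end KroneckerModule

section KroneckerCriterion

theorem phi_cases (n : ℕ) (l : ℙ k (Fin 2 → k)) :
    (P1.coord l = OnePoint.infty ∧ phi1 n l = 1 ∧ phi2 n l = nilMatrix k n) ∨
      ∃ b : k, P1.coord l = (b : OnePoint k) ∧ phi1 n l = b • 1 + nilMatrix k n ∧ phi2 n l = 1 := by
  unfold phi1 phi2
  induction P1.coord l using OnePoint.rec with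
  | infty => exact Or.inl ⟨rfl, rfl, rfl⟩
  | coe b => exact Or.inr ⟨b, rfl, rfl, rfl⟩

theorem P1.coord_scale (c : k) (l : ℙ k (Fin 2 → k)) :
    P1.coord (P1.scale c l) = (P1.coord l).map fun b => c * b :=
  letI := Classical.decEq k
  Equiv.symm_apply_apply _ _

theorem phi_scale_of_infty {n : ℕ} {l : ℙ k (Fin 2 → k)} (h : P1.coord l = OnePoint.infty) (c : k) :
    phi1 n (P1.scale c l) = 1 ∧ phi2 n (P1.scale c l) = nilMatrix k n := by
  rw [phi1, phi2, P1.coord_scale, h]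
  exact ⟨rfl, rfl⟩

theorem phi_scale_of_coe {n : ℕ} {l : ℙ k (Fin 2 → k)} {b : k} (h : P1.coord l = (b : OnePoint k))
    (c : k) : phi1 n (P1.scale c l) = (c * b) • 1 + nilMatrix k n ∧ phi2 n (P1.scale c l) = 1 := by
  rw [phi1, phi2, P1.coord_scale, h]
  exact ⟨rfl, rfl⟩

theorem phi_commute (n : ℕ) (l : ℙ k (Fin 2 → k)) : phi1 n l * phi2 n l = phi2 n l * phi1 n l := by
  rcases phi_cases n l with ⟨-, h1, h2⟩ | ⟨b, -, h1, h2⟩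
  · rw [h1, one_mul, mul_one]
  · rw [h2, one_mul, mul_one]

theorem phi_jointly_injective {n : ℕ} {l : ℙ k (Fin 2 → k)} {x : Fin n → k}
    (hx₁ : (phi1 n l).toLin' x = 0) (hx₂ : (phi2 n l).toLin' x = 0) : x = 0 := by
  rcases phi_cases n l with ⟨-, h1, h2⟩ | ⟨b, -, h1, h2⟩
  · rwa [h1, Matrix.toLin'_one] at hx₁
  · rwa [h2, Matrix.toLin'_one] at hx₂

/-- The diagonal map `x_i ↦ c ^ i x_i`. -/
def powDiag (n : ℕ) (c : k) : (Fin n → k) →ₗ[k] (Fin n → k) := diagOp fun i => c ^ i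

theorem powDiag_apply {n : ℕ} (c : k) (x : Fin n → k) (i : Fin n) :
    powDiag n c x i = c ^ i.val * x i := rfl

theorem powDiag_bijective (n : ℕ) {c : k} (hc : c ≠ 0) : Function.Bijective (powDiag n c) := by
  refine (LinearMap.injective_iff_surjective.mp ?_ |> fun h => ⟨?_, h⟩) <;>
  · rw [injective_iff_map_eq_zero]
    intro x hx
    funext i
    exact (mul_eq_zero.mp (congrFun hx i)).resolve_left (pow_ne_zero _ hc)

theorem nilMatrix_powDiag {n : ℕ} (c : k) (x : Fin n → k) :
    (nilMatrix k n).toLin' (powDiag n c x) = c • powDiag n c ((nilMatrix k n).toLin' x) := by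
  funext i
  rw [Pi.smul_apply, powDiag_apply, Matrix.toLin'_apply, Matrix.toLin'_apply, Matrix.mulVec,
    Matrix.mulVec, dotProduct, dotProduct, smul_eq_mul, Finset.mul_sum, Finset.mul_sum]
  refine Finset.sum_congr rfl fun j _ => ?_
  rw [powDiag_apply, nilMatrix, Matrix.of_apply]
  split_ifs with h
  · rw [← h, pow_succ]
    ring
  · ring

/-- A `B`-module whose maps `τ₁⁺, τ₂⁺` satisfy the relation of `φ₁, φ₂` up to the scalar `ρ` is
the module of the rescaled parameter. -/
theorem BMod.exists_hom_EPlus (Z : BMod k) {n : ℕ} {l : ℙ k (Fin 2 → k)} {ρ : k} (hρ : ρ ≠ 0)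
    (Θ : (Fin n → k) →ₗ[k] Z.Vp) (hΘ : Function.Bijective Θ) (hm : Module.finrank k Z.Vm = n)
    (hN : ∀ v, Z.t1m (Z.t2p v) = 0)
    (hr : ∀ x, Z.t1p (Θ ((phi2 n l).toLin' x)) = ρ • Z.t2p (Θ ((phi1 n l).toLin' x)))
    (h₂ : ∀ x, Z.t2p (Θ x) = 0 → Z.t2p (Θ ((phi1 n l).toLin' x)) = 0)
    (h₁ : ∀ x, Z.t1p (Θ x) = 0 → Z.t1p (Θ ((phi2 n l).toLin' x)) = 0)
    (hi : ∀ v, Z.t1p v = 0 → Z.t2p v = 0 → v = 0) :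
    ∃ f : BMod.Hom (BMod.EPlus n (P1.scale ρ l)) Z,
      Function.Bijective f.fp ∧ Function.Bijective f.fm := by
  have bij : ∀ f : (Fin n → k) →ₗ[k] Z.Vm, (∀ x, f x = 0 → x = 0) → Function.Bijective f := by
    intro f hf
    have hf' : Function.Injective f := (injective_iff_map_eq_zero f).mpr hf
    exact ⟨hf', (LinearMap.injective_iff_surjective_of_finrank_eq_finrank
      ((Module.finrank_fin_fun k).trans hm.symm)).mp hf'⟩
  have m11 : ∀ v, Z.t1m (Z.t1p v) = 0 := LinearMap.congr_fun Z.t1m_t1p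
  have m22 : ∀ v, Z.t2m (Z.t2p v) = 0 := LinearMap.congr_fun Z.t2m_t2p
  rcases phi_cases n l with ⟨hl, e1, e2⟩ | ⟨b, hl, e1, e2⟩
  · obtain ⟨e1', e2'⟩ := phi_scale_of_infty (n := n) hl ρ
    rw [e1] at h₂ hr
    rw [e2] at h₁ hr
    simp only [Matrix.toLin'_one, LinearMap.id_apply] at h₁ h₂ hr
    have hD := powDiag_bijective n hρ
    have t1 : ∀ x : Fin n → k, Z.t1p (Θ (powDiag n ρ ((phi1 n (P1.scale ρ l)).toLin' x)))
        = Z.t1p (Θ (powDiag n ρ x)) := fun x => by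
      rw [e1', Matrix.toLin'_one, LinearMap.id_apply]
    have t2 : ∀ x : Fin n → k, Z.t1p (Θ (powDiag n ρ ((phi2 n (P1.scale ρ l)).toLin' x)))
        = Z.t2p (Θ (powDiag n ρ x)) := fun x => by
      have := hr (powDiag n ρ x)
      rw [nilMatrix_powDiag, map_smul, map_smul] at this
      rw [e2']
      exact smul_right_injective _ hρ this
    refine ⟨⟨Θ ∘ₗ powDiag n ρ, Z.t1p ∘ₗ Θ ∘ₗ powDiag n ρ, t1, t2, fun x => ?_,
      fun x => ?_⟩, hΘ.comp hD, bij _ fun x hx => ?_⟩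
    · exact (map_zero _).trans (m11 _).symm
    · exact (map_zero _).trans ((Z.t2m_t1p_apply _).trans (hN _)).symm
    · have hx' : Z.t1p (Θ (powDiag n ρ x)) = 0 := hx
      have h3 := hr (powDiag n ρ x)
      rw [h₁ _ hx'] at h3
      have h4 := hi _ hx' ((smul_eq_zero.mp h3.symm).resolve_left hρ)
      exact hD.1 ((hΘ.1 (h4.trans (map_zero Θ).symm)).trans (map_zero _).symm)
  · obtain ⟨e1', e2'⟩ := phi_scale_of_coe (n := n) hl ρ
    rw [e1] at h₂ hr
    rw [e2] at h₁ hr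
    simp only [Matrix.toLin'_one, LinearMap.id_apply] at h₁ h₂ hr
    have hD := powDiag_bijective n (inv_ne_zero hρ)
    have hs : ∀ c : k, ((c • 1 + nilMatrix k n).toLin' : (Fin n → k) →ₗ[k] _)
        = c • LinearMap.id + (nilMatrix k n).toLin' := fun c => by
      rw [map_add, map_smul, Matrix.toLin'_one]
    have t1 : ∀ x : Fin n → k, Z.t2p (Θ (powDiag n ρ⁻¹ ((phi1 n (P1.scale ρ l)).toLin' x)))
        = Z.t1p (Θ (powDiag n ρ⁻¹ x)) := fun x => by
      rw [hr, e1', hs, hs, LinearMap.add_apply, LinearMap.add_apply, LinearMap.smul_apply,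
        LinearMap.smul_apply, LinearMap.id_apply, LinearMap.id_apply, nilMatrix_powDiag]
      simp only [map_add, map_smul, smul_add, smul_smul]
      rw [mul_inv_cancel₀ hρ, one_smul]
    have t2 : ∀ x : Fin n → k, Z.t2p (Θ (powDiag n ρ⁻¹ ((phi2 n (P1.scale ρ l)).toLin' x)))
        = Z.t2p (Θ (powDiag n ρ⁻¹ x)) := fun x => by
      rw [e2', Matrix.toLin'_one, LinearMap.id_apply]
    refine ⟨⟨Θ ∘ₗ powDiag n ρ⁻¹, Z.t2p ∘ₗ Θ ∘ₗ powDiag n ρ⁻¹, t1, t2, fun x => ?_,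
      fun x => ?_⟩, hΘ.comp hD, bij _ fun x hx => ?_⟩
    · exact (map_zero _).trans (hN _).symm
    · exact (map_zero _).trans (m22 _).symm
    · have hx' : Z.t2p (Θ (powDiag n ρ⁻¹ x)) = 0 := hx
      have h3 := hr (powDiag n ρ⁻¹ x)
      rw [h₂ _ hx', smul_zero] at h3
      have h4 := hi _ h3 hx'
      exact hD.1 ((hΘ.1 (h4.trans (map_zero Θ).symm)).trans (map_zero _).symm)

end KroneckerCriterion

section KroneckerBlocks

namespace SplitExt

variable {M X Y : UMod p q} {m : ℕ}

/-- The endomorphism `g` acts through the matrix `A` on the components of the quotient. -/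
def ActsBy (S : SplitExt M X Y m) (g : M →ₗ[Ubar p q] M) (A : Matrix (Fin m) (Fin m) k) : Prop :=
  ∀ i v, S.π i (g v) = ∑ j, A i j • S.π j v

theorem ActsBy.tensorRight (hp : 2 ≤ p) (hq : IsPrimitiveRoot q (2 * p)) {S : SplitExt M X Y m}
    {g : M →ₗ[Ubar p q] M} {A : Matrix (Fin m) (Fin m) k} (h : S.ActsBy g A) (N : UMod p q) :
    (S.tensorRight hp hq N).ActsBy (tmapU hp hq g LinearMap.id) A := fun i v =>
  tm_induction hp hq (P := fun v => tmapU hp hq (S.π i) LinearMap.id (tmapU hp hq g LinearMap.id v)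
      = ∑ j, A i j • tmapU hp hq (S.π j) LinearMap.id v)
    (fun a b => by
      simp only [tmapU_tm, LinearMap.id_apply]
      rw [h, map_sum, LinearMap.sum_apply]
      simp only [map_smul, LinearMap.smul_apply])
    (fun a b ha hb => by
      simp only [map_add, ha, hb, smul_add, Finset.sum_add_distrib]) v

theorem ActsBy.tensorLeft (hp : 2 ≤ p) (hq : IsPrimitiveRoot q (2 * p)) {S : SplitExt M X Y m}
    {g : M →ₗ[Ubar p q] M} {A : Matrix (Fin m) (Fin m) k} (h : S.ActsBy g A) (N : UMod p q) :
    (S.tensorLeft hp hq N).ActsBy (tmapU hp hq LinearMap.id g) A := fun i v =>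
  tm_induction hp hq (P := fun v => tmapU hp hq LinearMap.id (S.π i) (tmapU hp hq LinearMap.id g v)
      = ∑ j, A i j • tmapU hp hq LinearMap.id (S.π j) v)
    (fun a b => by
      simp only [tmapU_tm, LinearMap.id_apply]
      rw [h, map_sum]
      simp only [map_smul])
    (fun a b ha hb => by
      simp only [map_add, ha, hb, smul_add, Finset.sum_add_distrib]) v

theorem ActsBy.block [CharZero k] (hp : 2 ≤ p) (hq : IsPrimitiveRoot q (2 * p))
    {S : SplitExt M X Y m} {g : M →ₗ[Ubar p q] M} {A : Matrix (Fin m) (Fin m) k}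
    (h : S.ActsBy g A) {γ : k} (hγ : γ ∈ casValues p q) :
    (S.block hp hq hγ).ActsBy (UMod.block.map hp hq γ g) A := fun i v => by
  refine Subtype.ext ((h i v.1).trans ?_)
  have e : ∀ f : Fin m → X.block hp hq γ, (∑ i, f i).1 = ∑ i, (f i).1 :=
    fun f => map_sum (UMod.block.incl hp hq γ) f _
  rw [e]
  rfl

theorem eq_of_π_eq (S : SplitExt M X Y m) {ω : k} (hY : Module.finrank k (wtSub p q Y ω) = 0)
    {v w : M} (hv : 𝐊 ⋆ v = ω • v) (hw : 𝐊 ⋆ w = ω • w) (h : ∀ i, S.π i v = S.π i w) : v = w := by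
  have hY' : ∀ y : Y, 𝐊 ⋆ y = ω • y → y = 0 := fun y hy => by
    have h0 : (⟨y, hy⟩ : wtSub p q Y ω) = 0 :=
      (Module.finrank_zero_iff.mp hY).elim _ _
    exact congrArg Subtype.val h0
  have hρ : ∀ v : M, 𝐊 ⋆ v = ω • v → ∀ i, S.ρ i v = 0 := fun v hv i => hY' _ (by
    rw [← S.ρ_K, hv, map_smul])
  rw [S.decomp v, S.decomp w]
  simp only [h, hρ v hv, hρ w hw]

end SplitExt

theorem Kron.block (hp : 2 ≤ p) (hq : IsPrimitiveRoot q (2 * p)) {R : UMod p q} {ε ρ γ : k} {t : ℤ}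
    {g₁ g₂ : R →ₗ[Ubar p q] R} (h : Kron ε t ρ g₁ g₂) :
    Kron ε t ρ (UMod.block.map hp hq γ g₁) (UMod.block.map hp hq γ g₂) := by
  have hb : ∀ v : R.block hp hq γ, InBl (gam q ε t) v → InBl (gam q ε t) v.1 :=
    fun v hv => hv.map (UMod.block.incl hp hq γ)
  exact ⟨fun v hv hK => Subtype.ext (h.FE v.1 (hb v hv) (congrArg Subtype.val hK)),
    fun v hv hK => Subtype.ext (h.ratio v.1 (hb v hv) (congrArg Subtype.val hK)),
    fun v hv hK hE hF => Subtype.ext (h.inj v.1 (hb v hv) (congrArg Subtype.val hK)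
      (congrArg Subtype.val hE) (congrArg Subtype.val hF)),
    fun v hv hK => Subtype.ext (h.F v.1 (hb v hv) (congrArg Subtype.val hK))⟩

/-- A module in one block which extends `X ^ n` by `Y ^ n` and satisfies the predicate `Kron`
comes from the Kronecker module of the rescaled parameter. -/
theorem SplitExt.exists_equiv_EPlus [CharZero k] (hp : 2 ≤ p) (hq : IsPrimitiveRoot q (2 * p))
    {Q X Y : UMod p q} {n : ℕ} (S : SplitExt Q X Y n) {ε : k} (hε : ε * ε = 1) {a : ℕ}
    (ha : 0 < a ∧ a < p) (hQ : ∀ v : Q, InBl (p := p) (q := q) (gam q ε a) v)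
    {l : ℙ k (Fin 2 → k)} {g₁ g₂ : Q →ₗ[Ubar p q] Q} (h₁ : S.ActsBy g₁ (phi2 n l))
    (h₂ : S.ActsBy g₂ (phi1 n l)) {ρ : k} (hρ : ρ ≠ 0) (hK : Kron ε a ρ g₁ g₂)
    (dX : Module.finrank k (wtSub p q X (ε * q ^ ((a : ℤ) - 1))) = 1)
    (dY : Module.finrank k (wtSub p q Y (ε * q ^ ((a : ℤ) - 1))) = 0)
    (dX' : Module.finrank k (wtSub p q X (-ε * q ^ (((p - a : ℕ) : ℤ) - 1))) = 0)
    (dY' : Module.finrank k (wtSub p q Y (-ε * q ^ (((p - a : ℕ) : ℤ) - 1))) = 1) :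
    Nonempty (Q ≃ₗ[Ubar p q] PhiSigned hp hq hε a ha (BMod.EPlus n (P1.scale ρ l))) := by
  obtain ⟨h, h0, hspan⟩ := finrank_eq_one_iff'.mp dX
  have h0' : h.1 ≠ 0 := fun e => h0 (Subtype.ext e)
  have hσ : ∀ i, S.σ i h.1 ∈ wtSub p q Q (ε * q ^ ((a : ℤ) - 1)) := fun i => by
    rw [mem_wtSub, ← S.σ_K, mem_wtSub.mp h.2, map_smul]
  let Θ : (Fin n → k) →ₗ[k] wtSub p q Q (ε * q ^ ((a : ℤ) - 1)) :=
    Fintype.linearCombination k fun i => ⟨S.σ i h.1, hσ i⟩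
  have Θval : ∀ x, (Θ x).1 = ∑ i, x i • S.σ i h.1 := fun x => by
    rw [Fintype.linearCombination_apply, Submodule.coe_sum]
    rfl
  have πΘ : ∀ i x, S.π i (Θ x).1 = x i • h.1 := fun i x => by
    rw [Θval, map_sum, Finset.sum_eq_single i]
    · rw [LinearMap.map_smul_of_tower, S.π_σ, if_pos rfl]
    · intro j _ hj
      rw [LinearMap.map_smul_of_tower, S.π_σ, if_neg hj.symm, smul_zero]
    · exact fun hn => absurd (Finset.mem_univ _) hn
  have hΘ : Function.Bijective Θ := by
    constructor
    · rw [injective_iff_map_eq_zero]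
      intro x hx
      funext i
      have := πΘ i x
      rw [hx] at this
      exact (smul_eq_zero.mp (this.symm.trans (map_zero (S.π i)))).resolve_right h0'
    · intro v
      have : ∀ i, ∃ c : k, c • h.1 = S.π i v.1 := fun i => by
        obtain ⟨c, hc⟩ := hspan ⟨S.π i v.1, by
          rw [mem_wtSub, ← map_act, mem_wtSub.mp v.2, LinearMap.map_smul_of_tower]⟩
        exact ⟨c, congrArg Subtype.val hc⟩
      choose c hc using this
      exact ⟨c, Subtype.ext (S.eq_of_π_eq dY (mem_wtSub.mp (Θ c).2) (mem_wtSub.mp v.2) fun i => by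
        rw [πΘ, hc])⟩
  have comm : ∀ {g : Q →ₗ[Ubar p q] Q} {A : Matrix (Fin n) (Fin n) k}, S.ActsBy g A →
      ∀ x, g (Θ x).1 = (Θ (A.toLin' x)).1 := fun {g A} hg x => by
    refine S.eq_of_π_eq dY ?_ (mem_wtSub.mp (Θ _).2) fun i => ?_
    · rw [← map_act, mem_wtSub.mp (Θ x).2, LinearMap.map_smul_of_tower]
    · rw [hg, πΘ, Matrix.toLin'_apply, Matrix.mulVec, dotProduct, Finset.sum_smul]
      refine Finset.sum_congr rfl fun j _ => ?_
      rw [πΘ, smul_smul]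
  have hr : ∀ x, 𝐅 ^ (p - 1) ⋆ (Θ ((phi2 n l).toLin' x)).1
      = ρ • 𝐄 ⋆ (Θ ((phi1 n l).toLin' x)).1 := fun x => by
    rw [← comm h₁, ← comm h₂, ← map_act, ← map_act, hK.ratio _ (hQ _) (mem_wtSub.mp (Θ x).2)]
  have hs₂ : ∀ x, 𝐄 ⋆ (Θ x).1 = 0 → 𝐄 ⋆ (Θ ((phi1 n l).toLin' x)).1 = 0 := fun x hx => by
    rw [← comm h₂, ← map_act, hx, map_zero]
  have hs₁ : ∀ x, 𝐅 ^ (p - 1) ⋆ (Θ x).1 = 0 → 𝐅 ^ (p - 1) ⋆ (Θ ((phi2 n l).toLin' x)).1 = 0 :=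
    fun x hx => by rw [← comm h₁, ← map_act, hx, map_zero]
  have ep : p - 1 = p - a - 1 + a := by omega
  have hab : a + (p - a) = p := Nat.add_sub_cancel' ha.2.le
  let Z := BMod.ofBlock Q hp hq hε ha hQ
  have hF : ∀ v : Z.Vp, 𝐅 ^ (p - a - 1) ⋆ (Z.t1p v).1 = 𝐅 ^ (p - 1) ⋆ v.1 := fun v => by
    rw [ofBlock_t1p, ← F_add_act, ← ep]
  have hE : ∀ v : Z.Vp, 𝐅 ^ (p - a - 1) ⋆ (Z.t2p v).1 = 𝐄 ⋆ v.1 :=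
    fun v => ofBlock_t2p hp hq hε ha hQ v
  have inj : ∀ v : Z.Vm, 𝐅 ^ (p - a - 1) ⋆ v.1 = 0 → v = 0 := fun v hv => Subtype.ext (by
    refine eq_zero_of_F_pow (a := p - a) hp hq (sign_neg hε) (by omega) (by omega) ?_
      (mem_wtSub.mp v.2) hv
    rw [flip_gam hp hq rfl hab]
    exact hQ _)
  have t1_iff : ∀ v : Z.Vp, Z.t1p v = 0 ↔ 𝐅 ^ (p - 1) ⋆ v.1 = 0 := fun v => by
    rw [← hF]
    exact ⟨fun h => by rw [h]; exact act_zero _, inj _⟩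
  have t2_iff : ∀ v : Z.Vp, Z.t2p v = 0 ↔ 𝐄 ⋆ v.1 = 0 := fun v => by
    rw [← hE]
    exact ⟨fun h => by rw [h]; exact act_zero _, inj _⟩
  have key : ∀ v w : Z.Vp, 𝐅 ^ (p - 1) ⋆ v.1 = ρ • 𝐄 ⋆ w.1 → Z.t1p v = ρ • Z.t2p w :=
    fun v w h => sub_eq_zero.mp (inj _ (by
      change 𝐅 ^ (p - a - 1) ⋆ ((Z.t1p v).1 - ρ • (Z.t2p w).1) = 0
      rw [act_sub, usmul, hF, hE, h, sub_self]))
  have wt := fun v : Z.Vp => mem_wtSub.mp v.2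
  have hm : Module.finrank k Z.Vm = n := by
    refine (S.finrank_wtSub _).trans ?_
    rw [dX', dY', zero_add, mul_one]
  obtain ⟨f, hf, hf'⟩ := Z.exists_hom_EPlus (l := l) hρ Θ hΘ hm
    (fun v => Subtype.ext ((ofBlock_t1m_t2p hp hq hε ha hQ v).trans (hK.FE _ (hQ _) (wt v))))
    (fun x => key (Θ _) (Θ _) (hr x))
    (fun x hx => (t2_iff (Θ _)).mpr (hs₂ x ((t2_iff (Θ x)).mp hx)))
    (fun x hx => (t1_iff (Θ _)).mpr (hs₁ x ((t1_iff (Θ x)).mp hx)))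
    (fun v hv hv' => Subtype.ext (hK.inj _ (hQ _) (wt v) ((t2_iff v).mp hv') ((t1_iff v).mp hv)))
  obtain ⟨e⟩ := exists_equiv_of_hom hp hq hε ha f hf hf'
  exact ⟨(e.trans (blockEquiv hp hq hε ha hQ)).symm⟩

end KroneckerBlocks

section SplitEPlus

section

variable {n : ℕ} {l : ℙ k (Fin 2 → k)}

/-- A matrix which commutes with `φ₁` and `φ₂` gives an endomorphism of `E⁺(n; λ)`. -/
noncomputable def BMod.EPlus.endo (A : Matrix (Fin n) (Fin n) k)
    (h₁ : A * phi1 n l = phi1 n l * A) (h₂ : A * phi2 n l = phi2 n l * A) :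
    BMod.Hom (BMod.EPlus n l) (BMod.EPlus n l) where
  fp := A.toLin'
  fm := A.toLin'
  t1p := LinearMap.congr_fun (f := A.toLin' ∘ₗ (phi1 n l).toLin')
    (g := (phi1 n l).toLin' ∘ₗ A.toLin') (by rw [← Matrix.toLin'_mul, ← Matrix.toLin'_mul, h₁])
  t2p := LinearMap.congr_fun (f := A.toLin' ∘ₗ (phi2 n l).toLin')
    (g := (phi2 n l).toLin' ∘ₗ A.toLin') (by rw [← Matrix.toLin'_mul, ← Matrix.toLin'_mul, h₂])
  t1m _ := map_zero A.toLin'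
  t2m _ := map_zero A.toLin'

variable (n) (a b : ℕ) (i : Fin n)

/-- The `i`-th component of the first summand. -/
def fstCoord : ((Fin a → Fin n → k) × (Fin b → Fin n → k)) →ₗ[k] (Fin a → k) :=
  (LinearMap.proj i).compLeft (Fin a) ∘ₗ LinearMap.fst k _ _

/-- The `i`-th component of the second summand. -/
def sndCoord : ((Fin a → Fin n → k) × (Fin b → Fin n → k)) →ₗ[k] (Fin b → k) :=
  (LinearMap.proj i).compLeft (Fin b) ∘ₗ LinearMap.snd k _ _

/-- The inclusion of the `i`-th component of the first summand. -/
def fstIncl : (Fin a → k) →ₗ[k] ((Fin a → Fin n → k) × (Fin b → Fin n → k)) :=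
  LinearMap.inl k _ _ ∘ₗ (LinearMap.single k (fun _ : Fin n => k) i).compLeft (Fin a)

/-- The inclusion of the `i`-th component of the second summand. -/
def sndIncl : (Fin b → k) →ₗ[k] ((Fin a → Fin n → k) × (Fin b → Fin n → k)) :=
  LinearMap.inr k _ _ ∘ₗ (LinearMap.single k (fun _ : Fin n => k) i).compLeft (Fin b)

end

section

variable {ε : k} {n : ℕ} {l : ℙ k (Fin 2 → k)} {a b : ℕ} (ha : 0 < a) (hb : 0 < b) (i : Fin n)

theorem fstCoord_opE (x : (Fin a → Fin n → k) × (Fin b → Fin n → k)) :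
    fstCoord n a b i (opE q ε (BMod.EPlus n l) ha hb x) = stE q ε a (fstCoord n a b i x) := by
  funext j
  by_cases h : j.val + 1 < a
  · refine (congrFun (opE_fst_lt (BMod.EPlus n l) ha hb x j h) i).trans ?_
    refine Eq.trans ?_ (dif_pos h).symm
    exact add_zero _
  · refine (congrFun (opE_fst_last (BMod.EPlus n l) ha hb x j h) i).trans ?_
    exact (show stE q ε a (fstCoord n a b i x) j = 0 from dif_neg h).symm

theorem fstCoord_opF (x : (Fin a → Fin n → k) × (Fin b → Fin n → k)) :
    fstCoord n a b i (opF (BMod.EPlus n l) ha hb x) = stF k a (fstCoord n a b i x) := by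
  funext j
  by_cases h : 0 < j.val
  · refine (congrFun (opF_fst_pos (BMod.EPlus n l) ha hb x j h) i).trans ?_
    exact (if_pos h).symm
  · refine (congrFun (opF_fst_zero (BMod.EPlus n l) ha hb x j h) i).trans ?_
    exact (show stF k a (fstCoord n a b i x) j = 0 from if_neg h).symm

theorem sndIncl_stE (y : Fin b → k) :
    sndIncl n a b i (stE q (-ε) b y) = opE q ε (BMod.EPlus n l) ha hb (sndIncl n a b i y) := by
  refine Prod.ext (funext fun j => ?_) (funext fun j => ?_)
  · by_cases h : j.val + 1 < a
    · refine Eq.trans ?_ (opE_fst_lt (BMod.EPlus n l) ha hb (sndIncl n a b i y) j h).symm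
      exact ((add_zero _).trans (smul_zero _)).symm
    · exact (opE_fst_last (BMod.EPlus n l) ha hb (sndIncl n a b i y) j h).symm
  · by_cases h : j.val + 1 < b
    · refine Eq.trans ?_ (opE_snd_lt (BMod.EPlus n l) ha hb (sndIncl n a b i y) j h).symm
      refine (congrArg (Pi.single (M := fun _ : Fin n => k) i) (dif_pos h)).trans ?_
      refine Eq.trans ?_ (congrArg (_ + ·) (map_zero (BMod.EPlus n l).t1p).symm)
      exact (Pi.single_smul i (coeffE q (-ε) b (j.val + 1)) (y ⟨j.val + 1, h⟩)).trans
        (add_zero (M := Fin n → k) _).symm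
    · refine Eq.trans ?_ (opE_snd_last (BMod.EPlus n l) ha hb (sndIncl n a b i y) j h).symm
      refine (congrArg (Pi.single (M := fun _ : Fin n => k) i) (dif_neg h)).trans ?_
      exact (Pi.single_zero i).trans (map_zero (BMod.EPlus n l).t2p).symm

theorem sndIncl_stF (y : Fin b → k) :
    sndIncl n a b i (stF k b y) = opF (BMod.EPlus n l) ha hb (sndIncl n a b i y) := by
  refine Prod.ext (funext fun j => ?_) (funext fun j => ?_)
  · by_cases h : 0 < j.val
    · exact (opF_fst_pos (BMod.EPlus n l) ha hb (sndIncl n a b i y) j h).symm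
    · exact (opF_fst_zero (BMod.EPlus n l) ha hb (sndIncl n a b i y) j h).symm
  · by_cases h : 0 < j.val
    · refine Eq.trans ?_ (opF_snd_pos (BMod.EPlus n l) ha hb (sndIncl n a b i y) j h).symm
      exact congrArg (Pi.single (M := fun _ : Fin n => k) i) (if_pos h)
    · refine Eq.trans ?_ (opF_snd_zero (BMod.EPlus n l) ha hb (sndIncl n a b i y) j h).symm
      refine (congrArg (Pi.single (M := fun _ : Fin n => k) i) (if_neg h)).trans ?_
      exact (Pi.single_zero i).trans (map_zero (BMod.EPlus n l).t1p).symm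

theorem sndIncl_diagOp (y : Fin b → k) :
    sndIncl n a b i (diagOp (wt q (-ε) b) y)
      = opK q ε (BMod.EPlus n l) a b (sndIncl n a b i y) := by
  exact Prod.ext (funext fun j => (smul_zero (wt q ε a j.val) : _ • (0 : Fin n → k) = 0).symm)
    (funext fun j => Pi.single_smul i _ _)

theorem fstIncl_diagOp (y : Fin a → k) :
    fstIncl n a b i (diagOp (wt q ε a) y)
      = opK q ε (BMod.EPlus n l) a b (fstIncl n a b i y) := by
  exact Prod.ext (funext fun j => Pi.single_smul i _ _)
    (funext fun j => (smul_zero (wt q (-ε) b j.val) : _ • (0 : Fin n → k) = 0).symm)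

theorem fstCoord_fstIncl (i j : Fin n) (y : Fin a → k) :
    fstCoord n a b i (fstIncl n a b j y) = if i = j then y else 0 := by
  funext x
  refine (Pi.single_apply j (y x) i).trans ?_
  split_ifs <;> rfl

theorem sndCoord_sndIncl (i j : Fin n) (y : Fin b → k) :
    sndCoord n a b i (sndIncl n a b j y) = if i = j then y else 0 := by
  funext x
  refine (Pi.single_apply j (y x) i).trans ?_
  split_ifs <;> rfl

theorem incl_coord_decomp (x : (Fin a → Fin n → k) × (Fin b → Fin n → k)) :
    x = ∑ i, fstIncl n a b i (fstCoord n a b i x) + ∑ i, sndIncl n a b i (sndCoord n a b i x) := by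
  have h1 : ∀ (c : ℕ) (y : Fin c → Fin n → k),
      ∑ i, (LinearMap.single k (fun _ : Fin n => k) i).compLeft (Fin c)
        ((LinearMap.proj (R := k) (φ := fun _ : Fin n => k) i).compLeft (Fin c) y) = y := by
    intro c y
    funext j
    rw [Finset.sum_apply]
    exact Finset.univ_sum_single (y j)
  refine Prod.ext ?_ ?_
  · rw [Prod.fst_add, Prod.fst_sum, Prod.fst_sum]
    conv_lhs => rw [← h1 a x.1]
    refine (add_zero _).symm.trans (congrArg₂ (· + ·) rfl ?_)
    exact (Finset.sum_eq_zero fun i _ => rfl).symm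
  · rw [Prod.snd_add, Prod.snd_sum, Prod.snd_sum]
    conv_lhs => rw [← h1 b x.2]
    refine (zero_add _).symm.trans (congrArg₂ (· + ·) ?_ rfl)
    exact (Finset.sum_eq_zero fun i _ => rfl).symm

end

variable {ε : k} (hp : 2 ≤ p) (hq : IsPrimitiveRoot q (2 * p)) (hε : ε * ε = 1) {a : ℕ}
  (ha : 0 < a ∧ a < p) (n : ℕ) (l : ℙ k (Fin 2 → k))

/-- The module of `E⁺(n; λ)` as an extension of simple modules. -/
noncomputable def PhiSigned.split :
    SplitExt (PhiSigned hp hq hε a ha (BMod.EPlus n l)) (XMod hp hq hε ha.2.le)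
      (XMod hp hq (sign_neg hε) (Nat.sub_le p a)) n where
  π i := ofHomHom _ _ (fstCoord n a (p - a) i) (fstCoord_opE ha.1 (Nat.sub_pos_of_lt ha.2) i)
    (fstCoord_opF ha.1 (Nat.sub_pos_of_lt ha.2) i) (fun _ => rfl)
  ι i := ofHomHom _ _ (sndIncl n a (p - a) i) (sndIncl_stE ha.1 (Nat.sub_pos_of_lt ha.2) i)
    (sndIncl_stF ha.1 (Nat.sub_pos_of_lt ha.2) i) (sndIncl_diagOp i)
  σ i := fstIncl n a (p - a) i
  ρ i := sndCoord n a (p - a) i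
  σ_K i x := (congrArg (fstIncl n a (p - a) i) (lift_act _ x).2.2).trans
    ((fstIncl_diagOp i _).trans (lift_act _ _).2.2.symm)
  ρ_K i x := (congrArg (sndCoord n a (p - a) i) (lift_act _ x).2.2).trans
    (lift_act (simple_rel hp hq (sign_neg hε) (Nat.sub_le p a)) (sndCoord n a (p - a) i x)).2.2.symm
  π_σ i j x := fstCoord_fstIncl i j x
  ρ_ι i j y := sndCoord_sndIncl i j y
  π_ι _ _ _ := rfl
  decomp v := incl_coord_decomp v

theorem PhiSigned.split_actsBy {A : Matrix (Fin n) (Fin n) k} (h₁ : A * phi1 n l = phi1 n l * A)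
    (h₂ : A * phi2 n l = phi2 n l * A) :
    (PhiSigned.split hp hq hε ha n l).ActsBy
      (phiMap hp hq hε ha (BMod.EPlus.endo A h₁ h₂)) A := by
  intro i v
  funext j
  have e : ∀ f : Fin n → Fin a → k, (∑ i, f i) j = ∑ i, f i j := fun f => Finset.sum_apply _ _ _
  refine Eq.trans ?_ (e fun i' => A i i' • fstCoord n a (p - a) i' v).symm
  exact congrFun (Matrix.toLin'_apply A (PhiSigned.fst hp hq hε ha v j)) i

end SplitEPlus

section KroneckerRange

section

variable (hp : 2 ≤ p) (hq : IsPrimitiveRoot q (2 * p)) {ε : k} (hε : ε * ε = 1)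

theorem tmap_tmapU_comm {X X' N N' : UMod p q} (α : X →ₗ[k] X') (β : N →ₗ[k] N')
    (f : X →ₗ[Ubar p q] X) (f' : X' →ₗ[Ubar p q] X') (g : N →ₗ[Ubar p q] N)
    (g' : N' →ₗ[Ubar p q] N') (hα : ∀ x, α (f x) = f' (α x)) (hβ : ∀ x, β (g x) = g' (β x))
    (v : X.tensor hp hq N) :
    tmap hp hq α β (tmapU hp hq f g v) = tmapU hp hq f' g' (tmap hp hq α β v) :=
  tm_induction hp hq (P := fun v => tmap hp hq α β (tmapU hp hq f g v)
      = tmapU hp hq f' g' (tmap hp hq α β v))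
    (fun a b => by rw [tmapU_tm, tmap_tm, tmap_tm, tmapU_tm, hα, hβ])
    (fun a b ha hb => by rw [map_add, map_add, ha, hb, map_add, map_add]) v

theorem XMod.eq_smul_bas_zero (h1 : 1 ≤ p) (x : XMod hp hq hε h1) :
    ∃ c : k, x = c • XMod.bas hp hq hε h1 0 :=
  ⟨(show Fin 1 → k from x) 0, (XMod.eq_sum hp hq hε h1 x).trans (Fin.sum_univ_one _)⟩

theorem XMod.act_bas_zero (h1 : 1 ≤ p) :
    𝐄 ⋆ XMod.bas hp hq hε h1 0 = 0 ∧ 𝐅 ⋆ XMod.bas hp hq hε h1 0 = 0 ∧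
      𝐊 ⋆ XMod.bas hp hq hε h1 0 = ε • XMod.bas hp hq hε h1 0 ∧
      𝐋 ⋆ XMod.bas hp hq hε h1 0 = ε • XMod.bas hp hq hε h1 0 := by
  have hw : wt q ε 1 0 = ε := by simp [wt]
  rw [XMod.E_bas, XMod.F_bas, XMod.K_bas, XMod.L_bas, coeff_zero, zero_smul, hw,
    inv_eq_of_mul_eq_one_left hε]
  exact ⟨rfl, XMod.bas_of_le hp hq hε h1 (le_refl 1), rfl, rfl⟩

variable {N : UMod p q} {s' : ℕ} {g₁ g₂ : N →ₗ[Ubar p q] N}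

theorem kronRange_left_one (hs : 0 < s' ∧ s' < p) (hN : ∀ v : N, cas p q ⋆ v = gam q 1 s' • v)
    (hK : Kron 1 s' 1 g₁ g₂) (h1 : 1 ≤ p) :
    KronRange ((XMod hp hq hε h1).tensor hp hq N) ε (ε ^ (p - 1)) (-1) s' 1
      (tmapU hp hq LinearMap.id g₁) (tmapU hp hq LinearMap.id g₂) := by
  obtain ⟨bE, bF, bK, bL⟩ := XMod.act_bas_zero hp hq hε h1
  have surj : Function.Surjective
      (tm hp hq (M := XMod hp hq hε h1) (N := N) (XMod.bas hp hq hε h1 0)) := fun v =>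
    tm_induction hp hq (P := fun v => ∃ w, tm hp hq (XMod.bas hp hq hε h1 0) w = v)
      (fun x w => by
        obtain ⟨c, rfl⟩ := XMod.eq_smul_bas_zero hp hq hε h1 x
        exact ⟨c • w, by rw [map_smul, map_smul, LinearMap.smul_apply]⟩)
      (fun v w ⟨v', hv⟩ ⟨w', hw⟩ => ⟨v' + w', by rw [map_add, hv, hw]⟩) v
  have hfin : Module.finrank k N = Module.finrank k ((XMod hp hq hε h1).tensor hp hq N) := by
    rw [finrank_tensor, finrank_XMod, one_mul]
  have := KronRange.base hp hq hε (one_mul 1) hε (one_mul ε) (-1) hs hN hK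
    (tm hp hq (XMod.bas hp hq hε h1 0))
    ⟨(LinearMap.injective_iff_surjective_of_finrank_eq_finrank hfin).mpr surj, surj⟩
    (fun v => by rw [E_tm, bE, map_zero, LinearMap.zero_apply, zero_add, one_smul])
    (fun v => by rw [F_tm, bF, bL, map_zero, LinearMap.zero_apply, zero_add, map_smul,
      LinearMap.smul_apply])
    (fun v => by rw [K_tm, bK, map_smul, LinearMap.smul_apply])
    (f₁ := tmapU hp hq LinearMap.id g₁) (f₂ := tmapU hp hq LinearMap.id g₂)
    (fun v => tmapU_tm hp hq _ _ _ _) (fun v => tmapU_tm hp hq _ _ _ _)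
  rwa [mul_one] at this

theorem kronRange_right_one (hs : 0 < s' ∧ s' < p) (hN : ∀ v : N, cas p q ⋆ v = gam q 1 s' • v)
    (hK : Kron 1 s' 1 g₁ g₂) (h1 : 1 ≤ p) :
    KronRange (N.tensor hp hq (XMod hp hq hε h1)) ε ε 1 s' 1
      (tmapU hp hq g₁ LinearMap.id) (tmapU hp hq g₂ LinearMap.id) := by
  obtain ⟨bE, bF, bK, bL⟩ := XMod.act_bas_zero hp hq hε h1
  have surj : Function.Surjective
      ((tm hp hq (M := N) (N := XMod hp hq hε h1)).flip (XMod.bas hp hq hε h1 0)) := fun v =>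
    tm_induction hp hq (P := fun v => ∃ w, tm hp hq w (XMod.bas hp hq hε h1 0) = v)
      (fun w x => by
        obtain ⟨c, rfl⟩ := XMod.eq_smul_bas_zero hp hq hε h1 x
        exact ⟨c • w, by rw [map_smul, map_smul, LinearMap.smul_apply]⟩)
      (fun v w ⟨v', hv⟩ ⟨w', hw⟩ => ⟨v' + w', by rw [map_add, LinearMap.add_apply, hv, hw]⟩) v
  have hfin : Module.finrank k N = Module.finrank k (N.tensor hp hq (XMod hp hq hε h1)) := by
    rw [finrank_tensor, finrank_XMod, mul_one]
  have := KronRange.base hp hq hε hε (one_mul 1) (mul_one ε) 1 hs hN hK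
    ((tm hp hq).flip (XMod.bas hp hq hε h1 0))
    ⟨(LinearMap.injective_iff_surjective_of_finrank_eq_finrank hfin).mpr surj, surj⟩
    (fun v => by
      rw [LinearMap.flip_apply, LinearMap.flip_apply, E_tm, bE, bK, map_zero, add_zero, map_smul])
    (fun v => by
      rw [LinearMap.flip_apply, LinearMap.flip_apply, F_tm, bF, map_zero, add_zero, one_smul])
    (fun v => by rw [LinearMap.flip_apply, LinearMap.flip_apply, K_tm, bK, map_smul])
    (f₁ := tmapU hp hq g₁ LinearMap.id) (f₂ := tmapU hp hq g₂ LinearMap.id)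
    (fun v => tmapU_tm hp hq _ _ _ _) (fun v => tmapU_tm hp hq _ _ _ _)
  rwa [one_pow, one_mul] at this

theorem kronRange_left [CharZero k] (hs : 0 < s' ∧ s' < p)
    (hN : ∀ v : N, cas p q ⋆ v = gam q 1 s' • v) (hK : Kron 1 s' 1 g₁ g₂) {r : ℕ} (h1 : 1 ≤ r) :
    ∀ hr : r ≤ p, KronRange ((XMod hp hq hε hr).tensor hp hq N) ε (ε ^ (p - 1)) (-1) s' r
      (tmapU hp hq LinearMap.id g₁) (tmapU hp hq LinearMap.id g₂) := by
  induction r, h1 using Nat.le_induction with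
  | base => exact kronRange_left_one hp hq hε hs hN hK
  | succ r h1 ih =>
    intro hr
    obtain ⟨α, β, hS, α', β', hinv⟩ := XMod.exists_leftShift hp hq hε hr h1
    exact KronRange.step hp hq (sign_neg (one_mul 1))
      (fun ε t _ => ⟨LadderCoeff.left hp hq ε t, rfl, (hS.tensor hp hq N).ladder hp hq ε t⟩)
      (fun v => tmap_jointly_injective_left hp hq hinv v)
      (fun v => tmap_tmapU_comm hp hq _ _ _ _ _ _ (fun _ => rfl) (fun _ => rfl) v)
      (fun v => tmap_tmapU_comm hp hq _ _ _ _ _ _ (fun _ => rfl) (fun _ => rfl) v)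
      (fun v => tmap_tmapU_comm hp hq _ _ _ _ _ _ (fun _ => rfl) (fun _ => rfl) v)
      (fun v => tmap_tmapU_comm hp hq _ _ _ _ _ _ (fun _ => rfl) (fun _ => rfl) v)
      hε h1 (ih (Nat.le_of_succ_le hr))

theorem kronRange_right [CharZero k] (hs : 0 < s' ∧ s' < p)
    (hN : ∀ v : N, cas p q ⋆ v = gam q 1 s' • v) (hK : Kron 1 s' 1 g₁ g₂) {r : ℕ} (h1 : 1 ≤ r) :
    ∀ hr : r ≤ p, KronRange (N.tensor hp hq (XMod hp hq hε hr)) ε ε 1 s' r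
      (tmapU hp hq g₁ LinearMap.id) (tmapU hp hq g₂ LinearMap.id) := by
  induction r, h1 using Nat.le_induction with
  | base => exact kronRange_right_one hp hq hε hs hN hK
  | succ r h1 ih =>
    intro hr
    obtain ⟨α, β, hS, α', β', hinv⟩ := XMod.exists_rightShift hp hq hε hr h1
    exact KronRange.step hp hq (one_mul 1)
      (fun ε t hε => ⟨LadderCoeff.right hp hq ε t, rfl, (hS.tensor hp hq N).ladder hp hq hε t⟩)
      (fun v => tmap_jointly_injective_right hp hq hinv v)
      (fun v => tmap_tmapU_comm hp hq _ _ _ _ _ _ (fun _ => rfl) (fun _ => rfl) v)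
      (fun v => tmap_tmapU_comm hp hq _ _ _ _ _ _ (fun _ => rfl) (fun _ => rfl) v)
      (fun v => tmap_tmapU_comm hp hq _ _ _ _ _ _ (fun _ => rfl) (fun _ => rfl) v)
      (fun v => tmap_tmapU_comm hp hq _ _ _ _ _ _ (fun _ => rfl) (fun _ => rfl) v)
      hε h1 (ih (Nat.le_of_succ_le hr))

end

section

variable (hp : 2 ≤ p) (hq : IsPrimitiveRoot q (2 * p)) {a : ℕ} (ha : 0 < a ∧ a < p) (n : ℕ)
  (l : ℙ k (Fin 2 → k))

/-- The endomorphism of the module of `E⁺(n; λ)` given by `φ₁`. -/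
noncomputable def PhiSigned.phi1Endo : PhiSigned hp hq (one_mul 1) a ha (BMod.EPlus n l) →ₗ[Ubar p q]
    PhiSigned hp hq (one_mul 1) a ha (BMod.EPlus n l) :=
  phiMap hp hq (one_mul 1) ha (BMod.EPlus.endo (phi1 n l) rfl (phi_commute n l))

/-- The endomorphism of the module of `E⁺(n; λ)` given by `φ₂`. -/
noncomputable def PhiSigned.phi2Endo : PhiSigned hp hq (one_mul 1) a ha (BMod.EPlus n l) →ₗ[Ubar p q]
    PhiSigned hp hq (one_mul 1) a ha (BMod.EPlus n l) :=
  phiMap hp hq (one_mul 1) ha (BMod.EPlus.endo (phi2 n l) (phi_commute n l).symm rfl)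

theorem PhiSigned.cas_EPlus (v : PhiSigned hp hq (one_mul 1) a ha (BMod.EPlus n l)) :
    cas p q ⋆ v = gam q 1 a • v :=
  PhiSigned.cas_smul hp hq (one_mul 1) ha (fun _ => rfl) (fun _ => map_zero _) v

theorem PhiSigned.kron_EPlus :
    Kron 1 a 1 (PhiSigned.phi2Endo hp hq ha n l) (PhiSigned.phi1Endo hp hq ha n l) :=
  PhiSigned.kron hp hq (one_mul 1) ha rfl rfl (fun _ => phi_jointly_injective) _ _
    (LinearMap.congr_fun (f := (phi2 n l).toLin' ∘ₗ (phi1 n l).toLin')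
      (g := (phi1 n l).toLin' ∘ₗ (phi2 n l).toLin')
      (by rw [← Matrix.toLin'_mul, ← Matrix.toLin'_mul, phi_commute]))

end

end KroneckerRange

section TensorBlocks

/-- The dimension of a weight space of a block. -/
noncomputable def wtDim (hp : 2 ≤ p) (hq : IsPrimitiveRoot q (2 * p)) (M : UMod p q) (γ ω : k) : ℕ :=
  Module.finrank k (wtSub p q (M.block hp hq γ) ω)

theorem SplitExt.wtDim_eq [CharZero k] (hp : 2 ≤ p) (hq : IsPrimitiveRoot q (2 * p))
    {M X Y : UMod p q} {m : ℕ} (S : SplitExt M X Y m) {γ : k} (hγ : γ ∈ casValues p q) (ω : k) :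
    wtDim hp hq M γ ω = m * (wtDim hp hq X γ ω + wtDim hp hq Y γ ω) :=
  (S.block hp hq hγ).finrank_wtSub ω

/-- A highest weight vector of a tensor product of simple modules, in its block. -/
theorem one_le_wtDim (hp : 2 ≤ p) (hq : IsPrimitiveRoot q (2 * p)) {ε ε' ε'' : k} (hε : ε * ε = 1)
    (hε' : ε' * ε' = 1) (h : ε * ε' = ε'') {r r' l t : ℕ} (hr : r ≤ p) (hr' : r' ≤ p) (hl : l < r)
    (hl' : l < r') (ht : r + r' = 2 * l + t + 1) {γ : k} (hγ : gam q ε'' t = γ) :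
    1 ≤ wtDim hp hq ((XMod hp hq hε hr).tensor hp hq (XMod hp hq hε' hr')) γ
      (ε'' * q ^ ((t : ℤ) - 1)) := by
  obtain ⟨v, h0, -, hK, hB⟩ := exists_highest hp hq hε hε' hr hr' hl hl' ht
  rw [h] at hK hB
  rw [hγ] at hB
  have : Nontrivial (wtSub p q (((XMod hp hq hε hr).tensor hp hq (XMod hp hq hε' hr')).block hp hq γ)
      (ε'' * q ^ ((t : ℤ) - 1))) :=
    ⟨⟨⟨⟨v, hB⟩, Subtype.ext hK⟩, 0, fun e => h0 (congrArg (fun x => x.1.1) e)⟩⟩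
  exact Module.finrank_pos

/-- There are `d` vectors of weight `ω` whose images under `F E` are linearly independent. -/
def HasRank (Q : UMod p q) (ω : k) (d : ℕ) : Prop :=
  ∃ u : Fin d → Q, (∀ i, 𝐊 ⋆ u i = ω • u i) ∧ LinearIndependent k fun i => 𝐅 ⋆ 𝐄 ⋆ u i

theorem HasRank.of_fintype {Q : UMod p q} {ω : k} {ι : Type*} [Fintype ι] {d : ℕ}
    (hd : Fintype.card ι = d) {u : ι → Q} (hu : ∀ i, 𝐊 ⋆ u i = ω • u i)
    (hi : LinearIndependent k fun i => 𝐅 ⋆ 𝐄 ⋆ u i) : HasRank Q ω d :=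
  ⟨u ∘ (Fintype.equivFinOfCardEq hd).symm, fun _ => hu _,
    hi.comp _ (Fintype.equivFinOfCardEq hd).symm.injective⟩

namespace SplitExt

variable {M X Y : UMod p q} {m : ℕ}

theorem hasRank_of_quotient (S : SplitExt M X Y m) {ω : k} {d : ℕ} (h : HasRank X ω d) :
    HasRank M ω (m * d) := by
  obtain ⟨u, hu, hi⟩ := h
  refine HasRank.of_fintype (ι := Fin m × Fin d) (by simp)
    (u := fun x => S.σ x.1 (u x.2)) (fun x => by rw [← S.σ_K, hu, map_smul]) ?_
  rw [Fintype.linearIndependent_iff] at hi ⊢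
  intro c hc x
  refine hi (fun j => c (x.1, j)) ?_ x.2
  have := congrArg (S.π x.1) hc
  rw [map_zero, map_sum, Fintype.sum_prod_type] at this
  rw [← this]
  refine ((Finset.sum_eq_single x.1 ?_ ?_).trans ?_).symm
  · intro i _ hne
    refine Finset.sum_eq_zero fun j _ => ?_
    rw [LinearMap.map_smul_of_tower, map_act, map_act, S.π_σ, if_neg hne.symm, act_zero, act_zero,
      smul_zero]
  · exact fun hn => absurd (Finset.mem_univ _) hn
  · refine Finset.sum_congr rfl fun j _ => ?_
    rw [LinearMap.map_smul_of_tower, map_act, map_act, S.π_σ, if_pos rfl]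

theorem hasRank_of_sub (S : SplitExt M X Y m) {ω : k} {d : ℕ} (h : HasRank Y ω d) :
    HasRank M ω (m * d) := by
  obtain ⟨u, hu, hi⟩ := h
  refine HasRank.of_fintype (ι := Fin m × Fin d) (by simp)
    (u := fun x => S.ι x.1 (u x.2))
    (fun x => by rw [← map_act, hu, LinearMap.map_smul_of_tower]) ?_
  rw [Fintype.linearIndependent_iff] at hi ⊢
  intro c hc x
  refine hi (fun j => c (x.1, j)) ?_ x.2
  have := congrArg (S.ρ x.1) hc
  rw [map_zero, map_sum, Fintype.sum_prod_type] at this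
  rw [← this]
  refine ((Finset.sum_eq_single x.1 ?_ ?_).trans ?_).symm
  · intro i _ hne
    refine Finset.sum_eq_zero fun j _ => ?_
    rw [map_smul, ← map_act, ← map_act, S.ρ_ι, if_neg hne.symm, smul_zero]
  · exact fun hn => absurd (Finset.mem_univ _) hn
  · refine Finset.sum_congr rfl fun j _ => ?_
    rw [map_smul, ← map_act, ← map_act, S.ρ_ι, if_pos rfl]

end SplitExt

theorem hasRank_one [CharZero k] (hp : 2 ≤ p) (hq : IsPrimitiveRoot q (2 * p)) {ε ε' ε'' : k}
    (hε : ε * ε = 1) (hε' : ε' * ε' = 1) (h : ε * ε' = ε'') {r r' t : ℕ} (hr : r ≤ p) (hr' : r' ≤ p)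
    (htp : t < p) (hodd : (t + r + r') % 2 = 1) (ht : 2 * p + 1 ≤ t + r + r') :
    HasRank (((XMod hp hq hε hr).tensor hp hq (XMod hp hq hε' hr')).block hp hq (gam q ε'' t))
      (ε'' * q ^ ((t : ℤ) - 1)) 1 := by
  obtain ⟨u, h0, hK, hB⟩ := exists_projective_generator hp hq hε hε' hr hr'
    (l := (r + r' - t - 1) / 2) (l₀ := (r + r' + t - 1) / 2 - p) htp (by omega) (by omega)
    (by omega) (by omega)
  rw [h] at hK hB
  refine ⟨fun _ => ⟨u, hB⟩, fun _ => Subtype.ext hK, ?_⟩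
  rw [linearIndependent_unique_iff]
  exact fun e => h0 (congrArg Subtype.val e)

theorem HasRank.le_finrank [CharZero k] (hp : 2 ≤ p) (hq : IsPrimitiveRoot q (2 * p)) {ε : k}
    (hε : ε * ε = 1) {a d : ℕ} (ha : 0 < a ∧ a < p) {Q : UMod p q}
    (hQ : ∀ v : Q, InBl (p := p) (q := q) (gam q ε a) v)
    (h : HasRank Q (ε * q ^ ((a : ℤ) - 1)) d) : 2 * p * d ≤ Module.finrank k Q := by
  obtain ⟨u, hu, hi⟩ := h
  obtain ⟨h1, h2⟩ := finrank_ge_of_rank hp hq hε ha hQ hu hi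
  rw [Fintype.card_fin] at h1 h2
  have h3 := finrank_block hp hq hε ha hQ
  change _ = a * Module.finrank k (BMod.ofBlock Q hp hq hε ha hQ).Vp
    + (p - a) * Module.finrank k (BMod.ofBlock Q hp hq hε ha hQ).Vm at h3
  rw [h3]
  calc 2 * p * d = a * (2 * d) + (p - a) * (2 * d) := by
        rw [← add_mul, Nat.add_sub_cancel' ha.2.le]
        ring
    _ ≤ _ := Nat.add_le_add (Nat.mul_le_mul_left _ h1) (Nat.mul_le_mul_left _ h2)

end TensorBlocks

section TensorProduct

theorem ExistsShortExact.congr {R A A' B C C' : Type*} [Ring R] [AddCommGroup A] [Module R A]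
    [AddCommGroup A'] [Module R A'] [AddCommGroup B] [Module R B] [AddCommGroup C] [Module R C]
    [AddCommGroup C'] [Module R C'] (h : ExistsShortExact R A B C) (e : A ≃ₗ[R] A')
    (e' : C ≃ₗ[R] C') : ExistsShortExact R A' B C' := by
  obtain ⟨f, g, hf, hfg, hg⟩ := h
  refine ⟨f ∘ₗ e.symm.toLinearMap, e'.toLinearMap ∘ₗ g, hf.comp e.symm.injective, fun x => ?_,
    e'.surjective.comp hg⟩
  rw [LinearMap.comp_apply, LinearEquiv.coe_coe, LinearEquiv.map_eq_zero_iff, hfg x]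
  constructor
  · rintro ⟨y, rfl⟩
    exact ⟨e y, by simp⟩
  · rintro ⟨y, rfl⟩
    exact ⟨e.symm y, rfl⟩

theorem SplitExt.exists_equiv_block [CharZero k] (hp : 2 ≤ p) (hq : IsPrimitiveRoot q (2 * p))
    {R X Y : UMod p q} {n : ℕ} (S : SplitExt R X Y n) {ε : k} (hε : ε * ε = 1) {a : ℕ}
    (ha : 0 < a ∧ a < p) {l : ℙ k (Fin 2 → k)} {g₁ g₂ : R →ₗ[Ubar p q] R}
    (h₁ : S.ActsBy g₁ (phi2 n l)) (h₂ : S.ActsBy g₂ (phi1 n l)) {ρ : k} (hρ : ρ ≠ 0)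
    (hK : Kron ε a ρ g₁ g₂) {γ ω ω' : k} (hγ : gam q ε a = γ) (hω : ε * q ^ ((a : ℤ) - 1) = ω)
    (hω' : -ε * q ^ (((p - a : ℕ) : ℤ) - 1) = ω') (dX : wtDim hp hq X γ ω = 1)
    (dY : wtDim hp hq Y γ ω = 0) (dX' : wtDim hp hq X γ ω' = 0) (dY' : wtDim hp hq Y γ ω' = 1) :
    Nonempty (R.block hp hq γ ≃ₗ[Ubar p q]
      PhiSigned hp hq hε a ha (BMod.EPlus n (P1.scale ρ l))) := by
  subst hγ hω hω'
  have hm := gam_mem_casValues hp hq hε a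
  exact (S.block hp hq hm).exists_equiv_EPlus hp hq hε ha (UMod.block.inBl hp hq _)
    (h₁.block hp hq hm) (h₂.block hp hq hm) hρ (hK.block hp hq) dX dY dX' dY'

/-- The module of `E⁺(n; λ)`. -/
noncomputable abbrev EMod (hp : 2 ≤ p) (hq : IsPrimitiveRoot q (2 * p)) {s : ℕ} (hs : 0 < s ∧ s < p)
    (n : ℕ) (l : ℙ k (Fin 2 → k)) : UMod p q :=
  PhiSigned hp hq (one_mul (1 : k)) s hs (BMod.EPlus n l)

/-- The simple quotient of `E⁺(n; λ)`. -/
noncomputable abbrev XTop (hp : 2 ≤ p) (hq : IsPrimitiveRoot q (2 * p)) {s : ℕ}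
    (hs : 0 < s ∧ s < p) : UMod p q := XMod hp hq (one_mul (1 : k)) hs.2.le

/-- The simple submodule of `E⁺(n; λ)`. -/
noncomputable abbrev XBot (hp : 2 ≤ p) (hq : IsPrimitiveRoot q (2 * p)) (s : ℕ) : UMod p q :=
  XMod hp hq (sign_neg (one_mul (1 : k))) (Nat.sub_le p s)

section

variable [CharZero k] (hp : 2 ≤ p) (hq : IsPrimitiveRoot q (2 * p)) {s s' : ℕ} (hs : 0 < s ∧ s < p)
  (hs' : 0 < s' ∧ s' < p) (m n : ℕ) (l μ : ℙ k (Fin 2 → k))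

/-- The first factor as an extension, tensored with a module. -/
noncomputable abbrev splitRight (N : UMod p q) := (PhiSigned.split hp hq (one_mul 1) hs m l).tensorRight hp hq N

/-- The second factor as an extension, tensored with a module. -/
noncomputable abbrev splitLeft (N : UMod p q) := (PhiSigned.split hp hq (one_mul 1) hs' n μ).tensorLeft hp hq N

theorem wtDim_tensor {γ : k} (hγ : γ ∈ casValues p q) (ω : k) :
    wtDim hp hq ((EMod hp hq hs m l).tensor hp hq (EMod hp hq hs' n μ)) γ ω
      = m * n * ((wtDim hp hq ((XTop hp hq hs).tensor hp hq (XTop hp hq hs')) γ ω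
        + wtDim hp hq ((XTop hp hq hs).tensor hp hq (XBot hp hq s')) γ ω)
      + (wtDim hp hq ((XBot hp hq s).tensor hp hq (XTop hp hq hs')) γ ω
        + wtDim hp hq ((XBot hp hq s).tensor hp hq (XBot hp hq s')) γ ω)) := by
  rw [(splitRight hp hq hs m l _).wtDim_eq hp hq hγ,
    (splitLeft hp hq hs' n μ _).wtDim_eq hp hq hγ, (splitLeft hp hq hs' n μ _).wtDim_eq hp hq hγ]
  ring

theorem finrank_block_tensor {t : ℕ} (ht : 0 < t ∧ t < p) :
    Module.finrank k (((EMod hp hq hs m l).tensor hp hq (EMod hp hq hs' n μ)).block hp hq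
        (gam q 1 t))
      = t * wtDim hp hq ((EMod hp hq hs m l).tensor hp hq (EMod hp hq hs' n μ)) (gam q 1 t)
          (1 * q ^ ((t : ℤ) - 1))
        + (p - t) * wtDim hp hq ((EMod hp hq hs m l).tensor hp hq (EMod hp hq hs' n μ)) (gam q 1 t)
          (-1 * q ^ (((p - t : ℕ) : ℤ) - 1)) :=
  finrank_block hp hq (one_mul 1) ht (UMod.block.inBl hp hq _)

end

/-- The conditions on the index of a block which is not projective. -/
def Mid (p s s' t : ℕ) : Prop :=
  (t + s + s') % 2 = 1 ∧ s + 1 ≤ t + s' ∧ s' + 1 ≤ t + s ∧ t + 1 ≤ s + s' ∧ t + s + s' + 1 ≤ 2 * p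

theorem Mid.lt {p s s' t : ℕ} (h : Mid p s s' t) : 0 < t ∧ t < p := by
  obtain ⟨h0, h1, h2, h3, h4⟩ := h
  omega

section

variable (hp : 2 ≤ p) (hq : IsPrimitiveRoot q (2 * p)) {s s' t : ℕ} (hs : 0 < s ∧ s < p)
  (hs' : 0 < s' ∧ s' < p)

theorem one_le_wtDim_pieces (ht : 0 < t ∧ t < p) (h : Mid p s s' t) :
    1 ≤ wtDim hp hq ((XTop hp hq hs).tensor hp hq (XTop hp hq hs')) (gam q 1 t)
        (1 * q ^ ((t : ℤ) - 1)) ∧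
    1 ≤ wtDim hp hq ((XBot hp hq s).tensor hp hq (XBot hp hq s')) (gam q 1 t)
        (1 * q ^ ((t : ℤ) - 1)) ∧
    1 ≤ wtDim hp hq ((XTop hp hq hs).tensor hp hq (XBot hp hq s')) (gam q 1 t)
        (-1 * q ^ (((p - t : ℕ) : ℤ) - 1)) ∧
    1 ≤ wtDim hp hq ((XBot hp hq s).tensor hp hq (XTop hp hq hs')) (gam q 1 t)
        (-1 * q ^ (((p - t : ℕ) : ℤ) - 1)) := by
  obtain ⟨h0, h1, h2, h3, h4⟩ := h
  have hγ : gam q (-1) (p - t : ℕ) = gam q 1 t :=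
    flip_gam hp hq rfl (Nat.add_sub_cancel' ht.2.le)
  refine ⟨one_le_wtDim (l := (s + s' - t - 1) / 2) hp hq _ _ (one_mul 1) _ _ (by omega) (by omega)
      (by omega) rfl,
    one_le_wtDim (l := (2 * p - s - s' - t - 1) / 2) hp hq _ _ (by ring) _ _ (by omega) (by omega)
      (by omega) rfl,
    one_le_wtDim (l := (s + t - s' - 1) / 2) hp hq _ _ (one_mul _) _ _ (by omega) (by omega)
      (by omega) hγ,
    one_le_wtDim (l := (s' + t - s - 1) / 2) hp hq _ _ (mul_one _) _ _ (by omega) (by omega)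
      (by omega) hγ⟩

variable [CharZero k] (m n : ℕ) (l μ : ℙ k (Fin 2 → k))

theorem le_finrank_block_of_mid (ht : 0 < t ∧ t < p) (h : Mid p s s' t) :
    2 * p * (m * n) ≤ Module.finrank k (((EMod hp hq hs m l).tensor hp hq
      (EMod hp hq hs' n μ)).block hp hq (gam q 1 t)) := by
  obtain ⟨h1, h2, h3, h4⟩ := one_le_wtDim_pieces hp hq hs hs' ht h
  have hm := gam_mem_casValues hp hq (one_mul (1 : k)) t
  rw [finrank_block_tensor hp hq hs hs' m n l μ ht, wtDim_tensor hp hq hs hs' m n l μ hm,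
    wtDim_tensor hp hq hs hs' m n l μ hm]
  calc 2 * p * (m * n) = t * (m * n * 2) + (p - t) * (m * n * 2) := by
        rw [← add_mul, Nat.add_sub_cancel' ht.2.le]
        ring
    _ ≤ _ := Nat.add_le_add (Nat.mul_le_mul_left _ (Nat.mul_le_mul_left _ (by omega)))
      (Nat.mul_le_mul_left _ (Nat.mul_le_mul_left _ (by omega)))

/-- The dimensions of the weight spaces of the four tensor products of simple modules. -/
structure PieceDims (t : ℕ) (ω ω' : k) : Prop where
  pp : wtDim hp hq ((XTop hp hq hs).tensor hp hq (XTop hp hq hs')) (gam q 1 t) ω = 1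
  pm : wtDim hp hq ((XTop hp hq hs).tensor hp hq (XBot hp hq s')) (gam q 1 t) ω = 0
  mp : wtDim hp hq ((XBot hp hq s).tensor hp hq (XTop hp hq hs')) (gam q 1 t) ω = 0
  mm : wtDim hp hq ((XBot hp hq s).tensor hp hq (XBot hp hq s')) (gam q 1 t) ω = 1
  pp' : wtDim hp hq ((XTop hp hq hs).tensor hp hq (XTop hp hq hs')) (gam q 1 t) ω' = 0
  pm' : wtDim hp hq ((XTop hp hq hs).tensor hp hq (XBot hp hq s')) (gam q 1 t) ω' = 1
  mp' : wtDim hp hq ((XBot hp hq s).tensor hp hq (XTop hp hq hs')) (gam q 1 t) ω' = 1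
  mm' : wtDim hp hq ((XBot hp hq s).tensor hp hq (XBot hp hq s')) (gam q 1 t) ω' = 0

theorem pieceDims_of_finrank_le (hm : 1 ≤ m) (hn : 1 ≤ n) (ht : 0 < t ∧ t < p) (h : Mid p s s' t)
    (hle : Module.finrank k (((EMod hp hq hs m l).tensor hp hq
      (EMod hp hq hs' n μ)).block hp hq (gam q 1 t)) ≤ 2 * p * (m * n)) :
    PieceDims hp hq hs hs' t (1 * q ^ ((t : ℤ) - 1)) (-1 * q ^ (((p - t : ℕ) : ℤ) - 1)) := by
  obtain ⟨h1, h2, h3, h4⟩ := one_le_wtDim_pieces hp hq hs hs' ht h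
  have hγ := gam_mem_casValues hp hq (one_mul (1 : k)) t
  rw [finrank_block_tensor hp hq hs hs' m n l μ ht, wtDim_tensor hp hq hs hs' m n l μ hγ,
    wtDim_tensor hp hq hs hs' m n l μ hγ, mul_left_comm, mul_left_comm (p - t), ← mul_add,
    mul_comm (2 * p)] at hle
  have hle' := Nat.le_of_mul_le_mul_left hle (Nat.mul_pos hm hn)
  obtain ⟨e1, e2⟩ := eq_of_weighted_sum_le (d := 1) ht.1 (Nat.sub_pos_of_lt ht.2) (by omega)
    (by omega) (hle'.trans (by rw [Nat.add_sub_cancel' ht.2.le, mul_one]))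
  constructor <;> omega

end

end TensorProduct

section ExactSequences

variable [CharZero k] (hp : 2 ≤ p) (hq : IsPrimitiveRoot q (2 * p))

theorem exists_equiv_EPlus_of_phiSigned {Q : UMod p q} {t n : ℕ} (ht : 0 < t ∧ t < p)
    {x : ℙ k (Fin 2 → k)}
    (h : Nonempty (Q ≃ₗ[Ubar p q] PhiSigned hp hq (one_mul 1) t ht (BMod.EPlus n x))) :
    Nonempty (Q ≃ₗ[Ubar p q] EPlus hp hq t n x) := by
  rw [EPlus, Phi_eq hp hq t ht]
  exact h

theorem exists_equiv_EMinus_of_phiSigned {Q : UMod p q} {t n : ℕ} (ht : 0 < t ∧ t < p)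
    (ht' : 0 < p - t ∧ p - t < p) {x : ℙ k (Fin 2 → k)}
    (h : Nonempty (Q ≃ₗ[Ubar p q]
      PhiSigned hp hq (sign_neg (one_mul 1)) (p - t) ht' (BMod.EPlus n x))) :
    Nonempty (Q ≃ₗ[Ubar p q] EMinus hp hq (p - t) n x) := by
  rw [EMinus, Nat.sub_sub_self ht.2.le, Phi_eq hp hq t ht]
  obtain ⟨e⟩ := h
  obtain ⟨e'⟩ := exists_equiv_swap hp hq (sign_neg (one_mul (1 : k))) (one_mul 1) (by ring) ht' ht
    (Nat.sub_add_cancel ht.2.le) (BMod.EPlus n x)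
  exact ⟨e.trans e'⟩

variable {s s' t : ℕ} {hs : 0 < s ∧ s < p} {hs' : 0 < s' ∧ s' < p}

theorem minus_index (hp : 2 ≤ p) (hq : IsPrimitiveRoot q (2 * p)) (ht : 0 < t ∧ t < p) :
    gam q (-1) (p - t : ℕ) = gam q 1 t ∧
    -(-1) * q ^ (((p - (p - t) : ℕ) : ℤ) - 1) = 1 * q ^ ((t : ℤ) - 1) := by
  rw [Nat.sub_sub_self ht.2.le, neg_neg]
  exact ⟨flip_gam hp hq rfl (Nat.add_sub_cancel' ht.2.le), rfl⟩

theorem exists_equiv_left_top (ht : 0 < t ∧ t < p) (h : Mid p s s' t)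
    (D : PieceDims hp hq hs hs' t (1 * q ^ ((t : ℤ) - 1)) (-1 * q ^ (((p - t : ℕ) : ℤ) - 1)))
    (n : ℕ) (μ : ℙ k (Fin 2 → k)) :
    Nonempty (((XTop hp hq hs).tensor hp hq (EMod hp hq hs' n μ)).block hp hq (gam q 1 t)
      ≃ₗ[Ubar p q] EPlus hp hq t n (P1.scale ((-1) ^ (s - 1) * (qint q s' / qint q t)) μ)) := by
  obtain ⟨h0, h1, h2, h3, h4⟩ := h
  have hK := ((kronRange_left hp hq (one_mul 1) hs' (PhiSigned.cas_EPlus hp hq hs' n μ)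
    (PhiSigned.kron_EPlus hp hq hs' n μ) hs.1 hs.2.le) t ht.2.le h0 h1 h4).1 ⟨h2, h3⟩
  rw [one_pow, one_mul, mul_div_assoc] at hK
  refine exists_equiv_EPlus_of_phiSigned hp hq ht ((splitLeft hp hq hs' n μ _).exists_equiv_block
    hp hq _ ht ((PhiSigned.split_actsBy hp hq _ hs' n μ _ _).tensorLeft hp hq _)
    ((PhiSigned.split_actsBy hp hq _ hs' n μ _ _).tensorLeft hp hq _) ?_ hK rfl rfl rfl
    D.pp D.pm D.pp' D.pm')
  exact mul_ne_zero (pow_ne_zero _ (neg_ne_zero.mpr one_ne_zero)) (div_ne_zero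
    (qint_ne_zero hp hq (by omega) (by omega)) (qint_ne_zero hp hq (by omega) (by omega)))

theorem exists_equiv_left_bot (ht : 0 < t ∧ t < p) (h : Mid p s s' t)
    (D : PieceDims hp hq hs hs' t (1 * q ^ ((t : ℤ) - 1)) (-1 * q ^ (((p - t : ℕ) : ℤ) - 1)))
    (n : ℕ) (μ : ℙ k (Fin 2 → k)) :
    Nonempty (((XBot hp hq s).tensor hp hq (EMod hp hq hs' n μ)).block hp hq (gam q 1 t)
      ≃ₗ[Ubar p q] EMinus hp hq (p - t) n (P1.scale ((-1) ^ s * (qint q s' / qint q t)) μ)) := by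
  obtain ⟨h0, h1, h2, h3, h4⟩ := h
  have hs2 := hs.2
  have ht' : 0 < p - t ∧ p - t < p := by omega
  obtain ⟨hγ, hω⟩ := minus_index hp hq ht
  have hK := ((kronRange_left hp hq (sign_neg (one_mul 1)) hs' (PhiSigned.cas_EPlus hp hq hs' n μ)
    (PhiSigned.kron_EPlus hp hq hs' n μ) (Nat.sub_pos_of_lt hs.2) (Nat.sub_le p s)) (p - t)
    (Nat.sub_le p t) (by omega) (by omega) (by omega)).1 ⟨by omega, by omega⟩
  have hsgn : (-1 : k) ^ (p - 1) * (-1) ^ (p - s - 1) = (-1) ^ s := by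
    rw [← pow_add, show p - 1 + (p - s - 1) = s + 2 * (p - s - 1) by omega, pow_add, pow_mul]
    simp
  rw [hsgn, Nat.cast_sub ht.2.le, qint_p_sub hp hq, mul_div_assoc, ← Nat.cast_sub ht.2.le] at hK
  refine exists_equiv_EMinus_of_phiSigned hp hq ht ht'
    ((splitLeft hp hq hs' n μ _).exists_equiv_block
    hp hq _ ht' ((PhiSigned.split_actsBy hp hq _ hs' n μ _ _).tensorLeft hp hq _)
    ((PhiSigned.split_actsBy hp hq _ hs' n μ _ _).tensorLeft hp hq _) ?_ hK hγ rfl hω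
    D.mp' D.mm' D.mp D.mm)
  exact mul_ne_zero (pow_ne_zero _ (neg_ne_zero.mpr one_ne_zero)) (div_ne_zero
    (qint_ne_zero hp hq (by omega) (by omega)) (qint_ne_zero hp hq (by omega) (by omega)))

theorem exists_equiv_right_top (ht : 0 < t ∧ t < p) (h : Mid p s s' t)
    (D : PieceDims hp hq hs hs' t (1 * q ^ ((t : ℤ) - 1)) (-1 * q ^ (((p - t : ℕ) : ℤ) - 1)))
    (m : ℕ) (l : ℙ k (Fin 2 → k)) :
    Nonempty (((EMod hp hq hs m l).tensor hp hq (XTop hp hq hs')).block hp hq (gam q 1 t)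
      ≃ₗ[Ubar p q] EPlus hp hq t m (P1.scale (qint q s / qint q t) l)) := by
  obtain ⟨h0, h1, h2, h3, h4⟩ := h
  have hK := ((kronRange_right hp hq (one_mul 1) hs (PhiSigned.cas_EPlus hp hq hs m l)
    (PhiSigned.kron_EPlus hp hq hs m l) hs'.1 hs'.2.le) t ht.2.le (by omega) h2 (by omega)).1
    ⟨h1, by omega⟩
  rw [one_pow, one_mul, one_mul] at hK
  refine exists_equiv_EPlus_of_phiSigned hp hq ht ((splitRight hp hq hs m l _).exists_equiv_block
    hp hq _ ht ((PhiSigned.split_actsBy hp hq _ hs m l _ _).tensorRight hp hq _)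
    ((PhiSigned.split_actsBy hp hq _ hs m l _ _).tensorRight hp hq _) ?_ hK rfl rfl rfl
    D.pp D.mp D.pp' D.mp')
  exact div_ne_zero
    (qint_ne_zero hp hq (by omega) (by omega)) (qint_ne_zero hp hq (by omega) (by omega))

theorem exists_equiv_right_bot (ht : 0 < t ∧ t < p) (h : Mid p s s' t)
    (D : PieceDims hp hq hs hs' t (1 * q ^ ((t : ℤ) - 1)) (-1 * q ^ (((p - t : ℕ) : ℤ) - 1)))
    (m : ℕ) (l : ℙ k (Fin 2 → k)) :
    Nonempty (((EMod hp hq hs m l).tensor hp hq (XBot hp hq s')).block hp hq (gam q 1 t)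
      ≃ₗ[Ubar p q] EMinus hp hq (p - t) m (P1.scale (-(qint q s / qint q t)) l)) := by
  obtain ⟨h0, h1, h2, h3, h4⟩ := h
  have hs2 := hs'.2
  have ht' : 0 < p - t ∧ p - t < p := by omega
  obtain ⟨hγ, hω⟩ := minus_index hp hq ht
  have hK := ((kronRange_right hp hq (sign_neg (one_mul 1)) hs (PhiSigned.cas_EPlus hp hq hs m l)
    (PhiSigned.kron_EPlus hp hq hs m l) (Nat.sub_pos_of_lt hs'.2) (Nat.sub_le p s')) (p - t)
    (Nat.sub_le p t) (by omega) (by omega) (by omega)).1 ⟨by omega, by omega⟩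
  rw [one_pow, mul_one, Nat.cast_sub ht.2.le, qint_p_sub hp hq, mul_div_assoc, neg_one_mul,
    ← Nat.cast_sub ht.2.le] at hK
  refine exists_equiv_EMinus_of_phiSigned hp hq ht ht'
    ((splitRight hp hq hs m l _).exists_equiv_block
    hp hq _ ht' ((PhiSigned.split_actsBy hp hq _ hs m l _ _).tensorRight hp hq _)
    ((PhiSigned.split_actsBy hp hq _ hs m l _ _).tensorRight hp hq _) ?_ hK hγ rfl hω
    D.pm' D.mm' D.pm D.mm)
  exact neg_ne_zero.mpr (div_ne_zero
    (qint_ne_zero hp hq (by omega) (by omega)) (qint_ne_zero hp hq (by omega) (by omega)))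

theorem exists_shortExact_block (ht : 0 < t ∧ t < p) (h : Mid p s s' t)
    (D : PieceDims hp hq hs hs' t (1 * q ^ ((t : ℤ) - 1)) (-1 * q ^ (((p - t : ℕ) : ℤ) - 1)))
    (m n : ℕ) (l μ : ℙ k (Fin 2 → k)) :
    ExistsShortExact (Ubar p q)
      (Fin n → EMinus hp hq (p - t) m (P1.scale (-(qint q s / qint q t)) l))
      (((EMod hp hq hs m l).tensor hp hq (EMod hp hq hs' n μ)).block hp hq (gam q 1 t))
      (Fin n → EPlus hp hq t m (P1.scale (qint q s / qint q t) l)) ∧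
    ExistsShortExact (Ubar p q)
      (Fin m → EMinus hp hq (p - t) n (P1.scale ((-1) ^ s * (qint q s' / qint q t)) μ))
      (((EMod hp hq hs m l).tensor hp hq (EMod hp hq hs' n μ)).block hp hq (gam q 1 t))
      (Fin m → EPlus hp hq t n (P1.scale ((-1) ^ (s - 1) * (qint q s' / qint q t)) μ)) := by
  have hγ := gam_mem_casValues hp hq (one_mul (1 : k)) t
  obtain ⟨e₁⟩ := exists_equiv_left_top hp hq ht h D n μ
  obtain ⟨e₂⟩ := exists_equiv_left_bot hp hq ht h D n μ
  obtain ⟨e₃⟩ := exists_equiv_right_top hp hq ht h D m l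
  obtain ⟨e₄⟩ := exists_equiv_right_bot hp hq ht h D m l
  exact ⟨((splitLeft hp hq hs' n μ _).block hp hq hγ).exists_shortExact.congr
      (LinearEquiv.piCongrRight fun _ => e₄) (LinearEquiv.piCongrRight fun _ => e₃),
    ((splitRight hp hq hs m l _).block hp hq hγ).exists_shortExact.congr
      (LinearEquiv.piCongrRight fun _ => e₂) (LinearEquiv.piCongrRight fun _ => e₁)⟩

end ExactSequences

section Projectives

variable [CharZero k] (hp : 2 ≤ p) (hq : IsPrimitiveRoot q (2 * p))

/-- A module which splits into blocks whose dimensions are large enough is their product. -/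
theorem exists_equiv_pi_block (T : UMod p q) {ι : Type*} [Fintype ι] {γ : ι → k}
    (hγ : Function.Injective γ) (hm : ∀ i, γ i ∈ casValues p q) {c : ι → ℕ}
    (hc : ∀ i, c i ≤ Module.finrank k (T.block hp hq (γ i)))
    (hT : Module.finrank k T ≤ ∑ i, c i) :
    (∀ i, Module.finrank k (T.block hp hq (γ i)) ≤ c i) ∧
      Nonempty (T ≃ₗ[Ubar p q] ((i : ι) → T.block hp hq (γ i))) := by
  classical
  let g : ((i : ι) → T.block hp hq (γ i)) →ₗ[Ubar p q] T :=
    ∑ i, UMod.block.incl hp hq (γ i) ∘ₗ LinearMap.proj i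
  have hg : ∀ x, g x = ∑ i, (x i).1 := fun x => by
    simp only [g, LinearMap.sum_apply]
    rfl
  have inj : Function.Injective g := by
    rw [injective_iff_map_eq_zero]
    intro x hx
    funext i
    refine Subtype.ext ?_
    have h1 := congrArg (fun v => blockIdem hp hq (γ i) ⋆ v) hx
    simp only [hg, act_sum, act_zero] at h1
    rw [Finset.sum_eq_single i, blockIdem_of_inBl hp hq (hm i) (x i).2] at h1
    · exact h1
    · exact fun j _ hj => blockIdem_of_ne hp hq (hm i) (fun e => hj (hγ e).symm) (x j).2
    · exact fun hn => absurd (Finset.mem_univ _) hn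
  have hpi : Module.finrank k ((i : ι) → T.block hp hq (γ i))
      = ∑ i, Module.finrank k (T.block hp hq (γ i)) := Module.finrank_pi_fintype k
  have hle := LinearMap.finrank_le_finrank_of_injective (f := g.restrictScalars k) inj
  rw [hpi] at hle
  have hsum := Finset.sum_le_sum fun i (_ : i ∈ Finset.univ) => hc i
  have heq : ∑ i, c i = ∑ i, Module.finrank k (T.block hp hq (γ i)) := by omega
  have heq' := (Finset.sum_eq_sum_iff_of_le fun i _ => hc i).mp heq
  refine ⟨fun i => (heq' i (Finset.mem_univ i)).ge, ⟨(LinearEquiv.ofBijective g ⟨inj, ?_⟩).symm⟩⟩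
  exact (LinearMap.injective_iff_surjective_of_finrank_eq_finrank (f := g.restrictScalars k)
    (by omega)).mp inj

/-- Vectors of the blocks of `P` occur `d` times in the blocks of `T`. -/
def IsPiece (T P : UMod p q) (d : ℕ) : Prop :=
  ∀ γ ∈ casValues p q, ∀ ω : k,
    (HasRank (P.block hp hq γ) ω 1 → HasRank (T.block hp hq γ) ω d) ∧
    (1 ≤ wtDim hp hq P γ ω → d ≤ wtDim hp hq T γ ω)

section

variable {s s' : ℕ} (hs : 0 < s ∧ s < p) (hs' : 0 < s' ∧ s' < p) (m n : ℕ) (l μ : ℙ k (Fin 2 → k))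

theorem isPiece_pp : IsPiece hp hq ((EMod hp hq hs m l).tensor hp hq (EMod hp hq hs' n μ))
    ((XTop hp hq hs).tensor hp hq (XTop hp hq hs')) (m * n) := fun γ hγ ω =>
  ⟨fun h => by
    have := ((splitRight hp hq hs m l _).block hp hq hγ).hasRank_of_quotient
      (((splitLeft hp hq hs' n μ _).block hp hq hγ).hasRank_of_quotient h)
    rwa [mul_one] at this,
  fun h => by
    rw [wtDim_tensor hp hq hs hs' m n l μ hγ]
    exact Nat.le_mul_of_pos_right _ (by omega)⟩

theorem isPiece_pm : IsPiece hp hq ((EMod hp hq hs m l).tensor hp hq (EMod hp hq hs' n μ))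
    ((XTop hp hq hs).tensor hp hq (XBot hp hq s')) (m * n) := fun γ hγ ω =>
  ⟨fun h => by
    have := ((splitRight hp hq hs m l _).block hp hq hγ).hasRank_of_quotient
      (((splitLeft hp hq hs' n μ _).block hp hq hγ).hasRank_of_sub h)
    rwa [mul_one] at this,
  fun h => by
    rw [wtDim_tensor hp hq hs hs' m n l μ hγ]
    exact Nat.le_mul_of_pos_right _ (by omega)⟩

theorem isPiece_mp : IsPiece hp hq ((EMod hp hq hs m l).tensor hp hq (EMod hp hq hs' n μ))
    ((XBot hp hq s).tensor hp hq (XTop hp hq hs')) (m * n) := fun γ hγ ω =>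
  ⟨fun h => by
    have := ((splitRight hp hq hs m l _).block hp hq hγ).hasRank_of_sub
      (((splitLeft hp hq hs' n μ _).block hp hq hγ).hasRank_of_quotient h)
    rwa [mul_one] at this,
  fun h => by
    rw [wtDim_tensor hp hq hs hs' m n l μ hγ]
    exact Nat.le_mul_of_pos_right _ (by omega)⟩

theorem isPiece_mm : IsPiece hp hq ((EMod hp hq hs m l).tensor hp hq (EMod hp hq hs' n μ))
    ((XBot hp hq s).tensor hp hq (XBot hp hq s')) (m * n) := fun γ hγ ω =>
  ⟨fun h => by
    have := ((splitRight hp hq hs m l _).block hp hq hγ).hasRank_of_sub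
      (((splitLeft hp hq hs' n μ _).block hp hq hγ).hasRank_of_sub h)
    rwa [mul_one] at this,
  fun h => by
    rw [wtDim_tensor hp hq hs hs' m n l μ hγ]
    exact Nat.le_mul_of_pos_right _ (by omega)⟩

end

section

variable {ε ε' ε'' : k} {hε : ε * ε = 1} {hε' : ε' * ε' = 1} {r r' : ℕ} {hr : r ≤ p} {hr' : r' ≤ p}
  {T : UMod p q} {d : ℕ}

theorem IsPiece.hasRank (hP : IsPiece hp hq T ((XMod hp hq hε hr).tensor hp hq (XMod hp hq hε' hr')) d)
    (hε'' : ε'' * ε'' = 1) (h : ε * ε' = ε'') {t : ℕ} (htp : t < p)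
    (hodd : (t + r + r') % 2 = 1) (ht : 2 * p + 1 ≤ t + r + r') :
    HasRank (T.block hp hq (gam q ε'' t)) (ε'' * q ^ ((t : ℤ) - 1)) d :=
  (hP _ (gam_mem_casValues hp hq hε'' t) _).1 (hasRank_one hp hq hε hε' h hr hr' htp hodd ht)

theorem IsPiece.le_wtDim (hP : IsPiece hp hq T ((XMod hp hq hε hr).tensor hp hq (XMod hp hq hε' hr')) d)
    (hε'' : ε'' * ε'' = 1) (h : ε * ε' = ε'') (hodd : (p + r + r') % 2 = 1)
    (ht : 2 * p + 1 ≤ p + r + r') :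
    d ≤ wtDim hp hq T (gam q ε'' p) (ε'' * q ^ ((p : ℤ) - 1)) :=
  (hP _ (gam_mem_casValues hp hq hε'' p) _).2
    (one_le_wtDim (l := (r + r' - p - 1) / 2) hp hq hε hε' h hr hr' (by omega) (by omega) (by omega)
      rfl)

theorem IsPiece.le_finrank
    (hP : IsPiece hp hq T ((XMod hp hq hε hr).tensor hp hq (XMod hp hq hε' hr')) d)
    (hε'' : ε'' * ε'' = 1) (h : ε * ε' = ε'') {t : ℕ} (ht : 0 < t ∧ t ≤ p)
    (hodd : (t + r + r') % 2 = 1) (ht' : 2 * p + 1 ≤ t + r + r') :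
    (if t < p then 2 else 1) * p * d ≤ Module.finrank k (T.block hp hq (gam q ε'' t)) := by
  rcases Nat.lt_or_eq_of_le ht.2 with htp | rfl
  · rw [if_pos htp]
    exact (hP.hasRank hp hq hε'' h htp hodd ht').le_finrank hp hq hε'' ⟨ht.1, htp⟩
      (UMod.block.inBl hp hq _)
  · rw [if_neg (lt_irrefl t), one_mul, finrank_top hp hq hε'' (UMod.block.inBl hp hq _)]
    exact Nat.mul_le_mul_left _ (hP.le_wtDim hp hq hε'' h hodd ht')

theorem IsPiece.exists_equiv_of_lt
    (hP : IsPiece hp hq T ((XMod hp hq hε hr).tensor hp hq (XMod hp hq hε' hr')) d)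
    (hε'' : ε'' * ε'' = 1) (h : ε * ε' = ε'') {t : ℕ} (ht : 0 < t ∧ t < p)
    (hodd : (t + r + r') % 2 = 1) (ht' : 2 * p + 1 ≤ t + r + r')
    (hle : Module.finrank k (T.block hp hq (gam q ε'' t)) ≤ (if t < p then 2 else 1) * p * d) :
    Nonempty (T.block hp hq (gam q ε'' t) ≃ₗ[Ubar p q]
      (Fin d → PhiSigned hp hq hε'' t ht (BMod.PPlus k))) := by
  rw [if_pos ht.2] at hle
  obtain ⟨u, hu, hi⟩ := hP.hasRank hp hq hε'' h ht.2 hodd ht'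
  exact exists_equiv_PPlus hp hq hε'' ht (UMod.block.inBl hp hq _) hu hi hle

theorem IsPiece.exists_equiv_of_eq
    (hP : IsPiece hp hq T ((XMod hp hq hε hr).tensor hp hq (XMod hp hq hε' hr')) d)
    (hε'' : ε'' * ε'' = 1) (h : ε * ε' = ε'')
    (hodd : (p + r + r') % 2 = 1) (ht' : 2 * p + 1 ≤ p + r + r')
    (hle : Module.finrank k (T.block hp hq (gam q ε'' p)) ≤ (if p < p then 2 else 1) * p * d) :
    Nonempty (T.block hp hq (gam q ε'' p) ≃ₗ[Ubar p q]
      (Fin d → XMod hp hq hε'' (le_refl p))) := by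
  rw [if_neg (lt_irrefl p), one_mul, finrank_top hp hq hε'' (UMod.block.inBl hp hq _)] at hle
  exact exists_equiv_top hp hq hε'' (UMod.block.inBl hp hq _)
    (le_antisymm (Nat.le_of_mul_le_mul_left hle (by omega)) (hP.le_wtDim hp hq hε'' h hodd ht'))

theorem IsPiece.exists_equiv_PPlus
    (hP : IsPiece hp hq T ((XMod hp hq hε hr).tensor hp hq (XMod hp hq hε' hr')) d)
    (h : ε * ε' = 1) {t : ℕ} (ht : 0 < t ∧ t ≤ p)
    (hodd : (t + r + r') % 2 = 1) (ht' : 2 * p + 1 ≤ t + r + r')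
    (hle : Module.finrank k (T.block hp hq (gam q 1 t)) ≤ (if t < p then 2 else 1) * p * d) :
    Nonempty (T.block hp hq (gam q 1 t) ≃ₗ[Ubar p q] (Fin d → PPlus hp hq t)) := by
  rw [PPlus]
  rcases Nat.lt_or_eq_of_le ht.2 with htp | rfl
  · rw [if_neg htp.ne, Phi_eq hp hq t ⟨ht.1, htp⟩]
    exact hP.exists_equiv_of_lt hp hq (one_mul 1) h ⟨ht.1, htp⟩ hodd ht' hle
  · rw [if_pos rfl]
    exact hP.exists_equiv_of_eq hp hq (one_mul 1) h hodd ht' hle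

theorem IsPiece.exists_equiv_PMinus
    (hP : IsPiece hp hq T ((XMod hp hq hε hr).tensor hp hq (XMod hp hq hε' hr')) d)
    (h : ε * ε' = -1) {t : ℕ} (ht : 0 < t ∧ t ≤ p)
    (hodd : (t + r + r') % 2 = 1) (ht' : 2 * p + 1 ≤ t + r + r')
    (hle : Module.finrank k (T.block hp hq (gam q (-1) t)) ≤ (if t < p then 2 else 1) * p * d) :
    Nonempty (T.block hp hq (gam q (-1) t) ≃ₗ[Ubar p q] (Fin d → PMinus hp hq t)) := by
  rw [PMinus]
  rcases Nat.lt_or_eq_of_le ht.2 with htp | rfl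
  · rw [if_neg htp.ne, Phi_eq hp hq (p - t) (by omega)]
    obtain ⟨e⟩ := hP.exists_equiv_of_lt hp hq (sign_neg (one_mul 1)) h ⟨ht.1, htp⟩ hodd ht' hle
    obtain ⟨e'⟩ := exists_equiv_swap hp hq (sign_neg (one_mul (1 : k))) (one_mul 1) (by ring)
      ⟨ht.1, htp⟩ (by omega) (Nat.add_sub_cancel' htp.le) (BMod.PPlus k)
    exact ⟨e.trans (LinearEquiv.piCongrRight fun _ => e')⟩
  · rw [if_pos rfl]
    exact hP.exists_equiv_of_eq hp hq (sign_neg (one_mul 1)) h hodd ht' hle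

end

end Projectives

section Indices

variable {s s' : ℕ}

theorem mem_setI_iff (hs : 0 < s) (hs' : 0 < s') {t : ℕ} :
    t ∈ setI p s s' ↔ Mid p s s' t := by
  simp only [setI, Finset.mem_filter, Finset.mem_image, Finset.mem_Icc, Mid]
  constructor
  · rintro ⟨⟨i, hi, rfl⟩, ht⟩
    omega
  · rintro ⟨h0, h1, h2, h3, h4⟩
    exact ⟨⟨(t + 1 - (max s s' - min s s')) / 2, by omega, by omega⟩, by omega⟩

theorem mem_setJ_iff {N t : ℕ} :
    t ∈ setJ p N ↔ 1 ≤ t ∧ t ≤ p ∧ 2 * p + 1 ≤ t + N ∧ (t + N) % 2 = 1 := by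
  rw [setJ, Finset.mem_filter, Finset.mem_Icc, Nat.odd_iff]
  tauto

variable (p s s') in
/-- The indices of the summands. -/
abbrev SummandIndex : Type :=
  setI p s s' ⊕ setJ p (s + s') ⊕ setJ p (2 * p - s - s') ⊕ setJ p (p + s - s') ⊕
    setJ p (p - s + s')

variable (p s s') in
/-- The index `b` of the block of a summand, which has Casimir eigenvalue `gam q 1 b`. -/
def blockIndex : SummandIndex p s s' → ℕ :=
  Sum.elim (fun t => t) (Sum.elim (fun t => t) (Sum.elim (fun t => t)
    (Sum.elim (fun t => p - t) fun t => p - t)))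

theorem blockIndex_le (hs : 0 < s) (hs' : 0 < s') (i : SummandIndex p s s') :
    blockIndex p s s' i ≤ p := by
  rcases i with ⟨t, ht⟩ | ⟨t, ht⟩ | ⟨t, ht⟩ | ⟨t, ht⟩ | ⟨t, ht⟩
  · obtain ⟨h0, h1, h2, h3, h4⟩ := (mem_setI_iff hs hs').mp ht
    change t ≤ p
    omega
  · exact (mem_setJ_iff.mp ht).2.1
  · exact (mem_setJ_iff.mp ht).2.1
  · exact Nat.sub_le p t
  · exact Nat.sub_le p t

theorem blockIndex_injective (hs : 0 < s ∧ s < p) (hs' : 0 < s' ∧ s' < p) :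
    Function.Injective (blockIndex p s s') := by
  have hI := fun t : setI p s s' => (mem_setI_iff hs.1 hs'.1).mp t.2
  have hJ := fun (N : ℕ) (t : setJ p N) => mem_setJ_iff.mp t.2
  unfold blockIndex
  refine Function.Injective.sumElim Subtype.val_injective
    (Function.Injective.sumElim Subtype.val_injective
      (Function.Injective.sumElim Subtype.val_injective
        (Function.Injective.sumElim ?_ ?_ ?_) ?_) ?_) ?_
  · intro t t' h
    have := hJ _ t
    have := hJ _ t'
    dsimp only at h
    exact Subtype.ext (by omega)
  · intro t t' h
    have := hJ _ t
    have := hJ _ t'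
    dsimp only at h
    exact Subtype.ext (by omega)
  · intro t t'
    have := hJ _ t
    have := hJ _ t'
    omega
  · rintro t (t' | t') <;>
    · have := hJ _ t
      have := hJ _ t'
      simp only [Sum.elim_inl, Sum.elim_inr]
      omega
  · rintro t (t' | t' | t') <;>
    · have := hJ _ t
      have := hJ _ t'
      simp only [Sum.elim_inl, Sum.elim_inr]
      omega
  · rintro t (t' | t' | t' | t') <;>
    · obtain ⟨h0, h1, h2, h3, h4⟩ := hI t
      have := hJ _ t'
      simp only [Sum.elim_inl, Sum.elim_inr]
      omega

theorem exists_blockIndex_eq (hs : 0 < s ∧ s < p) (hs' : 0 < s' ∧ s' < p) {b : ℕ} (hb : b ≤ p)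
    (hodd : (b + s + s') % 2 = 1) : ∃ i, blockIndex p s s' i = b := by
  by_cases h1 : 2 * p + 1 ≤ b + (s + s')
  · exact ⟨Sum.inr (Sum.inl ⟨b, mem_setJ_iff.mpr (by omega)⟩), rfl⟩
  by_cases h2 : s + s' + 1 ≤ b
  · exact ⟨Sum.inr (Sum.inr (Sum.inl ⟨b, mem_setJ_iff.mpr (by omega)⟩)), rfl⟩
  by_cases h3 : b + s' + 1 ≤ s
  · exact ⟨Sum.inr (Sum.inr (Sum.inr (Sum.inl ⟨p - b, mem_setJ_iff.mpr (by omega)⟩))),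
      Nat.sub_sub_self hb⟩
  by_cases h4 : b + s + 1 ≤ s'
  · exact ⟨Sum.inr (Sum.inr (Sum.inr (Sum.inr ⟨p - b, mem_setJ_iff.mpr (by omega)⟩))),
      Nat.sub_sub_self hb⟩
  · exact ⟨Sum.inl ⟨b, (mem_setI_iff hs.1 hs'.1).mpr ⟨by omega, by omega, by omega, by omega,
      by omega⟩⟩, rfl⟩

/-- The number of neighbours of `b` in `0, …, p`. -/
def neighbours (p b : ℕ) : ℕ := (if 0 < b then 1 else 0) + if b < p then 1 else 0

theorem neighbours_eq {t : ℕ} (h : 0 < t) (h' : t ≤ p) :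
    neighbours p t = (if t < p then 2 else 1) ∧
      neighbours p (p - t) = if t < p then 2 else 1 := by
  unfold neighbours
  constructor <;> split_ifs <;> omega

theorem sum_neighbours (p c : ℕ) :
    ∑ b ∈ (Finset.range (p + 1)).filter (fun b => (b + c) % 2 = 1), neighbours p b = p := by
  rw [Finset.sum_filter]
  have e : ∀ b, (if (b + c) % 2 = 1 then neighbours p b else 0)
      = (if (b + c) % 2 = 1 ∧ 0 < b then 1 else 0) + (if (b + c) % 2 = 1 ∧ b < p then 1 else 0) := by
    intro b
    unfold neighbours
    split_ifs <;> first | rfl | omega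
  rw [Finset.sum_congr rfl fun b _ => e b, Finset.sum_add_distrib, Finset.sum_range_succ',
    Finset.sum_range_succ (fun b => if (b + c) % 2 = 1 ∧ b < p then 1 else 0), if_neg (by omega),
    if_neg (by omega), add_zero, add_zero, ← Finset.sum_add_distrib]
  refine (Finset.sum_congr rfl fun b hb => ?_).trans ((Finset.sum_const 1).trans (by simp))
  have := Finset.mem_range.mp hb
  split_ifs <;> omega

theorem le_sum_neighbours (hs : 0 < s ∧ s < p) (hs' : 0 < s' ∧ s' < p) :
    p ≤ ∑ i, neighbours p (blockIndex p s s' i) := by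
  classical
  rw [← Finset.sum_image (f := neighbours p) (s := Finset.univ) (g := blockIndex p s s')
    fun _ _ _ _ h => blockIndex_injective hs hs' h]
  conv_lhs => rw [← sum_neighbours p (s + s')]
  refine Finset.sum_le_sum_of_subset fun b hb => ?_
  rw [Finset.mem_filter, Finset.mem_range] at hb
  obtain ⟨i, rfl⟩ := exists_blockIndex_eq hs hs' (b := b) (by omega) (by omega)
  exact Finset.mem_image_of_mem _ (Finset.mem_univ i)

end Indices

section Decomposition

theorem blockGam_injective (hp : 2 ≤ p) (hq : IsPrimitiveRoot q (2 * p)) {s s' : ℕ}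
    (hs : 0 < s ∧ s < p) (hs' : 0 < s' ∧ s' < p) :
    Function.Injective fun i => gam q 1 (blockIndex p s s' i) := by
  intro i j h
  have hi := blockIndex_le hs.1 hs'.1 i
  have hj := blockIndex_le hs.1 hs'.1 j
  refine blockIndex_injective hs hs' ?_
  rcases (gam_one_eq_iff hp hq (one_mul 1) _ _).mp h with ⟨c, hc⟩ | ⟨c, hc⟩
  · have h1 : c < 1 := by
      by_contra hn
      nlinarith
    have h2 : -1 < c := by
      by_contra hn
      nlinarith
    obtain rfl : c = 0 := by omega
    omega
  · have h1 : c < 2 := by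
      by_contra hn
      nlinarith
    have h2 : -1 < c := by
      by_contra hn
      nlinarith
    obtain rfl | rfl : c = 0 ∨ c = 1 := by omega
    · omega
    · omega

theorem finrank_EMod (hp : 2 ≤ p) (hq : IsPrimitiveRoot q (2 * p)) {s : ℕ} (hs : 0 < s ∧ s < p)
    (n : ℕ) (l : ℙ k (Fin 2 → k)) : Module.finrank k (EMod hp hq hs n l) = p * n := by
  change Module.finrank k ((Fin s → Fin n → k) × (Fin (p - s) → Fin n → k)) = p * n
  have h : ∀ c : ℕ, Module.finrank k (Fin c → Fin n → k) = c * n := fun c => by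
    rw [Module.finrank_pi_fintype]
    simp
  rw [Module.finrank_prod, h, h, ← add_mul, Nat.add_sub_cancel' hs.2.le]

variable [CharZero k] (hp : 2 ≤ p) (hq : IsPrimitiveRoot q (2 * p)) {s s' : ℕ} (hs : 0 < s ∧ s < p)
  (hs' : 0 < s' ∧ s' < p) (m n : ℕ) (l μ : ℙ k (Fin 2 → k))

theorem gam_sub_index (hp : 2 ≤ p) (hq : IsPrimitiveRoot q (2 * p)) {t : ℕ} (ht : t ≤ p) :
    gam q 1 (p - t : ℕ) = gam q (-1) t := by
  have h := gam_swap hp hq (-1) t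
  rwa [neg_neg, ← Nat.cast_sub ht] at h

theorem le_finrank_blockIndex (i : SummandIndex p s s') :
    neighbours p (blockIndex p s s' i) * p * (m * n)
      ≤ Module.finrank k (((EMod hp hq hs m l).tensor hp hq (EMod hp hq hs' n μ)).block hp hq
        (gam q 1 (blockIndex p s s' i))) := by
  rcases i with ⟨t, ht⟩ | ⟨t, ht⟩ | ⟨t, ht⟩ | ⟨t, ht⟩ | ⟨t, ht⟩
  · have h := (mem_setI_iff hs.1 hs'.1).mp ht
    have ht' : 0 < t ∧ t < p := h.lt
    refine le_trans (le_of_eq ?_) (le_finrank_block_of_mid hp hq hs hs' m n l μ ht' h)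
    change neighbours p t * p * (m * n) = _
    rw [(neighbours_eq ht'.1 ht'.2.le).1, if_pos ht'.2]
  · obtain ⟨h1, h2, h3, h4⟩ := mem_setJ_iff.mp ht
    refine le_trans (le_of_eq ?_) ((isPiece_pp hp hq hs hs' m n l μ).le_finrank hp hq
      (one_mul 1) (one_mul 1) (t := t) ⟨h1, h2⟩ (by omega) (by omega))
    exact congrArg (fun x => x * p * (m * n)) (neighbours_eq h1 h2).1
  · obtain ⟨h1, h2, h3, h4⟩ := mem_setJ_iff.mp ht
    refine le_trans (le_of_eq ?_) ((isPiece_mm hp hq hs hs' m n l μ).le_finrank hp hq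
      (one_mul 1) (by ring) (t := t) ⟨h1, h2⟩ (by omega) (by omega))
    exact congrArg (fun x => x * p * (m * n)) (neighbours_eq h1 h2).1
  · obtain ⟨h1, h2, h3, h4⟩ := mem_setJ_iff.mp ht
    change neighbours p (p - t) * p * (m * n) ≤ Module.finrank k (((EMod hp hq hs m l).tensor hp hq
      (EMod hp hq hs' n μ)).block hp hq (gam q 1 (p - t : ℕ)))
    rw [gam_sub_index hp hq h2, (neighbours_eq h1 h2).2]
    exact (isPiece_pm hp hq hs hs' m n l μ).le_finrank hp hq (sign_neg (one_mul 1)) (one_mul _)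
      ⟨h1, h2⟩ (by omega) (by omega)
  · obtain ⟨h1, h2, h3, h4⟩ := mem_setJ_iff.mp ht
    change neighbours p (p - t) * p * (m * n) ≤ Module.finrank k (((EMod hp hq hs m l).tensor hp hq
      (EMod hp hq hs' n μ)).block hp hq (gam q 1 (p - t : ℕ)))
    rw [gam_sub_index hp hq h2, (neighbours_eq h1 h2).2]
    exact (isPiece_mp hp hq hs hs' m n l μ).le_finrank hp hq (sign_neg (one_mul 1)) (mul_one _)
      ⟨h1, h2⟩ (by omega) (by omega)

theorem blocks_of_tensor :
    (∀ i : SummandIndex p s s', Module.finrank k (((EMod hp hq hs m l).tensor hp hq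
        (EMod hp hq hs' n μ)).block hp hq (gam q 1 (blockIndex p s s' i)))
      ≤ neighbours p (blockIndex p s s' i) * p * (m * n)) ∧
    Nonempty ((EMod hp hq hs m l).tensor hp hq (EMod hp hq hs' n μ) ≃ₗ[Ubar p q]
      ((i : SummandIndex p s s') → ((EMod hp hq hs m l).tensor hp hq
        (EMod hp hq hs' n μ)).block hp hq (gam q 1 (blockIndex p s s' i)))) := by
  refine exists_equiv_pi_block hp hq _ (blockGam_injective hp hq hs hs')
    (fun i => gam_mem_casValues hp hq (one_mul 1) _) (le_finrank_blockIndex hp hq hs hs' m n l μ) ?_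
  rw [finrank_tensor, finrank_EMod, finrank_EMod, ← Finset.sum_mul, ← Finset.sum_mul]
  calc p * m * (p * n) = p * p * (m * n) := by ring
    _ ≤ _ := Nat.mul_le_mul_right _ (Nat.mul_le_mul_right _ (le_sum_neighbours hs hs'))

theorem inC_block (T : UMod p q) {t : ℕ} (ht : 0 < t ∧ t < p) :
    InC hp hq t (T.block hp hq (gam q 1 t)) := by
  refine ⟨ht.1, ht.2, BMod.ofBlock (T.block hp hq (gam q 1 t)) hp hq (one_mul 1) ht
    (UMod.block.inBl hp hq _), ?_⟩
  rw [Phi_eq hp hq t ht]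
  exact ⟨(blockEquiv hp hq (one_mul 1) ht (UMod.block.inBl hp hq _)).symm⟩

theorem exists_equiv_pp (t : setJ p (s + s'))
    (hle : Module.finrank k (((EMod hp hq hs m l).tensor hp hq (EMod hp hq hs' n μ)).block hp hq
      (gam q 1 (t : ℕ))) ≤ neighbours p t * p * (m * n)) :
    Nonempty (((EMod hp hq hs m l).tensor hp hq (EMod hp hq hs' n μ)).block hp hq
      (gam q 1 (t : ℕ)) ≃ₗ[Ubar p q] (Fin (m * n) → PPlus hp hq t)) := by
  obtain ⟨h1, h2, h3, h4⟩ := mem_setJ_iff.mp t.2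
  rw [(neighbours_eq h1 h2).1] at hle
  exact (isPiece_pp hp hq hs hs' m n l μ).exists_equiv_PPlus hp hq (one_mul 1) ⟨h1, h2⟩ (by omega)
    (by omega) hle

theorem exists_equiv_mm (t : setJ p (2 * p - s - s'))
    (hle : Module.finrank k (((EMod hp hq hs m l).tensor hp hq (EMod hp hq hs' n μ)).block hp hq
      (gam q 1 (t : ℕ))) ≤ neighbours p t * p * (m * n)) :
    Nonempty (((EMod hp hq hs m l).tensor hp hq (EMod hp hq hs' n μ)).block hp hq
      (gam q 1 (t : ℕ)) ≃ₗ[Ubar p q] (Fin (m * n) → PPlus hp hq t)) := by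
  obtain ⟨h1, h2, h3, h4⟩ := mem_setJ_iff.mp t.2
  rw [(neighbours_eq h1 h2).1] at hle
  exact (isPiece_mm hp hq hs hs' m n l μ).exists_equiv_PPlus hp hq (by ring) ⟨h1, h2⟩ (by omega)
    (by omega) hle

theorem exists_equiv_pm (t : setJ p (p + s - s'))
    (hle : Module.finrank k (((EMod hp hq hs m l).tensor hp hq (EMod hp hq hs' n μ)).block hp hq
      (gam q 1 (p - t : ℕ))) ≤ neighbours p (p - t) * p * (m * n)) :
    Nonempty (((EMod hp hq hs m l).tensor hp hq (EMod hp hq hs' n μ)).block hp hq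
      (gam q 1 (p - t : ℕ)) ≃ₗ[Ubar p q] (Fin (m * n) → PMinus hp hq t)) := by
  obtain ⟨h1, h2, h3, h4⟩ := mem_setJ_iff.mp t.2
  rw [(neighbours_eq h1 h2).2, gam_sub_index hp hq h2] at hle
  rw [gam_sub_index hp hq h2]
  exact (isPiece_pm hp hq hs hs' m n l μ).exists_equiv_PMinus hp hq (one_mul _) ⟨h1, h2⟩ (by omega)
    (by omega) hle

theorem exists_equiv_mp (t : setJ p (p - s + s'))
    (hle : Module.finrank k (((EMod hp hq hs m l).tensor hp hq (EMod hp hq hs' n μ)).block hp hq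
      (gam q 1 (p - t : ℕ))) ≤ neighbours p (p - t) * p * (m * n)) :
    Nonempty (((EMod hp hq hs m l).tensor hp hq (EMod hp hq hs' n μ)).block hp hq
      (gam q 1 (p - t : ℕ)) ≃ₗ[Ubar p q] (Fin (m * n) → PMinus hp hq t)) := by
  obtain ⟨h1, h2, h3, h4⟩ := mem_setJ_iff.mp t.2
  rw [(neighbours_eq h1 h2).2, gam_sub_index hp hq h2] at hle
  rw [gam_sub_index hp hq h2]
  exact (isPiece_mp hp hq hs hs' m n l μ).exists_equiv_PMinus hp hq (mul_one _) ⟨h1, h2⟩ (by omega)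
    (by omega) hle

end Decomposition

end QSl2

theorem mainTheorem2 {k : Type u} [Field k] [IsAlgClosed k] [CharZero k] {p : ℕ} {q : k}
    (hp : 2 ≤ p) (hq : IsPrimitiveRoot q (2 * p)) (s s' m n : ℕ) (hs : 1 ≤ s) (hsp : s ≤ p - 1)
    (hs' : 1 ≤ s') (hsp' : s' ≤ p - 1) (hm : 1 ≤ m) (hn : 1 ≤ n) (l μ : ℙ k (Fin 2 → k)) :
    ∃ V : QSl2.setI p s s' → QSl2.UMod p q,
      (∀ t : QSl2.setI p s s', QSl2.InC hp hq t (V t)) ∧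
      Nonempty (((QSl2.EPlus hp hq s m l).tensor hp hq (QSl2.EPlus hp hq s' n μ))
        ≃ₗ[QSl2.Ubar p q]
          ((t : QSl2.setI p s s') → V t) ×
          ((t : QSl2.setJ p (s + s')) → Fin (m * n) → QSl2.PPlus hp hq t) ×
          ((t : QSl2.setJ p (2 * p - s - s')) → Fin (m * n) → QSl2.PPlus hp hq t) ×
          ((t : QSl2.setJ p (p + s - s')) → Fin (m * n) → QSl2.PMinus hp hq t) ×
          ((t : QSl2.setJ p (p - s + s')) → Fin (m * n) → QSl2.PMinus hp hq t)) ∧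
      ∀ t : QSl2.setI p s s',
        QSl2.ExistsShortExact (QSl2.Ubar p q)
          (Fin n → QSl2.EMinus hp hq (p - t) m
            (QSl2.P1.scale (-(QSl2.qint q s / QSl2.qint q t)) l))
          (V t)
          (Fin n → QSl2.EPlus hp hq t m (QSl2.P1.scale (QSl2.qint q s / QSl2.qint q t) l)) ∧
        QSl2.ExistsShortExact (QSl2.Ubar p q)
          (Fin m → QSl2.EMinus hp hq (p - t) n
            (QSl2.P1.scale ((-1) ^ s * (QSl2.qint q s' / QSl2.qint q t)) μ))
          (V t)
          (Fin m → QSl2.EPlus hp hq t n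
            (QSl2.P1.scale ((-1) ^ (s - 1) * (QSl2.qint q s' / QSl2.qint q t)) μ)) := by
  have ha : 0 < s ∧ s < p := by omega
  have ha' : 0 < s' ∧ s' < p := by omega
  have hE : QSl2.EPlus hp hq s m l = QSl2.EMod hp hq ha m l := QSl2.Phi_eq hp hq s ha _
  have hE' : QSl2.EPlus hp hq s' n μ = QSl2.EMod hp hq ha' n μ := QSl2.Phi_eq hp hq s' ha' _
  rw [hE, hE']
  obtain ⟨hle, ⟨e⟩⟩ := QSl2.blocks_of_tensor hp hq ha ha' m n l μ
  have hM := fun t : QSl2.setI p s s' => (QSl2.mem_setI_iff ha.1 ha'.1).mp t.2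
  refine ⟨fun t => ((QSl2.EMod hp hq ha m l).tensor hp hq (QSl2.EMod hp hq ha' n μ)).block hp hq
    (QSl2.gam q 1 (t : ℕ)), fun t => ?_, ?_, fun t => ?_⟩
  · exact QSl2.inC_block hp hq _ (hM t).lt
  · have e₁ := fun t => QSl2.exists_equiv_pp hp hq ha ha' m n l μ t (hle (Sum.inr (Sum.inl t)))
    have e₂ := fun t =>
      QSl2.exists_equiv_mm hp hq ha ha' m n l μ t (hle (Sum.inr (Sum.inr (Sum.inl t))))
    have e₃ := fun t =>
      QSl2.exists_equiv_pm hp hq ha ha' m n l μ t (hle (Sum.inr (Sum.inr (Sum.inr (Sum.inl t)))))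
    have e₄ := fun t =>
      QSl2.exists_equiv_mp hp hq ha ha' m n l μ t (hle (Sum.inr (Sum.inr (Sum.inr (Sum.inr t)))))
    exact ⟨e.trans ((LinearEquiv.sumPiEquivProdPi _ _ _ _).trans
      ((LinearEquiv.refl _ _).prodCongr ((LinearEquiv.sumPiEquivProdPi _ _ _ _).trans
        ((LinearEquiv.piCongrRight fun t => (e₁ t).some).prodCongr
          ((LinearEquiv.sumPiEquivProdPi _ _ _ _).trans
            ((LinearEquiv.piCongrRight fun t => (e₂ t).some).prodCongr
              ((LinearEquiv.sumPiEquivProdPi _ _ _ _).trans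
                ((LinearEquiv.piCongrRight fun t => (e₃ t).some).prodCongr
                  (LinearEquiv.piCongrRight fun t => (e₄ t).some)))))))))⟩
  · refine QSl2.exists_shortExact_block hp hq (hM t).lt (hM t)
      (QSl2.pieceDims_of_finrank_le hp hq ha ha' m n l μ hm hn (hM t).lt (hM t)
        ((hle (Sum.inl t)).trans (le_of_eq ?_))) m n l μ
    have h2 : QSl2.neighbours p (t : ℕ) = 2 := by
      rw [QSl2.neighbours, if_pos (hM t).lt.1, if_pos (hM t).lt.2]
    exact congrArg (fun x => x * p * (m * n)) h2
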